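/- **Data.** Let $a,b,c\in C^\infty([0,1])$ and constants $\alpha,\gamma>0$ satisfy $a(x)\ge\alpha$ and $c(x)-\tfrac12 b'(x)\ge\gamma$ for $x\in(0,1)$. Let $k\ge 0$ be an integer and $\sigma\ge k+\tfrac32$ a real number. For $f\in C^\infty([0,1])$ and $\varepsilon>0$ consider $$\varepsilon u'''-(au')'+bu'+cu=f\ \text{ in }(0,1),\qquad u(0)=u(1)=u'(1)=0. \tag{1}$$ **Meshes.** For an even integer $N\ge2$ and $0<\varepsilon\le N^{-1}$ let $\varphi:[0,\tfrac12]\to[0,\infty)$ be one of $$\varphi(t)=2t\ln N\ \text{(S-mesh)},\qquad \varphi(t)=-\ln\bigl[1-2(1-N^{-1})t\bigr]\ \text{(BS-mesh)},\qquad \varphi(t)=-\ln\bigl[1-2(1-\varepsilon)t\bigr]\ \text{(B-mesh)}.$$ Put $\tau=\min\{\tfrac12,\tfrac{\sigma\varepsilon}{\alpha}\varphi(\tfrac12)\}$ and assume $\tau=\tfrac{\sigma\varepsilon}{\alpha}\varphi(\tfrac12)$. The mesh points are $x_i=\tfrac{2i}{N}(1-\tau)$ for $0\le i<N/2$ and $x_i=1-\tfrac{\sigma\varepsilon}{\alpha}\varphi(1-\tfrac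 iN)$ for $N/2\le i\le N$. Let $I_j=[x_{j-1},x_j]$, let $(\cdot,\cdot)_{I_j}$ be the $L^2(I_j)$ inner product, and let $\mathcal V_N$ be the space of functions whose restriction to each $I_j$ is a polynomial of degree at most $k$. For piecewise functions write $v_j^\pm$ for the one-sided limits at $x_j$, and $[v]_j=v_j^+-v_j^-$ for $1\le j\le N-1$, $[v]_0=v_0^+$, $[v]_N=-v_N^-$. Write $a_j=a(x_j)$, $b_j=b(x_j)$. **LDG method.** $(U,P,Q)\in\mathcal V_N^3$ is an LDG solution if for all $j=1,\dots,N$ and all $v,r,s\in\mathcal V_N$ $$(P,r)_{I_j}+(U,r')_{I_j}-\hat U_jr_j^-+\hat U_{j-1}r_{j-1}^+=0,$$ $$(Q,s)_{I_j}+\varepsilon\bigl((P,s')_{I_j}-\hat P_js_j^-+\hat P_{j-1}s_{j-1}^+\bigr)=0,$$ $$-(Q,v')_{I_j}+\hat Q_jv_j^--\hat Q_{j-1}v_{j-1}^++(aP,v')_{I_j}-a_j\tilde P_jv_j^-+a_{j-1}\tilde P_{j-1}v_{j-1}^+-(bU,v')_{I_j}+\widetilde{bU}_jv_j^--\widetilde{bU}_{j-1}v_{j-1}^++((c-b')U,v)_{I_j}=(f,v)_{I_j},$$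 where for $1\le j\le N-1$: $\hat U_j=U_j^-$, $\hat P_j=\tilde P_j=P_j^+$, $\hat Q_j=Q_j^+$, $\widetilde{bU}_j=\tfrac{b_j+|b_j|}2U_j^-+\tfrac{b_j-|b_j|}2U_j^+$; at $j=0$: $\hat U_0=0$, $\hat P_0=\tilde P_0=P_0^+$, $\hat Q_0=Q_0^+$, $\widetilde{bU}_0=\tfrac{b_0-|b_0|}2U_0^+$; and at $j=N$: $\hat U_N=\hat P_N=0$, $\hat Q_N=Q_N^-$, $\tilde P_N=P_N^-$, $\widetilde{bU}_N=\tfrac{b_N+|b_N|}2U_N^-$. **Energy norm.** For a triple $\boldsymbol z=(z_u,z_p,z_q)$ of piecewise functions, $$|||\boldsymbol z|||^2=\frac\varepsilon2\sum_{j=0}^N[z_p]_j^2+\int_0^1a\,z_p^2\,dx+\int_0^1\bigl(c-\tfrac12b'\bigr)z_u^2\,dx+\frac12\sum_{j=0}^N|b_j|\,[z_u]_j^2 .$$ **Theorem.** There is an integer $N_0$, depending only on $a,b,c,\alpha,\gamma,k,\sigma$, with $N_0=2$ if $a$ is constant, such that for all $f\in C^\infty([0,1])$ and all $M$ there is a constant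 $C>0$ with the following property. Let $N\ge \max\{2,N_0\}$ be even, $0<\varepsilon\le N^{-1}$, and take one of the three meshes above (with $\tau=\tfrac{\sigma\varepsilon}\alpha\varphi(\tfrac12)$). Let $u$ be a solution of (1) that can be written $u=\bar u+u_\varepsilon$ with $\bar u,u_\varepsilon\in C^{k+3}([0,1])$ and $$|\bar u^{(j)}(x)|\le M,\qquad |u_\varepsilon^{(j)}(x)|\le M\varepsilon^{1-j}e^{-\alpha(1-x)/\varepsilon}\qquad(0\le x\le1,\ 0\le j\le k+3),$$ let $(U,P,Q)$ be an LDG solution and let $\boldsymbol e=(u-U,\;u'-P,\;\varepsilon u''-Q)$. Then $$|||\boldsymbol e|||\le\begin{cases}C\bigl(\sqrt\varepsilon\,(N^{-1}\ln N)^k+(N^{-1}\ln N)^{k+1}+N^{-(k+1/2)}\bigr)&\text{on the S-mesh},\\[2pt] C\bigl(\sqrt\varepsilon\,N^{-k}(\ln N)^{1/2}+N^{-(k+1/2)}\bigr)&\text{on the BS-mesh and the B-mesh.}\end{cases}$$ In particular $C$ is independent of $\varepsilon$ and $N$. -/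

import Mathlib

open Set Polynomial
open scoped ContDiff

noncomputable section

namespace LDG

/-! ### The continuous problem -/

/-- The closed unit interval. -/
abbrev unitI : Set ℝ := Icc 0 1

/-- First derivative on `[0,1]` (one-sided at the end points). -/
def D (g : ℝ → ℝ) (t : ℝ) : ℝ := derivWithin g unitI t

/-- `u` is a classical solution of
`ε u''' - (a u')' + b u' + c u = f` in `(0,1)`, `u(0) = u(1) = u'(1) = 0`. -/
structure IsExactSolution (ε : ℝ) (a b c f u : ℝ → ℝ) : Prop where
  smooth : ContDiffOn ℝ 3 u unitI
  equation : ∀ t ∈ Ioo (0 : ℝ) 1,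
    ε * D (D (D u)) t - D (fun y => a y * D u y) t + b t * D u t + c t * u t = f t
  left : u 0 = 0
  right : u 1 = 0
  right_deriv : D u 1 = 0

/-- `u = ubar + ulay` on `[0,1]`, where for all `j = 0, …, ℓ` and `t ∈ [0,1]`
`|ubar⁽ʲ⁾(t)| ≤ M` and `|ulay⁽ʲ⁾(t)| ≤ M ε^(1-j) exp(-α (1-t)/ε)`. -/
def HasLayerDecomposition (ℓ : ℕ) (M ε α : ℝ) (u : ℝ → ℝ) : Prop :=
  ∃ ubar ulay : ℝ → ℝ,
    ContDiffOn ℝ (ℓ : WithTop ℕ∞) ubar unitI ∧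
    ContDiffOn ℝ (ℓ : WithTop ℕ∞) ulay unitI ∧
    (∀ t ∈ unitI, u t = ubar t + ulay t) ∧
    ∀ j : ℕ, j ≤ ℓ → ∀ t ∈ unitI,
      |iteratedDerivWithin j ubar unitI t| ≤ M ∧
      |iteratedDerivWithin j ulay unitI t| ≤
        M * ε ^ (1 - (j : ℤ)) * Real.exp (-(α * (1 - t)) / ε)

/-! ### Layer-adapted meshes -/

/-- The three mesh types: Shishkin, Bakhvalov-Shishkin, Bakhvalov-type. -/
inductive MeshKind where
  | shishkin
  | bakhvalovShishkin
  | bakhvalov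

/-- The mesh-generating function `φ`. -/
def meshGen (kind : MeshKind) (N : ℕ) (ε t : ℝ) : ℝ :=
  match kind with
  | .shishkin => 2 * t * Real.log N
  | .bakhvalovShishkin => -Real.log (1 - 2 * (1 - (N : ℝ)⁻¹) * t)
  | .bakhvalov => -Real.log (1 - 2 * (1 - ε) * t)

/-- The mesh parameter `τ = min {1/2, (σ ε / α) φ(1/2)}`; the transition point is `1 - τ`. -/
def tau (kind : MeshKind) (N : ℕ) (σ α ε : ℝ) : ℝ :=
  min (1 / 2) (σ * ε / α * meshGen kind N ε (1 / 2))

/-- The mesh points `x_i`, `i = 0, …, N`. -/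
def meshPoint (kind : MeshKind) (N : ℕ) (σ α ε : ℝ) (i : ℕ) : ℝ :=
  if i < N / 2 then 2 * (i : ℝ) / N * (1 - tau kind N σ α ε)
  else 1 - σ * ε / α * meshGen kind N ε (1 - (i : ℝ) / N)

/-! ### Piecewise functions and discontinuous piecewise polynomials

Elements are numbered from `0`: the element with index `i : Fin N` is `[x i, x (i+1)]`. -/

/-- A piecewise function: on the element `i` it is given by `v i`. -/
abbrev Broken (N : ℕ) := Fin N → ℝ → ℝ

/-- The discontinuous finite element space: one polynomial of degree at most `k` per element. -/
abbrev DGSpace (N k : ℕ) := Fin N → Polynomial.degreeLE ℝ (k : WithBot ℕ)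

/-- The piecewise function defined by an element of the finite element space. -/
def DGSpace.toBroken {N k : ℕ} (v : DGSpace N k) : Broken N :=
  fun i t => (v i : ℝ[X]).eval t

/-- The elementwise derivative. -/
def DGSpace.derivBroken {N k : ℕ} (v : DGSpace N k) : Broken N :=
  fun i t => (derivative (v i : ℝ[X])).eval t

/-- The right trace `v_j⁺` (from the element `[x j, x (j+1)]`); it is `0` for `j = N`. -/
def traceR {N : ℕ} (x : ℕ → ℝ) (v : Broken N) (j : ℕ) : ℝ :=
  if h : j < N then v ⟨j, h⟩ (x j) else 0

/-- The left trace `v_j⁻` (from the element `[x (j-1), x j]`); it is `0` for `j = 0`. -/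
def traceL {N : ℕ} (x : ℕ → ℝ) (v : Broken N) (j : ℕ) : ℝ :=
  if h : 0 < j ∧ j ≤ N then v ⟨j - 1, by omega⟩ (x j) else 0

/-- The jump `v_j⁺ - v_j⁻`, which is `v_0⁺` for `j = 0` and `-v_N⁻` for `j = N`. -/
def jump {N : ℕ} (x : ℕ → ℝ) (v : Broken N) (j : ℕ) : ℝ :=
  traceR x v j - traceL x v j

/-- The `L²` inner product on the element `i`. -/
def innerElem {N : ℕ} (x : ℕ → ℝ) (i : Fin N) (w v : ℝ → ℝ) : ℝ :=
  ∫ t in x i..x (i + 1), w t * v t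

/-! ### Numerical fluxes -/

/-- `Û_j`: `U_j⁻` at interior nodes, `0` at `j = 0` and at `j = N`. -/
def fluxU {N : ℕ} (x : ℕ → ℝ) (U : Broken N) (j : ℕ) : ℝ :=
  if j = 0 ∨ j = N then 0 else traceL x U j

/-- `P̂_j`: `P_j⁺` for `j < N`, `0` at `j = N`. -/
def fluxP {N : ℕ} (x : ℕ → ℝ) (P : Broken N) (j : ℕ) : ℝ :=
  if j = N then 0 else traceR x P j

/-- `Q̂_j`: `Q_j⁺` for `j < N`, `Q_N⁻` at `j = N`. -/
def fluxQ {N : ℕ} (x : ℕ → ℝ) (Q : Broken N) (j : ℕ) : ℝ :=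
  if j = N then traceL x Q j else traceR x Q j

/-- `P̃_j`: `P_j⁺` for `j < N`, `P_N⁻` at `j = N`. -/
def fluxPtilde {N : ℕ} (x : ℕ → ℝ) (P : Broken N) (j : ℕ) : ℝ :=
  if j = N then traceL x P j else traceR x P j

/-- The upwind flux for `b U`. -/
def fluxBU {N : ℕ} (x : ℕ → ℝ) (b : ℝ → ℝ) (U : Broken N) (j : ℕ) : ℝ :=
  if j = 0 then (b (x 0) - |b (x 0)|) / 2 * traceR x U 0
  else if j = N then (b (x N) + |b (x N)|) / 2 * traceL x U N
  else (b (x j) + |b (x j)|) / 2 * traceL x U j + (b (x j) - |b (x j)|) / 2 * traceR x U j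

/-! ### The LDG scheme -/

/-- `(U, P, Q)` is a solution of the LDG scheme on the mesh `x`: the three local equations hold on
every element and for all test functions `(v, r, s)` of the finite element space. -/
def IsLDGSolution {N k : ℕ} (x : ℕ → ℝ) (ε : ℝ) (a b c f : ℝ → ℝ) (U P Q : DGSpace N k) : Prop :=
  ∀ (v r s : DGSpace N k) (i : Fin N),
    -- the value at the right (left) end of the element `i`, from inside the element
    let endR : DGSpace N k → ℝ := fun z => z.toBroken i (x (i + 1))
    let endL : DGSpace N k → ℝ := fun z => z.toBroken i (x i)
    (innerElem x i (P.toBroken i) (r.toBroken i)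
      + innerElem x i (U.toBroken i) (r.derivBroken i)
      - fluxU x U.toBroken (i + 1) * endR r + fluxU x U.toBroken i * endL r = 0) ∧
    (innerElem x i (Q.toBroken i) (s.toBroken i)
      + ε * (innerElem x i (P.toBroken i) (s.derivBroken i)
        - fluxP x P.toBroken (i + 1) * endR s + fluxP x P.toBroken i * endL s) = 0) ∧
    (-innerElem x i (Q.toBroken i) (v.derivBroken i)
      + fluxQ x Q.toBroken (i + 1) * endR v - fluxQ x Q.toBroken i * endL v
      + innerElem x i (fun t => a t * P.toBroken i t) (v.derivBroken i)
      - a (x (i + 1)) * fluxPtilde x P.toBroken (i + 1) * endR v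
      + a (x i) * fluxPtilde x P.toBroken i * endL v
      - innerElem x i (fun t => b t * U.toBroken i t) (v.derivBroken i)
      + fluxBU x b U.toBroken (i + 1) * endR v - fluxBU x b U.toBroken i * endL v
      + innerElem x i (fun t => (c t - D b t) * U.toBroken i t) (v.toBroken i)
      = innerElem x i f (v.toBroken i))

/-! ### The energy norm and the error -/

/-- The energy norm of a triple `(U, P, Q)` of piecewise functions,
`‖(U,P,Q)‖_E² = (ε/2) ∑_{j=0}^N [P]_j² + ‖a^{1/2} P‖² + ‖(c - b'/2)^{1/2} U‖²
  + (1/2) ∑_{j=0}^N |b_j| [U]_j²`. It does not involve `Q`. -/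
def energyNorm {N : ℕ} (x : ℕ → ℝ) (ε : ℝ) (a b c : ℝ → ℝ)
    (W : Broken N × Broken N × Broken N) : ℝ :=
  Real.sqrt (
    (ε / 2 * ∑ j ∈ Finset.range (N + 1), jump x W.2.1 j ^ 2)
    + (∑ i : Fin N, (∫ t in x i..x (i + 1), a t * W.2.1 i t ^ 2))
    + (∑ i : Fin N, (∫ t in x i..x (i + 1), (c t - 1 / 2 * D b t) * W.1 i t ^ 2))
    + (1 / 2 * ∑ j ∈ Finset.range (N + 1), |b (x j)| * jump x W.1 j ^ 2))

/-- The error `(u - U, p - P, q - Q)` with `p = u'` and `q = ε u''`. -/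
def errorTriple {N k : ℕ} (ε : ℝ) (u : ℝ → ℝ) (U P Q : DGSpace N k) :
    Broken N × Broken N × Broken N :=
  (fun i t => u t - U.toBroken i t,
   fun i t => D u t - P.toBroken i t,
   fun i t => ε * D (D u) t - Q.toBroken i t)

/-- The convergence rate for each of the mesh types. -/
def rate (kind : MeshKind) (k N : ℕ) (ε : ℝ) : ℝ :=
  match kind with
  | .shishkin =>
      Real.sqrt ε * ((N : ℝ)⁻¹ * Real.log N) ^ k + ((N : ℝ)⁻¹ * Real.log N) ^ (k + 1)
        + (N : ℝ) ^ (-((k : ℝ) + 1 / 2))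
  | .bakhvalovShishkin | .bakhvalov =>
      Real.sqrt ε * (N : ℝ)⁻¹ ^ k * Real.sqrt (Real.log N) + (N : ℝ) ^ (-((k : ℝ) + 1 / 2))

end LDG

end

noncomputable section

namespace LDG

/-! ### Inverse estimates and Riesz representation for polynomials. -/

section

/-! The error is the sum of the errors of elementwise projections and of the differences ξ between
the projections and the discrete solution. The projections are the right Radau projection of u, the
L² projection of p = u' and the left Radau projection of q = ε u''. With this choice (ξ_u, ξ_p)
satisfies the first equation of the scheme without residual, so that ξ_p is a discrete derivative of
ξ_u (`IsDiscSolution.isDiscDeriv`), and most residual terms of the other two equations vanish by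
orthogonality or by interpolation at a node. What remains is to bound the energy of (ξ_u, ξ_p) by
the bilinear form of the scheme, and the residuals by the rate.

Stability. Test the second equation with ξ_p and the third one with ξ_u: the terms with ξ_q cancel,
and for constant `a` the form equals the energy (`coercive_of_const`). For variable `a` the
coefficient is frozen on each element; the defect contains a - a(x_i) = O(h) and can be absorbed as
long as ξ_u' is bounded by ξ_p. This is true on all elements except the last. There the flux of U at
x = 1 is zero, and the discrete derivative sees only the L² projection of ξ_u onto polynomials of
degree less than k. Hence ξ_u = v + w, where w lives on the last element and is orthogonal to these
polynomials (`IsDiscDeriv.exists_split`): v is controlled by ξ_p, and w only by its own energy. The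
third equation is tested with v + κ w. A small κ absorbs the product of the norms of ξ_p and w
coming from the diffusion term, and a small mesh width then absorbs the coupling of v and w through
the convection and reaction terms (`exists_coercive`). The latter restriction is the origin of N₀.

Residuals. Let ρ be N⁻¹ ln N on the S-mesh and N⁻¹ on the other two. The second equation, and the
third one tested with v, have residuals of order ρ^(k+1) (`IsProjError.abs_second_le`,
`IsProjError.abs_third_le`). Testing with w is delicate, because w' and the traces of w are
available only through inverse estimates. The differential equation is therefore used to rewrite the
p and q terms as integrals of f - b u' - c u and of the derivative of a times the projection of u'
against w (`IsSplit.third_w_eq`). Orthogonality of w to lower degrees then produces √h min(1, h/ε)^k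
with h the last width. If h ≤ ε this is of order √ε ρ^k; if h ≥ ε then ρ is bounded below and there
is nothing to gain (`IsLayerMesh.abs_third_w_le`). The term N^(-(k+1/2)) stems from the N unweighted
nodal jumps of the projection error of u and from the last element.

Mesh. Beyond widths of order N⁻¹, the meshes enter through one inequality: min(1, h/ε)^(k+1) times
the size of the layer on the element is at most (R ρ)^(k+1) (`IsMeshData.layer_le`). -/

lemma exists_coeff_bound (n : ℕ) : ∃ μ : ℝ, 0 < μ ∧ ∀ c : Fin n → ℝ,
    μ * ‖c‖ ^ 2 ≤ ∫ t in (0 : ℝ)..1, t * (∑ i, c i * t ^ (i : ℕ)) ^ 2 := by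
  -- A positive definite quadratic form on a finite-dimensional space: its minimum on the unit
  -- sphere is positive, and homogeneity extends the bound to all coefficient vectors. The weight t,
  -- which vanishes at one end, is the one produced by the factor t - z in a Radau projection.
  set Φ : (Fin n → ℝ) → ℝ := fun c => ∫ t in (0 : ℝ)..1, t * (∑ i, c i * t ^ (i : ℕ)) ^ 2 with hΦ
  have hcont : Continuous Φ := by
    apply intervalIntegral.continuous_parametric_intervalIntegral_of_continuous' 
    fun_prop
  have hpos : ∀ c, c ≠ 0 → 0 < Φ c := by
    intro c hc
    have hnn : ∀ t ∈ Ioc (0:ℝ) 1, 0 ≤ t * (∑ i, c i * t ^ (i : ℕ)) ^ 2 := fun t ht =>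
      mul_nonneg ht.1.le (sq_nonneg _)
    set v : ℝ[X] := ∑ i, C (c i) * X ^ (i : ℕ) with hv
    have hev : ∀ t, v.eval t = ∑ i, c i * t ^ (i : ℕ) := by
      intro t; simp [hv, eval_finsetSum]
    have hv0 : v ≠ 0 := by
      intro h0
      apply hc
      funext i
      have := congrArg (fun q : ℝ[X] => q.coeff i) h0
      simpa [hv, finsetSum_coeff, coeff_C_mul, coeff_X_pow, Fin.val_inj] using this
    have hfin : (v.rootSet ℝ).Finite := rootSet_finite v ℝ
    obtain ⟨t, ht, htv⟩ := ((Ioo_infinite (show (0:ℝ) < 1 by norm_num)).sdiff hfin).nonempty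
    have hvt : v.eval t ≠ 0 := by
      intro h; apply htv; rw [mem_rootSet]; exact ⟨hv0, by simpa [coe_aeval_eq_eval] using h⟩
    have hpt : 0 < t * (∑ i, c i * t ^ (i : ℕ)) ^ 2 := by
      rw [← hev]; have := ht.1; positivity
    refine intervalIntegral.integral_pos (by norm_num) (by fun_prop) hnn ⟨t, ⟨ht.1.le, ht.2.le⟩, hpt⟩
  have hscale : ∀ (s : ℝ) c, Φ (s • c) = s ^ 2 * Φ c := by
    intro s c
    simp only [hΦ]
    rw [← intervalIntegral.integral_const_mul]
    congr 1; funext t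
    have : ∑ i, (s • c) i * t ^ (i : ℕ) = s * ∑ i, c i * t ^ (i : ℕ) := by
      rw [Finset.mul_sum]; refine Finset.sum_congr rfl fun i _ => ?_; simp [mul_assoc]
    rw [this]; ring
  by_cases hne : (Metric.sphere (0 : Fin n → ℝ) 1).Nonempty
  · obtain ⟨c0, hc0, hmin⟩ := (isCompact_sphere (0 : Fin n → ℝ) 1).exists_isMinOn hne hcont.continuousOn
    have hc00 : c0 ≠ 0 := by
      rintro rfl; simp at hc0
    refine ⟨Φ c0, hpos c0 hc00, fun c => ?_⟩
    by_cases hc : c = 0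
    · subst hc; simp
    · have hn : ‖c‖ ≠ 0 := norm_ne_zero_iff.2 hc
      have h1 : Φ c0 ≤ Φ (‖c‖⁻¹ • c) := hmin (by simp [norm_smul, hn])
      rw [hscale] at h1
      have h2 : Φ c0 * ‖c‖ ^ 2 ≤ (‖c‖⁻¹ ^ 2 * Φ c) * ‖c‖ ^ 2 :=
        mul_le_mul_of_nonneg_right h1 (by positivity)
      refine h2.trans (le_of_eq ?_)
      field_simp
      rfl
  -- The sphere is empty only if the space is trivial, and then any constant serves.
  · refine ⟨1, one_pos, fun c => ?_⟩
    have hc : c = 0 := by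
      by_contra hc
      apply hne
      exact ⟨‖c‖⁻¹ • c, by simp [norm_smul, norm_ne_zero_iff.2 hc]⟩
    subst hc; simp

lemma natDegree_lt_of_degree_lt {v : ℝ[X]} {n : ℕ} (hn : 0 < n) (hv : v.degree < n) :
    v.natDegree < n := by
  by_cases h : v = 0
  · simpa [h] using hn
  · exact (natDegree_lt_iff_degree_lt h).2 hv

lemma degree_lt_of_natDegree_lt {v : ℝ[X]} {n : ℕ} (hv : v.natDegree < n) : v.degree < n :=
  lt_of_le_of_lt degree_le_natDegree (by exact_mod_cast hv)

lemma degree_derivative_lt_of_lt_succ {v : ℝ[X]} {k : ℕ} (hv : v.degree < (k + 1 : ℕ)) :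
    (derivative v).degree < k := by
  rw [degree_lt_iff_coeff_zero] at hv ⊢
  intro m hm
  rw [coeff_derivative, hv (m + 1) (by omega), zero_mul]

lemma degree_lt_mono {v : ℝ[X]} {m n : ℕ} (h : m ≤ n) (hv : v.degree < m) : v.degree < n :=
  lt_of_lt_of_le hv (by exact_mod_cast h)

lemma degree_derivative_lt' {v : ℝ[X]} {n : ℕ} (hv : v.degree < n) :
    (derivative v).degree < n := lt_of_le_of_lt (degree_derivative_le) hv

lemma degree_sub_lt' {v w : ℝ[X]} {n : ℕ} (hv : v.degree < n) (hw : w.degree < n) :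
    (v - w).degree < n := lt_of_le_of_lt (degree_sub_le v w) (max_lt hv hw)

lemma degree_add_lt' {v w : ℝ[X]} {n : ℕ} (hv : v.degree < n) (hw : w.degree < n) :
    (v + w).degree < n := lt_of_le_of_lt (degree_add_le v w) (max_lt hv hw)

lemma degree_smul_lt' {v : ℝ[X]} {n : ℕ} (s : ℝ) (hv : v.degree < n) :
    (s • v).degree < n := lt_of_le_of_lt (degree_smul_le s v) hv

lemma degree_C_lt (s : ℝ) {n : ℕ} (hn : 0 < n) : (C s : ℝ[X]).degree < n :=
  degree_lt_of_natDegree_lt (by simpa using hn)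

lemma abs_eval_le_of_coeff {v : ℝ[X]} {n : ℕ} {B t : ℝ} (hv : v.degree < n)
    (hB : ∀ i < n, |v.coeff i| ≤ B) (ht : t ∈ Icc (0 : ℝ) 1) : |v.eval t| ≤ n * B := by
  rcases Nat.eq_zero_or_pos n with rfl | hn
  · have : v = 0 := by
      rw [← degree_eq_bot]; exact (Nat.WithBot.lt_zero_iff).1 (by simpa using hv)
    simp [this]
  rw [eval_eq_sum_range' (natDegree_lt_of_degree_lt hn hv)]
  calc |∑ i ∈ Finset.range n, v.coeff i * t ^ i| ≤ ∑ i ∈ Finset.range n, |v.coeff i * t ^ i| :=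
        Finset.abs_sum_le_sum_abs _ _
    _ ≤ ∑ i ∈ Finset.range n, B := by
        refine Finset.sum_le_sum fun i hi => ?_
        rw [abs_mul, abs_pow]
        have h1 : |t| ^ i ≤ 1 := pow_le_one₀ (abs_nonneg _) (by rw [abs_of_nonneg ht.1]; exact ht.2)
        have h2 := hB i (Finset.mem_range.1 hi)
        nlinarith [abs_nonneg (v.coeff i), abs_nonneg t, pow_nonneg (abs_nonneg t) i]
    _ = n * B := by simp

/-- Inverse estimates for polynomials on an interval with base point `z` and signed length `h`,
with respect to the `L²` norm weighted by the distance to `z`. -/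
lemma exists_weighted_inverse (n : ℕ) : ∃ K : ℝ, 1 ≤ K ∧ ∀ (v : ℝ[X]), v.degree < n →
    ∀ z h : ℝ, h ≠ 0 → ∀ s ∈ Icc (0 : ℝ) 1,
      h ^ 2 * v.eval (z + h * s) ^ 2 ≤ K * ∫ t in z..z + h, (t - z) * v.eval t ^ 2 ∧
      h ^ 4 * (derivative v).eval (z + h * s) ^ 2 ≤ K * ∫ t in z..z + h, (t - z) * v.eval t ^ 2 := by
  obtain ⟨μ, hμ, hb⟩ := exists_coeff_bound n
  -- One factor n counts the coefficients, the other bounds the factor i + 1 that differentiation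
  -- puts on a coefficient, and μ converts coefficients into the weighted integral.
  refine ⟨max 1 ((n * (n * 1)) ^ 2 / μ), le_max_left _ _, fun v hv z h hh s hs => ?_⟩
  set V : ℝ[X] := v.comp (C z + C h * X) with hV
  have hVe : ∀ t, V.eval t = v.eval (z + h * t) := by intro t; simp [hV, eval_comp]
  have hVd : ∀ t, (derivative V).eval t = h * (derivative v).eval (z + h * t) := by
    intro t; simp [hV, derivative_comp, eval_comp]
  have hVdeg : V.degree < n := by
    rcases Nat.eq_zero_or_pos n with rfl | hn
    · have : v = 0 := by
        rw [← degree_eq_bot]; exact (Nat.WithBot.lt_zero_iff).1 (by simpa using hv)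
      simp [hV, this]
    · apply degree_lt_of_natDegree_lt
      have h1 : (C z + C h * X : ℝ[X]).natDegree ≤ 1 := by
        rw [add_comm]; exact natDegree_linear_le
      calc V.natDegree ≤ v.natDegree * (C z + C h * X : ℝ[X]).natDegree := natDegree_comp_le
        _ ≤ v.natDegree * 1 := Nat.mul_le_mul_left _ h1
        _ < n := by simpa using natDegree_lt_of_degree_lt hn hv
  set c : Fin n → ℝ := fun i => V.coeff i with hc
  -- The weight and the line element each contribute one factor h, so the integral is nonnegative
  -- for either sign of h.
  have hint : ∫ t in z..z + h, (t - z) * v.eval t ^ 2 =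
      h ^ 2 * ∫ t in (0 : ℝ)..1, t * (∑ i, c i * t ^ (i : ℕ)) ^ 2 := by
    have h1 : ∀ t, ∑ i, c i * t ^ (i : ℕ) = V.eval t := by
      intro t
      rcases Nat.eq_zero_or_pos n with rfl | hn
      · have : V = 0 := by
          rw [← degree_eq_bot]; exact (Nat.WithBot.lt_zero_iff).1 (by simpa using hVdeg)
        simp [this]
      · rw [eval_eq_sum_range' (natDegree_lt_of_degree_lt hn hVdeg), Finset.sum_range]
    have h2 := intervalIntegral.integral_comp_mul_add (a := 0) (b := 1)
      (fun t => (t - z) * v.eval t ^ 2) hh z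
    simp only [smul_eq_mul, mul_zero, zero_add, mul_one, add_sub_cancel_right] at h2
    rw [add_comm h z] at h2
    have h3 : ∫ t in z..z + h, (t - z) * v.eval t ^ 2 =
        h * ∫ x in (0:ℝ)..1, h * x * eval (h * x + z) v ^ 2 := by
      rw [h2]; field_simp
    rw [h3, ← intervalIntegral.integral_const_mul, ← intervalIntegral.integral_const_mul]
    congr 1; funext t
    rw [h1, hVe, add_comm z]; ring
  have hcb : ∀ i < n, |V.coeff i| ≤ ‖c‖ := fun i hi => norm_le_pi_norm c ⟨i, hi⟩
  have hcn : (0:ℝ) ≤ n := Nat.cast_nonneg n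
  have hn1 : n = 0 ∨ (1:ℝ) ≤ n := by
    rcases Nat.eq_zero_or_pos n with h | h
    · exact Or.inl h
    · right; exact_mod_cast h
  have hI := hb c
  set I := ∫ t in (0 : ℝ)..1, t * (∑ i, c i * t ^ (i : ℕ)) ^ 2
  have hI0 : 0 ≤ I := le_trans (by positivity) hI
  have key : ∀ y : ℝ, |y| ≤ n * (n * ‖c‖) →
      h ^ 2 * y ^ 2 ≤ max 1 ((n * (n * 1)) ^ 2 / μ) * (h ^ 2 * I) := by
    intro y hy
    have h1 : y ^ 2 ≤ (n * (n * ‖c‖)) ^ 2 := by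
      rw [← sq_abs y]; exact pow_le_pow_left₀ (abs_nonneg _) hy 2
    have h2 : (n * (n * ‖c‖)) ^ 2 ≤ ((n * (n * 1)) ^ 2 / μ) * I := by
      rw [div_mul_eq_mul_div, le_div_iff₀ hμ]
      nlinarith [mul_le_mul_of_nonneg_left hI (sq_nonneg ((n:ℝ) * (n * 1)))]
    have h3 : ((n * (n * 1)) ^ 2 / μ) * I ≤ max 1 ((n * (n * 1)) ^ 2 / μ) * I :=
      mul_le_mul_of_nonneg_right (le_max_right _ _) hI0
    nlinarith [mul_le_mul_of_nonneg_left ((h1.trans h2).trans h3) (sq_nonneg h)]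
  rw [hint]
  constructor
  · apply key
    rw [← hVe]
    refine (abs_eval_le_of_coeff hVdeg hcb hs).trans ?_
    rcases hn1 with h | h
    · simp [h]
    · nlinarith [norm_nonneg c, mul_nonneg hcn (norm_nonneg c)]
  · have : h ^ 4 * (derivative v).eval (z + h * s) ^ 2 =
      h ^ 2 * ((derivative V).eval s) ^ 2 := by rw [hVd]; ring
    rw [this]
    apply key
    refine abs_eval_le_of_coeff (degree_derivative_lt' hVdeg) (fun i hi => ?_) hs
    rw [coeff_derivative, abs_mul, mul_comm]
    by_cases hi1 : i + 1 < n
    · have h1 := hcb (i + 1) hi1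
      have h2 : |((i:ℝ) + 1)| ≤ n := by
        rw [abs_of_nonneg (by positivity)]; exact_mod_cast hi1.le
      exact mul_le_mul h2 h1 (abs_nonneg _) hcn
    · have : V.coeff (i + 1) = 0 := (degree_lt_iff_coeff_zero V n).1 hVdeg _ (by omega)
      rw [this]; simp; positivity

/-- Riesz representation in the polynomials of degree less than `n` with a weighted `L²` product. -/
lemma exists_weighted_riesz (n : ℕ) {l r : ℝ} (hlr : l < r) {wt : ℝ → ℝ} (hwt : Continuous wt)
    (hpos : ∀ t ∈ Ioo l r, 0 < wt t) (ℓ : ℝ[X] →ₗ[ℝ] ℝ) :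
    ∃ ψ : ℝ[X], ψ.degree < n ∧ ∀ s : ℝ[X], s.degree < n →
      ∫ t in l..r, wt t * (ψ.eval t * s.eval t) = ℓ s := by
  have hii : ∀ v s : ℝ[X], IntervalIntegrable (fun t => wt t * (v.eval t * s.eval t))
      MeasureTheory.volume l r := fun v s => Continuous.intervalIntegrable (by fun_prop) _ _
  let T : degreeLT ℝ n →ₗ[ℝ] Module.Dual ℝ (degreeLT ℝ n) :=
    LinearMap.mk₂ ℝ (fun v s => ∫ t in l..r, wt t * ((v : ℝ[X]).eval t * (s : ℝ[X]).eval t))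
      (by
        intro v v' s
        rw [← intervalIntegral.integral_add (hii _ _) (hii _ _)]
        congr 1; funext t; simp; ring)
      (by
        intro c v s
        simp only [smul_eq_mul]
        rw [← intervalIntegral.integral_const_mul]
        congr 1; funext t; simp; ring)
      (by
        intro v s s'
        rw [← intervalIntegral.integral_add (hii _ _) (hii _ _)]
        congr 1; funext t; simp; ring)
      (by
        intro c v s
        simp only [smul_eq_mul]
        rw [← intervalIntegral.integral_const_mul]
        congr 1; funext t; simp; ring)
  have hT : ∀ v s, T v s = ∫ t in l..r, wt t * ((v : ℝ[X]).eval t * (s : ℝ[X]).eval t) :=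
    fun v s => rfl
  -- The form is definite, since a nonzero polynomial has a non-root inside the interval.
  -- Injectivity into the dual space then gives surjectivity by equality of dimensions.
  have hinj : Function.Injective T := by
    rw [injective_iff_map_eq_zero]
    intro v hv
    by_contra hne
    have hv0 : (v : ℝ[X]) ≠ 0 := by simpa using hne
    have h0 : T v v = 0 := by rw [hv]; rfl
    rw [hT] at h0
    obtain ⟨t, ht, htv⟩ := ((Ioo_infinite hlr).sdiff (rootSet_finite (v : ℝ[X]) ℝ)).nonempty
    have hvt : (v : ℝ[X]).eval t ≠ 0 := by
      intro h; apply htv; rw [mem_rootSet]; exact ⟨hv0, by simpa [coe_aeval_eq_eval] using h⟩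
    have hwt0 : ∀ t ∈ Icc l r, 0 ≤ wt t := by
      intro t ht
      have := closure_Ioo hlr.ne ▸ ht
      exact closure_minimal (fun y hy => (hpos y hy).le) (isClosed_le continuous_const hwt) this
    have : 0 < ∫ t in l..r, wt t * ((v : ℝ[X]).eval t * (v : ℝ[X]).eval t) := by
      refine intervalIntegral.integral_pos hlr (by fun_prop)
        (fun y hy => mul_nonneg (hwt0 y ⟨hy.1.le, hy.2⟩) (mul_self_nonneg _))
        ⟨t, ⟨ht.1.le, ht.2.le⟩, mul_pos (hpos t ht) (mul_self_pos.2 hvt)⟩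
    linarith
  have : FiniteDimensional ℝ (degreeLT ℝ n) :=
    Module.Finite.equiv (degreeLTEquiv ℝ n).symm
  have hsurj : Function.Surjective T :=
    (LinearMap.injective_iff_surjective_of_finrank_eq_finrank
      (Subspace.dual_finrank_eq (K := ℝ) (V := degreeLT ℝ n)).symm).1 hinj
  obtain ⟨ψ, hψ⟩ := hsurj (ℓ.comp (degreeLT ℝ n).subtype)
  refine ⟨ψ, mem_degreeLT.1 ψ.2, fun s hs => ?_⟩
  have := congrArg (fun F => F ⟨s, mem_degreeLT.2 hs⟩) hψ
  simpa [hT] using this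

end

/-! ### L² estimates, inverse estimates and the projections on one element. -/

section

/-- The `L²` norm on `[l, r]`. -/
def l2 (l r : ℝ) (f : ℝ → ℝ) : ℝ := Real.sqrt (∫ t in l..r, f t ^ 2)

lemma l2_nonneg (l r : ℝ) (f : ℝ → ℝ) : 0 ≤ l2 l r f := Real.sqrt_nonneg _

lemma l2_sq {l r : ℝ} (h : l ≤ r) (f : ℝ → ℝ) : l2 l r f ^ 2 = ∫ t in l..r, f t ^ 2 :=
  Real.sq_sqrt (intervalIntegral.integral_nonneg h fun _ _ => sq_nonneg _)

/-- Cauchy-Schwarz, from the discriminant of the nonnegative quadratic polynomial s ↦ ∫ (s g + f)².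
-/
lemma abs_integral_mul_le {l r : ℝ} (h : l ≤ r) {f g : ℝ → ℝ} (hf : Continuous f)
    (hg : Continuous g) : |∫ t in l..r, f t * g t| ≤ l2 l r f * l2 l r g := by
  have hq : ∀ s : ℝ, 0 ≤ (∫ t in l..r, g t ^ 2) * (s * s) + (2 * ∫ t in l..r, f t * g t) * s
      + ∫ t in l..r, f t ^ 2 := by
    intro s
    have h0 : 0 ≤ ∫ t in l..r, (s * g t + f t) ^ 2 :=
      intervalIntegral.integral_nonneg h fun _ _ => sq_nonneg _
    have h1 : ∫ t in l..r, (s * g t + f t) ^ 2 =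
        (∫ t in l..r, g t ^ 2) * (s * s) + (2 * ∫ t in l..r, f t * g t) * s
      + ∫ t in l..r, f t ^ 2 := by
      rw [← intervalIntegral.integral_mul_const,
        ← intervalIntegral.integral_const_mul, ← intervalIntegral.integral_mul_const,
        ← intervalIntegral.integral_add, ← intervalIntegral.integral_add]
      · congr 1; funext t; ring
      all_goals exact Continuous.intervalIntegrable (by fun_prop) _ _
    linarith
  have hd := discrim_le_zero hq
  unfold discrim at hd
  rw [l2, l2, ← Real.sqrt_mul (intervalIntegral.integral_nonneg h fun _ _ => sq_nonneg _)]
  apply Real.abs_le_sqrt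
  nlinarith

lemma l2_le_of_abs_le {l r B : ℝ} (h : l ≤ r) {f : ℝ → ℝ} (hf : Continuous f) (hB : 0 ≤ B)
    (hfB : ∀ t ∈ Icc l r, |f t| ≤ B) : l2 l r f ≤ B * Real.sqrt (r - l) := by
  rw [l2, Real.sqrt_le_left (by positivity), mul_pow, Real.sq_sqrt (by linarith)]
  calc ∫ t in l..r, f t ^ 2 ≤ ∫ t in l..r, B ^ 2 := by
        refine intervalIntegral.integral_mono_on h (Continuous.intervalIntegrable (by fun_prop) _ _)
          (by simp) fun t ht => ?_
        rw [← sq_abs]; exact pow_le_pow_left₀ (abs_nonneg _) (hfB t ht) 2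
    _ = B ^ 2 * (r - l) := by simp; ring

lemma l2_mul_le {l r K : ℝ} (h : l ≤ r) {w f : ℝ → ℝ} (hw : Continuous w) (hf : Continuous f)
    (hK : 0 ≤ K) (hwK : ∀ t ∈ Icc l r, |w t| ≤ K) :
    l2 l r (fun t => w t * f t) ≤ K * l2 l r f := by
  rw [l2, Real.sqrt_le_left (mul_nonneg hK (l2_nonneg _ _ _)), mul_pow, l2_sq h,
    ← intervalIntegral.integral_const_mul]
  refine intervalIntegral.integral_mono_on h (Continuous.intervalIntegrable (by fun_prop) _ _)
    (Continuous.intervalIntegrable (by fun_prop) _ _) fun t ht => ?_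
  rw [mul_pow]
  refine mul_le_mul_of_nonneg_right ?_ (sq_nonneg _)
  rw [← sq_abs]; exact pow_le_pow_left₀ (abs_nonneg _) (hwK t ht) 2

lemma abs_integral_weight_le {l r K : ℝ} (h : l ≤ r) {w f g : ℝ → ℝ} (hw : Continuous w)
    (hf : Continuous f) (hg : Continuous g) (hK : 0 ≤ K) (hwK : ∀ t ∈ Icc l r, |w t| ≤ K) :
    |∫ t in l..r, w t * f t * g t| ≤ K * l2 l r f * l2 l r g :=
  (abs_integral_mul_le h (hw.mul hf) hg).trans
    (mul_le_mul_of_nonneg_right (l2_mul_le h hw hf hK hwK) (l2_nonneg _ _ _))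

lemma abs_integral_sup_le {l r B : ℝ} (h : l ≤ r) {f g : ℝ → ℝ} (hf : Continuous f)
    (hg : Continuous g) (hB : 0 ≤ B) (hfB : ∀ t ∈ Icc l r, |f t| ≤ B) :
    |∫ t in l..r, f t * g t| ≤ B * Real.sqrt (r - l) * l2 l r g :=
  (abs_integral_mul_le h hf hg).trans
    (mul_le_mul_of_nonneg_right (l2_le_of_abs_le h hf hB hfB) (l2_nonneg _ _ _))

/-- A constant for the inverse estimates for polynomials of degree less than `n`. -/
def invK (n : ℕ) : ℝ := (exists_weighted_inverse n).choose

lemma one_le_invK (n : ℕ) : 1 ≤ invK n := (exists_weighted_inverse n).choose_spec.1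

lemma invK_pos (n : ℕ) : 0 < invK n := lt_of_lt_of_le one_pos (one_le_invK n)

lemma weighted_inverse_left {n : ℕ} {v : ℝ[X]} (hv : v.degree < n) {l r : ℝ} (h : l < r) {t : ℝ}
    (ht : t ∈ Icc l r) :
    (r - l) ^ 2 * v.eval t ^ 2 ≤ invK n * ∫ t in l..r, (t - l) * v.eval t ^ 2 ∧
    (r - l) ^ 4 * (derivative v).eval t ^ 2 ≤
      invK n * ∫ t in l..r, (t - l) * v.eval t ^ 2 := by
  have hh : r - l ≠ 0 := by linarith
  have hpos : 0 < r - l := by linarith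
  have := (exists_weighted_inverse n).choose_spec.2 v hv l (r - l) hh ((t - l) / (r - l))
    ⟨by apply div_nonneg <;> linarith [ht.1], by rw [div_le_one hpos]; linarith [ht.2]⟩
  rw [mul_div_cancel₀ _ hh] at this
  simpa [invK] using this

lemma integral_dist_mul_sq_le {l r : ℝ} (h : l ≤ r) {f : ℝ → ℝ} (hf : Continuous f) :
    ∫ t in l..r, (t - l) * f t ^ 2 ≤ (r - l) * l2 l r f ^ 2 := by
  rw [l2_sq h, ← intervalIntegral.integral_const_mul]
  refine intervalIntegral.integral_mono_on h (Continuous.intervalIntegrable (by fun_prop) _ _)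
    (Continuous.intervalIntegrable (by fun_prop) _ _) fun t ht => ?_
  exact mul_le_mul_of_nonneg_right (by linarith [ht.2]) (sq_nonneg _)

/-- The weight is at most the length of the interval, so the weighted inverse estimate implies the
unweighted one. The square root of the constant is replaced by the constant itself, which is at
least 1. -/
lemma sqrt_mul_abs_eval_le {n : ℕ} {v : ℝ[X]} (hv : v.degree < n) {l r : ℝ} (h : l < r) {t : ℝ}
    (ht : t ∈ Icc l r) :
    Real.sqrt (r - l) * |v.eval t| ≤ invK n * l2 l r (fun t => v.eval t) := by
  have hpos : 0 < r - l := by linarith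
  have h1 := (weighted_inverse_left hv h ht).1
  have h2 := integral_dist_mul_sq_le h.le (f := fun t => v.eval t) (by fun_prop)
  have hK := one_le_invK n
  have h3 : (r - l) * v.eval t ^ 2 ≤ invK n * l2 l r (fun t => v.eval t) ^ 2 := by
    have := h1.trans (mul_le_mul_of_nonneg_left h2 (invK_pos n).le)
    have h4 : (r - l) * ((r - l) * v.eval t ^ 2) ≤
      (r - l) * (invK n * l2 l r (fun t => v.eval t) ^ 2) := by nlinarith
    exact le_of_mul_le_mul_left h4 hpos
  apply le_of_sq_le_sq _ (mul_nonneg (invK_pos n).le (l2_nonneg _ _ _))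
  rw [mul_pow, Real.sq_sqrt hpos.le, sq_abs, mul_pow]
  refine h3.trans (mul_le_mul_of_nonneg_right (by nlinarith) (sq_nonneg _))

lemma l2_derivative_le {n : ℕ} {v : ℝ[X]} (hv : v.degree < n) {l r : ℝ} (h : l < r) :
    (r - l) * l2 l r (fun t => (derivative v).eval t) ≤ invK n * l2 l r (fun t => v.eval t) := by
  have hpos : 0 < r - l := by linarith
  have hK := one_le_invK n
  have h2 := integral_dist_mul_sq_le h.le (f := fun t => v.eval t) (by fun_prop)
  set Y := l2 l r (fun t => v.eval t)
  have hY : 0 ≤ Y := l2_nonneg _ _ _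
  have h3 : ∀ t ∈ Icc l r, |(derivative v).eval t| ≤ invK n * Y / ((r - l) * Real.sqrt (r - l)) := by
    intro t ht
    have h1 := (weighted_inverse_left hv h ht).2
    rw [le_div_iff₀ (by positivity)]
    apply le_of_sq_le_sq _ (mul_nonneg (invK_pos n).le hY)
    rw [mul_pow, mul_pow, Real.sq_sqrt hpos.le, sq_abs]
    have h4 := h1.trans (mul_le_mul_of_nonneg_left h2 (invK_pos n).le)
    have h5 : (r - l) * ((derivative v).eval t ^ 2 * ((r - l) ^ 2 * (r - l))) ≤
      (r - l) * (invK n * Y ^ 2) := by nlinarith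
    have h6 := le_of_mul_le_mul_left h5 hpos
    have h7 : invK n * Y ^ 2 ≤ (invK n * Y) ^ 2 := by
      rw [mul_pow]; exact mul_le_mul_of_nonneg_right (by nlinarith) (sq_nonneg _)
    linarith
  have h4 := l2_le_of_abs_le h.le (f := fun t => (derivative v).eval t) (by fun_prop)
    (by have := (invK_pos n).le; positivity) h3
  have hs : 0 < Real.sqrt (r - l) := Real.sqrt_pos.2 hpos
  calc _ ≤ (r - l) * (invK n * Y / ((r - l) * Real.sqrt (r - l)) * Real.sqrt (r - l)) :=
        mul_le_mul_of_nonneg_left h4 hpos.le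
    _ = invK n * Y := by field_simp

/-- Linear functional given by integration against a continuous function. -/
def integralFunctional (l r : ℝ) (g : ℝ → ℝ) (hg : Continuous g) : ℝ[X] →ₗ[ℝ] ℝ where
  toFun s := ∫ t in l..r, g t * s.eval t
  map_add' s s' := by
    rw [← intervalIntegral.integral_add] <;>
      first
        | (congr 1; funext t; simp; ring)
        | exact Continuous.intervalIntegrable (by fun_prop) _ _
  map_smul' c s := by
    simp only [smul_eq_mul, RingHom.id_apply]
    rw [← intervalIntegral.integral_const_mul]
    congr 1; funext t; simp; ring

/-- Stability in the maximum norm: π - χ is the L² projection of g - χ, its L² norm is at most B √(r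
- l), and the inverse estimate turns this into a pointwise bound in which the length cancels.
Quasi-optimality against every χ is stated instead of a fixed rate, because the competitor is chosen
later according to whether the element resolves the layer. -/
lemma exists_l2_projection (n : ℕ) {l r : ℝ} (h : l < r) {g : ℝ → ℝ} (hg : Continuous g) :
    ∃ π : ℝ[X], π.degree < n ∧
      (∀ s : ℝ[X], s.degree < n → ∫ t in l..r, π.eval t * s.eval t = ∫ t in l..r, g t * s.eval t) ∧
      ∀ (χ : ℝ[X]) (B : ℝ), χ.degree < n → 0 ≤ B → (∀ t ∈ Icc l r, |g t - χ.eval t| ≤ B) →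
        ∀ t ∈ Icc l r, |g t - π.eval t| ≤ (1 + invK n ^ 2) * B := by
  obtain ⟨π, hπ, hs⟩ := exists_weighted_riesz n h (wt := fun _ => 1) continuous_const
    (fun _ _ => one_pos) (integralFunctional l r g hg)
  simp only [one_mul] at hs
  refine ⟨π, hπ, hs, fun χ B hχ hB hgB t ht => ?_⟩
  have hpos : 0 < r - l := by linarith
  set e := π - χ with he
  have hed : e.degree < n := degree_sub_lt' hπ hχ
  have h1 : ∫ t in l..r, (g t - χ.eval t) * e.eval t = l2 l r (fun t => e.eval t) ^ 2 := by
    have h2 := hs e hed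
    change _ = ∫ t in l..r, g t * e.eval t at h2
    have h3 : ∫ t in l..r, (g t - χ.eval t) * e.eval t =
        (∫ t in l..r, g t * e.eval t) - ∫ t in l..r, χ.eval t * e.eval t := by
      rw [← intervalIntegral.integral_sub] <;>
      first
        | (congr 1; funext t; ring)
        | exact Continuous.intervalIntegrable (by fun_prop) _ _
    rw [h3, ← h2, l2_sq h.le, ← intervalIntegral.integral_sub] 
    · congr 1; funext t; simp [he]; ring
    all_goals exact Continuous.intervalIntegrable (by fun_prop) _ _
  have h4 := (le_abs_self _).trans (abs_integral_sup_le h.le (f := fun t => g t - χ.eval t)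
    (g := fun t => e.eval t) (by fun_prop) (by fun_prop) hB hgB)
  rw [h1] at h4
  set Y := l2 l r (fun t => e.eval t)
  have hY : 0 ≤ Y := l2_nonneg _ _ _
  have hs0 : 0 < Real.sqrt (r - l) := Real.sqrt_pos.2 hpos
  have h5 : Y ≤ B * Real.sqrt (r - l) := by
    rcases hY.eq_or_lt with h0 | h0
    · rw [← h0]; positivity
    · exact le_of_mul_le_mul_right (by nlinarith) h0
  have h6 := sqrt_mul_abs_eval_le hed h ht
  have hK := one_le_invK n
  have h7 : |e.eval t| ≤ invK n * B := by
    have : Real.sqrt (r - l) * |e.eval t| ≤ Real.sqrt (r - l) * (invK n * B) := by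
      refine h6.trans ((mul_le_mul_of_nonneg_left h5 (invK_pos n).le).trans (le_of_eq (by ring)))
    exact le_of_mul_le_mul_left this hs0
  have h8 : g t - π.eval t = (g t - χ.eval t) - e.eval t := by simp [he]
  rw [h8]
  calc _ ≤ |g t - χ.eval t| + |e.eval t| := abs_sub _ _
    _ ≤ B + invK n * B := add_le_add (hgB t ht) h7
    _ ≤ (1 + invK n ^ 2) * B := by nlinarith [mul_nonneg hB (sub_nonneg.2 hK)]

/-- For negative h the positive weight on the interval is z - t; its sign and that of the reversed
integral compensate. Both orientations are needed for the two Radau projections. -/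
lemma exists_radau_riesz (k : ℕ) {z h : ℝ} (hh : h ≠ 0) (ℓ : ℝ[X] →ₗ[ℝ] ℝ) :
    ∃ ψ : ℝ[X], ψ.degree < k ∧ ∀ s : ℝ[X], s.degree < k →
      ∫ t in z..z + h, (t - z) * (ψ.eval t * s.eval t) = ℓ s := by
  rcases hh.lt_or_gt with hneg | hpos
  · obtain ⟨ψ, h1, h2⟩ := exists_weighted_riesz k (l := z + h) (r := z) (by linarith)
      (wt := fun t => z - t) (by fun_prop) (fun t ht => by linarith [ht.2]) ℓ
    refine ⟨ψ, h1, fun s hs => ?_⟩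
    rw [← h2 s hs, intervalIntegral.integral_symm, ← intervalIntegral.integral_neg]
    congr 1; funext t; ring
  · exact exists_weighted_riesz k (l := z) (r := z + h) (by linarith)
      (wt := fun t => t - z) (by fun_prop) (fun t ht => by linarith [ht.1]) ℓ

lemma mem_uIcc_add_iff {z h t : ℝ} (hh : h ≠ 0) (ht : t ∈ uIcc z (z + h)) :
    ∃ s ∈ Icc (0 : ℝ) 1, t = z + h * s := by
  refine ⟨(t - z) / h, ?_, by field_simp; ring⟩
  rcases hh.lt_or_gt with hneg | hpos
  · rw [uIcc_of_ge (by linarith)] at ht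
    exact ⟨div_nonneg_of_nonpos (by linarith [ht.2]) hneg.le,
      by rw [div_le_one_of_neg hneg]; linarith [ht.1]⟩
  · rw [uIcc_of_le (by linarith)] at ht
    exact ⟨div_nonneg (by linarith [ht.1]) hpos.le,
      by rw [div_le_one hpos]; linarith [ht.2]⟩

/-- Interpolation at z is built in by the ansatz π = g(z) + (X - z) ψ; the orthogonality conditions
become a Riesz problem for ψ in the product with weight t - z. For stability, e = π - χ is written
as e(z) + (X - z) φ. Here |e(z)| ≤ B by interpolation, and φ is bounded by testing the orthogonality
with φ itself and using the weighted inverse estimate. The sign of h decides whether z is the left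
or the right end. -/
lemma exists_radau_projection (k : ℕ) {z h : ℝ} (hh : h ≠ 0) {g : ℝ → ℝ} (hg : Continuous g) :
    ∃ π : ℝ[X], π.degree < ((k + 1 : ℕ) : WithBot ℕ) ∧ π.eval z = g z ∧
      (∀ s : ℝ[X], s.degree < k →
        ∫ t in z..z + h, π.eval t * s.eval t = ∫ t in z..z + h, g t * s.eval t) ∧
      ∀ (χ : ℝ[X]) (B : ℝ), χ.degree < ((k + 1 : ℕ) : WithBot ℕ) → 0 ≤ B →
        (∀ t ∈ uIcc z (z + h), |g t - χ.eval t| ≤ B) →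
        ∀ t ∈ uIcc z (z + h), |g t - π.eval t| ≤ (2 + 2 * invK k ^ 2) * B := by
  obtain ⟨ψ, hψ, hs⟩ := exists_radau_riesz k (z := z) hh
    (integralFunctional z (z + h) (fun t => g t - g z) (by fun_prop))
  have hs' : ∀ s : ℝ[X], s.degree < k → ∫ t in z..z + h, (t - z) * (ψ.eval t * s.eval t) =
    ∫ t in z..z + h, (g t - g z) * s.eval t := hs
  set π : ℝ[X] := C (g z) + (X - C z) * ψ with hπ
  have hπe : ∀ t, π.eval t = g z + (t - z) * ψ.eval t := by intro t; simp [hπ]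
  have hmul : ((X - C z) * ψ).degree < ((k + 1 : ℕ) : WithBot ℕ) := by
    by_cases h0 : ψ = 0
    · rw [h0]; simp
    · rw [degree_mul, degree_X_sub_C, degree_eq_natDegree h0]
      rw [degree_eq_natDegree h0] at hψ
      have : ψ.natDegree < k := by exact_mod_cast hψ
      norm_cast; omega
  have hπd : π.degree < ((k + 1 : ℕ) : WithBot ℕ) := degree_add_lt' (degree_C_lt _ (by omega)) hmul
  have horth : ∀ s : ℝ[X], s.degree < k →
        ∫ t in z..z + h, π.eval t * s.eval t = ∫ t in z..z + h, g t * s.eval t := by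
    intro s hsd
    have h1 := hs' s hsd
    have h2 : ∫ t in z..z + h, π.eval t * s.eval t =
        (∫ t in z..z + h, g z * s.eval t) +
        ∫ t in z..z + h, (t - z) * (ψ.eval t * s.eval t) := by
      rw [← intervalIntegral.integral_add] <;>
      first
        | (congr 1; funext t; rw [hπe]; ring)
        | exact Continuous.intervalIntegrable (by fun_prop) _ _
    rw [h2, h1, ← intervalIntegral.integral_add] <;>
      first
        | (congr 1; funext t; ring)
        | exact Continuous.intervalIntegrable (by fun_prop) _ _
  refine ⟨π, hπd, by simp [hπ], horth, fun χ B hχ hB hgB t ht => ?_⟩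
  set e := π - χ with he
  have hed : e.degree < ((k + 1 : ℕ) : WithBot ℕ) := degree_sub_lt' hπd hχ
  set φ := (e - C (e.eval z)) /ₘ (X - C z) with hφ
  have hfac : (X - C z) * φ = e - C (e.eval z) := by
    rw [hφ, mul_divByMonic_eq_iff_isRoot]; simp
  have hφd : φ.degree < k := by
    by_cases h0 : φ = 0
    · rw [h0]; simp
    · have h1 : ((X - C z) * φ).degree < ((k + 1 : ℕ) : WithBot ℕ) := by
        rw [hfac]; exact degree_sub_lt' hed (degree_C_lt _ (by omega))
      rw [degree_mul, degree_X_sub_C, degree_eq_natDegree h0] at h1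
      rw [degree_eq_natDegree h0]
      have : 1 + φ.natDegree < k + 1 := by exact_mod_cast h1
      norm_cast; omega
  have hee : ∀ t, e.eval t = e.eval z + (t - z) * φ.eval t := by
    intro t
    have := congrArg (fun q : ℝ[X] => q.eval t) hfac
    simp only [eval_mul, eval_sub, eval_X, eval_C] at this
    linarith
  have hez : |e.eval z| ≤ B := by
    have h1 := hgB z left_mem_uIcc
    have h2 : e.eval z = g z - χ.eval z := by simp [he, hπe]
    rwa [h2]
  -- The orthogonality relation with test function φ, in which π is replaced by g and the weighted
  -- square of φ is isolated.
  have hJ : ∫ t in z..z + h, (t - z) * φ.eval t ^ 2 =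
      ∫ t in z..z + h, (g t - χ.eval t - e.eval z) * φ.eval t := by
    have h1 := horth φ hφd
    have h2 : ∫ t in z..z + h, (t - z) * φ.eval t ^ 2 =
        (∫ t in z..z + h, π.eval t * φ.eval t) -
        ∫ t in z..z + h, (χ.eval t + e.eval z) * φ.eval t := by
      rw [← intervalIntegral.integral_sub] <;>
      first
        | (congr 1; funext t
           have := hee t
           have h3 : π.eval t = e.eval t + χ.eval t := by simp [he]
           rw [h3, this]; ring)
        | exact Continuous.intervalIntegrable (by fun_prop) _ _
    rw [h2, h1, ← intervalIntegral.integral_sub] <;>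
      first
        | (congr 1; funext t; ring)
        | exact Continuous.intervalIntegrable (by fun_prop) _ _
  set J := ∫ t in z..z + h, (t - z) * φ.eval t ^ 2 with hJdef
  have hinv : ∀ t ∈ uIcc z (z + h), h ^ 2 * φ.eval t ^ 2 ≤ invK k * J := by
    intro t ht
    obtain ⟨s, hs, rfl⟩ := mem_uIcc_add_iff hh ht
    exact ((exists_weighted_inverse k).choose_spec.2 φ hφd z h hh s hs).1
  have hK := one_le_invK k
  -- Read off from the inverse estimate, so that no distinction of the sign of h is needed.
  have hJ0 : 0 ≤ J := by
    have h1 := hinv z left_mem_uIcc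
    have h2 : 0 ≤ invK k * J := le_trans (by positivity) h1
    exact nonneg_of_mul_nonneg_right h2 (invK_pos k)
  have habs : ∀ t ∈ uIcc z (z + h), |h| * |φ.eval t| ≤ invK k * Real.sqrt J := by
    intro t ht
    apply le_of_sq_le_sq _ (mul_nonneg (invK_pos k).le (Real.sqrt_nonneg _))
    rw [mul_pow, mul_pow, sq_abs, sq_abs, Real.sq_sqrt hJ0]
    exact (hinv t ht).trans (mul_le_mul_of_nonneg_right (by nlinarith) hJ0)
  have hh' : 0 < |h| := abs_pos.2 hh
  -- The length |h| of the interval cancels the factor |h| in the bound `habs` for φ; this makes the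
  -- final constant independent of the element.
  have hJle : J ≤ 2 * B * (invK k * Real.sqrt J) := by
    have h1 : ∀ t ∈ Set.uIoc z (z + h), ‖(g t - χ.eval t - e.eval z) * φ.eval t‖ ≤
        2 * B * (invK k * Real.sqrt J / |h|) := by
      intro t ht
      have ht' : t ∈ uIcc z (z + h) := uIoc_subset_uIcc ht
      rw [Real.norm_eq_abs, abs_mul]
      refine mul_le_mul ?_ ?_ (abs_nonneg _) (by positivity)
      · have := abs_sub (g t - χ.eval t) (e.eval z)
        linarith [hgB t ht']
      · rw [le_div_iff₀ hh', mul_comm]; exact habs t ht'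
    have h2 := intervalIntegral.norm_integral_le_of_norm_le_const h1
    rw [← hJ, add_sub_cancel_left] at h2
    refine (le_abs_self J).trans (h2.trans (le_of_eq ?_))
    field_simp
  have hsJ : Real.sqrt J ≤ 2 * B * invK k := by
    rcases (Real.sqrt_nonneg J).eq_or_lt with h0 | h0
    · rw [← h0]; have := (invK_pos k).le; positivity
    · have h1 : Real.sqrt J * Real.sqrt J = J := Real.mul_self_sqrt hJ0
      exact le_of_mul_le_mul_right (by nlinarith) h0
  obtain ⟨s, hs01, hts⟩ := mem_uIcc_add_iff hh ht
  have h1 : |(t - z) * φ.eval t| ≤ |h| * |φ.eval t| := by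
    rw [abs_mul]
    refine mul_le_mul_of_nonneg_right ?_ (abs_nonneg _)
    rw [hts, add_sub_cancel_left, abs_mul, abs_of_nonneg hs01.1]
    exact mul_le_of_le_one_right (abs_nonneg _) hs01.2
  have h2 : g t - π.eval t = (g t - χ.eval t) - (e.eval z + (t - z) * φ.eval t) := by
    rw [← hee]; simp [he]
  have h3 : |h| * |φ.eval t| ≤ invK k * (2 * B * invK k) :=
    (habs t ht).trans (mul_le_mul_of_nonneg_left hsJ (invK_pos k).le)
  rw [h2]
  calc _ ≤ |g t - χ.eval t| + |e.eval z + (t - z) * φ.eval t| := abs_sub _ _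
    _ ≤ |g t - χ.eval t| + (|e.eval z| + |(t - z) * φ.eval t|) := by gcongr; exact abs_add_le _ _
    _ ≤ (2 + 2 * invK k ^ 2) * B := by linarith [hgB t ht]

end

/-! ### The bilinear forms of the scheme, summed over the elements. -/

section

lemma integral_lin2 {l r : ℝ} {F f g : ℝ → ℝ} (s t : ℝ) (hf : Continuous f) (hg : Continuous g)
    (h : ∀ y, F y = s * f y + t * g y) :
    ∫ y in l..r, F y = s * (∫ y in l..r, f y) + t * ∫ y in l..r, g y := by
  rw [← intervalIntegral.integral_const_mul, ← intervalIntegral.integral_const_mul,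
    ← intervalIntegral.integral_add]
  · simp only [h]
  all_goals exact Continuous.intervalIntegrable (by fun_prop) _ _

lemma integral_lin3 {l r : ℝ} {F f g e : ℝ → ℝ} (s t z : ℝ) (hf : Continuous f)
    (hg : Continuous g) (he : Continuous e) (h : ∀ y, F y = s * f y + t * g y + z * e y) :
    ∫ y in l..r, F y = s * (∫ y in l..r, f y) + t * (∫ y in l..r, g y) + z * ∫ y in l..r, e y := by
  rw [integral_lin2 (F := F) (f := fun y => s * f y + t * g y) (g := e) 1 z (by fun_prop) he
    (fun y => by rw [h]; ring), integral_lin2 (F := fun y => s * f y + t * g y) s t hf hg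
    (fun _ => rfl)]
  ring

/-- The trace from the left at the left end of the element `i`, which is `0` for `i = 0`. -/
def prev (x : ℕ → ℝ) (y : ℕ → ℝ → ℝ) : ℕ → ℝ
  | 0 => 0
  | i + 1 => y i (x (i + 1))

/-- The jump at the left end of the element `i`. -/
def jmp (x : ℕ → ℝ) (y : ℕ → ℝ → ℝ) (i : ℕ) : ℝ := y i (x i) - prev x y i

/-- Evaluation of a sequence of polynomials. -/
abbrev ev (v : ℕ → ℝ[X]) : ℕ → ℝ → ℝ := fun i t => (v i).eval t

/-- The form `∑ (a y, v') + ∑ a y⁺ [v] - a(x_N) y_N⁻ v_N⁻`. -/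
def aform (x : ℕ → ℝ) (n : ℕ) (a : ℝ → ℝ) (y : ℕ → ℝ → ℝ) (v : ℕ → ℝ[X]) : ℝ :=
  (∑ i ∈ Finset.range (n + 1), ((∫ t in x i..x (i + 1), a t * y i t * (derivative (v i)).eval t)
    + a (x i) * y i (x i) * jmp x (ev v) i))
    - a (x (n + 1)) * y n (x (n + 1)) * (v n).eval (x (n + 1))

/-- The convection-reaction form with upwind flux. -/
def bform (x : ℕ → ℝ) (n : ℕ) (b b1 c : ℝ → ℝ) (y : ℕ → ℝ → ℝ) (v : ℕ → ℝ[X]) : ℝ :=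
  (∑ i ∈ Finset.range (n + 1), (-(∫ t in x i..x (i + 1), b t * y i t * (derivative (v i)).eval t)
    - ((b (x i) + |b (x i)|) / 2 * prev x y i + (b (x i) - |b (x i)|) / 2 * y i (x i))
      * jmp x (ev v) i
    + ∫ t in x i..x (i + 1), (c t - b1 t) * y i t * (v i).eval t))
    + (b (x (n + 1)) + |b (x (n + 1))|) / 2 * y n (x (n + 1)) * (v n).eval (x (n + 1))

/-- The part of the squared energy norm that involves the first component. -/
def uquad (x : ℕ → ℝ) (n : ℕ) (b b1 c : ℝ → ℝ) (y : ℕ → ℝ → ℝ) : ℝ :=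
  (∑ i ∈ Finset.range (n + 1), ((∫ t in x i..x (i + 1), (c t - 1 / 2 * b1 t) * y i t ^ 2)
    + 1 / 2 * (|b (x i)| * jmp x y i ^ 2)))
    + 1 / 2 * (|b (x (n + 1))| * y n (x (n + 1)) ^ 2)

/-- The part of the squared energy norm that involves the second component. -/
def pquad (x : ℕ → ℝ) (n : ℕ) (ε : ℝ) (a : ℝ → ℝ) (y : ℕ → ℝ → ℝ) : ℝ :=
  (∑ i ∈ Finset.range (n + 1), ((∫ t in x i..x (i + 1), a t * y i t ^ 2)
    + ε / 2 * jmp x y i ^ 2)) + ε / 2 * y n (x (n + 1)) ^ 2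

/-- A mesh of `[0, 1]` with `n + 1` elements. -/
structure IsMesh (x : ℕ → ℝ) (n : ℕ) : Prop where
  zero : x 0 = 0
  one : x (n + 1) = 1
  lt : ∀ i ≤ n, x i < x (i + 1)

lemma IsMesh.mem {x : ℕ → ℝ} {n : ℕ} (hx : IsMesh x n) {i : ℕ} (hi : i ≤ n + 1) :
    x i ∈ Icc (0 : ℝ) 1 := by
  constructor
  · induction i with
    | zero => exact hx.zero.ge
    | succ j ih => exact (ih (by omega)).trans (hx.lt j (by omega)).le
  · have : ∀ j, j ≤ n + 1 → x (n + 1 - j) ≤ 1 := by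
      intro j
      induction j with
      | zero => intro _; exact hx.one.le
      | succ j ih =>
        intro hj
        have h1 := hx.lt (n + 1 - (j + 1)) (by omega)
        rw [show n + 1 - (j + 1) + 1 = n + 1 - j by omega] at h1
        exact h1.le.trans (ih (by omega))
    simpa [Nat.sub_sub_self hi] using this (n + 1 - i) (by omega)

lemma IsMesh.subset {x : ℕ → ℝ} {n : ℕ} (hx : IsMesh x n) {i : ℕ} (hi : i ≤ n) :
    Icc (x i) (x (i + 1)) ⊆ Icc 0 1 :=
  Icc_subset_Icc (hx.mem (by omega)).1 (hx.mem (by omega)).2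

lemma IsMesh.sum {x : ℕ → ℝ} {n : ℕ} (hx : IsMesh x n) :
    ∑ i ∈ Finset.range (n + 1), (x (i + 1) - x i) = 1 := by
  rw [Finset.sum_range_sub, hx.zero, hx.one, sub_zero]

/-- Assumptions on the coefficients, extended continuously to the real line. -/
structure IsCoeff (a a1 b b1 c : ℝ → ℝ) (α γ K : ℝ) : Prop where
  ca : Continuous a
  ca1 : Continuous a1
  cb : Continuous b
  cb1 : Continuous b1
  cc : Continuous c
  one_le : 1 ≤ K
  ba : ∀ t, |a t| ≤ K
  ba1 : ∀ t, |a1 t| ≤ K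
  bb : ∀ t, |b t| ≤ K
  bb1 : ∀ t, |b1 t| ≤ K
  bc : ∀ t, |c t| ≤ K
  da : ∀ t ∈ Ioo (0 : ℝ) 1, HasDerivAt a (a1 t) t
  db : ∀ t ∈ Ioo (0 : ℝ) 1, HasDerivAt b (b1 t) t
  pos_α : 0 < α
  pos_γ : 0 < γ
  le_a : ∀ t, α ≤ a t
  le_c : ∀ t, γ ≤ c t - 1 / 2 * b1 t

lemma integral_deriv_eq {l r : ℝ} (h : l ≤ r) {F f : ℝ → ℝ} (hF : Continuous F) (hf : Continuous f)
    (hd : ∀ t ∈ Ioo l r, HasDerivAt F (f t) t) : ∫ t in l..r, f t = F r - F l :=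
  intervalIntegral.integral_eq_sub_of_hasDerivAt_of_le h hF.continuousOn hd
    (hf.intervalIntegrable _ _)

/-- Integration by parts for two polynomials and a coefficient. -/
lemma integral_by_parts {l r : ℝ} (h : l ≤ r) {g g1 : ℝ → ℝ} (hg : Continuous g)
    (hg1 : Continuous g1) (hd : ∀ t ∈ Ioo l r, HasDerivAt g (g1 t) t) (v w : ℝ[X]) :
    (∫ t in l..r, (g1 t * v.eval t + g t * (derivative v).eval t) * w.eval t) +
      ∫ t in l..r, g t * v.eval t * (derivative w).eval t =
    g r * v.eval r * w.eval r - g l * v.eval l * w.eval l := by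
  rw [← intervalIntegral.integral_add]
  · refine integral_deriv_eq (F := fun t => g t * v.eval t * w.eval t) h (by fun_prop)
      (by fun_prop) fun t ht => ?_
    exact ((hd t ht).mul (v.hasDerivAt t)).mul (w.hasDerivAt t)
  all_goals exact Continuous.intervalIntegrable (by fun_prop) _ _

lemma integral_by_parts_one {l r : ℝ} (h : l ≤ r) (v w : ℝ[X]) :
    (∫ t in l..r, (derivative v).eval t * w.eval t) +
      ∫ t in l..r, v.eval t * (derivative w).eval t =
    v.eval r * w.eval r - v.eval l * w.eval l := by
  have := integral_by_parts h (g := fun _ => 1) (g1 := fun _ => 0) continuous_const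
    continuous_const (fun t _ => hasDerivAt_const t 1) v w
  simpa using this

section forms
variable {x : ℕ → ℝ} {n : ℕ} {a a1 b b1 c : ℝ → ℝ} {α γ K : ℝ}

/-- Half of the integral of (b u²)' is integrated by parts. At each node the upwind flux completes
the boundary terms to |b| times half the squared jump plus a telescoping part; the telescoped
remainder at x = 1 is -b u²/2, which combines with the outflow term to |b| u²/2. -/
lemma bform_self (hx : IsMesh x n) (hc : IsCoeff a a1 b b1 c α γ K) (u : ℕ → ℝ[X]) :
    bform x n b b1 c (ev u) u = uquad x n b b1 c (ev u) := by
  have hcb := hc.cb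
  have hcb1 := hc.cb1
  have hcc := hc.cc
  have key : ∀ i ∈ Finset.range (n + 1),
      (-(∫ t in x i..x (i + 1), b t * ev u i t * (derivative (u i)).eval t)
      - ((b (x i) + |b (x i)|) / 2 * prev x (ev u) i + (b (x i) - |b (x i)|) / 2 * ev u i (x i))
      * jmp x (ev u) i
      + ∫ t in x i..x (i + 1), (c t - b1 t) * ev u i t * (u i).eval t) =
      ((∫ t in x i..x (i + 1), (c t - 1 / 2 * b1 t) * ev u i t ^ 2)
        + 1 / 2 * (|b (x i)| * jmp x (ev u) i ^ 2)) +
      (1 / 2 * b (x i) * prev x (ev u) i ^ 2 -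
        1 / 2 * b (x (i + 1)) * prev x (ev u) (i + 1) ^ 2) := by
    intro i hi
    have hi' : i ≤ n := by simpa [Nat.lt_succ_iff] using hi
    have hlt := (hx.lt i hi').le
    have h1 := integral_by_parts hlt hcb hcb1
      (fun t ht => hc.db t ⟨(hx.mem (by omega)).1.trans_lt ht.1,
        ht.2.trans_le (hx.mem (by omega)).2⟩) (u i) (u i)
    have h2 : (∫ t in x i..x (i + 1), (b1 t * (u i).eval t + b t * (derivative (u i)).eval t) *
        (u i).eval t) = 1 * (∫ t in x i..x (i + 1), b1 t * (u i).eval t ^ 2) +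
        1 * ∫ t in x i..x (i + 1), b t * (u i).eval t * (derivative (u i)).eval t :=
      integral_lin2 1 1 (by fun_prop) (by fun_prop) (fun y => by ring)
    have h3 : ∫ t in x i..x (i + 1), (c t - b1 t) * ev u i t * (u i).eval t =
        1 * (∫ t in x i..x (i + 1), (c t - 1 / 2 * b1 t) * ev u i t ^ 2) +
        (-(1/2)) * ∫ t in x i..x (i + 1), b1 t * (u i).eval t ^ 2 :=
      integral_lin2 _ _ (by fun_prop) (by fun_prop) (fun y => by simp only [ev]; ring)
    rw [h3]
    rw [h2] at h1
    simp only [jmp, prev, ev] at *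
    linear_combination (-1 / 2) * h1
  rw [bform, uquad, Finset.sum_congr rfl key, Finset.sum_add_distrib, Finset.sum_range_sub']
  simp only [prev, ev]
  ring

/-- The added square replaces the trace in `aform` at x = 1 by the flux P̂_N = 0 of the second
equation. Without it the boundary contribution would have the wrong sign. -/
lemma aform_one_self (hx : IsMesh x n) (p : ℕ → ℝ[X]) :
    aform x n (fun _ => 1) (ev p) p + (p n).eval (x (n + 1)) ^ 2 =
      1 / 2 * (∑ i ∈ Finset.range (n + 1), jmp x (ev p) i ^ 2 + (p n).eval (x (n + 1)) ^ 2) := by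
  have key : ∀ i ∈ Finset.range (n + 1),
      ((∫ t in x i..x (i + 1), 1 * ev p i t * (derivative (p i)).eval t)
    + 1 * ev p i (x i) * jmp x (ev p) i) = 1 / 2 * jmp x (ev p) i ^ 2 +
      (1 / 2 * prev x (ev p) (i + 1) ^ 2 - 1 / 2 * prev x (ev p) i ^ 2) := by
    intro i hi
    have hi' : i ≤ n := by simpa [Nat.lt_succ_iff] using hi
    have h1 := integral_by_parts_one (hx.lt i hi').le (p i) (p i)
    simp only [mul_comm (eval _ (derivative _))] at h1
    simp only [one_mul, jmp, prev, ev] at *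
    linear_combination (1 / 2) * h1
  rw [aform, Finset.sum_congr rfl key, Finset.sum_add_distrib,
    Finset.sum_range_sub (fun i => 1 / 2 * prev x (ev p) i ^ 2), ← Finset.mul_sum]
  simp only [prev, ev]
  ring

lemma prev_add (y z : ℕ → ℝ → ℝ) (s : ℝ) (i : ℕ) :
    prev x (fun i t => y i t + s * z i t) i = prev x y i + s * prev x z i := by
  cases i <;> simp [prev]

lemma jmp_add (y z : ℕ → ℝ → ℝ) (s : ℝ) (i : ℕ) :
    jmp x (fun i t => y i t + s * z i t) i = jmp x y i + s * jmp x z i := by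
  simp only [jmp, prev_add]; ring

lemma ev_add (v w : ℕ → ℝ[X]) (s : ℝ) :
    ev (fun i => v i + s • w i) = fun i t => ev v i t + s * ev w i t := by
  funext i t; simp [ev]

lemma aform_add_left (ha : Continuous a) {y z : ℕ → ℝ → ℝ} (hy : ∀ i, Continuous (y i))
    (hz : ∀ i, Continuous (z i)) (s : ℝ) (v : ℕ → ℝ[X]) :
    aform x n a (fun i t => y i t + s * z i t) v = aform x n a y v + s * aform x n a z v := by
  simp only [aform, mul_sub, Finset.mul_sum]
  rw [sub_add_sub_comm, ← Finset.sum_add_distrib]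
  congr 1
  · refine Finset.sum_congr rfl fun i _ => ?_
    have := hy i
    have := hz i
    rw [integral_lin2 (f := fun t => a t * y i t * (derivative (v i)).eval t)
      (g := fun t => a t * z i t * (derivative (v i)).eval t) 1 s (by fun_prop) (by fun_prop)
      (fun t => by ring)]
    ring
  · ring

lemma aform_add_right (ha : Continuous a) {y : ℕ → ℝ → ℝ} (hy : ∀ i, Continuous (y i))
    (s : ℝ) (v w : ℕ → ℝ[X]) :
    aform x n a y (fun i => v i + s • w i) = aform x n a y v + s * aform x n a y w := by
  simp only [aform, mul_sub, Finset.mul_sum]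
  rw [sub_add_sub_comm, ← Finset.sum_add_distrib]
  congr 1
  · refine Finset.sum_congr rfl fun i _ => ?_
    have := hy i
    rw [integral_lin2 (f := fun t => a t * y i t * (derivative (v i)).eval t)
      (g := fun t => a t * y i t * (derivative (w i)).eval t) 1 s (by fun_prop) (by fun_prop)
      (fun t => by simp; ring), ev_add, jmp_add]
    ring
  · simp; ring

lemma bform_add_left (hb : Continuous b) (hb1 : Continuous b1) (hcc : Continuous c)
    {y z : ℕ → ℝ → ℝ} (hy : ∀ i, Continuous (y i))
    (hz : ∀ i, Continuous (z i)) (s : ℝ) (v : ℕ → ℝ[X]) :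
    bform x n b b1 c (fun i t => y i t + s * z i t) v =
      bform x n b b1 c y v + s * bform x n b b1 c z v := by
  rw [bform, bform, bform, mul_add s, add_add_add_comm, Finset.mul_sum, ← Finset.sum_add_distrib]
  congr 1
  · refine Finset.sum_congr rfl fun i _ => ?_
    have := hy i
    have := hz i
    have e1 : ∫ t in x i..x (i + 1), b t * (y i t + s * z i t) * (derivative (v i)).eval t =
        1 * (∫ t in x i..x (i + 1), b t * y i t * (derivative (v i)).eval t) +
        s * ∫ t in x i..x (i + 1), b t * z i t * (derivative (v i)).eval t :=
      integral_lin2 1 s (by fun_prop) (by fun_prop) (fun t => by ring)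
    have e2 : ∫ t in x i..x (i + 1), (c t - b1 t) * (y i t + s * z i t) * (v i).eval t =
        1 * (∫ t in x i..x (i + 1), (c t - b1 t) * y i t * (v i).eval t) +
        s * ∫ t in x i..x (i + 1), (c t - b1 t) * z i t * (v i).eval t :=
      integral_lin2 1 s (by fun_prop) (by fun_prop) (fun t => by ring)
    rw [e1, e2, prev_add]
    ring
  · ring

lemma bform_add_right (hb : Continuous b) (hb1 : Continuous b1) (hcc : Continuous c)
    {y : ℕ → ℝ → ℝ} (hy : ∀ i, Continuous (y i)) (s : ℝ) (v w : ℕ → ℝ[X]) :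
    bform x n b b1 c y (fun i => v i + s • w i) =
      bform x n b b1 c y v + s * bform x n b b1 c y w := by
  rw [bform, bform, bform, mul_add s, add_add_add_comm, Finset.mul_sum, ← Finset.sum_add_distrib]
  congr 1
  · refine Finset.sum_congr rfl fun i _ => ?_
    have := hy i
    have e1 : ∫ t in x i..x (i + 1), b t * y i t * (derivative (v i + s • w i)).eval t =
        1 * (∫ t in x i..x (i + 1), b t * y i t * (derivative (v i)).eval t) +
        s * ∫ t in x i..x (i + 1), b t * y i t * (derivative (w i)).eval t :=
      integral_lin2 1 s (by fun_prop) (by fun_prop) (fun t => by simp; ring)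
    have e2 : ∫ t in x i..x (i + 1), (c t - b1 t) * y i t * (v i + s • w i).eval t =
        1 * (∫ t in x i..x (i + 1), (c t - b1 t) * y i t * (v i).eval t) +
        s * ∫ t in x i..x (i + 1), (c t - b1 t) * y i t * (w i).eval t :=
      integral_lin2 1 s (by fun_prop) (by fun_prop) (fun t => by simp; ring)
    rw [e1, e2, ev_add, jmp_add]
    ring
  · simp; ring

end forms

lemma exists_antiderivative (l : ℝ) {k : ℕ} {s : ℝ[X]} (hs : s.degree < k) :
    ∃ r : ℝ[X], derivative r = s ∧ r.eval l = 0 ∧ r.degree < ((k + 1 : ℕ) : WithBot ℕ) := by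
  set R : ℝ[X] := ∑ i ∈ Finset.range k, C (s.coeff i / (i + 1)) * X ^ (i + 1) with hR
  have hRd : R.degree < ((k + 1 : ℕ) : WithBot ℕ) := by
    rw [degree_lt_iff_coeff_zero]
    intro m hm
    simp only [hR, finsetSum_coeff, coeff_C_mul, coeff_X_pow]
    refine Finset.sum_eq_zero fun i hi => ?_
    have := Finset.mem_range.1 hi
    rw [if_neg (by omega), mul_zero]
  refine ⟨R - C (R.eval l), ?_, by simp, degree_sub_lt' hRd (degree_C_lt _ (by omega))⟩
  ext m
  rw [derivative_sub, derivative_C, sub_zero, coeff_derivative]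
  simp only [hR, finsetSum_coeff, coeff_C_mul, coeff_X_pow]
  by_cases hm : m < k
  · rw [Finset.sum_eq_single m]
    · simp; field_simp
    · intro i _ him; rw [if_neg (by omega), mul_zero]
    · intro h; exact absurd (Finset.mem_range.2 hm) h
  · rw [Finset.sum_eq_zero, zero_mul, (degree_lt_iff_coeff_zero s k).1 hs m (by omega)]
    intro i hi
    have := Finset.mem_range.1 hi
    rw [if_neg (by omega), mul_zero]

end

/-! ### The discrete derivative and the splitting on the last element. -/

section

/-- `p` is the discrete derivative of `u`: the first equation of the scheme, with zero right-hand
side. -/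
structure IsDiscDeriv (x : ℕ → ℝ) (n k : ℕ) (u p : ℕ → ℝ[X]) : Prop where
  deg_u : ∀ i, (u i).degree < ((k + 1 : ℕ) : WithBot ℕ)
  deg_p : ∀ i, (p i).degree < ((k + 1 : ℕ) : WithBot ℕ)
  inner : ∀ i < n, ∀ r : ℝ[X], r.degree < ((k + 1 : ℕ) : WithBot ℕ) →
    ∫ t in x i..x (i + 1), (p i).eval t * r.eval t =
      (∫ t in x i..x (i + 1), (derivative (u i)).eval t * r.eval t) +
        jmp x (ev u) i * r.eval (x i)
  last : ∀ r : ℝ[X], r.degree < ((k + 1 : ℕ) : WithBot ℕ) →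
    ∫ t in x n..x (n + 1), (p n).eval t * r.eval t =
      -(∫ t in x n..x (n + 1), (u n).eval t * (derivative r).eval t) -
        prev x (ev u) n * r.eval (x n)

/-- The decomposition `u = v + w` where `w` is the component of `u` on the last element orthogonal
to the polynomials of degree less than `k`, with the bounds of `v` by the discrete derivative. -/
structure IsSplit (x : ℕ → ℝ) (n k : ℕ) (D : ℝ) (u p v w : ℕ → ℝ[X]) : Prop where
  eq : ∀ i, u i = v i + w i
  deg_v : ∀ i, (v i).degree < ((k + 1 : ℕ) : WithBot ℕ)
  deg_w : ∀ i, (w i).degree < ((k + 1 : ℕ) : WithBot ℕ)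
  deg_v_last : (v n).degree < k
  w_zero : ∀ i, i ≠ n → w i = 0
  w_orth : ∀ s : ℝ[X], s.degree < k → ∫ t in x n..x (n + 1), (w n).eval t * s.eval t = 0
  deriv_le : ∀ i ≤ n, l2 (x i) (x (i + 1)) (fun t => (derivative (v i)).eval t) ≤
    D * l2 (x i) (x (i + 1)) (ev p i)
  jmp_le : ∀ i ≤ n, |jmp x (ev v) i| ≤
    D * Real.sqrt (x (i + 1) - x i) * l2 (x i) (x (i + 1)) (ev p i)
  end_le : |(v n).eval (x (n + 1))| ≤
    D * Real.sqrt (x (n + 1) - x n) * l2 (x n) (x (n + 1)) (ev p n)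
  start_le : |(v n).eval (x n)| ≤
    D * Real.sqrt (x (n + 1) - x n) * l2 (x n) (x (n + 1)) (ev p n)
  prev_le : |prev x (ev v) n| ≤
    D * Real.sqrt (x (n + 1) - x n) * l2 (x n) (x (n + 1)) (ev p n)
  l2_v_last : l2 (x n) (x (n + 1)) (ev v n) ≤ (x (n + 1) - x n) * l2 (x n) (x (n + 1)) (ev p n)
  l2_v : ∀ i ≤ n, l2 (x i) (x (i + 1)) (ev v i) ≤ l2 (x i) (x (i + 1)) (ev u i)
  l2_w : l2 (x n) (x (n + 1)) (ev w n) ≤ l2 (x n) (x (n + 1)) (ev u n)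

lemma abs_integral_le_sqrt_mul {l r : ℝ} (h : l ≤ r) {f : ℝ → ℝ} (hf : Continuous f) :
    |∫ t in l..r, f t| ≤ Real.sqrt (r - l) * l2 l r f := by
  have := abs_integral_sup_le h (f := fun _ => 1) (B := 1) continuous_const hf zero_le_one
    (by simp)
  simpa using this

variable {x : ℕ → ℝ} {n k : ℕ} {u p v w : ℕ → ℝ[X]}

/-- The test function (X - x_i) u' vanishes at the left node, so the jump drops out, and it still
has degree at most k. This bounds u' by p in the norm weighted by the distance to the node, and the
weighted inverse estimate removes the weight. -/
lemma IsDiscDeriv.l2_derivative_le (hx : IsMesh x n) (hd : IsDiscDeriv x n k u p) {i : ℕ}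
    (hi : i < n) :
    l2 (x i) (x (i + 1)) (fun t => (derivative (u i)).eval t) ≤
      invK (k + 1) * l2 (x i) (x (i + 1)) (ev p i) := by
  have hlt := hx.lt i hi.le
  set l := x i
  set r := x (i + 1)
  set P := l2 l r (ev p i) with hP
  have hP0 : 0 ≤ P := l2_nonneg _ _ _
  have hpos : 0 < r - l := by linarith
  set s := derivative (u i) with hs
  have hsd : s.degree < k := degree_derivative_lt_of_lt_succ (hd.deg_u i)
  have hsd' : s.degree < ((k + 1 : ℕ) : WithBot ℕ) := degree_lt_mono (by omega) hsd
  set q : ℝ[X] := (X - C l) * s with hq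
  have hqd : q.degree < ((k + 1 : ℕ) : WithBot ℕ) := by
    by_cases h0 : s = 0
    · rw [hq, h0]; simp
    · rw [hq, degree_mul, degree_X_sub_C, degree_eq_natDegree h0]
      rw [degree_eq_natDegree h0] at hsd
      have : s.natDegree < k := by exact_mod_cast hsd
      norm_cast; omega
  have h1 := hd.inner i hi q hqd
  have h2 : q.eval l = 0 := by simp [hq]
  change _ = _ + _ * q.eval l at h1
  rw [h2, mul_zero, add_zero] at h1
  have h3 : ∫ t in l..r, (t - l) * s.eval t ^ 2 = ∫ t in l..r, s.eval t * q.eval t := by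
    congr 1; funext t; simp [hq]; ring
  have h4 : ∫ t in l..r, (p i).eval t * q.eval t ≤
      1 / 2 * (∫ t in l..r, (t - l) * (p i).eval t ^ 2) +
      1 / 2 * ∫ t in l..r, (t - l) * s.eval t ^ 2 := by
    rw [← integral_lin2 (F := fun t => 1 / 2 * ((t - l) * (p i).eval t ^ 2) +
      1 / 2 * ((t - l) * s.eval t ^ 2)) _ _ (by fun_prop) (by fun_prop) (fun _ => rfl)]
    refine intervalIntegral.integral_mono_on hlt.le (Continuous.intervalIntegrable (by fun_prop) _ _)
      (Continuous.intervalIntegrable (by fun_prop) _ _) fun t ht => ?_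
    simp only [hq, eval_mul, eval_sub, eval_X, eval_C]
    nlinarith [mul_nonneg (sub_nonneg.2 ht.1) (sq_nonneg ((p i).eval t - s.eval t))]
  have h5 := integral_dist_mul_sq_le hlt.le (f := ev p i) (by fun_prop)
  have h6 : ∫ t in l..r, (t - l) * s.eval t ^ 2 ≤ (r - l) * P ^ 2 := by
    rw [← h1] at h3
    simp only [ev] at h5
    linarith
  have hK := one_le_invK (k + 1)
  have h7 : ∀ t ∈ Icc l r, |s.eval t| ≤ invK (k + 1) * P / Real.sqrt (r - l) := by
    intro t ht
    have h8 := (weighted_inverse_left hsd' hlt ht).1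
    rw [le_div_iff₀ (by positivity)]
    apply le_of_sq_le_sq _ (mul_nonneg (invK_pos _).le hP0)
    rw [mul_pow, sq_abs, Real.sq_sqrt hpos.le]
    have h9 := h8.trans (mul_le_mul_of_nonneg_left h6 (invK_pos (k + 1)).le)
    have h10 : (r - l) * (s.eval t ^ 2 * (r - l)) ≤ (r - l) * (invK (k + 1) * P ^ 2) := by
      nlinarith
    refine (le_of_mul_le_mul_left h10 hpos).trans ?_
    rw [mul_pow]; exact mul_le_mul_of_nonneg_right (by nlinarith) (sq_nonneg _)
  have h8 := l2_le_of_abs_le hlt.le (f := fun t => s.eval t) (by fun_prop)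
    (by have := (invK_pos (k + 1)).le; positivity) h7
  refine h8.trans (le_of_eq ?_)
  have hs0 : 0 < Real.sqrt (r - l) := Real.sqrt_pos.2 hpos
  field_simp

/-- The constant test function expresses the jump by the means of p and u'. -/
lemma IsDiscDeriv.abs_jmp_le (hx : IsMesh x n) (hd : IsDiscDeriv x n k u p) {i : ℕ}
    (hi : i < n) :
    |jmp x (ev u) i| ≤ 2 * invK (k + 1) * Real.sqrt (x (i + 1) - x i) *
      l2 (x i) (x (i + 1)) (ev p i) := by
  have hlt := (hx.lt i hi.le).le
  have h1 := hd.inner i hi 1 (degree_C_lt 1 (by omega))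
  simp only [eval_one, mul_one] at h1
  have h2 : jmp x (ev u) i = (∫ t in x i..x (i + 1), (p i).eval t) -
    ∫ t in x i..x (i + 1), (derivative (u i)).eval t := by linarith
  have h3 := abs_integral_le_sqrt_mul hlt (f := ev p i) (by fun_prop)
  have h4 := abs_integral_le_sqrt_mul hlt (f := fun t => (derivative (u i)).eval t) (by fun_prop)
  have h5 := hd.l2_derivative_le hx hi
  have hK := one_le_invK (k + 1)
  have hs := Real.sqrt_nonneg (x (i + 1) - x i)
  have hp := l2_nonneg (x i) (x (i + 1)) (ev p i)
  rw [h2]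
  refine (abs_sub _ _).trans ?_
  have h6 := mul_le_mul_of_nonneg_left h5 hs
  have h7 : Real.sqrt (x (i + 1) - x i) * l2 (x i) (x (i + 1)) (ev p i) ≤
    invK (k + 1) * (Real.sqrt (x (i + 1) - x i) * l2 (x i) (x (i + 1)) (ev p i)) :=
    le_mul_of_one_le_left (mul_nonneg hs hp) hK
  simp only [ev] at *
  linarith

/-- On the last element the flux at x = 1 is zero, so the constant test function sees only the trace
from the left neighbour. -/
lemma IsDiscDeriv.abs_prev_le (hx : IsMesh x n) (hd : IsDiscDeriv x n k u p) :
    |prev x (ev u) n| ≤ Real.sqrt (x (n + 1) - x n) * l2 (x n) (x (n + 1)) (ev p n) := by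
  have h1 := hd.last 1 (degree_C_lt 1 (by omega))
  simp only [eval_one, mul_one, derivative_one, eval_zero, mul_zero,
    intervalIntegral.integral_zero, neg_zero, zero_sub] at h1
  have h3 := abs_integral_le_sqrt_mul (hx.lt n le_rfl).le (f := ev p n) (by fun_prop)
  rw [← abs_neg, ← h1]; exact h3

lemma l2_antiderivative_le {l r : ℝ} (h : l ≤ r) {s q : ℝ[X]} (hq : derivative q = s)
    (hl : q.eval l = 0) : l2 l r (fun t => q.eval t) ≤ (r - l) * l2 l r (fun t => s.eval t) := by
  have h1 : ∀ t ∈ Icc l r, |q.eval t| ≤ Real.sqrt (r - l) * l2 l r (fun t => s.eval t) := by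
    intro t ht
    have h2 : q.eval t = ∫ y in l..t, s.eval y := by
      rw [integral_deriv_eq (F := fun t => q.eval t) ht.1 (by fun_prop) (by fun_prop)
        (fun y _ => by rw [← hq]; exact q.hasDerivAt y), hl, sub_zero]
    rw [h2]
    refine (abs_integral_le_sqrt_mul ht.1 (f := fun t => s.eval t) (by fun_prop)).trans ?_
    refine mul_le_mul (Real.sqrt_le_sqrt (by linarith [ht.2])) ?_ (l2_nonneg _ _ _)
      (Real.sqrt_nonneg _)
    refine Real.sqrt_le_sqrt ?_
    refine intervalIntegral.integral_mono_interval le_rfl ht.1 ht.2 ?_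
      (Continuous.intervalIntegrable (by fun_prop) _ _)
    exact Filter.Eventually.of_forall fun _ => sq_nonneg _
  have h2 := l2_le_of_abs_le h (f := fun t => q.eval t) (by fun_prop)
    (mul_nonneg (Real.sqrt_nonneg _) (l2_nonneg _ _ _)) h1
  refine h2.trans (le_of_eq ?_)
  have := Real.mul_self_sqrt (sub_nonneg.2 h)
  linear_combination (l2 l r (fun t => s.eval t)) * this

/-- On the last element u enters the discrete derivative only through its products with r', of
degree less than k, that is, through its L² projection U. Testing with the antiderivative q of U
that vanishes at x_n removes the trace term and leaves ‖U‖² = -(p, q) ≤ h ‖p‖ ‖U‖. Thus U is even of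
order h ‖p‖, and inverse estimates bound its derivative and traces. The complement u - U is
invisible to p. -/
lemma IsDiscDeriv.exists_split (hx : IsMesh x n) (hd : IsDiscDeriv x n k u p) :
    ∃ v w, IsSplit x n k (4 * invK (k + 1)) u p v w := by
  have hlt := hx.lt n le_rfl
  have hpos : 0 < x (n + 1) - x n := by linarith
  obtain ⟨U, hU, hUs, -⟩ := exists_l2_projection k hlt (g := ev u n) (by fun_prop)
  have hU' : U.degree < ((k + 1 : ℕ) : WithBot ℕ) := degree_lt_mono (by omega) hU
  set P := l2 (x n) (x (n + 1)) (ev p n) with hP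
  have hP0 : 0 ≤ P := l2_nonneg _ _ _
  have hK := one_le_invK (k + 1)
  set S := Real.sqrt (x (n + 1) - x n) with hS
  have hS0 : 0 < S := Real.sqrt_pos.2 hpos
  have horth : ∀ s : ℝ[X], s.degree < k →
      ∫ t in x n..x (n + 1), (u n - U).eval t * s.eval t = 0 := by
    intro s hs
    rw [integral_lin2 (F := fun t => (u n - U).eval t * s.eval t)
      (f := fun t => (u n).eval t * s.eval t) (g := fun t => U.eval t * s.eval t) 1 (-1)
      (by fun_prop) (by fun_prop) (fun t => by simp; ring), hUs s hs]
    simp only [ev]; ring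
  -- Pythagoras: neither component of the split exceeds u in the L² norm.
  have hpyth : l2 (x n) (x (n + 1)) (ev u n) ^ 2 = l2 (x n) (x (n + 1)) (fun t => U.eval t) ^ 2 +
      l2 (x n) (x (n + 1)) (fun t => (u n - U).eval t) ^ 2 := by
    rw [l2_sq hlt.le, l2_sq hlt.le, l2_sq hlt.le, integral_lin3 (F := fun t => ev u n t ^ 2)
      (f := fun t => U.eval t ^ 2)
      (g := fun t => (u n - U).eval t ^ 2) (e := fun t => (u n - U).eval t * U.eval t) 1 1 2
      (by fun_prop) (by fun_prop) (by fun_prop) (fun t => by simp; ring), horth U hU]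
    ring
  have hl2U : l2 (x n) (x (n + 1)) (fun t => U.eval t) ≤ (x (n + 1) - x n) * P := by
    obtain ⟨q, hq1, hq2, hq3⟩ := exists_antiderivative (x n) hU
    have h1 := hd.last q hq3
    rw [hq1, hq2, mul_zero, sub_zero] at h1
    have h2 := hUs U hU
    have h3 : l2 (x n) (x (n + 1)) (fun t => U.eval t) ^ 2 ≤
        P * l2 (x n) (x (n + 1)) (fun t => q.eval t) := by
      have h4 := abs_integral_mul_le hlt.le (f := ev p n) (g := fun t => q.eval t)
        (by fun_prop) (by fun_prop)
      have h5 : l2 (x n) (x (n + 1)) (fun t => U.eval t) ^ 2 =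
          -∫ t in x n..x (n + 1), ev p n t * q.eval t := by
        rw [l2_sq hlt.le]
        simp only [ev] at h1 h2 ⊢
        rw [h1, ← h2, neg_neg]
        congr 1; funext t; ring
      rw [h5]
      exact (neg_le_abs _).trans h4
    have h4 := l2_antiderivative_le hlt.le hq1 hq2
    set Y := l2 (x n) (x (n + 1)) (fun t => U.eval t) with hY
    have hY0 : 0 ≤ Y := l2_nonneg _ _ _
    rcases hY0.eq_or_lt with h0 | h0
    · rw [← h0]; positivity
    · have := mul_le_mul_of_nonneg_left h4 hP0
      exact le_of_mul_le_mul_right (by nlinarith) h0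
  have hUsup : ∀ t ∈ Icc (x n) (x (n + 1)), |U.eval t| ≤ invK (k + 1) * S * P := by
    intro t ht
    have h1 := sqrt_mul_abs_eval_le hU' hlt ht
    have h2 := h1.trans (mul_le_mul_of_nonneg_left hl2U (invK_pos (k + 1)).le)
    have h3 : S * |U.eval t| ≤ S * (invK (k + 1) * S * P) := by
      refine h2.trans (le_of_eq ?_)
      have := Real.mul_self_sqrt hpos.le
      linear_combination -(invK (k + 1) * P) * this
    exact le_of_mul_le_mul_left h3 hS0
  have hSP : 0 ≤ invK (k + 1) * S * P := by have := (invK_pos (k + 1)).le; positivity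
  have hprevu := hd.abs_prev_le hx
  -- Nothing is split off away from the last element, so v and u have the same trace from the left
  -- at x_n.
  set v : ℕ → ℝ[X] := fun i => if i = n then U else u i with hv
  set w : ℕ → ℝ[X] := fun i => if i = n then u n - U else 0 with hw
  have hvn : v n = U := by simp [hv]
  have hwn : w n = u n - U := by simp [hw]
  have hvi : ∀ i, i ≠ n → v i = u i := fun i hi => by simp [hv, hi]
  have hevn : ev v n = fun t => U.eval t := by funext t; simp [ev, hvn]
  have hprev : ∀ i ≤ n, prev x (ev v) i = prev x (ev u) i := by
    intro i hi
    cases i with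
    | zero => rfl
    | succ j => simp only [prev, ev, hvi j (by omega)]
  have hSP' : S * P ≤ invK (k + 1) * S * P := by
    rw [mul_assoc]; exact le_mul_of_one_le_left (by positivity) hK
  have hD : 2 * (invK (k + 1) * S * P) ≤ 4 * invK (k + 1) * S * P := by linarith
  refine ⟨v, w, ?_⟩
  constructor
  · intro i
    by_cases h : i = n
    · subst h; rw [hvn, hwn]; ring
    · simp [hv, hw, h]
  · intro i
    by_cases h : i = n
    · subst h; rw [hvn]; exact hU'
    · rw [hvi i h]; exact hd.deg_u i
  · intro i
    by_cases h : i = n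
    · subst h; rw [hwn]; exact degree_sub_lt' (hd.deg_u _) hU'
    · simp [hw, h]
  · rw [hvn]; exact hU
  · intro i hi; simp [hw, hi]
  · rw [hwn]; exact horth
  · intro i hi
    by_cases h : i = n
    · subst h
      rw [hvn]
      have h1 := LDG.l2_derivative_le hU' hlt
      have h2 := h1.trans (mul_le_mul_of_nonneg_left hl2U (invK_pos (k + 1)).le)
      have h3 : l2 (x i) (x (i + 1)) (fun t => (derivative U).eval t) ≤ invK (k + 1) * P :=
        le_of_mul_le_mul_left (by linarith) hpos
      have : 0 ≤ invK (k + 1) * P := mul_nonneg (invK_pos _).le hP0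
      linarith
    · rw [hvi i h]
      have h1 := hd.l2_derivative_le hx (lt_of_le_of_ne hi h)
      have : 0 ≤ invK (k + 1) * l2 (x i) (x (i + 1)) (ev p i) :=
        mul_nonneg (invK_pos _).le (l2_nonneg _ _ _)
      linarith
  · intro i hi
    by_cases h : i = n
    · subst h
      rw [jmp, hprev i le_rfl]
      refine (abs_sub _ _).trans ?_
      have h1 := hUsup (x i) (left_mem_Icc.2 hlt.le)
      rw [hevn]
      linarith
    · have h1 := hd.abs_jmp_le hx (lt_of_le_of_ne hi h)
      rw [jmp, hprev i hi]
      have h2 : ev v i = ev u i := by funext t; simp [ev, hvi i h]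
      rw [h2]
      refine h1.trans ?_
      have : 0 ≤ invK (k + 1) * Real.sqrt (x (i + 1) - x i) * l2 (x i) (x (i + 1)) (ev p i) :=
        mul_nonneg (mul_nonneg (invK_pos _).le (Real.sqrt_nonneg _)) (l2_nonneg _ _ _)
      linarith
  · rw [hvn]; linarith [hUsup (x (n + 1)) (right_mem_Icc.2 hlt.le)]
  · rw [hvn]; linarith [hUsup (x n) (left_mem_Icc.2 hlt.le)]
  · rw [hprev n le_rfl]; linarith
  · rw [hevn]; exact hl2U
  · intro i hi
    by_cases h : i = n
    · subst h
      rw [hevn]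
      apply le_of_sq_le_sq _ (l2_nonneg _ _ _)
      rw [hpyth]; linarith [sq_nonneg (l2 (x i) (x (i + 1)) (fun t => (u i - U).eval t))]
    · have h2 : ev v i = ev u i := by funext t; simp [ev, hvi i h]
      rw [h2]
  · have : ev w n = fun t => (u n - U).eval t := by funext t; simp [ev, hwn]
    rw [this]
    apply le_of_sq_le_sq _ (l2_nonneg _ _ _)
    rw [hpyth]; linarith [sq_nonneg (l2 (x n) (x (n + 1)) (fun t => U.eval t))]

end

/-! ### Energy functionals, and the diffusion form with a variable coefficient. -/

section

lemma l2_add_le {l r : ℝ} (h : l ≤ r) {f g : ℝ → ℝ} (hf : Continuous f) (hg : Continuous g) :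
    l2 l r (fun t => f t + g t) ≤ l2 l r f + l2 l r g := by
  apply le_of_sq_le_sq _ (add_nonneg (l2_nonneg _ _ _) (l2_nonneg _ _ _))
  have h1 := (le_abs_self _).trans (abs_integral_mul_le h hf hg)
  rw [l2_sq h, integral_lin3 (F := fun t => (f t + g t) ^ 2) (f := fun t => f t ^ 2)
    (g := fun t => g t ^ 2) (e := fun t => f t * g t) 1 1 2 (by fun_prop) (by fun_prop)
    (by fun_prop) (fun t => by ring), ← l2_sq h, ← l2_sq h]
  nlinarith

variable {x : ℕ → ℝ} {n k : ℕ} {u p v w : ℕ → ℝ[X]} {a a1 b b1 c : ℝ → ℝ} {α γ K D : ℝ}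

/-- The superfluous factor 1 gives the sum the shape required by `jmp_add` and `ev_add`. -/
lemma uquad_add_le (hx : IsMesh x n) (hc : IsCoeff a a1 b b1 c α γ K) {y z : ℕ → ℝ → ℝ}
    (hy : ∀ i, Continuous (y i)) (hz : ∀ i, Continuous (z i)) :
    uquad x n b b1 c (fun i t => y i t + 1 * z i t) ≤
      2 * uquad x n b b1 c y + 2 * uquad x n b b1 c z := by
  have hcc := hc.cc
  have hcb1 := hc.cb1
  have h2 : ∀ s t : ℝ, (s + 1 * t) ^ 2 ≤ 2 * s ^ 2 + 2 * t ^ 2 := fun s t => by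
    nlinarith [sq_nonneg (s - t)]
  have h3 : ∀ j s t : ℝ, |j| * (s + 1 * t) ^ 2 ≤ 2 * (|j| * s ^ 2) + 2 * (|j| * t ^ 2) :=
    fun j s t => by nlinarith [mul_le_mul_of_nonneg_left (h2 s t) (abs_nonneg j)]
  rw [uquad, uquad, uquad, mul_add (2 : ℝ), mul_add (2 : ℝ), add_add_add_comm, Finset.mul_sum,
    Finset.mul_sum, ← Finset.sum_add_distrib]
  refine add_le_add (Finset.sum_le_sum fun i hi => ?_) ?_
  · have hi' : i ≤ n := by simpa [Nat.lt_succ_iff] using hi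
    have := hy i
    have := hz i
    rw [jmp_add]
    have h1 : ∫ t in x i..x (i + 1), (c t - 1 / 2 * b1 t) * (y i t + 1 * z i t) ^ 2 ≤
        2 * (∫ t in x i..x (i + 1), (c t - 1 / 2 * b1 t) * y i t ^ 2) +
        2 * ∫ t in x i..x (i + 1), (c t - 1 / 2 * b1 t) * z i t ^ 2 := by
      rw [← integral_lin2 (F := fun t => 2 * ((c t - 1 / 2 * b1 t) * y i t ^ 2) +
        2 * ((c t - 1 / 2 * b1 t) * z i t ^ 2)) 2 2 (by fun_prop) (by fun_prop) (fun _ => rfl)]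
      refine intervalIntegral.integral_mono_on (hx.lt i hi').le
        (Continuous.intervalIntegrable (by fun_prop) _ _)
        (Continuous.intervalIntegrable (by fun_prop) _ _) fun t _ => ?_
      have := hc.le_c t
      have := hc.pos_γ
      nlinarith [mul_le_mul_of_nonneg_left (h2 (y i t) (z i t))
        (show 0 ≤ c t - 1 / 2 * b1 t by linarith)]
    linarith [h3 (b (x i)) (jmp x y i) (jmp x z i)]
  · linarith [h3 (b (x (n + 1))) (y n (x (n + 1))) (z n (x (n + 1)))]

lemma pquad_add_le (hx : IsMesh x n) (hc : IsCoeff a a1 b b1 c α γ K) {ε : ℝ} (hε : 0 ≤ ε)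
    {y z : ℕ → ℝ → ℝ} (hy : ∀ i, Continuous (y i)) (hz : ∀ i, Continuous (z i)) :
    pquad x n ε a (fun i t => y i t + 1 * z i t) ≤ 2 * pquad x n ε a y + 2 * pquad x n ε a z := by
  have hca := hc.ca
  have h2 : ∀ s t : ℝ, (s + 1 * t) ^ 2 ≤ 2 * s ^ 2 + 2 * t ^ 2 := fun s t => by
    nlinarith [sq_nonneg (s - t)]
  have h3 : ∀ s t : ℝ, ε / 2 * (s + 1 * t) ^ 2 ≤ 2 * (ε / 2 * s ^ 2) + 2 * (ε / 2 * t ^ 2) :=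
    fun s t => by nlinarith [mul_le_mul_of_nonneg_left (h2 s t) hε]
  rw [pquad, pquad, pquad, mul_add (2 : ℝ), mul_add (2 : ℝ), add_add_add_comm, Finset.mul_sum,
    Finset.mul_sum, ← Finset.sum_add_distrib]
  refine add_le_add (Finset.sum_le_sum fun i hi => ?_) ?_
  · have hi' : i ≤ n := by simpa [Nat.lt_succ_iff] using hi
    have := hy i
    have := hz i
    rw [jmp_add]
    have h1 : ∫ t in x i..x (i + 1), a t * (y i t + 1 * z i t) ^ 2 ≤
        2 * (∫ t in x i..x (i + 1), a t * y i t ^ 2) +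
        2 * ∫ t in x i..x (i + 1), a t * z i t ^ 2 := by
      rw [← integral_lin2 (F := fun t => 2 * (a t * y i t ^ 2) +
        2 * (a t * z i t ^ 2)) 2 2 (by fun_prop) (by fun_prop) (fun _ => rfl)]
      refine intervalIntegral.integral_mono_on (hx.lt i hi').le
        (Continuous.intervalIntegrable (by fun_prop) _ _)
        (Continuous.intervalIntegrable (by fun_prop) _ _) fun t _ => ?_
      have := hc.le_a t
      have := hc.pos_α
      nlinarith [mul_le_mul_of_nonneg_left (h2 (y i t) (z i t)) (show 0 ≤ a t by linarith)]
    linarith [h3 (jmp x y i) (jmp x z i)]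
  · linarith [h3 (y n (x (n + 1))) (z n (x (n + 1)))]

lemma le_uquad (hx : IsMesh x n) (hc : IsCoeff a a1 b b1 c α γ K) {y : ℕ → ℝ → ℝ}
    (hy : ∀ i, Continuous (y i)) :
    γ * (∑ i ∈ Finset.range (n + 1), l2 (x i) (x (i + 1)) (y i) ^ 2) ≤ uquad x n b b1 c y := by
  rw [Finset.mul_sum, uquad]
  have hcc := hc.cc
  have hcb1 := hc.cb1
  refine le_add_of_le_of_nonneg (Finset.sum_le_sum fun i hi => ?_) (by positivity)
  have hi' : i ≤ n := by simpa [Nat.lt_succ_iff] using hi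
  have := hy i
  refine le_add_of_le_of_nonneg ?_ (by positivity)
  rw [l2_sq (hx.lt i hi').le, ← intervalIntegral.integral_const_mul]
  refine intervalIntegral.integral_mono_on (hx.lt i hi').le
    (Continuous.intervalIntegrable (by fun_prop) _ _)
    (Continuous.intervalIntegrable (by fun_prop) _ _) fun t _ => ?_
  exact mul_le_mul_of_nonneg_right (hc.le_c t) (sq_nonneg _)

lemma le_pquad (hx : IsMesh x n) (hc : IsCoeff a a1 b b1 c α γ K) {ε : ℝ} {y : ℕ → ℝ → ℝ}
    (hy : ∀ i, Continuous (y i)) :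
    α * (∑ i ∈ Finset.range (n + 1), l2 (x i) (x (i + 1)) (y i) ^ 2) +
      ε / 2 * (∑ i ∈ Finset.range (n + 1), jmp x y i ^ 2 + y n (x (n + 1)) ^ 2)
      ≤ pquad x n ε a y := by
  rw [mul_add, Finset.mul_sum, Finset.mul_sum, ← add_assoc, ← Finset.sum_add_distrib, pquad]
  have hca := hc.ca
  refine add_le_add_left (Finset.sum_le_sum fun i hi => ?_) _
  have hi' : i ≤ n := by simpa [Nat.lt_succ_iff] using hi
  have := hy i
  refine add_le_add_left ?_ _
  rw [l2_sq (hx.lt i hi').le, ← intervalIntegral.integral_const_mul]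
  refine intervalIntegral.integral_mono_on (hx.lt i hi').le
    (Continuous.intervalIntegrable (by fun_prop) _ _)
    (Continuous.intervalIntegrable (by fun_prop) _ _) fun t _ => ?_
  exact mul_le_mul_of_nonneg_right (hc.le_a t) (sq_nonneg _)

lemma IsSplit.prev_w (hs : IsSplit x n k D u p v w) {i : ℕ} (hi : i ≤ n) :
    prev x (ev w) i = 0 := by
  cases i with
  | zero => rfl
  | succ j => simp [prev, ev, hs.w_zero j (by omega)]

lemma IsSplit.prev_v (hs : IsSplit x n k D u p v w) {i : ℕ} (hi : i ≤ n) :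
    prev x (ev v) i = prev x (ev u) i := by
  cases i with
  | zero => rfl
  | succ j => simp [prev, ev, hs.eq j, hs.w_zero j (by omega)]

lemma IsSplit.jmp_w (hs : IsSplit x n k D u p v w) : jmp x (ev w) n = (w n).eval (x n) := by
  rw [jmp, hs.prev_w le_rfl, sub_zero]

lemma IsSplit.test_of_ne (hs : IsSplit x n k D u p v w) (κ : ℝ) {i : ℕ} (hi : i ≠ n) :
    v i + κ • w i = u i := by
  rw [hs.eq i, hs.w_zero i hi]; simp

lemma IsSplit.jmp_test (hs : IsSplit x n k D u p v w) (κ : ℝ) {i : ℕ} (hi : i ≤ n) :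
    jmp x (ev fun i => v i + κ • w i) i = (v i + κ • w i).eval (x i) - prev x (ev u) i := by
  rw [jmp, ev_add, prev_add, hs.prev_w hi, hs.prev_v hi]
  simp

lemma IsSplit.jmp_test_of_ne (hs : IsSplit x n k D u p v w) (κ : ℝ) {i : ℕ} (hi : i < n) :
    jmp x (ev fun i => v i + κ • w i) i = jmp x (ev u) i := by
  rw [hs.jmp_test κ hi.le, hs.test_of_ne κ hi.ne]; rfl

/-- The discrete integration by parts on the last element. -/
lemma IsSplit.last_identity (hx : IsMesh x n) (hd : IsDiscDeriv x n k u p)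
    (hs : IsSplit x n k D u p v w) (κ : ℝ) {y : ℝ[X]}
    (hy : y.degree < ((k + 1 : ℕ) : WithBot ℕ)) :
    (∫ t in x n..x (n + 1), y.eval t * (derivative (v n + κ • w n)).eval t)
      + y.eval (x n) * jmp x (ev fun i => v i + κ • w i) n
      - y.eval (x (n + 1)) * (v n + κ • w n).eval (x (n + 1)) =
    ∫ t in x n..x (n + 1), (p n).eval t * y.eval t := by
  rw [hs.jmp_test κ le_rfl, hd.last y hy]
  have h1 := integral_by_parts_one (hx.lt n le_rfl).le y (v n + κ • w n)
  have h2 := hs.w_orth (derivative y) (degree_derivative_lt_of_lt_succ hy)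
  have h3 : ∫ t in x n..x (n + 1), (derivative y).eval t * (v n + κ • w n).eval t =
      1 * (∫ t in x n..x (n + 1), (u n).eval t * (derivative y).eval t) +
      (κ - 1) * ∫ t in x n..x (n + 1), (w n).eval t * (derivative y).eval t :=
    integral_lin2 _ _ (by fun_prop) (by fun_prop)
      (fun t => by rw [hs.eq n]; simp only [eval_add, eval_smul, smul_eq_mul]; ring)
  rw [h2] at h3
  linear_combination h1 - h3

/-- On the inner elements this is the definition of the discrete derivative. On the last one it
holds for every κ, since after integration by parts w meets only y', to which it is orthogonal. It
makes the q terms of the second and third equations cancel although w is rescaled in the test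
function. -/
lemma IsSplit.aform_one (hx : IsMesh x n) (hd : IsDiscDeriv x n k u p)
    (hs : IsSplit x n k D u p v w) (κ : ℝ) {y : ℕ → ℝ[X]}
    (hy : ∀ i, (y i).degree < ((k + 1 : ℕ) : WithBot ℕ)) :
    aform x n (fun _ => 1) (ev y) (fun i => v i + κ • w i) =
      ∑ i ∈ Finset.range (n + 1), ∫ t in x i..x (i + 1), (p i).eval t * (y i).eval t := by
  rw [aform, Finset.sum_range_succ, Finset.sum_range_succ, add_sub_assoc]
  congr 1
  · refine Finset.sum_congr rfl fun i hi => ?_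
    have hi' : i < n := Finset.mem_range.1 hi
    rw [hs.jmp_test_of_ne κ hi', hs.test_of_ne κ hi'.ne, hd.inner i hi' _ (hy i)]
    simp only [one_mul, ev, mul_comm]
  · rw [← hs.last_identity hx hd κ (hy n)]
    simp only [one_mul, ev]

lemma abs_sub_left_le (hx : IsMesh x n) {g g1 : ℝ → ℝ} (hg : Continuous g) (hg1 : Continuous g1)
    (hb : ∀ t, |g1 t| ≤ K) (hd : ∀ t ∈ Ioo (0 : ℝ) 1, HasDerivAt g (g1 t) t) {i : ℕ} (hi : i ≤ n)
    {t : ℝ} (ht : t ∈ Icc (x i) (x (i + 1))) : |g t - g (x i)| ≤ K * (x (i + 1) - x i) := by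
  have h1 := hx.mem (i := i) (by omega)
  have h2 := hx.mem (i := i + 1) (by omega)
  rw [← integral_deriv_eq ht.1 hg hg1
    (fun y hy => hd y ⟨h1.1.trans_lt hy.1, (hy.2.trans_le ht.2).trans_le h2.2⟩)]
  have hK : 0 ≤ K := (abs_nonneg _).trans (hb 0)
  have h3 := intervalIntegral.norm_integral_le_of_norm_le_const (a := x i) (b := t) (f := g1)
    (C := K) (fun y _ => hb y)
  rw [Real.norm_eq_abs, abs_of_nonneg (sub_nonneg.2 ht.1)] at h3
  exact h3.trans (mul_le_mul_of_nonneg_left (by linarith [ht.2]) hK)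

/-- The coefficient is frozen at x_n. The frozen part is `IsSplit.last_identity` with y = p; the
remainder has the factor a - a(x_n), which vanishes at the left end, and integration by parts moves
the derivative off the test function and removes the boundary term at x = 1. So w occurs without
derivative and without trace. -/
lemma IsSplit.aform_last_eq (hx : IsMesh x n) (hc : IsCoeff a a1 b b1 c α γ K)
    (hd : IsDiscDeriv x n k u p) (hs : IsSplit x n k D u p v w) (κ : ℝ) :
    (∫ t in x n..x (n + 1), a t * ev p n t * (derivative (v n + κ • w n)).eval t)
      + a (x n) * ev p n (x n) * jmp x (ev fun i => v i + κ • w i) n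
      - a (x (n + 1)) * ev p n (x (n + 1)) * (v n + κ • w n).eval (x (n + 1))
      - ∫ t in x n..x (n + 1), a t * ev p n t ^ 2 =
    -(∫ t in x n..x (n + 1), (a1 t * (p n).eval t + (a t - a (x n)) * (derivative (p n)).eval t) *
        (v n).eval t)
    - κ * (∫ t in x n..x (n + 1), (a1 t * (p n).eval t + (a t - a (x n)) *
        (derivative (p n)).eval t) * (w n).eval t)
    - ∫ t in x n..x (n + 1), (a t - a (x n)) * ev p n t * ev p n t := by
  have hca := hc.ca
  have hca1 := hc.ca1
  have hlt := (hx.lt n le_rfl).le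
  have h1 := hs.last_identity hx hd κ (hd.deg_p n)
  have h2 := integral_by_parts hlt (g := fun t => a t - a (x n)) (by fun_prop) hca1
    (fun t ht => (hc.da t ⟨(hx.mem (by omega)).1.trans_lt ht.1,
      ht.2.trans_le (hx.mem (by omega)).2⟩).sub_const _) (p n) (v n + κ • w n)
  have h3 : ∫ t in x n..x (n + 1), (a1 t * (p n).eval t + (a t - a (x n)) *
        (derivative (p n)).eval t) * (v n + κ • w n).eval t =
      1 * (∫ t in x n..x (n + 1), (a1 t * (p n).eval t + (a t - a (x n)) *
        (derivative (p n)).eval t) * (v n).eval t) +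
      κ * (∫ t in x n..x (n + 1), (a1 t * (p n).eval t + (a t - a (x n)) *
        (derivative (p n)).eval t) * (w n).eval t) :=
    integral_lin2 _ _ (by fun_prop) (by fun_prop) (fun t => by simp; ring)
  have h4 : ∫ t in x n..x (n + 1), (a t - a (x n)) * (p n).eval t *
        (derivative (v n + κ • w n)).eval t =
      1 * (∫ t in x n..x (n + 1), a t * ev p n t * (derivative (v n + κ • w n)).eval t) +
      (-a (x n)) * ∫ t in x n..x (n + 1), (p n).eval t * (derivative (v n + κ • w n)).eval t :=
    integral_lin2 _ _ (by fun_prop) (by fun_prop) (fun t => by ring)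
  have h5 : ∫ t in x n..x (n + 1), (a t - a (x n)) * ev p n t * ev p n t =
      1 * (∫ t in x n..x (n + 1), a t * ev p n t ^ 2) +
      (-a (x n)) * ∫ t in x n..x (n + 1), (p n).eval t * (p n).eval t :=
    integral_lin2 _ _ (by fun_prop) (by fun_prop) (fun t => by simp only [ev]; ring)
  simp only [ev] at *
  linear_combination a (x n) * h1 + h2 - h4 - h3 + h5

/-- The diffusion form is coercive up to a perturbation. -/
lemma IsSplit.abs_aform_sub_le (hx : IsMesh x n) (hc : IsCoeff a a1 b b1 c α γ K)
    (hd : IsDiscDeriv x n k u p) (hs : IsSplit x n k D u p v w) (hD : 1 ≤ D) {κ : ℝ} (hκ : 0 ≤ κ)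
    {H : ℝ} (hH : ∀ i ≤ n, x (i + 1) - x i ≤ H) :
    |aform x n a (ev p) (fun i => v i + κ • w i) -
      ∑ i ∈ Finset.range (n + 1), ∫ t in x i..x (i + 1), a t * ev p i t ^ 2| ≤
    K * (D + invK (k + 1) + 2) * (H * (∑ i ∈ Finset.range (n + 1),
        l2 (x i) (x (i + 1)) (ev p i) ^ 2) +
      κ * (l2 (x n) (x (n + 1)) (ev p n) * l2 (x n) (x (n + 1)) (ev w n))) := by
  have hca := hc.ca
  have hca1 := hc.ca1
  have hK0 : 0 ≤ K := zero_le_one.trans hc.one_le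
  have hI := one_le_invK (k + 1)
  have hdelta : ∀ i ≤ n, ∀ t ∈ Icc (x i) (x (i + 1)), |a t - a (x i)| ≤ K * (x (i + 1) - x i) :=
    fun i hi t ht => abs_sub_left_le hx hca hca1 hc.ba1 hc.da hi ht
  -- On inner elements a(x_i) times the discrete derivative relation, tested with p, is subtracted.
  -- What is left contains a - a(x_i) = O(h), and u' is bounded by p.
  have hinner : ∀ i < n, |(∫ t in x i..x (i + 1), a t * ev p i t *
        (derivative (v i + κ • w i)).eval t)
      + a (x i) * ev p i (x i) * jmp x (ev fun i => v i + κ • w i) i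
      - ∫ t in x i..x (i + 1), a t * ev p i t ^ 2| ≤
      K * (D + invK (k + 1) + 2) * (H * l2 (x i) (x (i + 1)) (ev p i) ^ 2) := by
    intro i hi
    have hlt := (hx.lt i hi.le).le
    have h1 := hd.inner i hi _ (hd.deg_p i)
    have h2 : ∫ t in x i..x (i + 1), (a t - a (x i)) * ev p i t *
        ((derivative (u i)).eval t) =
      1 * (∫ t in x i..x (i + 1), a t * ev p i t * (derivative (u i)).eval t) +
      (-a (x i)) * ∫ t in x i..x (i + 1), (derivative (u i)).eval t * (p i).eval t :=
      integral_lin2 _ _ (by fun_prop) (by fun_prop) (fun t => by simp only [ev]; ring)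
    have h3 : ∫ t in x i..x (i + 1), (a t - a (x i)) * ev p i t * ev p i t =
      1 * (∫ t in x i..x (i + 1), a t * ev p i t ^ 2) +
      (-a (x i)) * ∫ t in x i..x (i + 1), (p i).eval t * (p i).eval t :=
      integral_lin2 _ _ (by fun_prop) (by fun_prop) (fun t => by simp only [ev]; ring)
    have h4 : (∫ t in x i..x (i + 1), a t * ev p i t *
        (derivative (v i + κ • w i)).eval t)
      + a (x i) * ev p i (x i) * jmp x (ev fun i => v i + κ • w i) i
      - ∫ t in x i..x (i + 1), a t * ev p i t ^ 2 =
      (∫ t in x i..x (i + 1), (a t - a (x i)) * ev p i t * ((derivative (u i)).eval t)) -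
      ∫ t in x i..x (i + 1), (a t - a (x i)) * ev p i t * ev p i t := by
      rw [hs.jmp_test_of_ne κ hi, hs.test_of_ne κ hi.ne, h2, h3]
      simp only [ev] at *
      linear_combination (-a (x i)) * h1
    have hpos : 0 ≤ K * (x (i + 1) - x i) := mul_nonneg hK0 (by linarith)
    have h5 := abs_integral_weight_le hlt (w := fun t => a t - a (x i)) (f := ev p i)
      (g := fun t => (derivative (u i)).eval t) (by fun_prop) (by fun_prop) (by fun_prop)
      hpos (hdelta i hi.le)
    have h6 := abs_integral_weight_le hlt (w := fun t => a t - a (x i)) (f := ev p i)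
      (g := ev p i) (by fun_prop) (by fun_prop) (by fun_prop) hpos (hdelta i hi.le)
    have h7 := hd.l2_derivative_le hx hi
    rw [h4]
    refine (abs_sub _ _).trans ((add_le_add h5 h6).trans ?_)
    have hP := l2_nonneg (x i) (x (i + 1)) (ev p i)
    set P := l2 (x i) (x (i + 1)) (ev p i)
    have h8 : K * (x (i + 1) - x i) * P ≤ K * H * P :=
      mul_le_mul_of_nonneg_right (mul_le_mul_of_nonneg_left (hH i hi.le) hK0) hP
    have h9 : 0 ≤ K * H * P := (mul_nonneg hpos hP).trans h8
    calc _ ≤ K * (x (i + 1) - x i) * P * (invK (k + 1) * P) +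
          K * (x (i + 1) - x i) * P * P := by
          gcongr
      _ ≤ K * H * P * (invK (k + 1) * P) + K * H * P * P := by gcongr
      _ ≤ _ := by nlinarith [mul_nonneg h9 hP]
  have hlast := hs.aform_last_eq hx hc hd κ
  have hlt := (hx.lt n le_rfl).le
  have hpos : 0 ≤ K * (x (n + 1) - x n) := mul_nonneg hK0 (by linarith)
  set P := l2 (x n) (x (n + 1)) (ev p n) with hPdef
  have hP : 0 ≤ P := l2_nonneg _ _ _
  set W := l2 (x n) (x (n + 1)) (ev w n) with hWdef
  have hW : 0 ≤ W := l2_nonneg _ _ _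
  have hG : l2 (x n) (x (n + 1)) (fun t => a1 t * (p n).eval t + (a t - a (x n)) *
      (derivative (p n)).eval t) ≤ K * (1 + invK (k + 1)) * P := by
    have h1 := l2_add_le hlt (f := fun t => a1 t * (p n).eval t)
      (g := fun t => (a t - a (x n)) * (derivative (p n)).eval t) (by fun_prop) (by fun_prop)
    have h2 := l2_mul_le hlt (w := a1) (f := ev p n) hca1 (by fun_prop) hK0 (fun t _ => hc.ba1 t)
    have h3 := l2_mul_le hlt (w := fun t => a t - a (x n)) (f := fun t => (derivative (p n)).eval t)
      (by fun_prop) (by fun_prop) hpos (hdelta n le_rfl)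
    have h4 := LDG.l2_derivative_le (hd.deg_p n) (hx.lt n le_rfl)
    have h5 := mul_le_mul_of_nonneg_left h4 hK0
    simp only [ev] at *
    linarith
  have hv := abs_integral_mul_le hlt (f := fun t => a1 t * (p n).eval t + (a t - a (x n)) *
      (derivative (p n)).eval t) (g := ev v n) (by fun_prop) (by fun_prop)
  have hw := abs_integral_mul_le hlt (f := fun t => a1 t * (p n).eval t + (a t - a (x n)) *
      (derivative (p n)).eval t) (g := ev w n) (by fun_prop) (by fun_prop)
  have hpp := abs_integral_weight_le hlt (w := fun t => a t - a (x n)) (f := ev p n)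
      (g := ev p n) (by fun_prop) (by fun_prop) (by fun_prop) hpos (hdelta n le_rfl)
  have hvl := hs.l2_v_last
  -- On the last element v gains a factor h, because its norm is at most h ‖p‖. The term with w has
  -- no such factor; its only smallness is that of κ.
  have hlastle : |(∫ t in x n..x (n + 1), a t * ev p n t * (derivative (v n + κ • w n)).eval t)
      + a (x n) * ev p n (x n) * jmp x (ev fun i => v i + κ • w i) n
      - a (x (n + 1)) * ev p n (x (n + 1)) * (v n + κ • w n).eval (x (n + 1))
      - ∫ t in x n..x (n + 1), a t * ev p n t ^ 2| ≤
      K * (D + invK (k + 1) + 2) * (H * P ^ 2 + κ * (P * W)) := by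
    rw [hlast]
    have hH0 : 0 ≤ H := by linarith [hH n le_rfl]
    have e1 : l2 (x n) (x (n + 1)) (ev v n) ≤ H * P :=
      hvl.trans (mul_le_mul_of_nonneg_right (hH n le_rfl) hP)
    have hGP : 0 ≤ K * (1 + invK (k + 1)) * P := (l2_nonneg _ _ _).trans hG
    have e2 := hv.trans (mul_le_mul hG e1 (l2_nonneg _ _ _) hGP)
    have e3 := hw.trans (mul_le_mul_of_nonneg_right hG hW)
    have e4 : K * (x (n + 1) - x n) * P * P ≤ K * H * P * P := by
      have := hH n le_rfl; gcongr
    refine (abs_sub _ _).trans ?_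
    refine (add_le_add ((abs_sub _ _).trans (add_le_add (le_of_eq (abs_neg _))
      (le_of_eq (abs_mul _ _)))) hpp).trans ?_
    rw [abs_of_nonneg hκ]
    have e5 := mul_le_mul_of_nonneg_left e3 hκ
    simp only [ev] at *
    have e6 : 0 ≤ K * H * P * P := by positivity
    have e7 : 0 ≤ κ * (K * P * W) := by positivity
    nlinarith [mul_nonneg (zero_le_one.trans hD) e6, mul_nonneg (zero_le_one.trans hD) e7]
  have hsplit : aform x n a (ev p) (fun i => v i + κ • w i) -
      ∑ i ∈ Finset.range (n + 1), ∫ t in x i..x (i + 1), a t * ev p i t ^ 2 =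
      (∑ i ∈ Finset.range n, ((∫ t in x i..x (i + 1), a t * ev p i t *
        (derivative (v i + κ • w i)).eval t)
      + a (x i) * ev p i (x i) * jmp x (ev fun i => v i + κ • w i) i
      - ∫ t in x i..x (i + 1), a t * ev p i t ^ 2)) +
      ((∫ t in x n..x (n + 1), a t * ev p n t * (derivative (v n + κ • w n)).eval t)
      + a (x n) * ev p n (x n) * jmp x (ev fun i => v i + κ • w i) n
      - a (x (n + 1)) * ev p n (x (n + 1)) * (v n + κ • w n).eval (x (n + 1))
      - ∫ t in x n..x (n + 1), a t * ev p n t ^ 2) := by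
    rw [aform, Finset.sum_range_succ, Finset.sum_range_succ, Finset.sum_sub_distrib]
    ring
  rw [hsplit]
  refine (abs_add_le _ _).trans ((add_le_add ((Finset.abs_sum_le_sum_abs _ _).trans
    (Finset.sum_le_sum fun i hi => hinner i (Finset.mem_range.1 hi))) hlastle).trans
    (le_of_eq ?_))
  rw [Finset.sum_range_succ, ← Finset.mul_sum, ← Finset.mul_sum]
  ring

end

/-! ### Weak coupling of the two components, and coercivity. -/

section

variable {x : ℕ → ℝ} {n k : ℕ} {u p v w : ℕ → ℝ[X]} {a a1 b b1 c : ℝ → ℝ} {α γ K D : ℝ}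

lemma IsSplit.uquad_w (hs : IsSplit x n k D u p v w) :
    uquad x n b b1 c (ev w) = (∫ t in x n..x (n + 1), (c t - 1 / 2 * b1 t) * ev w n t ^ 2)
      + 1 / 2 * (|b (x n)| * (w n).eval (x n) ^ 2)
      + 1 / 2 * (|b (x (n + 1))| * (w n).eval (x (n + 1)) ^ 2) := by
  rw [uquad, Finset.sum_range_succ, Finset.sum_eq_zero, zero_add, hs.jmp_w]
  intro i hi
  have hi' : i < n := Finset.mem_range.1 hi
  rw [jmp, hs.prev_w hi'.le]
  simp [ev, hs.w_zero i hi'.ne]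

lemma IsSplit.bform_w_left (hs : IsSplit x n k D u p v w) (z : ℕ → ℝ[X]) :
    bform x n b b1 c (ev w) z =
      -(∫ t in x n..x (n + 1), b t * ev w n t * (derivative (z n)).eval t)
      - ((b (x n) - |b (x n)|) / 2 * (w n).eval (x n)) * jmp x (ev z) n
      + (∫ t in x n..x (n + 1), (c t - b1 t) * ev w n t * (z n).eval t)
      + (b (x (n + 1)) + |b (x (n + 1))|) / 2 * (w n).eval (x (n + 1)) *
        (z n).eval (x (n + 1)) := by
  rw [bform, Finset.sum_range_succ, Finset.sum_eq_zero, zero_add, hs.prev_w le_rfl, mul_zero,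
    zero_add]
  intro i hi
  have hi' : i < n := Finset.mem_range.1 hi
  rw [hs.prev_w hi'.le]
  simp [ev, hs.w_zero i hi'.ne]

lemma IsSplit.bform_w_right (hs : IsSplit x n k D u p v w) (y : ℕ → ℝ → ℝ) :
    bform x n b b1 c y w =
      -(∫ t in x n..x (n + 1), b t * y n t * (derivative (w n)).eval t)
      - ((b (x n) + |b (x n)|) / 2 * prev x y n + (b (x n) - |b (x n)|) / 2 * y n (x n))
        * (w n).eval (x n)
      + (∫ t in x n..x (n + 1), (c t - b1 t) * y n t * (w n).eval t)
      + (b (x (n + 1)) + |b (x (n + 1))|) / 2 * y n (x (n + 1)) * (w n).eval (x (n + 1)) := by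
  rw [bform, Finset.sum_range_succ, Finset.sum_eq_zero, zero_add, hs.jmp_w]
  intro i hi
  have hi' : i < n := Finset.mem_range.1 hi
  rw [jmp, hs.prev_w hi'.le]
  simp [ev, hs.w_zero i hi'.ne]

lemma abs_pos_part_le (β : ℝ) : |(β + |β|) / 2| ≤ |β| := by
  rw [abs_le]; constructor <;> cases abs_cases β <;> linarith

lemma abs_neg_part_le (β : ℝ) : |(β - |β|) / 2| ≤ |β| := by
  rw [abs_le]; constructor <;> cases abs_cases β <;> linarith

/-- The energy contains the boundary values of w only with the weight |b|, which may vanish.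
Multiplication by |b| ≤ K bounds |b| |y|, and the cross terms need no more than that. -/
lemma abs_mul_le_of_sq {β y S K : ℝ} (hK : 1 ≤ K) (hβ : |β| ≤ K) (h : |β| * y ^ 2 ≤ 2 * S)
    (hS : 0 ≤ S) : |β| * |y| ≤ 2 * K * Real.sqrt S := by
  apply le_of_sq_le_sq _ (by positivity)
  have h0 : (|β| * |y|) ^ 2 = |β| * (|β| * y ^ 2) := by rw [← sq_abs y]; ring
  rw [h0, mul_pow, Real.sq_sqrt hS]
  have h1 : |β| * (|β| * y ^ 2) ≤ K * (2 * S) :=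
    mul_le_mul hβ h (by positivity) (by linarith)
  have h2 : K * (2 * S) ≤ (2 * K) ^ 2 * S := by nlinarith [mul_nonneg (sub_nonneg.2 hK) hS]
  exact h1.trans h2

/-- The bounds for the component `w` by its part of the energy. -/
lemma IsSplit.w_bounds (hx : IsMesh x n) (hc : IsCoeff a a1 b b1 c α γ K)
    (hs : IsSplit x n k D u p v w) :
    0 ≤ uquad x n b b1 c (ev w) ∧
    l2 (x n) (x (n + 1)) (ev w n) ≤ Real.sqrt γ⁻¹ * Real.sqrt (uquad x n b b1 c (ev w)) ∧
    |b (x n)| * |(w n).eval (x n)| ≤ 2 * K * Real.sqrt (uquad x n b b1 c (ev w)) ∧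
    |b (x (n + 1))| * |(w n).eval (x (n + 1))| ≤
      2 * K * Real.sqrt (uquad x n b b1 c (ev w)) := by
  have h1 := le_uquad hx hc (y := ev w) (fun i => by fun_prop)
  rw [Finset.sum_range_succ] at h1
  have h2 : 0 ≤ ∑ i ∈ Finset.range n, l2 (x i) (x (i + 1)) (ev w i) ^ 2 := by positivity
  have hγ := hc.pos_γ
  have h3 : γ * l2 (x n) (x (n + 1)) (ev w n) ^ 2 ≤ uquad x n b b1 c (ev w) := by nlinarith
  have h0 : 0 ≤ uquad x n b b1 c (ev w) := le_trans (by positivity) h3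
  have h4 := hs.uquad_w (x := x) (n := n) (b := b) (b1 := b1) (c := c)
  have h5 : 0 ≤ ∫ t in x n..x (n + 1), (c t - 1 / 2 * b1 t) * ev w n t ^ 2 :=
    intervalIntegral.integral_nonneg (hx.lt n le_rfl).le fun t _ =>
      mul_nonneg (by linarith [hc.le_c t]) (sq_nonneg _)
  have h6 : 0 ≤ |b (x n)| * (w n).eval (x n) ^ 2 := by positivity
  have h7 : 0 ≤ |b (x (n + 1))| * (w n).eval (x (n + 1)) ^ 2 := by positivity
  refine ⟨h0, ?_, ?_, ?_⟩
  · rw [← Real.sqrt_mul (by positivity)]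
    apply Real.le_sqrt_of_sq_le
    rw [inv_mul_eq_div, le_div_iff₀ hγ]; linarith
  · exact abs_mul_le_of_sq hc.one_le (hc.bb _) (by linarith) h0
  · exact abs_mul_le_of_sq hc.one_le (hc.bb _) (by linarith) h0

lemma abs_sub_add_add_le (s t y z : ℝ) : |-s - t + y + z| ≤ |s| + |t| + |y| + |z| := by
  have h1 := neg_abs_le s
  have h2 := le_abs_self s
  have h3 := neg_abs_le t
  have h4 := le_abs_self t
  have h5 := neg_abs_le y
  have h6 := le_abs_self y
  have h7 := neg_abs_le z
  have h8 := le_abs_self z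
  rw [abs_le]; constructor <;> linarith

/-- The convection-reaction form couples the two components of a split weakly. -/
lemma IsSplit.abs_cross_le (hx : IsMesh x n) (hc : IsCoeff a a1 b b1 c α γ K)
    (hs : IsSplit x n k D u p v w) (hD : 1 ≤ D) :
    |bform x n b b1 c (ev w) v| ≤ 10 * K * D * K * (1 + Real.sqrt γ⁻¹) *
      (Real.sqrt (x (n + 1) - x n) * l2 (x n) (x (n + 1)) (ev p n) *
        Real.sqrt (uquad x n b b1 c (ev w))) ∧
    |bform x n b b1 c (ev v) w| ≤ 10 * K * D * K * (1 + Real.sqrt γ⁻¹) *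
      (Real.sqrt (x (n + 1) - x n) * l2 (x n) (x (n + 1)) (ev p n) *
        Real.sqrt (uquad x n b b1 c (ev w))) := by
  obtain ⟨hS0, hW, hwL, hwR⟩ := hs.w_bounds hx hc
  have hcb := hc.cb
  have hcb1 := hc.cb1
  have hcc := hc.cc
  have hK := hc.one_le
  have hlt := hx.lt n le_rfl
  have hpos : 0 < x (n + 1) - x n := by linarith
  have hone : x (n + 1) - x n ≤ 1 := by
    linarith [(hx.mem (i := n) (by omega)).1, (hx.mem (i := n + 1) le_rfl).2]
  set R := Real.sqrt (uquad x n b b1 c (ev w)) with hR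
  have hR0 : 0 ≤ R := Real.sqrt_nonneg _
  set G := Real.sqrt γ⁻¹ with hG
  have hG0 : 0 ≤ G := Real.sqrt_nonneg _
  set P := l2 (x n) (x (n + 1)) (ev p n) with hP
  have hP0 : 0 ≤ P := l2_nonneg _ _ _
  set s := Real.sqrt (x (n + 1) - x n) with hsdef
  have hs0 : 0 ≤ s := Real.sqrt_nonneg _
  have hss : s * s = x (n + 1) - x n := Real.mul_self_sqrt hpos.le
  have hs1 : s ≤ 1 := by rw [hsdef]; exact Real.sqrt_le_one.2 hone
  set h := x (n + 1) - x n with hh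
  have hhs : h ≤ s := by nlinarith
  set W := l2 (x n) (x (n + 1)) (ev w n) with hWdef
  have hW0 : 0 ≤ W := l2_nonneg _ _ _
  have hdelta : ∀ t ∈ Icc (x n) (x (n + 1)), |b t - b (x n)| ≤ K * h :=
    fun t ht => abs_sub_left_le hx hcb hcb1 hc.bb1 hc.db le_rfl ht
  have hKh : 0 ≤ K * h := by positivity
  have hcbK : ∀ t ∈ Icc (x n) (x (n + 1)), |c t - b1 t| ≤ 2 * K := fun t _ =>
    (abs_sub _ _).trans (by linarith [hc.bc t, hc.bb1 t])
  have hvl := hs.l2_v_last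
  have hder := hs.deriv_le n le_rfl
  have hV0 := l2_nonneg (x n) (x (n + 1)) (ev v n)
  have hdd : (derivative (v n)).degree < k :=
    lt_of_le_of_lt degree_derivative_le hs.deg_v_last
  have horth := hs.w_orth _ hdd
  set M := s * P * R with hM
  have hM0 : 0 ≤ M := by positivity
  have hWD : h * D * P * W ≤ D * G * M := by
    have h1 : P * W ≤ P * (G * R) := mul_le_mul_of_nonneg_left hW hP0
    have h2 : h * (P * W) ≤ s * (P * (G * R)) := mul_le_mul hhs h1 (by positivity) hs0
    nlinarith [mul_le_mul_of_nonneg_left h2 (zero_le_one.trans hD)]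
  have hWV : l2 (x n) (x (n + 1)) (ev v n) * W ≤ G * M := by
    have h1 : P * W ≤ P * (G * R) := mul_le_mul_of_nonneg_left hW hP0
    have h2 : h * (P * W) ≤ s * (P * (G * R)) := mul_le_mul hhs h1 (by positivity) hs0
    nlinarith [mul_le_mul_of_nonneg_right hvl hW0]
  -- the term with `b - b(x_n)`
  have hbw : |∫ t in x n..x (n + 1), (b t - b (x n)) * ev w n t * (derivative (v n)).eval t| ≤
      K * (D * G * M) := by
    have h1 := abs_integral_weight_le hlt.le (w := fun t => b t - b (x n)) (f := ev w n)
      (g := fun t => (derivative (v n)).eval t) (by fun_prop) (by fun_prop) (by fun_prop) hKh hdelta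
    have h2 : K * h * W * l2 (x n) (x (n + 1)) (fun t => (derivative (v n)).eval t) ≤
      K * h * W * (D * P) := mul_le_mul_of_nonneg_left hder (by positivity)
    have h3 := mul_le_mul_of_nonneg_left hWD (zero_le_one.trans hK)
    linarith
  -- Since w is orthogonal to v', whose degree is less than k, the value b(x_n) may be subtracted
  -- from b; this gains a factor h.
  have hbw' : ∫ t in x n..x (n + 1), b t * ev w n t * (derivative (v n)).eval t =
      ∫ t in x n..x (n + 1), (b t - b (x n)) * ev w n t * (derivative (v n)).eval t := by
    rw [integral_lin2 (F := fun t => (b t - b (x n)) * ev w n t * (derivative (v n)).eval t)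
      (f := fun t => b t * ev w n t * (derivative (v n)).eval t)
      (g := fun t => (w n).eval t * (derivative (v n)).eval t) 1 (-b (x n)) (by fun_prop)
      (by fun_prop) (fun t => by simp only [ev]; ring), horth]
    ring
  have hcw : |∫ t in x n..x (n + 1), (c t - b1 t) * ev v n t * (w n).eval t| ≤
      2 * K * (G * M) := by
    have h1 := abs_integral_weight_le hlt.le (w := fun t => c t - b1 t) (f := ev v n)
      (g := ev w n) (by fun_prop) (by fun_prop) (by fun_prop) (by positivity) hcbK
    have h2 := mul_le_mul_of_nonneg_left hWV (show 0 ≤ 2 * K by positivity)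
    simp only [ev] at *
    linarith
  have hcw' : ∫ t in x n..x (n + 1), (c t - b1 t) * ev w n t * (v n).eval t =
      ∫ t in x n..x (n + 1), (c t - b1 t) * ev v n t * (w n).eval t := by
    congr 1; funext t; simp only [ev]; ring
  have htr : ∀ β y z : ℝ, |β| * |y| ≤ 2 * K * R → |z| ≤ D * s * P →
      |β| * |y| * |z| ≤ 2 * K * D * M := by
    intro β y z h1 h2
    have := mul_le_mul h1 h2 (abs_nonneg _) (by positivity)
    exact this.trans (le_of_eq (by rw [hM]; ring))
  have hend := hs.end_le
  have hstart := hs.start_le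
  have hprev := hs.prev_le
  have hjmp := hs.jmp_le n le_rfl
  have hconst : 4 * K * D * G * M + 8 * K * D * M ≤ 10 * K * D * K * (1 + G) * M := by
    have : 10 * K * D * (1 + G) * M ≤ K * (10 * K * D * (1 + G) * M) :=
      le_mul_of_one_le_left (by positivity) hK
    have h2 : 0 ≤ K * D * G * M := by positivity
    have h3 : 0 ≤ K * D * M := by positivity
    linarith
  have hDG : G * M ≤ D * (G * M) := le_mul_of_one_le_left (by positivity) hD
  have hKDG := mul_le_mul_of_nonneg_left hDG (zero_le_one.trans hK)
  constructor
  · rw [hs.bform_w_left, hbw', hcw']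
    refine (abs_sub_add_add_le _ _ _ _).trans ?_
    have t2 : |(b (x n) - |b (x n)|) / 2 * (w n).eval (x n) * jmp x (ev v) n| ≤ 2 * K * D * M := by
      rw [abs_mul, abs_mul]
      refine le_trans ?_ (htr _ _ _ hwL hjmp)
      exact mul_le_mul_of_nonneg_right (mul_le_mul_of_nonneg_right (abs_neg_part_le _)
        (abs_nonneg _)) (abs_nonneg _)
    have t4 : |(b (x (n + 1)) + |b (x (n + 1))|) / 2 * (w n).eval (x (n + 1)) *
        (v n).eval (x (n + 1))| ≤ 2 * K * D * M := by
      rw [abs_mul, abs_mul]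
      refine le_trans ?_ (htr _ _ _ hwR hend)
      exact mul_le_mul_of_nonneg_right (mul_le_mul_of_nonneg_right (abs_pos_part_le _)
        (abs_nonneg _)) (abs_nonneg _)
    refine (add_le_add (add_le_add (add_le_add hbw t2) hcw) t4).trans (le_trans ?_ hconst)
    have h3 : 0 ≤ K * D * M := by positivity
    have h4 : 0 ≤ K * D * G * M := by positivity
    linarith
  -- In the other cross term the derivative falls on w, where the energy does not control it.
  -- Integration by parts moves it to v, and all boundary terms carry the factor b.
  · have hibp := integral_by_parts hlt.le hcb hcb1 (fun t ht => hc.db t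
      ⟨(hx.mem (by omega)).1.trans_lt ht.1, ht.2.trans_le (hx.mem (by omega)).2⟩) (v n) (w n)
    have hsplit : ∫ t in x n..x (n + 1), (b1 t * (v n).eval t + b t * (derivative (v n)).eval t) *
        (w n).eval t = 1 * (∫ t in x n..x (n + 1), b1 t * ev v n t * (w n).eval t) +
        1 * ∫ t in x n..x (n + 1), b t * ev w n t * (derivative (v n)).eval t :=
      integral_lin2 _ _ (by fun_prop) (by fun_prop) (fun t => by simp only [ev]; ring)
    have hb1vw : |∫ t in x n..x (n + 1), b1 t * ev v n t * (w n).eval t| ≤ K * (G * M) := by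
      have h1 := abs_integral_weight_le hlt.le (w := b1) (f := ev v n)
        (g := ev w n) (by fun_prop) (by fun_prop) (by fun_prop) (by positivity)
        (fun t _ => hc.bb1 t)
      have h2 := mul_le_mul_of_nonneg_left hWV (zero_le_one.trans hK)
      simp only [ev] at *
      linarith
    have tL : |b (x n) * (v n).eval (x n) * (w n).eval (x n)| ≤ 2 * K * D * M := by
      rw [mul_right_comm, abs_mul, abs_mul]
      exact htr _ _ _ hwL hstart
    have tR : |b (x (n + 1)) * (v n).eval (x (n + 1)) * (w n).eval (x (n + 1))| ≤
        2 * K * D * M := by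
      rw [mul_right_comm, abs_mul, abs_mul]
      exact htr _ _ _ hwR hend
    have tL' : |(b (x n) - |b (x n)|) / 2 * (v n).eval (x n) * (w n).eval (x n)| ≤
        2 * K * D * M := by
      rw [mul_right_comm, abs_mul, abs_mul]
      refine le_trans ?_ (htr _ _ _ hwL hstart)
      exact mul_le_mul_of_nonneg_right (mul_le_mul_of_nonneg_right (abs_neg_part_le _)
        (abs_nonneg _)) (abs_nonneg _)
    have tP : |(b (x n) + |b (x n)|) / 2 * prev x (ev v) n * (w n).eval (x n)| ≤
        2 * K * D * M := by
      rw [mul_right_comm, abs_mul, abs_mul]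
      refine le_trans ?_ (htr _ _ _ hwL hprev)
      exact mul_le_mul_of_nonneg_right (mul_le_mul_of_nonneg_right (abs_pos_part_le _)
        (abs_nonneg _)) (abs_nonneg _)
    have tR' : |(b (x (n + 1)) + |b (x (n + 1))|) / 2 * (v n).eval (x (n + 1)) *
        (w n).eval (x (n + 1))| ≤ 2 * K * D * M := by
      rw [mul_right_comm, abs_mul, abs_mul]
      refine le_trans ?_ (htr _ _ _ hwR hend)
      exact mul_le_mul_of_nonneg_right (mul_le_mul_of_nonneg_right (abs_pos_part_le _)
        (abs_nonneg _)) (abs_nonneg _)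
    have hmain : bform x n b b1 c (ev v) w =
        (∫ t in x n..x (n + 1), b1 t * ev v n t * (w n).eval t) +
        (∫ t in x n..x (n + 1), (b t - b (x n)) * ev w n t * (derivative (v n)).eval t) -
        b (x (n + 1)) * (v n).eval (x (n + 1)) * (w n).eval (x (n + 1)) +
        b (x n) * (v n).eval (x n) * (w n).eval (x n) -
        (b (x n) + |b (x n)|) / 2 * prev x (ev v) n * (w n).eval (x n) -
        (b (x n) - |b (x n)|) / 2 * (v n).eval (x n) * (w n).eval (x n) +
        (∫ t in x n..x (n + 1), (c t - b1 t) * ev v n t * (w n).eval t) +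
        (b (x (n + 1)) + |b (x (n + 1))|) / 2 * (v n).eval (x (n + 1)) *
        (w n).eval (x (n + 1)) := by
      rw [hs.bform_w_right, ← hbw']
      simp only [ev] at *
      linear_combination hsplit - hibp
    rw [hmain]
    have h3 : 0 ≤ K * D * M := by positivity
    have h4 : 0 ≤ K * D * G * M := by positivity
    have hconst' : 4 * K * D * G * M + 10 * K * D * M ≤ 10 * K * D * K * (1 + G) * M := by
      have : 10 * K * D * (1 + G) * M ≤ K * (10 * K * D * (1 + G) * M) :=
        le_mul_of_one_le_left (by positivity) hK
      linarith
    rw [abs_le] at *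
    constructor <;> linarith [hb1vw.1, hb1vw.2, hbw.1, hbw.2, tL.1, tL.2, tR.1, tR.2, tL'.1,
      tL'.2, tP.1, tP.2, tR'.1, tR'.2, hcw.1, hcw.2]

lemma IsSplit.sum_identity (hx : IsMesh x n) (hc : IsCoeff a a1 b b1 c α γ K)
    (hs : IsSplit x n k D u p v w) (κ : ℝ) :
    bform x n b b1 c (ev u) (fun i => v i + κ • w i) =
      uquad x n b b1 c (ev v) + κ * uquad x n b b1 c (ev w) +
      bform x n b b1 c (ev w) v + κ * bform x n b b1 c (ev v) w := by
  have hu : ev u = fun i t => ev v i t + 1 * ev w i t := by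
    funext i t; simp [ev, hs.eq i]
  rw [bform_add_right hc.cb hc.cb1 hc.cc (fun i => by fun_prop), hu,
    bform_add_left hc.cb hc.cb1 hc.cc (fun i => by fun_prop) (fun i => by fun_prop),
    bform_add_left hc.cb hc.cb1 hc.cc (fun i => by fun_prop) (fun i => by fun_prop),
    bform_self hx hc, bform_self hx hc]
  ring

/-- The value of the bilinear form of the scheme at the discrete solution `(u, p)` and the test
functions `(v + κ w, p)`. -/
def testValue (x : ℕ → ℝ) (n : ℕ) (ε : ℝ) (a b b1 c : ℝ → ℝ) (u p v w : ℕ → ℝ[X]) (κ : ℝ) : ℝ :=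
  ε * (aform x n (fun _ => 1) (ev p) p + (p n).eval (x (n + 1)) ^ 2) +
    aform x n a (ev p) (fun i => v i + κ • w i) +
    bform x n b b1 c (ev u) (fun i => v i + κ • w i)

lemma pquad_eq (hx : IsMesh x n) {ε : ℝ} :
    pquad x n ε a (ev p) = ε * (aform x n (fun _ => 1) (ev p) p + (p n).eval (x (n + 1)) ^ 2) +
      ∑ i ∈ Finset.range (n + 1), ∫ t in x i..x (i + 1), a t * ev p i t ^ 2 := by
  rw [aform_one_self hx, pquad, Finset.sum_add_distrib, ← Finset.mul_sum]
  simp only [ev]; ring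

/-- For constant `a` the diffusion form is a(0) times the form with coefficient 1, to which
`IsSplit.aform_one` applies without error. With κ = 1 the test function is u itself, and
`bform_self` applies; hence no restriction on the mesh. -/
theorem coercive_of_const (hx : IsMesh x n) (hc : IsCoeff a a1 b b1 c α γ K)
    (ha : ∀ t ∈ Icc (0 : ℝ) 1, a t = a 0) {ε : ℝ}
    (hd : IsDiscDeriv x n k u p) (hs : IsSplit x n k D u p v w) :
    pquad x n ε a (ev p) + uquad x n b b1 c (ev u) = testValue x n ε a b b1 c u p v w 1 := by
  have huv : (fun i => v i + (1 : ℝ) • w i) = u := by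
    funext i; rw [hs.eq i, one_smul]
  have h1 := hs.aform_one hx hd 1 hd.deg_p
  rw [testValue, pquad_eq hx, huv, bform_self hx hc]
  rw [huv] at h1
  have hsub : ∀ i ≤ n, ∀ t ∈ uIcc (x i) (x (i + 1)), a t = a 0 := fun i hi t ht =>
    ha t (hx.subset hi (by rwa [uIcc_of_le (hx.lt i hi).le] at ht))
  have h2 : aform x n a (ev p) u = a 0 * aform x n (fun _ => 1) (ev p) u := by
    rw [aform, aform, mul_sub, Finset.mul_sum, ha (x (n + 1)) (hx.mem le_rfl)]
    congr 1
    · refine Finset.sum_congr rfl fun i hi => ?_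
      have hi' : i ≤ n := by simpa [Nat.lt_succ_iff] using hi
      rw [mul_add, ← intervalIntegral.integral_const_mul, ha (x i) (hx.mem (by omega))]
      congr 1
      · refine intervalIntegral.integral_congr fun t ht => ?_
        simp only [hsub i hi' t ht]; ring
      · ring
    · ring
  have h3 : ∑ i ∈ Finset.range (n + 1), ∫ t in x i..x (i + 1), a t * ev p i t ^ 2 =
      a 0 * ∑ i ∈ Finset.range (n + 1), ∫ t in x i..x (i + 1), (p i).eval t * (p i).eval t := by
    rw [Finset.mul_sum]
    refine Finset.sum_congr rfl fun i hi => ?_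
    have hi' : i ≤ n := by simpa [Nat.lt_succ_iff] using hi
    rw [← intervalIntegral.integral_const_mul]
    refine intervalIntegral.integral_congr fun t ht => ?_
    simp only [hsub i hi' t ht]; ring
  rw [h2, h3, h1]

/-- There are two perturbations: κ ‖p‖ ‖w‖ from the diffusion on the last element, and √h ‖p‖ times
the root of the energy S of w from the cross terms. The form contains the energy of w only with the
factor κ. Young's inequality handles the first one if κ is small compared with α, and the second one
if h is small compared with κ; so κ is fixed first and then H₀. -/
theorem exists_coercive (hc : IsCoeff a a1 b b1 c α γ K) (hD : 1 ≤ D) (k : ℕ) :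
    ∃ κ H₀ C : ℝ, 0 < κ ∧ κ ≤ 1 ∧ 0 < H₀ ∧ 0 < C ∧
      ∀ (x : ℕ → ℝ) (n : ℕ) (ε : ℝ) (u p v w : ℕ → ℝ[X]), 0 ≤ ε → IsMesh x n →
        IsDiscDeriv x n k u p → IsSplit x n k D u p v w → (∀ i ≤ n, x (i + 1) - x i ≤ H₀) →
        pquad x n ε a (ev p) + uquad x n b b1 c (ev u) ≤
          C * testValue x n ε a b b1 c u p v w κ := by
  have hK := hc.one_le
  have hα := hc.pos_α
  have hγ := hc.pos_γ
  set G := Real.sqrt γ⁻¹ with hG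
  have hG0 : 0 ≤ G := Real.sqrt_nonneg _
  set C1 := K * (D + invK (k + 1) + 2) with hC1
  have hC1pos : 0 < C1 := by have := invK_pos (k + 1); positivity
  set C5 := 10 * K * D * K * (1 + G) with hC5
  have hC5pos : 0 < C5 := by positivity
  -- Chosen such that κ C1² G² ≤ α / 8; the summand 1 in the denominator only prevents division by
  -- zero.
  set κ := min 1 (α / (8 * (C1 ^ 2 * G ^ 2 + 1))) with hκ
  have hκ0 : 0 < κ := lt_min one_pos (by positivity)
  have hκ1 : κ ≤ 1 := min_le_left _ _
  have hκ2 : κ * (C1 ^ 2 * G ^ 2) ≤ α / 8 := by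
    have h1 : κ ≤ α / (8 * (C1 ^ 2 * G ^ 2 + 1)) := min_le_right _ _
    rw [le_div_iff₀ (by positivity)] at h1
    nlinarith
  -- H₀ makes (C1 + 4 C5² / κ) H₀ equal to α / 8: the first summand is the O(h) defect of the
  -- diffusion form, the second one the Young constant of the cross terms.
  refine ⟨κ, α / (8 * (C1 + 4 * C5 ^ 2 / κ)), 4 / κ, hκ0, hκ1, by positivity, by positivity,
    fun x n ε u p v w hε hx hd hs hH => ?_⟩
  set H := α / (8 * (C1 + 4 * C5 ^ 2 / κ)) with hHdef
  have hH8 : (C1 + 4 * C5 ^ 2 / κ) * H = α / 8 := by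
    rw [hHdef]; field_simp
  have h3 := hs.abs_aform_sub_le hx hc hd hD hκ0.le hH
  obtain ⟨h4, h5⟩ := hs.abs_cross_le hx hc hD
  obtain ⟨hS0, hW, -, -⟩ := hs.w_bounds hx hc
  rw [← hC1] at h3
  rw [← hG, ← hC5] at h4 h5
  have hid := hs.sum_identity hx hc κ
  have hpq := pquad_eq (a := a) (p := p) (ε := ε) hx
  have hle := le_pquad hx hc (ε := ε) (y := ev p) (fun i => by fun_prop)
  have huu : uquad x n b b1 c (ev u) ≤
      2 * uquad x n b b1 c (ev v) + 2 * uquad x n b b1 c (ev w) := by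
    have hu : ev u = fun i t => ev v i t + 1 * ev w i t := by
      funext i t; simp [ev, hs.eq i]
    rw [hu]
    exact uquad_add_le hx hc (fun i => by fun_prop) (fun i => by fun_prop)
  have hSv : 0 ≤ uquad x n b b1 c (ev v) :=
    le_trans (by positivity) (le_uquad hx hc (y := ev v) (fun i => by fun_prop))
  set A := ∑ i ∈ Finset.range (n + 1), l2 (x i) (x (i + 1)) (ev p i) ^ 2 with hA
  set P := l2 (x n) (x (n + 1)) (ev p n) with hP
  have hP0 : 0 ≤ P := l2_nonneg _ _ _
  have hPA : P ^ 2 ≤ A := by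
    rw [hA, Finset.sum_range_succ]
    have : 0 ≤ ∑ i ∈ Finset.range n, l2 (x i) (x (i + 1)) (ev p i) ^ 2 := by positivity
    linarith
  set S := uquad x n b b1 c (ev w) with hS
  set R := Real.sqrt S with hR
  have hR0 : 0 ≤ R := Real.sqrt_nonneg _
  have hRS : R ^ 2 = S := Real.sq_sqrt hS0
  set W := l2 (x n) (x (n + 1)) (ev w n) with hWdef
  set s := Real.sqrt (x (n + 1) - x n) with hsdef
  have hs0 : 0 ≤ s := Real.sqrt_nonneg _
  have hsH : s ^ 2 ≤ H := by
    rw [hsdef, Real.sq_sqrt (by linarith [hx.lt n le_rfl])]; exact hH n le_rfl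
  have y1 : κ * (C1 * (P * W)) ≤ κ / 4 * S + α / 8 * A := by
    have e1 : κ * (C1 * (P * W)) ≤ κ * (C1 * (P * (G * R))) := by gcongr
    have e2 : κ * (C1 * (P * (G * R))) ≤ κ / 4 * R ^ 2 + κ * (C1 ^ 2 * G ^ 2) * P ^ 2 := by
      have e3 := mul_nonneg hκ0.le (sq_nonneg (R / 2 - C1 * G * P))
      have e4 : κ * (R / 2 - C1 * G * P) ^ 2 = κ / 4 * R ^ 2 + κ * (C1 ^ 2 * G ^ 2) * P ^ 2 -
        κ * (C1 * (P * (G * R))) := by ring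
      linarith only [e3, e4]
    have e3 : κ * (C1 ^ 2 * G ^ 2) * P ^ 2 ≤ α / 8 * A :=
      mul_le_mul hκ2 hPA (sq_nonneg _) (by positivity)
    rw [hRS] at e2
    linarith only [e1, e2, e3]
  have y2 : 2 * (C5 * (s * P * R)) ≤ κ / 4 * S + 4 * C5 ^ 2 / κ * H * A := by
    have e2 : 2 * (C5 * (s * P * R)) ≤ κ / 4 * R ^ 2 + 4 * C5 ^ 2 / κ * (s ^ 2 * P ^ 2) := by
      have e3 : 0 ≤ (κ / 2 * R - 2 * C5 * (s * P)) ^ 2 / κ := by positivity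
      have e4 : (κ / 2 * R - 2 * C5 * (s * P)) ^ 2 / κ =
        κ / 4 * R ^ 2 - 2 * (C5 * (s * P * R)) + 4 * C5 ^ 2 / κ * (s ^ 2 * P ^ 2) := by
        field_simp; ring
      linarith only [e3, e4]
    have e3 : 4 * C5 ^ 2 / κ * (s ^ 2 * P ^ 2) ≤ 4 * C5 ^ 2 / κ * (H * A) := by
      refine mul_le_mul_of_nonneg_left ?_ (by positivity)
      exact mul_le_mul hsH hPA (sq_nonneg _) ((sq_nonneg s).trans hsH)
    rw [hRS] at e2
    linarith only [e2, e3]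
  have hε' : 0 ≤ ε / 2 * (∑ i ∈ Finset.range (n + 1), jmp x (ev p) i ^ 2 +
      ev p n (x (n + 1)) ^ 2) := by positivity
  have hcross : -(2 * (C5 * (s * P * R))) ≤
      bform x n b b1 c (ev w) v + κ * bform x n b b1 c (ev v) w := by
    have e1 := (abs_le.1 h4).1
    have e2 := (abs_le.1 h5).1
    have e3 := mul_le_mul_of_nonneg_left e2 hκ0.le
    have e4 : κ * (C5 * (s * P * R)) ≤ 1 * (C5 * (s * P * R)) := by gcongr
    linarith only [e1, e3, e4]
  -- The losses are α / 8 twice in the L² norm of p, hence at most a quarter of `pquad`, and κ / 4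
  -- twice in the energy of w.
  have htv : testValue x n ε a b b1 c u p v w κ ≥
      3 / 4 * pquad x n ε a (ev p) + uquad x n b b1 c (ev v) + κ / 2 * S := by
    rw [testValue, hid]
    have e1 := (abs_le.1 h3).1
    have e2 : (C1 + 4 * C5 ^ 2 / κ) * H * A = α / 8 * A := by rw [hH8]
    linarith only [e1, e2, hcross, y1, y2, hpq, hle, hε']
  have hpq0 : 0 ≤ pquad x n ε a (ev p) := le_trans (by positivity) hle
  -- The factor 4 / κ turns (κ / 2) S into the 2 S required by the bound of the energy of v + w.
  have h6 : pquad x n ε a (ev p) + uquad x n b b1 c (ev u) ≤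
      4 / κ * (3 / 4 * pquad x n ε a (ev p) + uquad x n b b1 c (ev v) + κ / 2 * S) := by
    have e1 : 4 / κ * (3 / 4 * pquad x n ε a (ev p) + uquad x n b b1 c (ev v) + κ / 2 * S) =
      (1 / κ) * (3 * pquad x n ε a (ev p)) + (1 / κ) * (4 * uquad x n b b1 c (ev v)) + 2 * S := by
      field_simp; ring
    have e2 : 1 ≤ 1 / κ := by rw [le_div_iff₀ hκ0]; linarith
    rw [e1]
    linarith only [huu, hpq0, hSv, mul_le_mul_of_nonneg_right e2 (show 0 ≤ 3 * pquad x n ε a (ev p) by positivity),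
      mul_le_mul_of_nonneg_right e2 (show 0 ≤ 4 * uquad x n b b1 c (ev v) by positivity)]
  exact h6.trans (mul_le_mul_of_nonneg_left htv (by positivity))

end

/-! ### Consistency of the scheme, and the residuals of the projection errors. -/

section

variable {x : ℕ → ℝ} {n k : ℕ} {u p v w : ℕ → ℝ[X]} {a a1 b b1 c : ℝ → ℝ} {α γ K D ε : ℝ}

lemma integral_by_parts_fun {l r : ℝ} (h : l ≤ r) {g g1 : ℝ → ℝ} (hg : Continuous g)
    (hg1 : Continuous g1) (hd : ∀ t ∈ Ioo l r, HasDerivAt g (g1 t) t) (v : ℝ[X]) :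
    (∫ t in l..r, g1 t * v.eval t) + ∫ t in l..r, g t * (derivative v).eval t =
    g r * v.eval r - g l * v.eval l := by
  have := integral_by_parts h hg hg1 hd 1 v
  simpa using this

/-- The smooth solution of the boundary value problem, extended continuously to the real line;
`p` is its first derivative, `p1` the second one, and `q1` is the derivative of `ε p1`. -/
structure IsExact (ε : ℝ) (a a1 b c f u p p1 q1 : ℝ → ℝ) : Prop where
  cf : Continuous f
  cu : Continuous u
  cp : Continuous p
  cp1 : Continuous p1
  cq1 : Continuous q1
  du : ∀ t ∈ Ioo (0 : ℝ) 1, HasDerivAt u (p t) t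
  dp : ∀ t ∈ Ioo (0 : ℝ) 1, HasDerivAt p (p1 t) t
  dq : ∀ t ∈ Ioo (0 : ℝ) 1, HasDerivAt (fun t => ε * p1 t) (q1 t) t
  eq : ∀ t ∈ Ioo (0 : ℝ) 1,
    q1 t - (a1 t * p t + a t * p1 t) + b t * p t + c t * u t = f t
  left : u 0 = 0
  right : u 1 = 0
  right_deriv : p 1 = 0

lemma sum_mul_jmp (y : ℝ → ℝ) (v : ℕ → ℝ[X]) (n : ℕ) :
    ∑ i ∈ Finset.range (n + 1), y (x i) * jmp x (ev v) i =
      (∑ i ∈ Finset.range (n + 1), (y (x i) * (v i).eval (x i) -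
        y (x (i + 1)) * (v i).eval (x (i + 1)))) + y (x (n + 1)) * (v n).eval (x (n + 1)) := by
  induction n with
  | zero => simp [jmp, prev]
  | succ n ih =>
    rw [Finset.sum_range_succ, ih, Finset.sum_range_succ _ (n + 1)]
    simp only [jmp, prev, ev]
    ring

lemma Ioo_subset_of_mesh (hx : IsMesh x n) {i : ℕ} (hi : i ≤ n) {t : ℝ}
    (ht : t ∈ Ioo (x i) (x (i + 1))) : t ∈ Ioo (0 : ℝ) 1 :=
  ⟨(hx.mem (by omega)).1.trans_lt ht.1, ht.2.trans_le (hx.mem (by omega)).2⟩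

/-- For a continuous argument the sum over the jumps of v (`sum_mul_jmp`) cancels the boundary terms
of the elementwise integration by parts. -/
lemma aform_const_eq (hx : IsMesh x n) {g g1 a y : ℝ → ℝ} (hgy : ∀ t, g t = a t * y t)
    (hg : Continuous g)
    (hg1 : Continuous g1) (hd : ∀ t ∈ Ioo (0 : ℝ) 1, HasDerivAt g (g1 t) t) (v : ℕ → ℝ[X]) :
    aform x n a (fun _ => y) v =
      -∑ i ∈ Finset.range (n + 1), ∫ t in x i..x (i + 1), g1 t * (v i).eval t := by
  simp only [aform, ← hgy]
  rw [Finset.sum_add_distrib, sum_mul_jmp, add_sub_assoc, add_sub_cancel_right,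
    ← Finset.sum_add_distrib, ← Finset.sum_neg_distrib]
  refine Finset.sum_congr rfl fun i hi => ?_
  have hi' : i ≤ n := by simpa [Nat.lt_succ_iff] using hi
  have := integral_by_parts_fun (hx.lt i hi').le hg hg1
    (fun t ht => hd t (Ioo_subset_of_mesh hx hi' ht)) (v i)
  linarith

lemma integral_congr_Ioo {l r : ℝ} (h : l ≤ r) {f g : ℝ → ℝ} (hfg : ∀ t ∈ Ioo l r, f t = g t) :
    ∫ t in l..r, f t = ∫ t in l..r, g t := by
  rw [intervalIntegral.integral_of_le h, intervalIntegral.integral_of_le h,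
    MeasureTheory.integral_Ioc_eq_integral_Ioo, MeasureTheory.integral_Ioc_eq_integral_Ioo]
  exact MeasureTheory.setIntegral_congr_fun measurableSet_Ioo hfg

section exact
variable {f U P P1 Q1 : ℝ → ℝ}

/-- The traces of U from both sides agree at the nodes, at x = 0 by the boundary condition, so
upwinding has no effect; the condition at x = 1 removes the outflow term. -/
lemma IsExact.bform_eq (hx : IsMesh x n) (hc : IsCoeff a a1 b b1 c α γ K)
    (he : IsExact ε a a1 b c f U P P1 Q1) (v : ℕ → ℝ[X]) :
    bform x n b b1 c (fun _ => U) v =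
      ∑ i ∈ Finset.range (n + 1), ∫ t in x i..x (i + 1), (b t * P t + c t * U t) * (v i).eval t := by
  have hprev : ∀ i, prev x (fun _ => U) i = U (x i) := by
    intro i; cases i with
    | zero => rw [hx.zero, he.left]; rfl
    | succ j => rfl
  have hcb := hc.cb
  have hcb1 := hc.cb1
  have hcc := hc.cc
  have hcU := he.cu
  have hcP := he.cp
  have h1 := aform_const_eq hx (g := fun t => b t * U t) (g1 := fun t => b1 t * U t + b t * P t)
    (a := b) (y := U) (fun t => rfl) (by fun_prop) (by fun_prop)
    (fun t ht => (hc.db t ht).mul (he.du t ht)) v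
  have h2 : bform x n b b1 c (fun _ => U) v = -aform x n b (fun _ => U) v +
      ∑ i ∈ Finset.range (n + 1), ∫ t in x i..x (i + 1), (c t - b1 t) * U t * (v i).eval t := by
    rw [bform, aform, neg_sub, hx.one, he.right]
    simp only [mul_zero, zero_mul, add_zero, zero_sub]
    rw [← Finset.sum_neg_distrib, ← Finset.sum_add_distrib]
    refine Finset.sum_congr rfl fun i _ => ?_
    rw [hprev]; ring
  rw [h2, h1, neg_neg, ← Finset.sum_add_distrib]
  refine Finset.sum_congr rfl fun i _ => ?_
  rw [integral_lin2 (F := fun t => (b t * P t + c t * U t) * (v i).eval t)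
    (f := fun t => (b1 t * U t + b t * P t) * (v i).eval t)
    (g := fun t => (c t - b1 t) * U t * (v i).eval t) 1 1 (by fun_prop) (by fun_prop)
    (fun t => by ring)]
  ring

/-- Consistency of the third equation of the scheme. -/
lemma IsExact.consistent_third (hx : IsMesh x n) (hc : IsCoeff a a1 b b1 c α γ K)
    (he : IsExact ε a a1 b c f U P P1 Q1) (v : ℕ → ℝ[X]) :
    -aform x n (fun _ => 1) (fun _ t => ε * P1 t) v + aform x n a (fun _ => P) v +
      bform x n b b1 c (fun _ => U) v =
      ∑ i ∈ Finset.range (n + 1), ∫ t in x i..x (i + 1), f t * (v i).eval t := by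
  have hca := hc.ca
  have hca1 := hc.ca1
  have hcb := hc.cb
  have hcc := hc.cc
  have hcU := he.cu
  have hcP := he.cp
  have hcP1 := he.cp1
  have hcQ1 := he.cq1
  rw [aform_const_eq hx (g := fun t => ε * P1 t) (g1 := Q1) (fun t => by ring) (by fun_prop)
    hcQ1 he.dq, aform_const_eq hx (g := fun t => a t * P t)
    (g1 := fun t => a1 t * P t + a t * P1 t) (fun t => rfl) (by fun_prop) (by fun_prop)
    (fun t ht => (hc.da t ht).mul (he.dp t ht)), he.bform_eq hx hc, neg_neg,
    ← Finset.sum_neg_distrib, ← Finset.sum_add_distrib, ← Finset.sum_add_distrib]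
  refine Finset.sum_congr rfl fun i hi => ?_
  have hi' : i ≤ n := by simpa [Nat.lt_succ_iff] using hi
  rw [integral_congr_Ioo (hx.lt i hi').le (f := fun t => f t * (v i).eval t)
    (g := fun t => (Q1 t - (a1 t * P t + a t * P1 t) + b t * P t + c t * U t) * (v i).eval t)
    (fun t ht => by simp only [he.eq t (Ioo_subset_of_mesh hx hi' ht)])]
  rw [integral_lin3 (F := fun t => (Q1 t - (a1 t * P t + a t * P1 t) + b t * P t + c t * U t) *
    (v i).eval t) (f := fun t => Q1 t * (v i).eval t)
    (g := fun t => (a1 t * P t + a t * P1 t) * (v i).eval t)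
    (e := fun t => (b t * P t + c t * U t) * (v i).eval t) 1 (-1) 1 (by fun_prop) (by fun_prop)
    (by fun_prop) (fun t => by ring)]
  ring

/-- Consistency of the second equation of the scheme. -/
lemma IsExact.consistent_second (hx : IsMesh x n) (he : IsExact ε a a1 b c f U P P1 Q1)
    (s : ℕ → ℝ[X]) :
    (∑ i ∈ Finset.range (n + 1), ∫ t in x i..x (i + 1), ε * P1 t * (s i).eval t) +
      ε * (aform x n (fun _ => 1) (fun _ => P) s + P (x (n + 1)) * (s n).eval (x (n + 1))) = 0 := by
  have hcP := he.cp
  have hcP1 := he.cp1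
  rw [aform_const_eq hx (g := P) (g1 := P1) (fun t => by ring) hcP hcP1 he.dp, hx.one,
    he.right_deriv, zero_mul, add_zero, mul_neg, Finset.mul_sum, ← sub_eq_add_neg,
    ← Finset.sum_sub_distrib]
  refine Finset.sum_eq_zero fun i _ => ?_
  rw [← intervalIntegral.integral_const_mul, sub_eq_zero]
  congr 1; funext t; ring

end exact

/-- Errors of the projections: right Radau for the first component, `L²` for the second one, left
Radau for the third one. -/
structure IsProjError (x : ℕ → ℝ) (n k : ℕ) (δ δu : ℝ) (y z q : ℕ → ℝ → ℝ) : Prop where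
  cy : ∀ i, Continuous (y i)
  cz : ∀ i, Continuous (z i)
  cq : ∀ i, Continuous (q i)
  nonneg : 0 ≤ δu
  le : δu ≤ δ
  by' : ∀ i ≤ n, ∀ t ∈ Icc (x i) (x (i + 1)), |y i t| ≤ δu
  bz : ∀ i ≤ n, ∀ t ∈ Icc (x i) (x (i + 1)), |z i t| ≤ δ
  bq : ∀ i ≤ n, ∀ t ∈ Icc (x i) (x (i + 1)), |q i t| ≤ δ
  y_right : ∀ i ≤ n, y i (x (i + 1)) = 0
  q_left : ∀ i ≤ n, q i (x i) = 0
  z_orth : ∀ i ≤ n, ∀ s : ℝ[X], s.degree < ((k + 1 : ℕ) : WithBot ℕ) →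
    ∫ t in x i..x (i + 1), z i t * s.eval t = 0
  q_orth : ∀ i ≤ n, ∀ s : ℝ[X], s.degree < k → ∫ t in x i..x (i + 1), q i t * s.eval t = 0

/-- Cauchy-Schwarz, with the widths adding up to 1. -/
lemma sum_sqrt_mul_le (hx : IsMesh x n) {y : ℕ → ℝ} :
    ∑ i ∈ Finset.range (n + 1), Real.sqrt (x (i + 1) - x i) * y i ≤
      Real.sqrt (∑ i ∈ Finset.range (n + 1), y i ^ 2) := by
  have h1 := Finset.sum_mul_sq_le_sq_mul_sq (Finset.range (n + 1))
    (fun i => Real.sqrt (x (i + 1) - x i)) y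
  have h2 : ∑ i ∈ Finset.range (n + 1), Real.sqrt (x (i + 1) - x i) ^ 2 = 1 := by
    rw [← hx.sum]
    refine Finset.sum_congr rfl fun i hi => ?_
    have hi' : i ≤ n := by simpa [Nat.lt_succ_iff] using hi
    exact Real.sq_sqrt (by linarith [hx.lt i hi'])
  rw [h2, one_mul] at h1
  exact Real.le_sqrt_of_sq_le h1

lemma IsProjError.prev_y {δ δu : ℝ} {y z q : ℕ → ℝ → ℝ} (he : IsProjError x n k δ δu y z q) {i : ℕ}
    (hi : i ≤ n) : prev x y i = 0 := by
  cases i with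
  | zero => rfl
  | succ j => exact he.y_right j (by omega)

/-- The residual of the second equation. -/
lemma IsProjError.abs_second_le {δ δu : ℝ} {y z q : ℕ → ℝ → ℝ} (hx : IsMesh x n)
    (hc : IsCoeff a a1 b b1 c α γ K) (he : IsProjError x n k δ δu y z q)
    (hp : ∀ i, (p i).degree < ((k + 1 : ℕ) : WithBot ℕ)) (hε : 0 < ε)
    (hεN : ε * (n + 1) ≤ 1) :
    |(∑ i ∈ Finset.range (n + 1), ∫ t in x i..x (i + 1), q i t * (p i).eval t) +
      ε * (aform x n (fun _ => 1) z p + z n (x (n + 1)) * (p n).eval (x (n + 1)))| ≤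
    (Real.sqrt α⁻¹ + 2) * δ * Real.sqrt (pquad x n ε a (ev p)) := by
  have hα := hc.pos_α
  have hδ : 0 ≤ δ := he.nonneg.trans he.le
  set A := ∑ i ∈ Finset.range (n + 1), l2 (x i) (x (i + 1)) (ev p i) ^ 2 with hA
  set J := ∑ i ∈ Finset.range (n + 1), jmp x (ev p) i ^ 2 with hJ
  have hJ0 : 0 ≤ J := by positivity
  have hA0 : 0 ≤ A := by positivity
  have hle := le_pquad hx hc (ε := ε) (y := ev p) (fun i => by fun_prop)
  set E := pquad x n ε a (ev p)
  have hq0 : 0 ≤ ε / 2 * ev p n (x (n + 1)) ^ 2 := by positivity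
  have hAE : α * A ≤ E := by
    have : 0 ≤ ε / 2 * J := by positivity
    linarith
  have hJE : ε / 2 * J ≤ E := by
    have : 0 ≤ α * A := by positivity
    linarith
  have hE0 : 0 ≤ E := le_trans (by positivity) hAE
  have h1 : |∑ i ∈ Finset.range (n + 1), ∫ t in x i..x (i + 1), q i t * (p i).eval t| ≤
      δ * Real.sqrt A := by
    refine (Finset.abs_sum_le_sum_abs _ _).trans ?_
    have := mul_le_mul_of_nonneg_left
      (sum_sqrt_mul_le hx (y := fun i => l2 (x i) (x (i + 1)) (ev p i))) hδ
    refine le_trans ?_ this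
    rw [Finset.mul_sum]
    refine Finset.sum_le_sum fun i hi => ?_
    have hi' : i ≤ n := by simpa [Nat.lt_succ_iff] using hi
    have := abs_integral_sup_le (hx.lt i hi').le (he.cq i) (g := ev p i) (by fun_prop) hδ
      (he.bq i hi')
    simp only [ev] at *
    linarith
  -- The L² projection error is orthogonal to p', and the added term cancels the trace at x = 1;
  -- only jumps of p remain.
  have h2 : aform x n (fun _ => 1) z p + z n (x (n + 1)) * (p n).eval (x (n + 1)) =
      ∑ i ∈ Finset.range (n + 1), z i (x i) * jmp x (ev p) i := by
    rw [aform]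
    simp only [one_mul]
    rw [sub_add_cancel]
    refine Finset.sum_congr rfl fun i hi => ?_
    have hi' : i ≤ n := by simpa [Nat.lt_succ_iff] using hi
    rw [he.z_orth i hi' _ (degree_derivative_lt' (hp i)), zero_add]
  have h3 : |∑ i ∈ Finset.range (n + 1), z i (x i) * jmp x (ev p) i| ≤
      δ * ∑ i ∈ Finset.range (n + 1), |jmp x (ev p) i| := by
    refine (Finset.abs_sum_le_sum_abs _ _).trans ?_
    rw [Finset.mul_sum]
    refine Finset.sum_le_sum fun i hi => ?_
    have hi' : i ≤ n := by simpa [Nat.lt_succ_iff] using hi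
    rw [abs_mul]
    exact mul_le_mul_of_nonneg_right (he.bz i hi' _ (left_mem_Icc.2 (hx.lt i hi').le))
      (abs_nonneg _)
  -- Cauchy-Schwarz over the n + 1 nodes costs √(n + 1), and the energy controls the jumps only with
  -- the weight ε. Both are compensated by ε (n + 1) ≤ 1.
  have h4 : ε * (∑ i ∈ Finset.range (n + 1), |jmp x (ev p) i|) ≤ 2 * Real.sqrt E := by
    apply le_of_sq_le_sq _ (by positivity)
    have h5 := Finset.sum_mul_sq_le_sq_mul_sq (Finset.range (n + 1)) (fun _ => (1 : ℝ))
      (fun i => |jmp x (ev p) i|)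
    simp only [one_mul, one_pow, Finset.sum_const, Finset.card_range, nsmul_eq_mul, mul_one,
      sq_abs] at h5
    rw [← hJ] at h5
    push_cast at h5
    rw [mul_pow, mul_pow, Real.sq_sqrt hE0]
    calc _ ≤ ε ^ 2 * (((n : ℝ) + 1) * J) := mul_le_mul_of_nonneg_left h5 (sq_nonneg _)
      _ = (ε * (n + 1)) * (ε * J) := by ring
      _ ≤ 1 * (ε * J) := mul_le_mul_of_nonneg_right hεN (by positivity)
      _ ≤ 2 ^ 2 * E := by linarith
  have h6 : Real.sqrt A ≤ Real.sqrt α⁻¹ * Real.sqrt E := by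
    rw [← Real.sqrt_mul (by positivity)]
    apply Real.sqrt_le_sqrt
    rw [inv_mul_eq_div, le_div_iff₀ hα]; linarith
  rw [h2]
  refine (abs_add_le _ _).trans ?_
  rw [abs_mul, abs_of_pos hε]
  have h7 := mul_le_mul_of_nonneg_left h3 hε.le
  have h8 := mul_le_mul_of_nonneg_left h4 hδ
  have h9 := mul_le_mul_of_nonneg_left h6 hδ
  linarith

/-- The residual of the third equation, tested with the well-controlled part of the split. -/
lemma IsProjError.abs_third_le {δ δu : ℝ} {y z q : ℕ → ℝ → ℝ} (hx : IsMesh x n)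
    (hc : IsCoeff a a1 b b1 c α γ K) (he : IsProjError x n k δ δu y z q)
    (hs : IsSplit x n k D u p v w) (hD : 1 ≤ D) :
    |-aform x n (fun _ => 1) q v + aform x n a z v + bform x n b b1 c y v| ≤
      8 * K * D * δ * (Real.sqrt (∑ i ∈ Finset.range (n + 1), l2 (x i) (x (i + 1)) (ev p i) ^ 2) +
        Real.sqrt (∑ i ∈ Finset.range (n + 1), l2 (x i) (x (i + 1)) (ev u i) ^ 2)) := by
  have hδ : 0 ≤ δ := he.nonneg.trans he.le
  have hca := hc.ca
  have hcb := hc.cb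
  have hcb1 := hc.cb1
  have hcc := hc.cc
  have hK := hc.one_le
  set pn : ℕ → ℝ := fun i => Real.sqrt (x (i + 1) - x i) * l2 (x i) (x (i + 1)) (ev p i) with hpn
  set un : ℕ → ℝ := fun i => Real.sqrt (x (i + 1) - x i) * l2 (x i) (x (i + 1)) (ev u i) with hun
  have hpn0 : ∀ i, 0 ≤ pn i := fun i => mul_nonneg (Real.sqrt_nonneg _) (l2_nonneg _ _ _)
  have hun0 : ∀ i, 0 ≤ un i := fun i => mul_nonneg (Real.sqrt_nonneg _) (l2_nonneg _ _ _)
  have hsp := sum_sqrt_mul_le hx (y := fun i => l2 (x i) (x (i + 1)) (ev p i))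
  have hsu := sum_sqrt_mul_le hx (y := fun i => l2 (x i) (x (i + 1)) (ev u i))
  have hpnn : pn n ≤ ∑ i ∈ Finset.range (n + 1), pn i :=
    Finset.single_le_sum (f := pn) (fun i _ => hpn0 i) (by simp)
  have hlast := hx.lt n le_rfl
  have hend : |(v n).eval (x (n + 1))| ≤ D * pn n := by
    have := hs.end_le; rw [hpn]; linarith
  have hjmp : ∀ i ≤ n, |jmp x (ev v) i| ≤ D * pn i := fun i hi => by
    have := hs.jmp_le i hi; rw [hpn]; linarith
  have hmem : ∀ i ≤ n, x i ∈ Icc (x i) (x (i + 1)) := fun i hi => left_mem_Icc.2 (hx.lt i hi).le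
  -- The left Radau error is orthogonal to v' and vanishes at every left end; only its value at x =
  -- 1 is left, and v is small there.
  have hq : |aform x n (fun _ => 1) q v| ≤ K * D * δ * pn n := by
    have h1 : aform x n (fun _ => 1) q v = -(q n (x (n + 1)) * (v n).eval (x (n + 1))) := by
      rw [aform, Finset.sum_eq_zero]
      · ring
      · intro i hi
        have hi' : i ≤ n := by simpa [Nat.lt_succ_iff] using hi
        simp only [one_mul]
        rw [he.q_orth i hi' _ (degree_derivative_lt_of_lt_succ (hs.deg_v i)), he.q_left i hi']
        ring
    rw [h1, abs_neg, abs_mul]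
    have h2 := mul_le_mul (he.bq n le_rfl _ (right_mem_Icc.2 hlast.le)) hend (abs_nonneg _) hδ
    have h3 : 0 ≤ δ * (D * pn n) := by have := hpn0 n; positivity
    nlinarith [mul_nonneg (sub_nonneg.2 hK) h3]
  -- Orthogonality does not remove the term with variable `a`. It is estimated directly, since v'
  -- and the jumps of v are controlled by p.
  have hz : |aform x n a z v| ≤ (∑ i ∈ Finset.range (n + 1), 2 * K * D * δ * pn i) +
      K * D * δ * pn n := by
    rw [aform]
    refine (abs_sub _ _).trans (add_le_add ((Finset.abs_sum_le_sum_abs _ _).trans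
      (Finset.sum_le_sum fun i hi => ?_)) ?_)
    · have hi' : i ≤ n := by simpa [Nat.lt_succ_iff] using hi
      have := he.cz i
      have h1 := abs_integral_sup_le (hx.lt i hi').le (f := fun t => a t * z i t)
        (g := fun t => (derivative (v i)).eval t) (by fun_prop) (by fun_prop)
        (B := K * δ) (by positivity) (fun t ht => by
          rw [abs_mul]; exact mul_le_mul (hc.ba t) (he.bz i hi' t ht) (abs_nonneg _) (by positivity))
      have h2 := mul_le_mul_of_nonneg_left (hs.deriv_le i hi')
        (show 0 ≤ K * δ * Real.sqrt (x (i + 1) - x i) by positivity)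
      have h3 : |a (x i) * z i (x i) * jmp x (ev v) i| ≤ K * δ * (D * pn i) := by
        rw [abs_mul, abs_mul]
        exact mul_le_mul (mul_le_mul (hc.ba _) (he.bz i hi' _ (hmem i hi')) (abs_nonneg _)
          (by positivity)) (hjmp i hi') (abs_nonneg _) (by positivity)
      refine (abs_add_le _ _).trans ?_
      simp only [hpn] at *
      linarith
    · rw [abs_mul, abs_mul]
      have h3 := mul_le_mul (mul_le_mul (hc.ba (x (n + 1))) (he.bz n le_rfl _
        (right_mem_Icc.2 hlast.le)) (abs_nonneg _) (by positivity)) hend (abs_nonneg _)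
        (by positivity)
      linarith
  -- The right Radau error vanishes at every right end, so the upwind flux contains only its right
  -- trace and the outflow term is zero.
  have hy : |bform x n b b1 c y v| ≤ ∑ i ∈ Finset.range (n + 1), (2 * K * D * δ * pn i +
      2 * K * δ * un i) := by
    rw [bform, he.y_right n le_rfl, mul_zero, zero_mul, add_zero]
    refine (Finset.abs_sum_le_sum_abs _ _).trans (Finset.sum_le_sum fun i hi => ?_)
    have hi' : i ≤ n := by simpa [Nat.lt_succ_iff] using hi
    have := he.cy i
    rw [he.prev_y hi', mul_zero, zero_add]
    have hyb : ∀ t ∈ Icc (x i) (x (i + 1)), |y i t| ≤ δ := fun t ht =>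
      (he.by' i hi' t ht).trans he.le
    have h1 := abs_integral_sup_le (hx.lt i hi').le (f := fun t => b t * y i t)
        (g := fun t => (derivative (v i)).eval t) (by fun_prop) (by fun_prop)
        (B := K * δ) (by positivity) (fun t ht => by
          rw [abs_mul]; exact mul_le_mul (hc.bb t) (hyb t ht) (abs_nonneg _) (by positivity))
    have h2 := mul_le_mul_of_nonneg_left (hs.deriv_le i hi')
        (show 0 ≤ K * δ * Real.sqrt (x (i + 1) - x i) by positivity)
    have h3 : |(b (x i) - |b (x i)|) / 2 * y i (x i) * jmp x (ev v) i| ≤ K * δ * (D * pn i) := by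
      rw [abs_mul, abs_mul]
      exact mul_le_mul (mul_le_mul ((abs_neg_part_le _).trans (hc.bb _)) (hyb _ (hmem i hi'))
        (abs_nonneg _) (by positivity)) (hjmp i hi') (abs_nonneg _) (by positivity)
    have h4 := abs_integral_sup_le (hx.lt i hi').le (f := fun t => (c t - b1 t) * y i t)
        (g := ev v i) (by fun_prop) (by fun_prop)
        (B := 2 * K * δ) (by positivity) (fun t ht => by
          rw [abs_mul]
          exact mul_le_mul ((abs_sub _ _).trans (by linarith [hc.bc t, hc.bb1 t])) (hyb t ht)
            (abs_nonneg _) (by positivity))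
    have h5 := mul_le_mul_of_nonneg_left (hs.l2_v i hi')
        (show 0 ≤ 2 * K * δ * Real.sqrt (x (i + 1) - x i) by positivity)
    have h6 := abs_sub_add_add_le (∫ t in x i..x (i + 1), b t * y i t *
      (derivative (v i)).eval t) ((b (x i) - |b (x i)|) / 2 * y i (x i) * jmp x (ev v) i)
      (∫ t in x i..x (i + 1), (c t - b1 t) * y i t * (v i).eval t) 0
    rw [add_zero, abs_zero, add_zero] at h6
    refine h6.trans ?_
    simp only [hpn, hun, ev] at *
    linarith
  rw [Finset.sum_add_distrib, ← Finset.mul_sum, ← Finset.mul_sum] at hy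
  rw [← Finset.mul_sum] at hz
  set SP := Real.sqrt (∑ i ∈ Finset.range (n + 1), l2 (x i) (x (i + 1)) (ev p i) ^ 2)
  set SU := Real.sqrt (∑ i ∈ Finset.range (n + 1), l2 (x i) (x (i + 1)) (ev u i) ^ 2)
  have hSU : 0 ≤ SU := Real.sqrt_nonneg _
  have c1 : 0 ≤ K * D * δ := by positivity
  have c2 : 0 ≤ K * δ := by positivity
  have c3 : K * δ * SU ≤ K * D * δ * SU := by
    have := mul_nonneg c2 hSU
    nlinarith
  have e1 := mul_le_mul_of_nonneg_left hsp c1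
  have e2 := mul_le_mul_of_nonneg_left hsu c2
  have e3 := mul_le_mul_of_nonneg_left hpnn c1
  have e4 : 0 ≤ K * D * δ * SP := mul_nonneg c1 (Real.sqrt_nonneg _)
  have e5 : 0 ≤ K * D * δ * SU := mul_nonneg c1 hSU
  have h1 := abs_add_le (-aform x n (fun _ => 1) q v + aform x n a z v) (bform x n b b1 c y v)
  have h2 := abs_add_le (-aform x n (fun _ => 1) q v) (aform x n a z v)
  rw [abs_neg] at h2
  simp only [hpn, hun] at *
  linarith

end

/-! ### The residual of the third equation tested with the component w. -/

section

variable {x : ℕ → ℝ} {n k : ℕ} {u p v w : ℕ → ℝ[X]} {a a1 b b1 c : ℝ → ℝ} {α γ K D ε : ℝ}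
  {f U P P1 Q1 : ℝ → ℝ}

lemma IsSplit.aform_w (hs : IsSplit x n k D u p v w) (y : ℕ → ℝ → ℝ) :
    aform x n a y w = (∫ t in x n..x (n + 1), a t * y n t * (derivative (w n)).eval t)
      + a (x n) * y n (x n) * (w n).eval (x n)
      - a (x (n + 1)) * y n (x (n + 1)) * (w n).eval (x (n + 1)) := by
  rw [aform, Finset.sum_range_succ, Finset.sum_eq_zero, zero_add, hs.jmp_w]
  intro i hi
  have hi' : i < n := Finset.mem_range.1 hi
  rw [jmp, hs.prev_w hi'.le]
  simp [ev, hs.w_zero i hi'.ne]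

/-- Testing the errors of p and q with w' would cost an inverse power of the width. Instead,
consistency trades the exact p and q for f - b u' - c u; the projection of q disappears because its
derivative has degree less than k, and that of p is integrated by parts. -/
lemma IsSplit.third_w_eq (hx : IsMesh x n) (hc : IsCoeff a a1 b b1 c α γ K)
    (he : IsExact ε a a1 b c f U P P1 Q1) (hs : IsSplit x n k D u p v w)
    {πp πq : ℕ → ℝ[X]} (hq : (πq n).degree < ((k + 1 : ℕ) : WithBot ℕ)) (y : ℕ → ℝ → ℝ) :
    -aform x n (fun _ => 1) (fun i t => ε * P1 t - (πq i).eval t) w +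
      aform x n a (fun i t => P t - (πp i).eval t) w + bform x n b b1 c y w =
    (∫ t in x n..x (n + 1), (f t - (b t * P t + c t * U t)) * (w n).eval t) +
    (∫ t in x n..x (n + 1), (a1 t * (πp n).eval t + a t * (derivative (πp n)).eval t) *
      (w n).eval t) + bform x n b b1 c y w := by
  have hca := hc.ca
  have hca1 := hc.ca1
  have hcb := hc.cb
  have hcc := hc.cc
  have hcU := he.cu
  have hcP := he.cp
  have hcP1 := he.cp1
  have hcf := he.cf
  have hlt := hx.lt n le_rfl
  have h1 := he.consistent_third hx hc w
  rw [he.bform_eq hx hc] at h1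
  have hsum : ∀ g : ℝ → ℝ, ∑ i ∈ Finset.range (n + 1), ∫ t in x i..x (i + 1),
      g t * (w i).eval t = ∫ t in x n..x (n + 1), g t * (w n).eval t := by
    intro g
    rw [Finset.sum_range_succ, Finset.sum_eq_zero, zero_add]
    intro i hi
    simp [hs.w_zero i (Finset.mem_range.1 hi).ne]
  rw [hsum, hsum] at h1
  have h2 : aform x n (fun _ => 1) (fun i t => ε * P1 t - (πq i).eval t) w =
      aform x n (fun _ => 1) (fun _ t => ε * P1 t) w +
        (-1) * aform x n (fun _ => 1) (ev πq) w := by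
    rw [← aform_add_left continuous_const (fun i => by fun_prop) (fun i => by fun_prop)]
    congr 1; funext i t; simp only [ev]; ring
  have h3 : aform x n a (fun i t => P t - (πp i).eval t) w =
      aform x n a (fun _ => P) w + (-1) * aform x n a (ev πp) w := by
    rw [← aform_add_left hca (fun i => by fun_prop) (fun i => by fun_prop)]
    congr 1; funext i t; simp only [ev]; ring
  have h4 : aform x n (fun _ => 1) (ev πq) w = 0 := by
    rw [hs.aform_w]
    have e1 := integral_by_parts_one hlt.le (πq n) (w n)
    have e2 := hs.w_orth _ (degree_derivative_lt_of_lt_succ hq)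
    have e3 : ∫ t in x n..x (n + 1), (derivative (πq n)).eval t * (w n).eval t =
      ∫ t in x n..x (n + 1), (w n).eval t * (derivative (πq n)).eval t := by
      congr 1; funext t; ring
    simp only [one_mul, ev] at *
    linarith
  have h5 : aform x n a (ev πp) w = -∫ t in x n..x (n + 1),
      (a1 t * (πp n).eval t + a t * (derivative (πp n)).eval t) * (w n).eval t := by
    rw [hs.aform_w]
    have e1 := integral_by_parts hlt.le hca hca1
      (fun t ht => hc.da t (Ioo_subset_of_mesh hx le_rfl ht)) (πp n) (w n)
    simp only [ev] at *
    linarith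
  have h6 : ∫ t in x n..x (n + 1), (f t - (b t * P t + c t * U t)) * (w n).eval t =
      1 * (∫ t in x n..x (n + 1), f t * (w n).eval t) +
      (-1) * ∫ t in x n..x (n + 1), (b t * P t + c t * U t) * (w n).eval t :=
    integral_lin2 _ _ (by fun_prop) (by fun_prop) (fun t => by ring)
  rw [h2, h3, h4, h5, h6]
  linarith

/-- Any polynomial of degree less than k may be subtracted from g, since w is orthogonal to it. -/
lemma IsSplit.abs_integral_mul_w_le (hx : IsMesh x n) (hs : IsSplit x n k D u p v w)
    {g : ℝ → ℝ} (hg : Continuous g) {χ : ℝ[X]} (hχ : χ.degree < k) {B : ℝ} (hB : 0 ≤ B)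
    (hgχ : ∀ t ∈ Icc (x n) (x (n + 1)), |g t - χ.eval t| ≤ B) :
    |∫ t in x n..x (n + 1), g t * (w n).eval t| ≤
      B * Real.sqrt (x (n + 1) - x n) * l2 (x n) (x (n + 1)) (ev w n) := by
  have h1 := abs_integral_sup_le (hx.lt n le_rfl).le (f := fun t => g t - χ.eval t) (g := ev w n)
    (by fun_prop) (by fun_prop) hB hgχ
  have h2 : ∫ t in x n..x (n + 1), (g t - χ.eval t) * ev w n t =
      1 * (∫ t in x n..x (n + 1), g t * (w n).eval t) +
      (-1) * ∫ t in x n..x (n + 1), (w n).eval t * χ.eval t :=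
    integral_lin2 _ _ (by fun_prop) (by fun_prop) (fun t => by simp only [ev]; ring)
  rw [h2, hs.w_orth χ hχ] at h1
  simpa using h1

lemma IsSplit.sqrt_mul_w_le (hx : IsMesh x n) (hs : IsSplit x n k D u p v w) {t : ℝ}
    (ht : t ∈ Icc (x n) (x (n + 1))) :
    |(w n).eval t| ≤
      invK (k + 1) * l2 (x n) (x (n + 1)) (ev w n) / Real.sqrt (x (n + 1) - x n) := by
  have hpos : 0 < x (n + 1) - x n := by linarith [hx.lt n le_rfl]
  rw [le_div_iff₀ (Real.sqrt_pos.2 hpos), mul_comm]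
  exact sqrt_mul_abs_eval_le (hs.deg_w n) (hx.lt n le_rfl) ht

lemma IsSplit.l2_w_deriv_le (hx : IsMesh x n) (hs : IsSplit x n k D u p v w) :
    Real.sqrt (x (n + 1) - x n) * l2 (x n) (x (n + 1)) (fun t => (derivative (w n)).eval t) ≤
      invK (k + 1) * l2 (x n) (x (n + 1)) (ev w n) / Real.sqrt (x (n + 1) - x n) := by
  have hpos : 0 < x (n + 1) - x n := by linarith [hx.lt n le_rfl]
  rw [le_div_iff₀ (Real.sqrt_pos.2 hpos), mul_right_comm, Real.mul_self_sqrt hpos.le]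
  exact LDG.l2_derivative_le (hs.deg_w n) (hx.lt n le_rfl)

/-- The derivative and the traces of w are available only through inverse estimates, hence the
division by the root of the width. The projection error of u is small enough to afford this. -/
lemma IsSplit.abs_bform_w_le (hx : IsMesh x n) (hc : IsCoeff a a1 b b1 c α γ K)
    (hs : IsSplit x n k D u p v w) {y : ℕ → ℝ → ℝ} (hyc : Continuous (y n))
    (hprev : prev x y n = 0) (hyR : y n (x (n + 1)) = 0) {β : ℝ} (hβ : 0 ≤ β)
    (hyβ : ∀ t ∈ Icc (x n) (x (n + 1)), |y n t| ≤ β) :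
    |bform x n b b1 c y w| ≤ 4 * K * invK (k + 1) * (β / Real.sqrt (x (n + 1) - x n)) *
      l2 (x n) (x (n + 1)) (ev w n) := by
  have hlt := hx.lt n le_rfl
  have hpos : 0 < x (n + 1) - x n := by linarith
  have hone : x (n + 1) - x n ≤ 1 := by
    linarith [(hx.mem (i := n) (by omega)).1, (hx.mem (i := n + 1) le_rfl).2]
  have hcb := hc.cb
  have hcb1 := hc.cb1
  have hcc := hc.cc
  have hK := hc.one_le
  have hI := one_le_invK (k + 1)
  set s := Real.sqrt (x (n + 1) - x n) with hsd
  have hs0 : 0 < s := Real.sqrt_pos.2 hpos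
  have hs1 : s ≤ 1 := Real.sqrt_le_one.2 hone
  set W := l2 (x n) (x (n + 1)) (ev w n) with hW
  have hW0 : 0 ≤ W := l2_nonneg _ _ _
  rw [hs.bform_w_right, hprev, hyR, mul_zero, zero_add, mul_zero, zero_mul, add_zero]
  have h1 := abs_integral_sup_le hlt.le (f := fun t => b t * y n t)
    (g := fun t => (derivative (w n)).eval t) (by fun_prop) (by fun_prop)
    (B := K * β) (by positivity) (fun t ht => by
      rw [abs_mul]; exact mul_le_mul (hc.bb t) (hyβ t ht) (abs_nonneg _) (by positivity))
  have h2 := mul_le_mul_of_nonneg_left (hs.l2_w_deriv_le hx) (show 0 ≤ K * β by positivity)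
  have h3 : |(b (x n) - |b (x n)|) / 2 * y n (x n) * (w n).eval (x n)| ≤
      K * β * (invK (k + 1) * W / s) := by
    rw [abs_mul, abs_mul]
    exact mul_le_mul (mul_le_mul ((abs_neg_part_le _).trans (hc.bb _))
      (hyβ _ (left_mem_Icc.2 hlt.le)) (abs_nonneg _) (by positivity))
      (hs.sqrt_mul_w_le hx (left_mem_Icc.2 hlt.le)) (abs_nonneg _) (by positivity)
  have h4 := abs_integral_sup_le hlt.le (f := fun t => (c t - b1 t) * y n t)
        (g := ev w n) (by fun_prop) (by fun_prop)
        (B := 2 * K * β) (by positivity) (fun t ht => by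
          rw [abs_mul]
          exact mul_le_mul ((abs_sub _ _).trans (by linarith [hc.bc t, hc.bb1 t])) (hyβ t ht)
            (abs_nonneg _) (by positivity))
  have h5 : s * W ≤ invK (k + 1) * W / s := by
    rw [le_div_iff₀ hs0]
    have : s * s ≤ 1 := by nlinarith
    nlinarith [mul_nonneg (sub_nonneg.2 hI) hW0, mul_nonneg (sub_nonneg.2 this) hW0]
  have h6 := mul_le_mul_of_nonneg_left h5 (show 0 ≤ 2 * K * β by positivity)
  have h7 := abs_sub_add_add_le (∫ t in x n..x (n + 1), b t * y n t *
      (derivative (w n)).eval t) ((b (x n) - |b (x n)|) / 2 * y n (x n) * (w n).eval (x n))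
      (∫ t in x n..x (n + 1), (c t - b1 t) * y n t * (w n).eval t) 0
  rw [add_zero, abs_zero, add_zero] at h7
  refine h7.trans ?_
  have h8 : 4 * K * invK (k + 1) * (β / s) * W = 4 * (K * β * (invK (k + 1) * W / s)) := by ring
  rw [h8]
  simp only [ev] at *
  linarith

/-- The remainder of the diffusion term for a smooth enough second component. -/
lemma IsSplit.abs_diffusion_w_le (hx : IsMesh x n) (hc : IsCoeff a a1 b b1 c α γ K)
    (he : IsExact ε a a1 b c f U P P1 Q1) (hs : IsSplit x n k D u p v w) {π χ : ℝ[X]}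
    (hπ : π.degree < ((k + 1 : ℕ) : WithBot ℕ)) (hχ : χ.degree < k) {B β : ℝ} (hB : 0 ≤ B)
    (hβ : 0 ≤ β)
    (hB' : ∀ t ∈ Icc (x n) (x (n + 1)), |a1 t * P t + (a t - a (x n)) * P1 t - χ.eval t| ≤ B)
    (hβ' : ∀ t ∈ Icc (x n) (x (n + 1)), |P t - π.eval t| ≤ β) :
    |∫ t in x n..x (n + 1), (a1 t * π.eval t + a t * (derivative π).eval t) * (w n).eval t| ≤
      (B + 2 * K * invK (k + 1) * β) * Real.sqrt (x (n + 1) - x n) *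
        l2 (x n) (x (n + 1)) (ev w n) := by
  have hlt := hx.lt n le_rfl
  have hpos : 0 < x (n + 1) - x n := by linarith
  have hca := hc.ca
  have hca1 := hc.ca1
  have hcP := he.cp
  have hcP1 := he.cp1
  have hK := hc.one_le
  set s := Real.sqrt (x (n + 1) - x n) with hsd
  have hs0 : 0 < s := Real.sqrt_pos.2 hpos
  have hss : s * s = x (n + 1) - x n := Real.mul_self_sqrt hpos.le
  set W := l2 (x n) (x (n + 1)) (ev w n) with hW
  have hW0 : 0 ≤ W := l2_nonneg _ _ _
  have hdelta : ∀ t ∈ Icc (x n) (x (n + 1)), |a t - a (x n)| ≤ K * (x (n + 1) - x n) :=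
    fun t ht => abs_sub_left_le hx hca hca1 hc.ba1 hc.da le_rfl ht
  have hKh : 0 ≤ K * (x (n + 1) - x n) := by positivity
  have h1 := hs.abs_integral_mul_w_le hx (g := fun t => a1 t * P t + (a t - a (x n)) * P1 t)
    (by fun_prop) hχ hB hB'
  have h2 := integral_by_parts_fun hlt.le (g := fun t => (a t - a (x n)) * P t)
    (g1 := fun t => a1 t * P t + (a t - a (x n)) * P1 t) (by fun_prop) (by fun_prop)
    (fun t ht => ((hc.da t (Ioo_subset_of_mesh hx le_rfl ht)).sub_const _).mul
      (he.dp t (Ioo_subset_of_mesh hx le_rfl ht))) (w n)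
  have h3 := integral_by_parts hlt.le (g := fun t => a t - a (x n)) (by fun_prop) hca1
    (fun t ht => (hc.da t (Ioo_subset_of_mesh hx le_rfl ht)).sub_const _) π (w n)
  have h4 : ∫ t in x n..x (n + 1), (a1 t * π.eval t + (a t - a (x n)) * (derivative π).eval t) *
      (w n).eval t =
      1 * (∫ t in x n..x (n + 1), (a1 t * π.eval t + a t * (derivative π).eval t) * (w n).eval t) +
      (-a (x n)) * ∫ t in x n..x (n + 1), (w n).eval t * (derivative π).eval t :=
    integral_lin2 _ _ (by fun_prop) (by fun_prop) (fun t => by ring)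
  rw [hs.w_orth _ (degree_derivative_lt_of_lt_succ hπ)] at h4
  have h5 : ∫ t in x n..x (n + 1), (a t - a (x n)) * (P t - π.eval t) *
      (derivative (w n)).eval t =
      1 * (∫ t in x n..x (n + 1), (a t - a (x n)) * P t * (derivative (w n)).eval t) +
      (-1) * ∫ t in x n..x (n + 1), (a t - a (x n)) * π.eval t * (derivative (w n)).eval t :=
    integral_lin2 _ _ (by fun_prop) (by fun_prop) (fun t => by ring)
  -- The part a(x_n) π' is orthogonal to w, so the coefficient may be replaced by a - a(x_n). Then π
  -- is exchanged for P: the part with P returns to a function that χ approximates, and P - π is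
  -- multiplied by a - a(x_n) = O(h), which compensates the inverse estimates for w' and for the
  -- trace of w.
  have h6 : ∫ t in x n..x (n + 1), (a1 t * π.eval t + a t * (derivative π).eval t) *
      (w n).eval t =
      (∫ t in x n..x (n + 1), (a1 t * P t + (a t - a (x n)) * P1 t) * (w n).eval t) +
      (∫ t in x n..x (n + 1), (a t - a (x n)) * (P t - π.eval t) * (derivative (w n)).eval t) -
      (a (x (n + 1)) - a (x n)) * (P (x (n + 1)) - π.eval (x (n + 1))) *
        (w n).eval (x (n + 1)) := by
    rw [h5]
    linear_combination h3 - h4 - h2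
  have hb : ∀ t ∈ Icc (x n) (x (n + 1)), |(a t - a (x n)) * (P t - π.eval t)| ≤
      K * (x (n + 1) - x n) * β := fun t ht => by
    rw [abs_mul]; exact mul_le_mul (hdelta t ht) (hβ' t ht) (abs_nonneg _) hKh
  have h7 := abs_integral_sup_le hlt.le (f := fun t => (a t - a (x n)) * (P t - π.eval t))
    (g := fun t => (derivative (w n)).eval t) (by fun_prop) (by fun_prop)
    (B := K * (x (n + 1) - x n) * β) (by positivity) hb
  have h8 := mul_le_mul_of_nonneg_left (hs.l2_w_deriv_le hx)
    (show 0 ≤ K * (x (n + 1) - x n) * β by positivity)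
  have h9 : |(a (x (n + 1)) - a (x n)) * (P (x (n + 1)) - π.eval (x (n + 1))) *
        (w n).eval (x (n + 1))| ≤ K * (x (n + 1) - x n) * β * (invK (k + 1) * W / s) := by
    rw [abs_mul]
    exact mul_le_mul (hb _ (right_mem_Icc.2 hlt.le)) (hs.sqrt_mul_w_le hx (right_mem_Icc.2 hlt.le))
      (abs_nonneg _) (by positivity)
  have h10 : K * (x (n + 1) - x n) * β * (invK (k + 1) * W / s) =
      K * invK (k + 1) * β * s * W := by
    rw [← hss]; field_simp
  rw [h10] at h8 h9
  rw [h6]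
  have h11 := abs_sub (((∫ t in x n..x (n + 1), (a1 t * P t + (a t - a (x n)) * P1 t) *
      (w n).eval t) +
      (∫ t in x n..x (n + 1), (a t - a (x n)) * (P t - π.eval t) * (derivative (w n)).eval t)))
      ((a (x (n + 1)) - a (x n)) * (P (x (n + 1)) - π.eval (x (n + 1))) *
        (w n).eval (x (n + 1)))
  have h12 := abs_add_le (∫ t in x n..x (n + 1), (a1 t * P t + (a t - a (x n)) * P1 t) *
      (w n).eval t)
      (∫ t in x n..x (n + 1), (a t - a (x n)) * (P t - π.eval t) * (derivative (w n)).eval t)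
  linarith

/-- A crude bound of the diffusion term. -/
lemma IsSplit.abs_diffusion_w_le' (hx : IsMesh x n) (hc : IsCoeff a a1 b b1 c α γ K)
    (hs : IsSplit x n k D u p v w) {π : ℝ[X]}
    (hπ : π.degree < ((k + 1 : ℕ) : WithBot ℕ)) {S : ℝ} (hS : 0 ≤ S)
    (hS' : ∀ t ∈ Icc (x n) (x (n + 1)), |π.eval t| ≤ S) :
    |∫ t in x n..x (n + 1), (a1 t * π.eval t + a t * (derivative π).eval t) * (w n).eval t| ≤
      2 * K * invK (k + 1) * S * Real.sqrt (x (n + 1) - x n) *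
        l2 (x n) (x (n + 1)) (ev w n) := by
  have hlt := hx.lt n le_rfl
  have hpos : 0 < x (n + 1) - x n := by linarith
  have hca := hc.ca
  have hca1 := hc.ca1
  have hK := hc.one_le
  have hI := one_le_invK (k + 1)
  set W := l2 (x n) (x (n + 1)) (ev w n) with hW
  have hW0 : 0 ≤ W := l2_nonneg _ _ _
  have hdelta : ∀ t ∈ Icc (x n) (x (n + 1)), |a t - a (x n)| ≤ K * (x (n + 1) - x n) :=
    fun t ht => abs_sub_left_le hx hca hca1 hc.ba1 hc.da le_rfl ht
  have hKh : 0 ≤ K * (x (n + 1) - x n) := by positivity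
  -- Again the frozen part a(x_n) π' is separated, to vanish by orthogonality; the factor a - a(x_n)
  -- pays for the inverse estimate of π'.
  have h4 : ∫ t in x n..x (n + 1), (a1 t * π.eval t + a t * (derivative π).eval t) *
      (w n).eval t =
      1 * (∫ t in x n..x (n + 1), a1 t * π.eval t * (w n).eval t) +
      1 * (∫ t in x n..x (n + 1), (a t - a (x n)) * (derivative π).eval t * (w n).eval t) +
      a (x n) * ∫ t in x n..x (n + 1), (w n).eval t * (derivative π).eval t :=
    integral_lin3 _ _ _ (by fun_prop) (by fun_prop) (by fun_prop) (fun t => by ring)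
  rw [hs.w_orth _ (degree_derivative_lt_of_lt_succ hπ)] at h4
  have h5 := abs_integral_weight_le hlt.le (w := a1) (f := fun t => π.eval t) (g := ev w n)
    hca1 (by fun_prop) (by fun_prop) (by positivity) (fun t _ => hc.ba1 t)
  have h6 := abs_integral_weight_le hlt.le (w := fun t => a t - a (x n))
    (f := fun t => (derivative π).eval t) (g := ev w n)
    (by fun_prop) (by fun_prop) (by fun_prop) hKh hdelta
  have h7 := LDG.l2_derivative_le hπ hlt
  have h8 := l2_le_of_abs_le hlt.le (f := fun t => π.eval t) (by fun_prop) hS hS'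
  set Y := l2 (x n) (x (n + 1)) (fun t => π.eval t)
  have hY0 : 0 ≤ Y := l2_nonneg _ _ _
  have h9 : K * (x (n + 1) - x n) * l2 (x n) (x (n + 1)) (fun t => (derivative π).eval t) ≤
      K * (invK (k + 1) * Y) := by
    rw [mul_assoc]; exact mul_le_mul_of_nonneg_left h7 (by positivity)
  have h10 := mul_le_mul_of_nonneg_right h9 hW0
  have h11 : K * Y * W ≤ K * (invK (k + 1) * Y) * W := by
    have : Y ≤ invK (k + 1) * Y := le_mul_of_one_le_left hY0 hI
    gcongr
  have h12 : K * (invK (k + 1) * Y) * W ≤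
      K * (invK (k + 1) * (S * Real.sqrt (x (n + 1) - x n))) * W := by
    have := invK_pos (k + 1)
    gcongr
  rw [h4, mul_zero, add_zero, one_mul, one_mul]
  refine (abs_add_le _ _).trans ?_
  simp only [ev] at *
  linarith

end

/-! ### Extension of functions from [0, 1], derivative bounds and Taylor approximation. -/

section

/-- Continuous extension of a function on `[0, 1]` by constants. -/
def ext (g : ℝ → ℝ) (t : ℝ) : ℝ := g (max 0 (min t 1))

lemma clamp_mem (t : ℝ) : max 0 (min t 1) ∈ Icc (0 : ℝ) 1 :=
  ⟨le_max_left _ _, max_le zero_le_one (min_le_right _ _)⟩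

lemma ext_of_mem (g : ℝ → ℝ) {t : ℝ} (ht : t ∈ Icc (0 : ℝ) 1) : ext g t = g t := by
  rw [ext, min_eq_left ht.2, max_eq_right ht.1]

lemma continuous_ext {g : ℝ → ℝ} (hg : ContinuousOn g (Icc 0 1)) : Continuous (ext g) :=
  hg.comp_continuous (by fun_prop) clamp_mem

lemma hasDerivAt_ext {g g1 : ℝ → ℝ} {t : ℝ} (ht : t ∈ Ioo (0 : ℝ) 1)
    (hd : HasDerivWithinAt g (g1 t) (Icc 0 1) t) : HasDerivAt (ext g) (ext g1 t) t := by
  have hn : Icc (0 : ℝ) 1 ∈ nhds t := Icc_mem_nhds ht.1 ht.2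
  rw [ext_of_mem g1 (Ioo_subset_Icc_self ht)]
  refine (hd.hasDerivAt hn).congr_of_eventuallyEq ?_
  filter_upwards [hn] with y hy using ext_of_mem g hy

/-- `g` has `n` derivatives on `[l, r]`, the one of order `j` being bounded by `K ρ ^ j`. -/
def DerivBound (l r ρ : ℝ) : ℕ → ℝ → (ℝ → ℝ) → Prop
  | 0, K, g => Continuous g ∧ ∀ t ∈ Icc l r, |g t| ≤ K
  | n + 1, K, g => Continuous g ∧ (∀ t ∈ Icc l r, |g t| ≤ K) ∧
      ∃ g1 : ℝ → ℝ, (∀ t ∈ Ioo l r, HasDerivAt g (g1 t) t) ∧ DerivBound l r ρ n (K * ρ) g1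

namespace DerivBound
variable {l r ρ K K' : ℝ} {n : ℕ} {g h : ℝ → ℝ}

lemma continuous (hg : DerivBound l r ρ n K g) : Continuous g := by
  cases n <;> exact hg.1

lemma bound (hg : DerivBound l r ρ n K g) : ∀ t ∈ Icc l r, |g t| ≤ K := by
  cases n
  · exact hg.2
  · exact hg.2.1

lemma pred (hg : DerivBound l r ρ (n + 1) K g) : DerivBound l r ρ n K g := by
  induction n generalizing K g with
  | zero => exact ⟨hg.1, hg.2.1⟩
  | succ n ih =>
    obtain ⟨h1, h2, g1, h3, h4⟩ := hg
    exact ⟨h1, h2, g1, h3, ih h4⟩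

lemma mono {ρ' : ℝ} (hg : DerivBound l r ρ n K g) (hρ : 0 ≤ ρ) (hρρ : ρ ≤ ρ') (hK : 0 ≤ K)
    (hKK : K ≤ K') : DerivBound l r ρ' n K' g := by
  induction n generalizing K K' g with
  | zero => exact ⟨hg.1, fun t ht => (hg.2 t ht).trans hKK⟩
  | succ n ih =>
    obtain ⟨h1, h2, g1, h3, h4⟩ := hg
    exact ⟨h1, fun t ht => (h2 t ht).trans hKK, g1, h3,
      ih h4 (mul_nonneg hK hρ) (mul_le_mul hKK hρρ hρ (hK.trans hKK))⟩

lemma congr (hg : DerivBound l r ρ n K g) (hh : Continuous h) (hgh : ∀ t ∈ Icc l r, g t = h t) :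
    DerivBound l r ρ n K h := by
  have hb : ∀ t ∈ Icc l r, |h t| ≤ K := fun t ht => by rw [← hgh t ht]; exact hg.bound t ht
  cases n with
  | zero => exact ⟨hh, hb⟩
  | succ n =>
    obtain ⟨h1, h2, g1, h3, h4⟩ := hg
    refine ⟨hh, hb, g1, fun t ht => (h3 t ht).congr_of_eventuallyEq ?_, h4⟩
    filter_upwards [Icc_mem_nhds ht.1 ht.2] with y hy using (hgh y hy).symm

lemma add (hg : DerivBound l r ρ n K g) (hh : DerivBound l r ρ n K' h) :
    DerivBound l r ρ n (K + K') (fun t => g t + h t) := by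
  induction n generalizing K K' g h with
  | zero =>
    exact ⟨hg.1.add hh.1, fun t ht => (abs_add_le _ _).trans (add_le_add (hg.2 t ht) (hh.2 t ht))⟩
  | succ n ih =>
    obtain ⟨h1, h2, g1, h3, h4⟩ := hg
    obtain ⟨e1, e2, g2, e3, e4⟩ := hh
    refine ⟨h1.add e1, fun t ht => (abs_add_le _ _).trans (add_le_add (h2 t ht) (e2 t ht)),
      fun t => g1 t + g2 t, fun t ht => (h3 t ht).add (e3 t ht), ?_⟩
    rw [add_mul]
    exact ih h4 e4

lemma neg (hg : DerivBound l r ρ n K g) : DerivBound l r ρ n K (fun t => -g t) := by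
  induction n generalizing K g with
  | zero => exact ⟨hg.1.neg, fun t ht => by rw [abs_neg]; exact hg.2 t ht⟩
  | succ n ih =>
    obtain ⟨h1, h2, g1, h3, h4⟩ := hg
    exact ⟨h1.neg, fun t ht => by rw [abs_neg]; exact h2 t ht, fun t => -g1 t,
      fun t ht => (h3 t ht).neg, ih h4⟩

/-- Each differentiation by the product rule doubles the number of terms, which gives 2 ^ n. -/
lemma mul (hg : DerivBound l r ρ n K g) (hh : DerivBound l r ρ n K' h) (hK : 0 ≤ K) (hK' : 0 ≤ K')
    (hρ : 0 ≤ ρ) :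
    DerivBound l r ρ n (2 ^ n * (K * K')) (fun t => g t * h t) := by
  have hb : ∀ t ∈ Icc l r, |g t * h t| ≤ 2 ^ n * (K * K') := fun t ht => by
    rw [abs_mul]
    refine (mul_le_mul (hg.bound t ht) (hh.bound t ht) (abs_nonneg _) hK).trans ?_
    exact le_mul_of_one_le_left (mul_nonneg hK hK') (one_le_pow₀ one_le_two)
  induction n generalizing K K' g h with
  | zero => exact ⟨hg.1.mul hh.1, hb⟩
  | succ n ih =>
    have hg' := hg
    have hh' := hh
    obtain ⟨h1, h2, g1, h3, h4⟩ := hg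
    obtain ⟨e1, e2, g2, e3, e4⟩ := hh
    refine ⟨h1.mul e1, hb, fun t => g1 t * h t + g t * g2 t,
      fun t ht => (h3 t ht).mul (e3 t ht), ?_⟩
    have hb' : ∀ {K K' : ℝ} {g h : ℝ → ℝ}, 0 ≤ K → 0 ≤ K' → (∀ t ∈ Icc l r, |g t| ≤ K) →
        (∀ t ∈ Icc l r, |h t| ≤ K') → ∀ t ∈ Icc l r, |g t * h t| ≤ 2 ^ n * (K * K') := by
      intro K K' g h hK hK' hg hh t ht
      rw [abs_mul]
      refine (mul_le_mul (hg t ht) (hh t ht) (abs_nonneg _) hK).trans ?_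
      exact le_mul_of_one_le_left (mul_nonneg hK hK') (one_le_pow₀ one_le_two)
    have a1 := ih h4 hh'.pred (mul_nonneg hK hρ) hK'
      (hb' (mul_nonneg hK hρ) hK' h4.bound hh'.bound)
    have a2 := ih hg'.pred e4 hK (mul_nonneg hK' hρ)
      (hb' hK (mul_nonneg hK' hρ) hg'.bound e4.bound)
    have := a1.add a2
    rwa [show 2 ^ n * (K * ρ * K') + 2 ^ n * (K * (K' * ρ)) = 2 ^ (n + 1) * (K * K') * ρ by ring]
      at this

/-- Taylor approximation. -/
lemma exists_approx (hlr : l ≤ r) (hg : DerivBound l r ρ n K g) :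
    ∃ χ : ℝ[X], χ.degree < n ∧ ∀ t ∈ Icc l r, |g t - χ.eval t| ≤ K * (ρ * (r - l)) ^ n := by
  induction n generalizing K g with
  | zero => exact ⟨0, by simp, fun t ht => by simpa using hg.2 t ht⟩
  | succ n ih =>
    obtain ⟨h1, h2, g1, h3, h4⟩ := hg
    obtain ⟨χ, hχ, hb⟩ := ih h4
    -- The approximation of the derivative is integrated from l, with the value at l matched; this
    -- gains the factor r - l.
    obtain ⟨q, hq1, hq2, hq3⟩ := exists_antiderivative l hχ
    refine ⟨q + C (g l), degree_add_lt' hq3 (degree_C_lt _ (by omega)), fun t ht => ?_⟩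
    have hc1 := h4.continuous
    have e1 : ∫ y in l..t, (g1 y - χ.eval y) = (g t - q.eval t) - (g l - q.eval l) :=
      integral_deriv_eq (F := fun y => g y - q.eval y) ht.1 (by fun_prop) (by fun_prop)
        (fun y hy => (h3 y ⟨hy.1, hy.2.trans_le ht.2⟩).sub (by rw [← hq1]; exact q.hasDerivAt y))
    have e2 := intervalIntegral.norm_integral_le_of_norm_le_const (a := l) (b := t)
      (f := fun y => g1 y - χ.eval y) (C := K * ρ * (ρ * (r - l)) ^ n) (fun y hy => by
        rw [uIoc_of_le ht.1] at hy
        exact hb y ⟨hy.1.le, hy.2.trans ht.2⟩)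
    rw [e1, hq2, Real.norm_eq_abs, abs_of_nonneg (sub_nonneg.2 ht.1)] at e2
    have e3 : g t - (q + C (g l)).eval t = g t - q.eval t - (g l - 0) := by simp; ring
    rw [e3]
    have e4 : 0 ≤ K * ρ * (ρ * (r - l)) ^ n := (abs_nonneg _).trans (hb l ⟨le_rfl, hlr⟩)
    calc _ ≤ _ := e2
      _ ≤ K * ρ * (ρ * (r - l)) ^ n * (r - l) :=
          mul_le_mul_of_nonneg_left (by linarith [ht.2]) e4
      _ = _ := by ring

/-- `DerivBound` asks for derivatives only in the open interval, where the one-sided derivatives are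
ordinary ones and the extension by constants plays no role. -/
lemma of_iteratedDerivWithin {m : ℕ} {N : ℕ} (hl : 0 ≤ l) (hr : r ≤ 1)
    (hg : ContDiffOn ℝ (N : WithTop ℕ∞) g (Icc 0 1)) (hmn : m + n ≤ N)
    (hb : ∀ j ≤ n, ∀ t ∈ Icc l r, |iteratedDerivWithin (m + j) g (Icc 0 1) t| ≤ K * ρ ^ j) :
    DerivBound l r ρ n K (ext (iteratedDerivWithin m g (Icc 0 1))) := by
  have hU : UniqueDiffOn ℝ (Icc (0 : ℝ) 1) := uniqueDiffOn_Icc zero_lt_one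
  have hsub : ∀ t ∈ Icc l r, t ∈ Icc (0 : ℝ) 1 := fun t ht => ⟨hl.trans ht.1, ht.2.trans hr⟩
  have hcont : Continuous (ext (iteratedDerivWithin m g (Icc 0 1))) :=
    continuous_ext (hg.continuousOn_iteratedDerivWithin (by exact_mod_cast (by omega : m ≤ N)) hU)
  have hb0 : ∀ t ∈ Icc l r, |ext (iteratedDerivWithin m g (Icc 0 1)) t| ≤ K := fun t ht => by
    rw [ext_of_mem _ (hsub t ht)]; simpa using hb 0 (Nat.zero_le _) t ht
  induction n generalizing K m with
  | zero => exact ⟨hcont, hb0⟩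
  | succ n ih =>
    refine ⟨hcont, hb0, ext (iteratedDerivWithin (m + 1) g (Icc 0 1)), fun t ht => ?_, ?_⟩
    · have ht' : t ∈ Ioo (0 : ℝ) 1 := ⟨hl.trans_lt ht.1, ht.2.trans_le hr⟩
      refine hasDerivAt_ext ht' ?_
      rw [iteratedDerivWithin_succ]
      exact ((hg.differentiableOn_iteratedDerivWithin (by exact_mod_cast (by omega : m < N)) hU) t
        (Ioo_subset_Icc_self ht')).hasDerivWithinAt
    · have hb1 : ∀ j ≤ n, ∀ t ∈ Icc l r,
          |iteratedDerivWithin (m + 1 + j) g (Icc 0 1) t| ≤ K * ρ * ρ ^ j := fun j hj t ht => by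
        have := hb (j + 1) (by omega) t ht
        rw [show m + (j + 1) = m + 1 + j by ring, pow_succ] at this
        linarith
      refine ih (by omega) hb1 (continuous_ext (hg.continuousOn_iteratedDerivWithin
        (by exact_mod_cast (by omega : m + 1 ≤ N)) hU)) fun t ht => ?_
      rw [ext_of_mem _ (hsub t ht)]; simpa using hb1 0 (Nat.zero_le _) t ht

end DerivBound

lemma exists_iteratedDerivWithin_bound {g : ℝ → ℝ} (hg : ContDiffOn ℝ ∞ g (Icc 0 1)) (N : ℕ) :
    ∃ K : ℝ, 1 ≤ K ∧ ∀ j ≤ N, ∀ t ∈ Icc (0 : ℝ) 1, |iteratedDerivWithin j g (Icc 0 1) t| ≤ K := by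
  have hU : UniqueDiffOn ℝ (Icc (0 : ℝ) 1) := uniqueDiffOn_Icc zero_lt_one
  induction N with
  | zero =>
    obtain ⟨K, hK⟩ := isCompact_Icc.exists_bound_of_continuousOn
      (hg.continuousOn_iteratedDerivWithin (m := 0) (by simp) hU)
    refine ⟨max 1 K, le_max_left _ _, fun j hj t ht => ?_⟩
    obtain rfl : j = 0 := by omega
    exact (hK t ht).trans (le_max_right _ _)
  | succ N ih =>
    obtain ⟨K, hK1, hK⟩ := ih
    obtain ⟨K', hK'⟩ := isCompact_Icc.exists_bound_of_continuousOn
      (hg.continuousOn_iteratedDerivWithin (m := N + 1) (by exact_mod_cast le_top) hU)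
    refine ⟨max K K', hK1.trans (le_max_left _ _), fun j hj t ht => ?_⟩
    rcases Nat.lt_or_ge j (N + 1) with h | h
    · exact (hK j (by omega) t ht).trans (le_max_left _ _)
    · obtain rfl : j = N + 1 := by omega
      exact (hK' t ht).trans (le_max_right _ _)

/-- Approximation of the sum of a smooth function and a layer function. -/
lemma exists_approx_of_layer {l r ε K₀ K₁ : ℝ} {m : ℕ} {g g0 g1 : ℝ → ℝ} (hlr : l ≤ r)
    (h0 : DerivBound l r 1 m K₀ g0) (h1 : DerivBound l r ε⁻¹ m K₁ g1)
    (hg : ∀ t ∈ Icc l r, g t = g0 t + g1 t) :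
    ∃ χ : ℝ[X], χ.degree < m ∧ ∀ t ∈ Icc l r,
      |g t - χ.eval t| ≤ K₀ * (r - l) ^ m + K₁ * min 1 ((r - l) / ε) ^ m := by
  obtain ⟨χ0, d0, e0⟩ := h0.exists_approx hlr
  have : ∃ χ : ℝ[X], χ.degree < m ∧ ∀ t ∈ Icc l r,
      |g1 t - χ.eval t| ≤ K₁ * min 1 ((r - l) / ε) ^ m := by
    -- On an element wider than ε a Taylor polynomial of the layer part is useless, and zero is the
    -- better approximation.
    rcases le_total 1 ((r - l) / ε) with h | h
    · refine ⟨0, by simp, fun t ht => ?_⟩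
      rw [min_eq_left h]; simpa using h1.bound t ht
    · rw [min_eq_right h, div_eq_inv_mul]
      exact h1.exists_approx hlr
  obtain ⟨χ1, d1, e1⟩ := this
  refine ⟨χ0 + χ1, degree_add_lt' d0 d1, fun t ht => ?_⟩
  have h2 : g t - (χ0 + χ1).eval t = (g0 t - χ0.eval t) + (g1 t - χ1.eval t) := by
    rw [hg t ht]; simp; ring
  rw [h2]
  have := e0 t ht
  rw [one_mul] at this
  exact (abs_add_le _ _).trans (add_le_add this (e1 t ht))

end

/-! ### The layer-adapted meshes. -/

section

/-- The factor `N⁻¹ ln N` or `N⁻¹` that governs the approximation of the layer. -/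
def layerRate (kind : MeshKind) (N : ℕ) : ℝ :=
  match kind with
  | .shishkin => (N : ℝ)⁻¹ * Real.log N
  | .bakhvalovShishkin | .bakhvalov => (N : ℝ)⁻¹

lemma log_nat_ge {N : ℕ} (hN : 2 ≤ N) : 1 / 2 ≤ Real.log N := by
  have h1 : Real.log 2 ≤ Real.log N := Real.log_le_log (by norm_num) (by exact_mod_cast hN)
  linarith [Real.log_two_gt_d9]

lemma inv_le_layerRate (kind : MeshKind) {N : ℕ} (hN : 2 ≤ N) :
    (N : ℝ)⁻¹ ≤ 2 * layerRate kind N := by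
  have h0 : (0 : ℝ) ≤ (N : ℝ)⁻¹ := by positivity
  cases kind <;> simp only [layerRate] <;> nlinarith [log_nat_ge hN]

lemma layerRate_pos (kind : MeshKind) {N : ℕ} (hN : 2 ≤ N) : 0 < layerRate kind N := by
  have h0 : (0 : ℝ) < (N : ℝ)⁻¹ := by
    have : (0 : ℝ) < N := by exact_mod_cast (by omega : 0 < N)
    positivity
  linarith [inv_le_layerRate kind hN]

/-- On the Bakhvalov-type meshes the term N^(-(k+1)) is absorbed by N^(-(k+1/2)). The factor 2 pays
for √(ln N), which is only known to be at least 1/2. -/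
lemma layerRate_sum_le_rate (kind : MeshKind) (k : ℕ) {N : ℕ} (hN : 2 ≤ N) {ε : ℝ} :
    Real.sqrt ε * layerRate kind N ^ k + layerRate kind N ^ (k + 1)
      + (N : ℝ) ^ (-((k : ℝ) + 1 / 2)) ≤ 2 * rate kind k N ε := by
  have hN1 : (1 : ℝ) ≤ N := by exact_mod_cast (by omega : 1 ≤ N)
  have hN0 : (0 : ℝ) < N := by linarith
  have hl := log_nat_ge hN
  have h0 : 0 ≤ (N : ℝ) ^ (-((k : ℝ) + 1 / 2)) := by positivity
  have h1 : ((N : ℝ)⁻¹) ^ (k + 1) ≤ (N : ℝ) ^ (-((k : ℝ) + 1 / 2)) := by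
    rw [← Real.rpow_natCast, ← Real.rpow_neg_one, ← Real.rpow_mul hN0.le]
    exact Real.rpow_le_rpow_of_exponent_le hN1 (by push_cast; linarith)
  have h2 : 1 / 2 ≤ Real.sqrt (Real.log N) := Real.le_sqrt_of_sq_le (by linarith)
  have h3 : 0 ≤ Real.sqrt ε * (N : ℝ)⁻¹ ^ k := by positivity
  cases kind
  · have h4 : 0 ≤ (N : ℝ)⁻¹ * Real.log N := by positivity
    have h5 : 0 ≤ Real.sqrt ε * ((N : ℝ)⁻¹ * Real.log N) ^ k := by positivity
    have h6 := pow_nonneg h4 (k + 1)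
    simp only [layerRate, rate]; linarith
  all_goals
    simp only [layerRate, rate]
    nlinarith

section Generator
variable {kind : MeshKind} {N k : ℕ} {ε σ α s t θ : ℝ}

lemma meshGen_zero : meshGen kind N ε 0 = 0 := by
  cases kind <;> simp [meshGen]

/-- The generators of the Bakhvalov-type meshes have a common form. -/
lemma meshGen_cases (kind : MeshKind) (hN : 2 ≤ N) (hε : 0 < ε) (hεN : ε ≤ (N : ℝ)⁻¹) :
    (kind = .shishkin ∧ ∀ t, meshGen kind N ε t = 2 * t * Real.log N) ∨
    (layerRate kind N = (N : ℝ)⁻¹ ∧ ∃ θ : ℝ, 0 < θ ∧ ε ≤ θ ∧ θ ≤ (N : ℝ)⁻¹ ∧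
      ∀ t, meshGen kind N ε t = -Real.log (1 - 2 * (1 - θ) * t)) := by
  have hN0 : (0 : ℝ) < N := by exact_mod_cast (by omega : 0 < N)
  cases kind
  · exact Or.inl ⟨rfl, fun _ => rfl⟩
  · exact Or.inr ⟨rfl, (N : ℝ)⁻¹, by positivity, hεN, le_rfl, fun _ => rfl⟩
  · exact Or.inr ⟨rfl, ε, hε, le_rfl, hεN, fun _ => rfl⟩

lemma bakhvalov_arg_ge (hθ : θ ≤ 1) (ht : t ≤ 1 / 2) : θ ≤ 1 - 2 * (1 - θ) * t := by
  nlinarith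

lemma inv_le_half (hN : 2 ≤ N) : (N : ℝ)⁻¹ ≤ 1 / 2 := by
  rw [one_div]
  exact inv_anti₀ (by norm_num) (by exact_mod_cast hN)

lemma meshGen_lt (hN : 2 ≤ N) (hε : 0 < ε) (hεN : ε ≤ (N : ℝ)⁻¹) (hst : s < t)
    (ht : t ≤ 1 / 2) : meshGen kind N ε s < meshGen kind N ε t := by
  rcases meshGen_cases kind hN hε hεN with ⟨-, h⟩ | ⟨-, θ, h1, h2, h3, h⟩
  · rw [h, h]; nlinarith [log_nat_ge hN]
  · have := inv_le_half hN
    have h4 := bakhvalov_arg_ge (θ := θ) (t := t) (by linarith) ht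
    rw [h, h]
    refine neg_lt_neg (Real.log_lt_log (by linarith) ?_)
    nlinarith

lemma log_le_meshGen_half (hN : 2 ≤ N) (hε : 0 < ε) (hεN : ε ≤ (N : ℝ)⁻¹) :
    Real.log N ≤ meshGen kind N ε (1 / 2) := by
  rcases meshGen_cases kind hN hε hεN with ⟨-, h⟩ | ⟨-, θ, h1, h2, h3, h⟩
  · rw [h]; linarith
  · rw [h, show 1 - 2 * (1 - θ) * (1 / 2) = θ by ring, le_neg, ← Real.log_inv]
    exact Real.log_le_log h1 h3

lemma log_sub_log_le {X Y : ℝ} (hX : 0 < X) (hY : 0 < Y) :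
    Real.log X - Real.log Y ≤ (X - Y) / Y := by
  rw [← Real.log_div hX.ne' hY.ne']
  refine (Real.log_le_sub_one_of_pos (by positivity)).trans_eq ?_
  field_simp

/-- On the S-mesh this is ε ln N ≤ 1. On the others the argument of the logarithm stays above θ ≥ ε,
so the increment of the logarithm is at most 2 N⁻¹ / θ. -/
lemma meshGen_step_le (hN : 2 ≤ N) (hε : 0 < ε) (hεN : ε ≤ (N : ℝ)⁻¹)
    (ht : s + (N : ℝ)⁻¹ ≤ 1 / 2) :
    ε * (meshGen kind N ε (s + (N : ℝ)⁻¹) - meshGen kind N ε s) ≤ 2 * (N : ℝ)⁻¹ := by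
  have hN0 : (0 : ℝ) < N := by exact_mod_cast (by omega : 0 < N)
  have hi : 0 < (N : ℝ)⁻¹ := by positivity
  rcases meshGen_cases kind hN hε hεN with ⟨-, h⟩ | ⟨-, θ, h1, h2, h3, h⟩
  · rw [h, h]
    have h4 : ε * Real.log N ≤ 1 := by
      calc ε * Real.log N ≤ (N : ℝ)⁻¹ * N := by
            refine mul_le_mul hεN (Real.log_le_self hN0.le) (by linarith [log_nat_ge hN]) hi.le
        _ = 1 := by field_simp
    nlinarith
  · have hh := inv_le_half hN
    rw [h, h]
    have h4 := bakhvalov_arg_ge (θ := θ) (by linarith) ht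
    have h5 := bakhvalov_arg_ge (θ := θ) (t := s) (by linarith) (by linarith)
    set X := 1 - 2 * (1 - θ) * s with hX
    set Y := 1 - 2 * (1 - θ) * (s + (N : ℝ)⁻¹) with hY
    have h6 := log_sub_log_le (X := X) (Y := Y) (by linarith) (by linarith)
    have h7 : X - Y ≤ 2 * (N : ℝ)⁻¹ := by rw [hX, hY]; nlinarith
    have h8 : (X - Y) / Y ≤ 2 * (N : ℝ)⁻¹ / θ := by gcongr
    calc ε * (-Real.log Y - -Real.log X) ≤ ε * (2 * (N : ℝ)⁻¹ / θ) :=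
          mul_le_mul_of_nonneg_left (by linarith) hε.le
      _ = ε / θ * (2 * (N : ℝ)⁻¹) := by ring
      _ ≤ 1 * (2 * (N : ℝ)⁻¹) := by
          refine mul_le_mul_of_nonneg_right ?_ (by positivity)
          rwa [div_le_one h1]
      _ = _ := one_mul _

/-- On the S-mesh the width divided by ε is already of order N⁻¹ ln N, and the exponential is
dropped. On the Bakhvalov-type meshes the exponential is X^σ ≤ X^(k+1), with X the argument of the
logarithm at s, and the relative width is a multiple of ln(X / Y), with Y the next argument. It
remains to show that the minimum of 1 and this width, times X, is of order N⁻¹. -/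
lemma meshGen_layer_le (hN : 2 ≤ N) (hε : 0 < ε) (hεN : ε ≤ (N : ℝ)⁻¹) (hα : 0 < α)
    (hσ : (k : ℝ) + 1 ≤ σ) (hs : 0 ≤ s) (ht : s + (N : ℝ)⁻¹ ≤ 1 / 2) :
    min 1 (σ / α * (meshGen kind N ε (s + (N : ℝ)⁻¹) - meshGen kind N ε s)) ^ (k + 1)
      * Real.exp (-(σ * meshGen kind N ε s)) ≤ ((4 * (σ / α) + 4) * layerRate kind N) ^ (k + 1) := by
  have hN0 : (0 : ℝ) < N := by exact_mod_cast (by omega : 0 < N)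
  have hi : 0 < (N : ℝ)⁻¹ := by positivity
  have hσ0 : 0 < σ := by linarith [Nat.cast_nonneg (α := ℝ) k]
  have hr : 0 < σ / α := by positivity
  have hmono := meshGen_lt (kind := kind) hN hε hεN (lt_add_of_pos_right s hi) ht
  set d := σ / α * (meshGen kind N ε (s + (N : ℝ)⁻¹) - meshGen kind N ε s) with hd
  have hd0 : 0 ≤ d := mul_nonneg hr.le (by linarith)
  have hm0 : 0 ≤ min 1 d := le_min zero_le_one hd0
  have hρ := layerRate_pos kind hN
  have hnn : 0 ≤ meshGen kind N ε s := by
    rcases hs.eq_or_lt with h | h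
    · rw [← h, meshGen_zero]
    · rw [← meshGen_zero (kind := kind) (N := N) (ε := ε)]
      exact (meshGen_lt hN hε hεN h (by linarith)).le
  rcases meshGen_cases kind hN hε hεN with ⟨hk, h⟩ | ⟨hk, θ, h1, h2, h3, h⟩
  · have h4 : min 1 d ≤ (4 * (σ / α) + 4) * layerRate kind N := by
      refine (min_le_right _ _).trans ?_
      have e : d = 2 * (σ / α) * layerRate kind N := by
        rw [hd, h, h, hk, layerRate]; ring
      rw [e]
      exact mul_le_mul_of_nonneg_right (by linarith) hρ.le
    calc _ ≤ min 1 d ^ (k + 1) * 1 := by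
          refine mul_le_mul_of_nonneg_left ?_ (pow_nonneg hm0 _)
          rw [Real.exp_le_one_iff]
          linarith [mul_nonneg hσ0.le hnn]
      _ ≤ _ := by rw [mul_one]; exact pow_le_pow_left₀ hm0 h4 _
  · have hh := inv_le_half hN
    have h4 := bakhvalov_arg_ge (θ := θ) (by linarith) ht
    have h5 := bakhvalov_arg_ge (θ := θ) (t := s) (by linarith) (by linarith)
    set X := 1 - 2 * (1 - θ) * s with hX
    set Y := 1 - 2 * (1 - θ) * (s + (N : ℝ)⁻¹) with hY
    have hX0 : 0 < X := by linarith
    have hY0 : 0 < Y := by linarith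
    have hθ : 0 ≤ 1 - θ := by linarith
    have hX1 : X ≤ 1 := by rw [hX]; linarith [mul_nonneg hθ hs]
    have hexp : Real.exp (-(σ * meshGen kind N ε s)) ≤ X ^ (k + 1) := by
      rw [h, mul_neg, neg_neg, mul_comm, Real.exp_mul, Real.exp_log hX0, ← Real.rpow_natCast]
      exact Real.rpow_le_rpow_of_exponent_ge hX0 hX1 (by push_cast; exact hσ)
    have hde : d = σ / α * (Real.log X - Real.log Y) := by rw [hd, h, h]; ring
    have h6 := log_sub_log_le hX0 hY0
    have hXY : X - Y = 2 * ((1 - θ) * (N : ℝ)⁻¹) := by rw [hX, hY]; ring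
    have h7 : X - Y ≤ 2 * (N : ℝ)⁻¹ := by linarith [mul_pos h1 hi]
    have h70 : 0 ≤ X - Y := by linarith [mul_nonneg hθ hi.le]
    clear_value X Y
    have h8 : min 1 d * X ≤ (4 * (σ / α) + 4) * layerRate kind N := by
      rw [hk]
      -- If X - Y ≤ Y then X ≤ 2 Y, and ln(X / Y) ≤ (X - Y) / Y gives the bound. Otherwise X ≤ 2 (X
      -- - Y) ≤ 4 N⁻¹, and the minimum is estimated by 1.
      rcases le_total (X - Y) Y with h9 | h9
      · have h10 : (X - Y) / Y * X ≤ 2 * (X - Y) := by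
          rw [div_mul_eq_mul_div, div_le_iff₀ hY0]
          linarith [mul_nonneg h70 (sub_nonneg.2 h9)]
        calc min 1 d * X ≤ d * X := mul_le_mul_of_nonneg_right (min_le_right _ _) hX0.le
          _ = σ / α * ((Real.log X - Real.log Y) * X) := by rw [hde]; ring
          _ ≤ σ / α * (4 * (N : ℝ)⁻¹) := by
              refine mul_le_mul_of_nonneg_left ?_ hr.le
              have := mul_le_mul_of_nonneg_right h6 hX0.le
              linarith
          _ ≤ _ := by linarith
      · calc min 1 d * X ≤ 1 * X := mul_le_mul_of_nonneg_right (min_le_left _ _) hX0.le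
          _ ≤ 4 * (N : ℝ)⁻¹ := by linarith
          _ ≤ _ := by linarith [mul_pos hr hi]
    calc _ ≤ min 1 d ^ (k + 1) * X ^ (k + 1) :=
          mul_le_mul_of_nonneg_left hexp (pow_nonneg hm0 _)
      _ = (min 1 d * X) ^ (k + 1) := (mul_pow _ _ _).symm
      _ ≤ _ := pow_le_pow_left₀ (mul_nonneg hm0 hX0.le) h8 _

end Generator

/-- The parameters of a layer-adapted mesh with `N = n + 1` elements. -/
structure IsMeshData (kind : MeshKind) (n : ℕ) (σ α ε : ℝ) : Prop where
  even : Even (n + 1)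
  pos_ε : 0 < ε
  le_ε : ε ≤ ((n + 1 : ℕ) : ℝ)⁻¹
  pos_α : 0 < α
  pos_σ : 0 < σ
  tau_eq : tau kind (n + 1) σ α ε = σ * ε / α * meshGen kind (n + 1) ε (1 / 2)

namespace IsMeshData
variable {kind : MeshKind} {n k i : ℕ} {ε σ α : ℝ}

lemma two_le (h : IsMeshData kind n σ α ε) : 2 ≤ n + 1 := by
  obtain ⟨m, hm⟩ := h.even; omega

/-- At i = N / 2 the definition of the mesh uses the fine formula; the assumption on `tau` makes the
two formulas agree at the transition point. -/
lemma coarse (h : IsMeshData kind n σ α ε) (hi : 2 * i ≤ n + 1) :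
    meshPoint kind (n + 1) σ α ε i
      = 2 * (i : ℝ) / (n + 1 : ℕ) * (1 - tau kind (n + 1) σ α ε) := by
  rw [meshPoint]
  split_ifs with h1
  · rfl
  · obtain ⟨m, hm⟩ := h.even
    have h2 : n + 1 = 2 * i := by omega
    have hi0 : (i : ℝ) ≠ 0 := by
      have : i ≠ 0 := by omega
      exact_mod_cast this
    have h3 : ((n + 1 : ℕ) : ℝ) = 2 * i := by rw [h2]; push_cast; ring
    rw [h.tau_eq, h3, show 1 - (i : ℝ) / (2 * i) = 1 / 2 by field_simp; norm_num]
    field_simp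

lemma fine (hi : n + 1 ≤ 2 * i) :
    meshPoint kind (n + 1) σ α ε i
      = 1 - σ * ε / α * meshGen kind (n + 1) ε (1 - (i : ℝ) / (n + 1 : ℕ)) := by
  rw [meshPoint, if_neg (by omega)]

lemma tau_le (kind : MeshKind) (N : ℕ) (σ α ε : ℝ) : tau kind N σ α ε ≤ 1 / 2 := min_le_left _ _

lemma tau_nonneg (h : IsMeshData kind n σ α ε) : 0 ≤ tau kind (n + 1) σ α ε := by
  have h1 := log_le_meshGen_half (kind := kind) h.two_le h.pos_ε h.le_ε
  have h2 := log_nat_ge h.two_le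
  have := h.pos_ε; have := h.pos_α; have := h.pos_σ
  rw [h.tau_eq]
  exact mul_nonneg (by positivity) (by linarith)

/-- The argument of the generator at the right end of a fine element, and its increment. -/
lemma fine_arg (hi : i ≤ n) (hi2 : n + 1 ≤ 2 * i) :
    0 ≤ 1 - ((i + 1 : ℕ) : ℝ) / (n + 1 : ℕ) ∧
    1 - (i : ℝ) / (n + 1 : ℕ) = 1 - ((i + 1 : ℕ) : ℝ) / (n + 1 : ℕ) + ((n + 1 : ℕ) : ℝ)⁻¹ ∧
    1 - (i : ℝ) / (n + 1 : ℕ) ≤ 1 / 2 := by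
  have h0 : (0 : ℝ) < (n + 1 : ℕ) := by positivity
  refine ⟨?_, by push_cast; ring, ?_⟩
  · rw [sub_nonneg, div_le_one h0]
    exact_mod_cast (by omega : i + 1 ≤ n + 1)
  · rw [sub_le_comm, le_div_iff₀ h0]
    have : ((n + 1 : ℕ) : ℝ) ≤ 2 * i := by exact_mod_cast hi2
    linarith

lemma coarse_width (h : IsMeshData kind n σ α ε) (hi : 2 * (i + 1) ≤ n + 1) :
    meshPoint kind (n + 1) σ α ε (i + 1) - meshPoint kind (n + 1) σ α ε i
      = 2 * ((n + 1 : ℕ) : ℝ)⁻¹ * (1 - tau kind (n + 1) σ α ε) := by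
  rw [h.coarse hi, h.coarse (by omega)]; push_cast; ring

lemma fine_width (hi : i ≤ n) (hi2 : n + 1 ≤ 2 * i) :
    meshPoint kind (n + 1) σ α ε (i + 1) - meshPoint kind (n + 1) σ α ε i
      = σ * ε / α * (meshGen kind (n + 1) ε
          (1 - ((i + 1 : ℕ) : ℝ) / (n + 1 : ℕ) + ((n + 1 : ℕ) : ℝ)⁻¹)
        - meshGen kind (n + 1) ε (1 - ((i + 1 : ℕ) : ℝ) / (n + 1 : ℕ))) := by
  rw [fine hi2, fine (by omega), (fine_arg hi hi2).2.1]; ring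

/-- Since N is even, no element straddles the transition point. -/
lemma coarse_or_fine (h : IsMeshData kind n σ α ε) (i : ℕ) :
    2 * (i + 1) ≤ n + 1 ∨ n + 1 ≤ 2 * i := by
  obtain ⟨m, hm⟩ := h.even; omega

lemma isMesh (h : IsMeshData kind n σ α ε) : IsMesh (meshPoint kind (n + 1) σ α ε) n where
  zero := by rw [h.coarse (by omega)]; simp
  one := by
    have h0 : ((n + 1 : ℕ) : ℝ) ≠ 0 := by positivity
    rw [fine (by omega), div_self h0, sub_self, meshGen_zero]; simp
  lt i hi := by
    have h0 : (0 : ℝ) < (n + 1 : ℕ) := by positivity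
    rw [← sub_pos]
    rcases h.coarse_or_fine i with h1 | h1
    · rw [h.coarse_width h1]
      have := tau_le kind (n + 1) σ α ε
      exact mul_pos (by positivity) (by linarith)
    · obtain ⟨e1, e2, e3⟩ := fine_arg hi h1
      rw [fine_width hi h1]
      have := h.pos_ε; have := h.pos_α; have := h.pos_σ
      refine mul_pos (by positivity) (sub_pos.2 (meshGen_lt h.two_le h.pos_ε h.le_ε
        (lt_add_of_pos_right _ (by positivity)) (e2 ▸ e3)))

lemma width_le (h : IsMeshData kind n σ α ε) (hi : i ≤ n) :
    meshPoint kind (n + 1) σ α ε (i + 1) - meshPoint kind (n + 1) σ α ε i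
      ≤ (2 + 2 * (σ / α)) * ((n + 1 : ℕ) : ℝ)⁻¹ := by
  have h0 : (0 : ℝ) < ((n + 1 : ℕ) : ℝ)⁻¹ := by positivity
  have := h.pos_ε; have := h.pos_α; have := h.pos_σ
  have hr : 0 < σ / α := by positivity
  rcases h.coarse_or_fine i with h1 | h1
  · rw [h.coarse_width h1]
    nlinarith [h.tau_nonneg, mul_pos hr h0]
  · obtain ⟨e1, e2, e3⟩ := fine_arg hi h1
    rw [fine_width hi h1]
    have := meshGen_step_le (kind := kind) h.two_le h.pos_ε h.le_ε (e2 ▸ e3)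
    rw [show σ * ε / α = σ / α * ε by ring, mul_assoc]
    nlinarith [mul_le_mul_of_nonneg_left this hr.le]

/-- Fine elements are covered by `meshGen_layer_le`. On the coarse part the layer has decayed to
exp(-α τ / ε) = exp(-σ φ(1/2)), and φ(1/2) ≥ ln N turns this into at most N^(-(k+1)). -/
lemma layer_le (h : IsMeshData kind n σ α ε) (hσ : (k : ℝ) + 1 ≤ σ) (hi : i ≤ n) :
    min 1 ((meshPoint kind (n + 1) σ α ε (i + 1) - meshPoint kind (n + 1) σ α ε i) / ε) ^ (k + 1)
      * Real.exp (-(α * (1 - meshPoint kind (n + 1) σ α ε (i + 1))) / ε)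
      ≤ ((4 * (σ / α) + 4) * layerRate kind (n + 1)) ^ (k + 1) := by
  have h0 : (0 : ℝ) < ((n + 1 : ℕ) : ℝ)⁻¹ := by positivity
  have hε := h.pos_ε; have hα := h.pos_α; have hσ0 := h.pos_σ
  have hr : 0 < σ / α := by positivity
  have hρ := layerRate_pos kind h.two_le
  rcases h.coarse_or_fine i with h1 | h1
  · have hlt : 0 ≤ meshPoint kind (n + 1) σ α ε (i + 1) - meshPoint kind (n + 1) σ α ε i :=
      (sub_pos.2 (h.isMesh.lt i hi)).le
    have e1 : min 1 ((meshPoint kind (n + 1) σ α ε (i + 1) - meshPoint kind (n + 1) σ α ε i) / ε)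
        ^ (k + 1) ≤ 1 :=
      pow_le_one₀ (le_min zero_le_one (by positivity)) (min_le_left _ _)
    have e2 : meshPoint kind (n + 1) σ α ε (i + 1) ≤ 1 - tau kind (n + 1) σ α ε := by
      rw [h.coarse h1]
      have : 2 * ((i + 1 : ℕ) : ℝ) / (n + 1 : ℕ) ≤ 1 := by
        rw [div_le_one (by positivity)]; exact_mod_cast h1
      exact mul_le_of_le_one_left (by linarith [tau_le kind (n + 1) σ α ε]) this
    have e3 : Real.exp (-(α * (1 - meshPoint kind (n + 1) σ α ε (i + 1))) / ε)
        ≤ (((n + 1 : ℕ) : ℝ)⁻¹) ^ (k + 1) := by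
      have hN0 : (0 : ℝ) < (n + 1 : ℕ) := by positivity
      have e4 := log_le_meshGen_half (kind := kind) h.two_le h.pos_ε h.le_ε
      have e5 := log_nat_ge h.two_le
      rw [← Real.exp_log (pow_pos h0 (k + 1)), Real.exp_le_exp, Real.log_pow, Real.log_inv,
        neg_div, mul_neg, neg_le_neg_iff, le_div_iff₀ hε]
      rw [h.tau_eq] at e2
      calc ((k + 1 : ℕ) : ℝ) * Real.log ((n + 1 : ℕ) : ℝ) * ε
          ≤ σ * meshGen kind (n + 1) ε (1 / 2) * ε := by
            refine mul_le_mul_of_nonneg_right ?_ hε.le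
            exact mul_le_mul (by push_cast; exact hσ) e4 (by linarith) hσ0.le
        _ = α * (σ * ε / α * meshGen kind (n + 1) ε (1 / 2)) := by field_simp
        _ ≤ _ := mul_le_mul_of_nonneg_left (by linarith) hα.le
    calc _ ≤ 1 * (((n + 1 : ℕ) : ℝ)⁻¹) ^ (k + 1) :=
          mul_le_mul e1 e3 (Real.exp_pos _).le zero_le_one
      _ ≤ _ := by
          rw [one_mul]
          refine pow_le_pow_left₀ h0.le ?_ _
          have := inv_le_layerRate kind h.two_le
          nlinarith [mul_pos hr hρ]
  · obtain ⟨e1, e2, e3⟩ := fine_arg hi h1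
    have := meshGen_layer_le (kind := kind) (k := k) h.two_le hε h.le_ε hα hσ e1 (e2 ▸ e3)
    rw [fine_width hi h1, fine (i := i + 1) (by omega)]
    convert this using 3
    · congr 1; field_simp
    · field_simp; ring

/-- The last element resolves the layer. -/
lemma last_le (h : IsMeshData kind n σ α ε) (hσ : 1 ≤ σ) :
    min 1 ((meshPoint kind (n + 1) σ α ε (n + 1) - meshPoint kind (n + 1) σ α ε n) / ε)
      ≤ (4 * (σ / α) + 4) * layerRate kind (n + 1) := by
  -- At the right end of the last element the exponential is 1, so the case k = 0 bounds the minimum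
  -- itself.
  have := h.layer_le (k := 0) (by simpa using hσ) (le_refl n)
  rw [h.isMesh.one] at this ⊢
  simpa using this

end IsMeshData

end

/-! ### The scheme in summed form, the projections and the error equation. -/

section

variable {x : ℕ → ℝ} {n k : ℕ} {u p v w : ℕ → ℝ[X]} {a a1 b b1 c : ℝ → ℝ} {α γ K D ε : ℝ}
  {f U P P1 Q1 : ℝ → ℝ}

/-- The LDG scheme, where the second and the third equation are summed over the elements. -/
structure IsDiscSolution (x : ℕ → ℝ) (n k : ℕ) (ε : ℝ) (a b b1 c f : ℝ → ℝ) (u p q : ℕ → ℝ[X]) :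
    Prop where
  deg_u : ∀ i, (u i).degree < ((k + 1 : ℕ) : WithBot ℕ)
  deg_p : ∀ i, (p i).degree < ((k + 1 : ℕ) : WithBot ℕ)
  deg_q : ∀ i, (q i).degree < ((k + 1 : ℕ) : WithBot ℕ)
  inner : ∀ i < n, ∀ r : ℝ[X], r.degree < ((k + 1 : ℕ) : WithBot ℕ) →
    (∫ t in x i..x (i + 1), (p i).eval t * r.eval t) +
      (∫ t in x i..x (i + 1), (u i).eval t * (derivative r).eval t) -
      (u i).eval (x (i + 1)) * r.eval (x (i + 1)) + prev x (ev u) i * r.eval (x i) = 0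
  last : ∀ r : ℝ[X], r.degree < ((k + 1 : ℕ) : WithBot ℕ) →
    (∫ t in x n..x (n + 1), (p n).eval t * r.eval t) +
      (∫ t in x n..x (n + 1), (u n).eval t * (derivative r).eval t) +
      prev x (ev u) n * r.eval (x n) = 0
  second : ∀ s : ℕ → ℝ[X], (∀ i, (s i).degree < ((k + 1 : ℕ) : WithBot ℕ)) →
    (∑ i ∈ Finset.range (n + 1), ∫ t in x i..x (i + 1), (q i).eval t * (s i).eval t) +
      ε * (aform x n (fun _ => 1) (ev p) s + (p n).eval (x (n + 1)) * (s n).eval (x (n + 1))) = 0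
  third : ∀ v : ℕ → ℝ[X], (∀ i, (v i).degree < ((k + 1 : ℕ) : WithBot ℕ)) →
    -aform x n (fun _ => 1) (ev q) v + aform x n a (ev p) v + bform x n b b1 c (ev u) v =
      ∑ i ∈ Finset.range (n + 1), ∫ t in x i..x (i + 1), f t * (v i).eval t

/-- Projections of `U`, `P`, `Q`: a Radau projection with the right end points, the `L²`
projection, and a Radau projection with the left end points. -/
structure IsProj (x : ℕ → ℝ) (n k : ℕ) (U P Q : ℝ → ℝ) (πu πp πq : ℕ → ℝ[X]) : Prop where
  deg_u : ∀ i, (πu i).degree < ((k + 1 : ℕ) : WithBot ℕ)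
  deg_p : ∀ i, (πp i).degree < ((k + 1 : ℕ) : WithBot ℕ)
  deg_q : ∀ i, (πq i).degree < ((k + 1 : ℕ) : WithBot ℕ)
  u_right : ∀ i ≤ n, (πu i).eval (x (i + 1)) = U (x (i + 1))
  q_left : ∀ i ≤ n, (πq i).eval (x i) = Q (x i)
  u_orth : ∀ i ≤ n, ∀ s : ℝ[X], s.degree < k →
    ∫ t in x i..x (i + 1), (πu i).eval t * s.eval t = ∫ t in x i..x (i + 1), U t * s.eval t
  p_orth : ∀ i ≤ n, ∀ s : ℝ[X], s.degree < ((k + 1 : ℕ) : WithBot ℕ) →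
    ∫ t in x i..x (i + 1), (πp i).eval t * s.eval t = ∫ t in x i..x (i + 1), P t * s.eval t
  q_orth : ∀ i ≤ n, ∀ s : ℝ[X], s.degree < k →
    ∫ t in x i..x (i + 1), (πq i).eval t * s.eval t = ∫ t in x i..x (i + 1), Q t * s.eval t

lemma integral_sub_eq_zero {l r : ℝ} {g : ℝ → ℝ} (hg : Continuous g) (π s : ℝ[X])
    (h : ∫ t in l..r, π.eval t * s.eval t = ∫ t in l..r, g t * s.eval t) :
    ∫ t in l..r, (g t - π.eval t) * s.eval t = 0 := by
  have : ∫ t in l..r, (g t - π.eval t) * s.eval t =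
      1 * (∫ t in l..r, g t * s.eval t) + (-1) * ∫ t in l..r, π.eval t * s.eval t :=
    integral_lin2 _ _ (by fun_prop) (by fun_prop) (fun t => by ring)
  rw [this, h]; ring

lemma IsProj.isProjError {Q : ℝ → ℝ} {πu πp πq : ℕ → ℝ[X]} (hπ : IsProj x n k U P Q πu πp πq)
    (hU : Continuous U) (hP : Continuous P) (hQ : Continuous Q) {δ δu : ℝ} (h0 : 0 ≤ δu)
    (h1 : δu ≤ δ)
    (hbu : ∀ i ≤ n, ∀ t ∈ Icc (x i) (x (i + 1)), |U t - (πu i).eval t| ≤ δu)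
    (hbp : ∀ i ≤ n, ∀ t ∈ Icc (x i) (x (i + 1)), |P t - (πp i).eval t| ≤ δ)
    (hbq : ∀ i ≤ n, ∀ t ∈ Icc (x i) (x (i + 1)), |Q t - (πq i).eval t| ≤ δ) :
    IsProjError x n k δ δu (fun i t => U t - (πu i).eval t) (fun i t => P t - (πp i).eval t)
      (fun i t => Q t - (πq i).eval t) where
  cy i := by fun_prop
  cz i := by fun_prop
  cq i := by fun_prop
  nonneg := h0
  le := h1
  by' := hbu
  bz := hbp
  bq := hbq
  y_right i hi := by rw [hπ.u_right i hi, sub_self]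
  q_left i hi := by rw [hπ.q_left i hi, sub_self]
  z_orth i hi s hs := integral_sub_eq_zero hP _ _ (hπ.p_orth i hi s hs)
  q_orth i hi s hs := integral_sub_eq_zero hQ _ _ (hπ.q_orth i hi s hs)

/-- The differences of the projections and the discrete solution satisfy the homogeneous first
equation. -/
lemma IsDiscSolution.isDiscDeriv (hx : IsMesh x n) {b1 : ℝ → ℝ}
    (he : IsExact ε a a1 b c f U P P1 Q1) {Q : ℝ → ℝ} {πu πp πq Uh Ph Qh : ℕ → ℝ[X]}
    (hd : IsDiscSolution x n k ε a b b1 c f Uh Ph Qh) (hπ : IsProj x n k U P Q πu πp πq) :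
    IsDiscDeriv x n k (fun i => πu i - Uh i) (fun i => πp i - Ph i) := by
  have hsplit : ∀ i (r : ℝ[X]), ∫ t in x i..x (i + 1), (πp i - Ph i).eval t * r.eval t =
      1 * (∫ t in x i..x (i + 1), (πp i).eval t * r.eval t) +
      (-1) * ∫ t in x i..x (i + 1), (Ph i).eval t * r.eval t := fun i r =>
    integral_lin2 _ _ (by fun_prop) (by fun_prop) (fun t => by simp; ring)
  have hsplit' : ∀ i (r : ℝ[X]), ∫ t in x i..x (i + 1), (πu i - Uh i).eval t * r.eval t =
      1 * (∫ t in x i..x (i + 1), (πu i).eval t * r.eval t) +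
      (-1) * ∫ t in x i..x (i + 1), (Uh i).eval t * r.eval t := fun i r =>
    integral_lin2 _ _ (by fun_prop) (by fun_prop) (fun t => by simp; ring)
  have hprev : ∀ i ≤ n, prev x (ev fun i => πu i - Uh i) i = U (x i) - prev x (ev Uh) i := by
    intro i hi
    cases i with
    | zero => simp [prev, hx.zero, he.left]
    | succ j => simp [prev, ev, hπ.u_right j (by omega)]
  -- The projections satisfy the first equation exactly: r is admissible for the L² projection of P
  -- and r' for the Radau projection of U, so both projections can be removed. The nodal values of
  -- the right Radau projection then provide the fluxes.
  have hparts : ∀ i ≤ n, ∀ r : ℝ[X], r.degree < ((k + 1 : ℕ) : WithBot ℕ) →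
      (∫ t in x i..x (i + 1), (πp i).eval t * r.eval t) +
        (∫ t in x i..x (i + 1), (πu i).eval t * (derivative r).eval t) =
      U (x (i + 1)) * r.eval (x (i + 1)) - U (x i) * r.eval (x i) := fun i hi r hr => by
    rw [hπ.p_orth i hi r hr, hπ.u_orth i hi _ (degree_derivative_lt_of_lt_succ hr)]
    exact integral_by_parts_fun (hx.lt i hi).le he.cu he.cp
      (fun t ht => he.du t (Ioo_subset_of_mesh hx hi ht)) r
  refine ⟨fun i => degree_sub_lt' (hπ.deg_u i) (hd.deg_u i),
    fun i => degree_sub_lt' (hπ.deg_p i) (hd.deg_p i), fun i hi r hr => ?_, fun r hr => ?_⟩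
  · have h1 := hparts i hi.le r hr
    have h2 := hd.inner i hi r hr
    have h3 := integral_by_parts_one (hx.lt i hi.le).le (πu i - Uh i) r
    rw [hsplit'] at h3
    have h4 := hπ.u_right i hi.le
    rw [hsplit, jmp, hprev i hi.le]
    simp only [ev, eval_sub] at *
    rw [h4] at h3
    linarith
  · have h1 := hparts n le_rfl r hr
    have h2 := hd.last r hr
    rw [hsplit, hsplit', hprev n le_rfl]
    rw [hx.one, he.right] at h1
    rw [hx.one] at h2 ⊢
    linarith

/-- The second equation is tested with the p difference and the third one with v + κ w. The two
terms with the q difference cancel by `IsSplit.aform_one`, whatever κ is; only residuals of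
projection errors remain on the right. -/
lemma IsDiscSolution.testValue_eq (hx : IsMesh x n) (hc : IsCoeff a a1 b b1 c α γ K)
    (he : IsExact ε a a1 b c f U P P1 Q1) {πu πp πq Uh Ph Qh : ℕ → ℝ[X]}
    (hd : IsDiscSolution x n k ε a b b1 c f Uh Ph Qh)
    (hπ : IsProj x n k U P (fun t => ε * P1 t) πu πp πq)
    (hs : IsSplit x n k D (fun i => πu i - Uh i) (fun i => πp i - Ph i) v w) (κ : ℝ) :
    testValue x n ε a b b1 c (fun i => πu i - Uh i) (fun i => πp i - Ph i) v w κ =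
      -((∑ i ∈ Finset.range (n + 1), ∫ t in x i..x (i + 1),
          (ε * P1 t - (πq i).eval t) * (πp i - Ph i).eval t) +
        ε * (aform x n (fun _ => 1) (fun i t => P t - (πp i).eval t) (fun i => πp i - Ph i) +
          (P (x (n + 1)) - (πp n).eval (x (n + 1))) * (πp n - Ph n).eval (x (n + 1)))) -
      (-aform x n (fun _ => 1) (fun i t => ε * P1 t - (πq i).eval t) (fun i => v i + κ • w i) +
        aform x n a (fun i t => P t - (πp i).eval t) (fun i => v i + κ • w i) +
        bform x n b b1 c (fun i t => U t - (πu i).eval t) (fun i => v i + κ • w i)) := by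
  have hca := hc.ca
  have hcU := he.cu
  have hcP := he.cp
  have hcP1 := he.cp1
  set ξp : ℕ → ℝ[X] := fun i => πp i - Ph i with hξp
  set z : ℕ → ℝ[X] := fun i => v i + κ • w i with hz
  have hdz : ∀ i, (z i).degree < ((k + 1 : ℕ) : WithBot ℕ) := fun i =>
    degree_add_lt' (hs.deg_v i) (degree_smul_lt' _ (hs.deg_w i))
  have hdp : ∀ i, (ξp i).degree < ((k + 1 : ℕ) : WithBot ℕ) := fun i =>
    degree_sub_lt' (hπ.deg_p i) (hd.deg_p i)
  have e2 := he.consistent_second hx ξp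
  have d2 := hd.second ξp hdp
  have e3 := he.consistent_third hx hc z
  have d3 := hd.third z hdz
  have o := hs.aform_one hx (hd.isDiscDeriv hx he hπ) κ
    (y := fun i => πq i - Qh i) (fun i => degree_sub_lt' (hπ.deg_q i) (hd.deg_q i))
  have hA : ∀ (A : ℝ → ℝ), Continuous A → ∀ (y : ℕ → ℝ → ℝ) (π h s : ℕ → ℝ[X]),
      (∀ i, Continuous (y i)) →
      aform x n A (ev fun i => π i - h i) s + aform x n A (fun i t => y i t - (π i).eval t) s =
        aform x n A y s - aform x n A (ev h) s := by
    intro A hA y π h s hy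
    have h1 := aform_add_left (x := x) (n := n) hA (y := ev fun i => π i - h i)
      (z := fun i t => y i t - (π i).eval t) (fun i => by fun_prop) (fun i => by fun_prop) 1 s
    have h2 := aform_add_left (x := x) (n := n) hA (y := y) (z := ev h)
      hy (fun i => by fun_prop) (-1) s
    have h3 : (fun i t => (ev fun i => π i - h i) i t + 1 * (y i t - (π i).eval t)) =
        fun i t => y i t + (-1) * ev h i t := by
      funext i t; simp only [ev, eval_sub]; ring
    rw [h3, h2] at h1
    linarith
  have hB : bform x n b b1 c (ev fun i => πu i - Uh i) z +
      bform x n b b1 c (fun i t => U t - (πu i).eval t) z =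
        bform x n b b1 c (fun _ => U) z - bform x n b b1 c (ev Uh) z := by
    have h1 := bform_add_left (x := x) (n := n) hc.cb hc.cb1 hc.cc (y := ev fun i => πu i - Uh i)
      (z := fun i t => U t - (πu i).eval t) (fun i => by fun_prop) (fun i => by fun_prop) 1 z
    have h2 := bform_add_left (x := x) (n := n) hc.cb hc.cb1 hc.cc (y := fun _ => U) (z := ev Uh)
      (fun i => by fun_prop) (fun i => by fun_prop) (-1) z
    have h3 : (fun i t => (ev fun i => πu i - Uh i) i t + 1 * (U t - (πu i).eval t)) =
        fun i t => U t + (-1) * ev Uh i t := by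
      funext i t; simp only [ev, eval_sub]; ring
    rw [h3, h2] at h1
    linarith
  have a1 := hA (fun _ => 1) continuous_const (fun _ => P) πp Ph ξp (fun _ => hcP)
  have a2 := hA (fun _ => 1) continuous_const (fun _ t => ε * P1 t) πq Qh z
    (fun _ => by fun_prop)
  have a3 := hA a hca (fun _ => P) πp Ph z (fun _ => hcP)
  have hI : (∑ i ∈ Finset.range (n + 1), ∫ t in x i..x (i + 1), (ξp i).eval t *
        (πq i - Qh i).eval t) +
      (∑ i ∈ Finset.range (n + 1), ∫ t in x i..x (i + 1),
          (ε * P1 t - (πq i).eval t) * (ξp i).eval t) =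
      (∑ i ∈ Finset.range (n + 1), ∫ t in x i..x (i + 1), ε * P1 t * (ξp i).eval t) -
      ∑ i ∈ Finset.range (n + 1), ∫ t in x i..x (i + 1), (Qh i).eval t * (ξp i).eval t := by
    rw [← Finset.sum_add_distrib, ← Finset.sum_sub_distrib]
    refine Finset.sum_congr rfl fun i _ => ?_
    rw [← intervalIntegral.integral_add, ← intervalIntegral.integral_sub]
    · congr 1; funext t; simp only [eval_sub]; ring
    all_goals exact Continuous.intervalIntegrable (by fun_prop) _ _
  have hend : (ξp n).eval (x (n + 1)) = (πp n).eval (x (n + 1)) - (Ph n).eval (x (n + 1)) := by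
    simp [hξp]
  rw [testValue]
  change _ = -(_ + ε * (_ + (P (x (n + 1)) - (πp n).eval (x (n + 1))) *
    (ξp n).eval (x (n + 1)))) - _
  have key : ε * (ξp n).eval (x (n + 1)) ^ 2 = ε * (((πp n).eval (x (n + 1)) -
    (Ph n).eval (x (n + 1))) * (ξp n).eval (x (n + 1))) := by rw [← hend]; ring
  simp only [mul_add ε, sub_mul, mul_sub ε] at *
  have a1' := congrArg (ε * ·) a1
  simp only [mul_add ε, mul_sub ε] at a1'
  linarith

end

/-! ### The energy estimate. -/

section

variable {x : ℕ → ℝ} {n k : ℕ} {u p v w : ℕ → ℝ[X]} {a a1 b b1 c : ℝ → ℝ} {α γ K D ε : ℝ}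
  {f U P P1 Q1 : ℝ → ℝ}

lemma integral_sq_weight_le {l r B δ : ℝ} (h : l ≤ r) {g y : ℝ → ℝ} (hg : Continuous g)
    (hy : Continuous y) (hB : 0 ≤ B) (hgB : ∀ t, g t ≤ B) (hyδ : ∀ t ∈ Icc l r, |y t| ≤ δ) :
    ∫ t in l..r, g t * y t ^ 2 ≤ B * δ ^ 2 * (r - l) := by
  have h1 : ∫ t in l..r, g t * y t ^ 2 ≤ ∫ _ in l..r, B * δ ^ 2 := by
    refine intervalIntegral.integral_mono_on h (Continuous.intervalIntegrable (by fun_prop) _ _)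
      (Continuous.intervalIntegrable (by fun_prop) _ _) fun t ht => ?_
    have h2 : y t ^ 2 ≤ δ ^ 2 := sq_le_sq.2 ((hyδ t ht).trans (le_abs_self _))
    exact mul_le_mul (hgB t) h2 (sq_nonneg _) hB
  rwa [intervalIntegral.integral_const, smul_eq_mul, mul_comm] at h1

namespace IsProjError
variable {δ δu : ℝ} {y z q : ℕ → ℝ → ℝ}

/-- There are n + 1 jumps of size at most 2 δ with weight ε / 2, and ε (n + 1) ≤ 1. -/
lemma pquad_le (hx : IsMesh x n) (hc : IsCoeff a a1 b b1 c α γ K)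
    (he : IsProjError x n k δ δu y z q) (hε : 0 < ε) (hεN : ε * (n + 1) ≤ 1) :
    pquad x n ε a z ≤ (K + 3) * δ ^ 2 := by
  have hK := hc.one_le
  have h1 : ∀ i ∈ Finset.range (n + 1), (∫ t in x i..x (i + 1), a t * z i t ^ 2)
      + ε / 2 * jmp x z i ^ 2 ≤ K * δ ^ 2 * (x (i + 1) - x i) + ε / 2 * (2 * δ) ^ 2 := by
    intro i hi
    have hi' : i ≤ n := by simpa [Nat.lt_succ_iff] using hi
    have hj : |jmp x z i| ≤ 2 * δ := by
      have e1 := he.bz i hi' _ (left_mem_Icc.2 (hx.lt i hi').le)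
      have e2 : |prev x z i| ≤ δ := by
        cases i with
        | zero => simpa [prev] using he.nonneg.trans he.le
        | succ j => exact he.bz j (by omega) _ (right_mem_Icc.2 (hx.lt j (by omega)).le)
      exact (abs_sub _ _).trans (by linarith)
    refine add_le_add (integral_sq_weight_le (hx.lt i hi').le hc.ca (he.cz i) (by linarith)
      (fun t => (le_abs_self _).trans (hc.ba t)) (he.bz i hi')) ?_
    exact mul_le_mul_of_nonneg_left (sq_le_sq.2 (hj.trans (le_abs_self _))) (by positivity)
  have h2 := Finset.sum_le_sum h1
  rw [Finset.sum_add_distrib (f := fun i => K * δ ^ 2 * (x (i + 1) - x i)), ← Finset.mul_sum,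
    hx.sum, Finset.sum_const, Finset.card_range, nsmul_eq_mul] at h2
  have h3 : z n (x (n + 1)) ^ 2 ≤ δ ^ 2 :=
    sq_le_sq.2 ((he.bz n le_rfl _ (right_mem_Icc.2 (hx.lt n le_rfl).le)).trans (le_abs_self _))
  have hn : (0 : ℝ) ≤ n := Nat.cast_nonneg n
  have hε1 : ε ≤ 1 := by linarith [mul_nonneg hε.le hn]
  rw [pquad]
  have h4 := mul_le_mul_of_nonneg_left h3 (show 0 ≤ ε / 2 by positivity)
  have h5 := mul_le_mul_of_nonneg_right hεN (show 0 ≤ 2 * δ ^ 2 by positivity)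
  have h6 := mul_le_mul_of_nonneg_right hε1 (show 0 ≤ δ ^ 2 / 2 by positivity)
  push_cast at h2
  have h7 := sq_nonneg δ
  linarith

/-- The jumps of the first component carry no factor ε, so their sum costs n + 1, that is, √N in the
energy norm. This loss is the reason for the separate, smaller bound δu. -/
lemma uquad_le (hx : IsMesh x n) (hc : IsCoeff a a1 b b1 c α γ K)
    (he : IsProjError x n k δ δu y z q) :
    uquad x n b b1 c y ≤ 3 * K * (n + 1) * δu ^ 2 := by
  have hK := hc.one_le
  have h1 : ∀ i ∈ Finset.range (n + 1), (∫ t in x i..x (i + 1), (c t - 1 / 2 * b1 t) * y i t ^ 2)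
      + 1 / 2 * (|b (x i)| * jmp x y i ^ 2) ≤
      2 * K * δu ^ 2 * (x (i + 1) - x i) + 1 / 2 * (K * δu ^ 2) := by
    intro i hi
    have hi' : i ≤ n := by simpa [Nat.lt_succ_iff] using hi
    have hcb := hc.cb1
    have hcc := hc.cc
    have e1 : jmp x y i ^ 2 ≤ δu ^ 2 := by
      rw [jmp, he.prev_y hi', sub_zero]
      exact sq_le_sq.2 ((he.by' i hi' _ (left_mem_Icc.2 (hx.lt i hi').le)).trans (le_abs_self _))
    refine add_le_add (integral_sq_weight_le (hx.lt i hi').le (by fun_prop) (he.cy i) (by linarith)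
      (fun t => ?_) (he.by' i hi')) ?_
    · have := le_abs_self (c t)
      have := neg_abs_le (b1 t)
      linarith [hc.bc t, hc.bb1 t]
    · have := mul_le_mul (hc.bb (x i)) e1 (sq_nonneg _) (by linarith)
      linarith
  have h2 := Finset.sum_le_sum h1
  rw [Finset.sum_add_distrib (f := fun i => 2 * K * δu ^ 2 * (x (i + 1) - x i)), ← Finset.mul_sum,
    hx.sum, Finset.sum_const, Finset.card_range, nsmul_eq_mul] at h2
  rw [uquad, he.y_right n le_rfl]
  push_cast at h2
  have hn : (0 : ℝ) ≤ n := Nat.cast_nonneg n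
  have h3 : 0 ≤ K * δu ^ 2 := by positivity
  have h4 := mul_nonneg hn h3
  linarith

end IsProjError

lemma sqrt_sum_le_of_le_pquad (hx : IsMesh x n) (hc : IsCoeff a a1 b b1 c α γ K) (hε : 0 ≤ ε)
    {y : ℕ → ℝ → ℝ} (hy : ∀ i, Continuous (y i)) :
    Real.sqrt (∑ i ∈ Finset.range (n + 1), l2 (x i) (x (i + 1)) (y i) ^ 2) ≤
      Real.sqrt α⁻¹ * Real.sqrt (pquad x n ε a y) := by
  rw [← Real.sqrt_mul (inv_nonneg.2 hc.pos_α.le)]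
  refine Real.sqrt_le_sqrt ?_
  rw [inv_mul_eq_div, le_div_iff₀ hc.pos_α, mul_comm]
  have h1 := le_pquad hx hc (ε := ε) hy
  have h2 : 0 ≤ ε / 2 * (∑ i ∈ Finset.range (n + 1), jmp x y i ^ 2 + y n (x (n + 1)) ^ 2) := by
    have : 0 ≤ ∑ i ∈ Finset.range (n + 1), jmp x y i ^ 2 :=
      Finset.sum_nonneg fun _ _ => sq_nonneg _
    positivity
  linarith

lemma sqrt_sum_le_of_le_uquad (hx : IsMesh x n) (hc : IsCoeff a a1 b b1 c α γ K)
    {y : ℕ → ℝ → ℝ} (hy : ∀ i, Continuous (y i)) :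
    Real.sqrt (∑ i ∈ Finset.range (n + 1), l2 (x i) (x (i + 1)) (y i) ^ 2) ≤
      Real.sqrt γ⁻¹ * Real.sqrt (uquad x n b b1 c y) := by
  rw [← Real.sqrt_mul (inv_nonneg.2 hc.pos_γ.le)]
  refine Real.sqrt_le_sqrt ?_
  rw [inv_mul_eq_div, le_div_iff₀ hc.pos_γ, mul_comm]
  exact le_uquad hx hc hy

lemma pquad_nonneg (hx : IsMesh x n) (hc : IsCoeff a a1 b b1 c α γ K) (hε : 0 ≤ ε)
    {y : ℕ → ℝ → ℝ} (hy : ∀ i, Continuous (y i)) : 0 ≤ pquad x n ε a y := by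
  have h1 := le_pquad hx hc (ε := ε) hy
  have h2 : 0 ≤ ∑ i ∈ Finset.range (n + 1), jmp x y i ^ 2 :=
    Finset.sum_nonneg fun _ _ => sq_nonneg _
  have h3 : 0 ≤ ∑ i ∈ Finset.range (n + 1), l2 (x i) (x (i + 1)) (y i) ^ 2 :=
    Finset.sum_nonneg fun _ _ => sq_nonneg _
  have h4 := hc.pos_α
  refine le_trans ?_ h1
  positivity

lemma uquad_nonneg (hx : IsMesh x n) (hc : IsCoeff a a1 b b1 c α γ K)
    {y : ℕ → ℝ → ℝ} (hy : ∀ i, Continuous (y i)) : 0 ≤ uquad x n b b1 c y := by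
  have h3 : 0 ≤ ∑ i ∈ Finset.range (n + 1), l2 (x i) (x (i + 1)) (y i) ^ 2 :=
    Finset.sum_nonneg fun _ _ => sq_nonneg _
  exact (mul_nonneg hc.pos_γ.le h3).trans (le_uquad hx hc hy)

/-- The constant in the bound of the energy error. -/
def energyConst (α γ K D C : ℝ) : ℝ :=
  C * (Real.sqrt α⁻¹ + 2 + 8 * K * D * (Real.sqrt α⁻¹ + Real.sqrt γ⁻¹) + Real.sqrt γ⁻¹)

/-- The energy of the difference of the projection and the discrete solution. -/
lemma IsDiscSolution.sqrt_energy_le (hx : IsMesh x n) (hc : IsCoeff a a1 b b1 c α γ K)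
    (hε : 0 < ε) (hεN : ε * (n + 1) ≤ 1)
    (he : IsExact ε a a1 b c f U P P1 Q1) {πu πp πq Uh Ph Qh : ℕ → ℝ[X]}
    (hd : IsDiscSolution x n k ε a b b1 c f Uh Ph Qh)
    (hπ : IsProj x n k U P (fun t => ε * P1 t) πu πp πq)
    (hs : IsSplit x n k D (fun i => πu i - Uh i) (fun i => πp i - Ph i) v w) (hD : 1 ≤ D)
    {δ δu Δ C κ : ℝ}
    (hr : IsProjError x n k δ δu (fun i t => U t - (πu i).eval t) (fun i t => P t - (πp i).eval t)
      (fun i t => ε * P1 t - (πq i).eval t))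
    (hκ : 0 ≤ κ) (hκ1 : κ ≤ 1) (hC : 0 ≤ C) (hΔ : 0 ≤ Δ)
    (hcoer : pquad x n ε a (ev fun i => πp i - Ph i) + uquad x n b b1 c (ev fun i => πu i - Uh i) ≤
      C * testValue x n ε a b b1 c (fun i => πu i - Uh i) (fun i => πp i - Ph i) v w κ)
    (hw : |-aform x n (fun _ => 1) (fun i t => ε * P1 t - (πq i).eval t) w +
      aform x n a (fun i t => P t - (πp i).eval t) w +
      bform x n b b1 c (fun i t => U t - (πu i).eval t) w| ≤
      Δ * l2 (x n) (x (n + 1)) (ev w n)) :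
    Real.sqrt (pquad x n ε a (ev fun i => πp i - Ph i) +
      uquad x n b b1 c (ev fun i => πu i - Uh i)) ≤ energyConst α γ K D C * (δ + Δ) := by
  have hδ : 0 ≤ δ := hr.nonneg.trans hr.le
  have hK := hc.one_le
  rw [hd.testValue_eq hx hc he hπ hs] at hcoer
  rw [aform_add_right continuous_const hr.cq, aform_add_right hc.ca hr.cz,
    bform_add_right hc.cb hc.cb1 hc.cc hr.cy] at hcoer
  have hdp : ∀ i, ((fun i => πp i - Ph i) i).degree < ((k + 1 : ℕ) : WithBot ℕ) := fun i =>
    degree_sub_lt' (hπ.deg_p i) (hd.deg_p i)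
  have h2 := hr.abs_second_le hx hc hdp hε hεN
  have h3 := hr.abs_third_le hx hc hs hD
  have cp : ∀ i, Continuous ((ev fun i => πp i - Ph i) i) := fun i => by fun_prop
  have cu : ∀ i, Continuous ((ev fun i => πu i - Uh i) i) := fun i => by fun_prop
  have sp := sqrt_sum_le_of_le_pquad hx hc hε.le cp
  have su := sqrt_sum_le_of_le_uquad hx hc cu
  have np := pquad_nonneg hx hc hε.le cp
  have nu := uquad_nonneg hx hc cu
  have hwu : l2 (x n) (x (n + 1)) (ev w n) ≤ Real.sqrt (∑ i ∈ Finset.range (n + 1),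
      l2 (x i) (x (i + 1)) ((ev fun i => πu i - Uh i) i) ^ 2) := by
    refine hs.l2_w.trans (Real.le_sqrt_of_sq_le ?_)
    exact Finset.single_le_sum (f := fun i => l2 (x i) (x (i + 1))
      ((ev fun i => πu i - Uh i) i) ^ 2) (fun _ _ => sq_nonneg _) (Finset.self_mem_range_succ n)
  set Y := pquad x n ε a (ev fun i => πp i - Ph i)
  set Z := uquad x n b b1 c (ev fun i => πu i - Uh i)
  set S := Real.sqrt (Y + Z) with hS
  have hYS : Real.sqrt Y ≤ S := Real.sqrt_le_sqrt (by linarith)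
  have hZS : Real.sqrt Z ≤ S := Real.sqrt_le_sqrt (by linarith)
  have hS0 : 0 ≤ S := Real.sqrt_nonneg _
  have hα0 := Real.sqrt_nonneg α⁻¹
  have hγ0 := Real.sqrt_nonneg γ⁻¹
  have sp' := sp.trans (mul_le_mul_of_nonneg_left hYS hα0)
  have su' := su.trans (mul_le_mul_of_nonneg_left hZS hγ0)
  have hw' := hw.trans (mul_le_mul_of_nonneg_left (hwu.trans su') hΔ)
  have h2' := h2.trans (mul_le_mul_of_nonneg_left hYS (by positivity))
  have h3' := h3.trans (mul_le_mul_of_nonneg_left (add_le_add sp' su') (by positivity))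
  have hκw : ∀ t : ℝ, |t| ≤ Δ * (Real.sqrt γ⁻¹ * S) → -(κ * t) ≤ Δ * (Real.sqrt γ⁻¹ * S) := by
    intro t ht
    calc -(κ * t) ≤ |κ * t| := neg_le_abs _
      _ = κ * |t| := by rw [abs_mul, abs_of_nonneg hκ]
      _ ≤ 1 * |t| := mul_le_mul_of_nonneg_right hκ1 (abs_nonneg _)
      _ ≤ _ := by rwa [one_mul]
  have hw'' := hκw _ hw'
  have e2 := (neg_le_abs _).trans h2'
  have e3 := (neg_le_abs _).trans h3'
  have hSS : S * S = Y + Z := Real.mul_self_sqrt (by linarith)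
  set A := Real.sqrt α⁻¹ + 2 + 8 * K * D * (Real.sqrt α⁻¹ + Real.sqrt γ⁻¹) + Real.sqrt γ⁻¹ with hA
  have hA0 : 0 ≤ A := by positivity
  -- All residuals are linear in S, so that S² ≤ C A (δ + Δ) S, and one factor S can be divided out.
  have hfin : Y + Z ≤ C * (A * (δ + Δ) * S) := by
    refine hcoer.trans (mul_le_mul_of_nonneg_left ?_ hC)
    have g1 : 0 ≤ (8 * K * D * (Real.sqrt α⁻¹ + Real.sqrt γ⁻¹) + Real.sqrt α⁻¹ + 2) * Δ * S := by
      positivity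
    have g2 : 0 ≤ Real.sqrt γ⁻¹ * δ * S := by positivity
    have g3 : A * (δ + Δ) * S = (Real.sqrt α⁻¹ + 2) * δ * S +
      8 * K * D * δ * (Real.sqrt α⁻¹ * S + Real.sqrt γ⁻¹ * S) + Δ * (Real.sqrt γ⁻¹ * S) +
      (8 * K * D * (Real.sqrt α⁻¹ + Real.sqrt γ⁻¹) + Real.sqrt α⁻¹ + 2) * Δ * S +
      Real.sqrt γ⁻¹ * δ * S := by rw [hA]; ring
    rw [g3]
    linarith
  rw [energyConst, ← hA]
  rcases hS0.eq_or_lt with h0 | h0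
  · rw [← h0]; positivity
  · refine le_of_mul_le_mul_right ?_ h0
    rw [hSS]; linarith

/-- The energy of the error. -/
lemma IsExact.sqrt_error_le (hx : IsMesh x n) (hc : IsCoeff a a1 b b1 c α γ K)
    (hε : 0 < ε) (hεN : ε * (n + 1) ≤ 1)
    (he : IsExact ε a a1 b c f U P P1 Q1) {πu πp πq Uh Ph : ℕ → ℝ[X]}
    {δ δu E : ℝ}
    (hr : IsProjError x n k δ δu (fun i t => U t - (πu i).eval t) (fun i t => P t - (πp i).eval t)
      (fun i t => ε * P1 t - (πq i).eval t))
    (hE : Real.sqrt (pquad x n ε a (ev fun i => πp i - Ph i) +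
      uquad x n b b1 c (ev fun i => πu i - Uh i)) ≤ E) :
    Real.sqrt (pquad x n ε a (fun i t => P t - (Ph i).eval t) +
      uquad x n b b1 c (fun i t => U t - (Uh i).eval t)) ≤
    2 * ((K + 3) * δ + 3 * K * (Real.sqrt (n + 1) * δu) + E) := by
  have hcU := he.cu
  have hcP := he.cp
  have hK := hc.one_le
  have hδu := hr.nonneg
  have hδ : 0 ≤ δ := hr.nonneg.trans hr.le
  have h1 := pquad_add_le hx hc hε.le (y := fun i t => P t - (πp i).eval t)
    (z := ev fun i => πp i - Ph i) (fun i => by fun_prop) (fun i => by fun_prop)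
  have h2 := uquad_add_le hx hc (y := fun i t => U t - (πu i).eval t)
    (z := ev fun i => πu i - Uh i) (fun i => by fun_prop) (fun i => by fun_prop)
  have e1 : (fun i t => P t - (πp i).eval t + 1 * (ev fun i => πp i - Ph i) i t) =
      fun i t => P t - (Ph i).eval t := by
    funext i t; simp only [ev, eval_sub]; ring
  have e2 : (fun i t => U t - (πu i).eval t + 1 * (ev fun i => πu i - Uh i) i t) =
      fun i t => U t - (Uh i).eval t := by
    funext i t; simp only [ev, eval_sub]; ring
  rw [e1] at h1
  rw [e2] at h2
  have h3 := hr.pquad_le hx hc hε hεN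
  have h4 := hr.uquad_le hx hc
  have np := pquad_nonneg hx hc hε.le (y := ev fun i => πp i - Ph i) (fun i => by fun_prop)
  have nu := uquad_nonneg hx hc (y := ev fun i => πu i - Uh i) (fun i => by fun_prop)
  have hE0 : 0 ≤ E := (Real.sqrt_nonneg _).trans hE
  have h5 := (Real.sqrt_le_left hE0).1 hE
  have hn : (0 : ℝ) ≤ n := Nat.cast_nonneg n
  have h6 : (n + 1 : ℝ) = Real.sqrt (n + 1) ^ 2 := (Real.sq_sqrt (by linarith)).symm
  set s := Real.sqrt (n + 1 : ℝ)
  have hs : 0 ≤ s := Real.sqrt_nonneg _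
  rw [h6] at h4
  refine Real.sqrt_le_iff.2 ⟨by positivity, ?_⟩
  have h7 : (K + 3) * δ ^ 2 ≤ ((K + 3) * δ) ^ 2 := by
    rw [mul_pow, pow_two (K + 3)]
    exact mul_le_mul_of_nonneg_right (le_mul_of_one_le_left (by linarith) (by linarith))
      (sq_nonneg _)
  have h8 : 3 * K * s ^ 2 * δu ^ 2 ≤ (3 * K * (s * δu)) ^ 2 := by
    rw [mul_pow, pow_two (3 * K), mul_pow, ← mul_assoc]
    refine mul_le_mul_of_nonneg_right ?_ (sq_nonneg _)
    exact mul_le_mul_of_nonneg_right (le_mul_of_one_le_left (by linarith) (by linarith))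
      (sq_nonneg _)
  have g1 : 0 ≤ (K + 3) * δ := by positivity
  have g2 : 0 ≤ 3 * K * (s * δu) := by positivity
  have g3 := mul_nonneg g1 g2
  have g4 := mul_nonneg g1 hE0
  have g5 := mul_nonneg g2 hE0
  have g6 : (2 * ((K + 3) * δ + 3 * K * (s * δu) + E)) ^ 2 =
    4 * (((K + 3) * δ) ^ 2 + (3 * K * (s * δu)) ^ 2 + E ^ 2) + 8 * ((K + 3) * δ * (3 * K * (s * δu)))
      + 8 * ((K + 3) * δ * E) + 8 * (3 * K * (s * δu) * E) := by ring
  have g7 := sq_nonneg ((K + 3) * δ)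
  have g8 := sq_nonneg (3 * K * (s * δu))
  have g9 := sq_nonneg E
  linarith

end

/-! ### Projection errors on layer-adapted meshes. -/

section

variable {x : ℕ → ℝ} {n k : ℕ} {u p v w : ℕ → ℝ[X]} {a a1 b b1 c : ℝ → ℝ} {α γ K D ε : ℝ}
  {f U P P1 Q1 : ℝ → ℝ}

/-- The stability constant of the projections. -/
def projConst (k : ℕ) : ℝ := 2 + 2 * invK k ^ 2 + invK (k + 1) ^ 2

lemma one_le_projConst (k : ℕ) : 1 ≤ projConst k := by
  rw [projConst]; nlinarith [sq_nonneg (invK k), sq_nonneg (invK (k + 1))]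

/-- `π` approximates `g` on `[l, r]` up to a constant as well as any polynomial of degree at
most `k`. -/
def QuasiOptimal (l r : ℝ) (k : ℕ) (g : ℝ → ℝ) (π : ℝ[X]) : Prop :=
  ∀ (χ : ℝ[X]) (B : ℝ), χ.degree < ((k + 1 : ℕ) : WithBot ℕ) → 0 ≤ B →
    (∀ t ∈ Icc l r, |g t - χ.eval t| ≤ B) → ∀ t ∈ Icc l r, |g t - π.eval t| ≤ projConst k * B

/-- The base point is r and the signed length l - r is negative. -/
lemma exists_right_radau (k : ℕ) {l r : ℝ} (h : l < r) {g : ℝ → ℝ} (hg : Continuous g) :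
    ∃ π : ℝ[X], π.degree < ((k + 1 : ℕ) : WithBot ℕ) ∧ π.eval r = g r ∧
      (∀ s : ℝ[X], s.degree < k → ∫ t in l..r, π.eval t * s.eval t = ∫ t in l..r, g t * s.eval t) ∧
      QuasiOptimal l r k g π := by
  obtain ⟨π, h1, h2, h3, h4⟩ := exists_radau_projection k (z := r) (h := l - r)
    (by linarith) hg
  rw [add_sub_cancel, uIcc_of_ge h.le] at *
  refine ⟨π, h1, h2, fun s hs => ?_, fun χ B hχ hB hb t ht => ?_⟩
  · rw [intervalIntegral.integral_symm r l, h3 s hs, ← intervalIntegral.integral_symm]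
  · refine (h4 χ B hχ hB hb t ht).trans (mul_le_mul_of_nonneg_right ?_ hB)
    rw [projConst]; linarith [sq_nonneg (invK (k + 1))]

lemma exists_left_radau (k : ℕ) {l r : ℝ} (h : l < r) {g : ℝ → ℝ} (hg : Continuous g) :
    ∃ π : ℝ[X], π.degree < ((k + 1 : ℕ) : WithBot ℕ) ∧ π.eval l = g l ∧
      (∀ s : ℝ[X], s.degree < k → ∫ t in l..r, π.eval t * s.eval t = ∫ t in l..r, g t * s.eval t) ∧
      QuasiOptimal l r k g π := by
  obtain ⟨π, h1, h2, h3, h4⟩ := exists_radau_projection k (z := l) (h := r - l)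
    (by linarith) hg
  rw [add_sub_cancel, uIcc_of_le h.le] at *
  refine ⟨π, h1, h2, h3, fun χ B hχ hB hb t ht => ?_⟩
  refine (h4 χ B hχ hB hb t ht).trans (mul_le_mul_of_nonneg_right ?_ hB)
  rw [projConst]; linarith [sq_nonneg (invK (k + 1))]

lemma exists_l2_projection' (k : ℕ) {l r : ℝ} (h : l < r) {g : ℝ → ℝ} (hg : Continuous g) :
    ∃ π : ℝ[X], π.degree < ((k + 1 : ℕ) : WithBot ℕ) ∧
      (∀ s : ℝ[X], s.degree < ((k + 1 : ℕ) : WithBot ℕ) →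
        ∫ t in l..r, π.eval t * s.eval t = ∫ t in l..r, g t * s.eval t) ∧
      QuasiOptimal l r k g π := by
  obtain ⟨π, h1, h3, h4⟩ := exists_l2_projection (k + 1) h hg
  refine ⟨π, h1, h3, fun χ B hχ hB hb t ht => ?_⟩
  refine (h4 χ B hχ hB hb t ht).trans (mul_le_mul_of_nonneg_right ?_ hB)
  rw [projConst]; linarith [sq_nonneg (invK k)]

lemma exists_isProj (hx : IsMesh x n) (k : ℕ) {U P Q : ℝ → ℝ} (hU : Continuous U)
    (hP : Continuous P) (hQ : Continuous Q) :
    ∃ πu πp πq : ℕ → ℝ[X], IsProj x n k U P Q πu πp πq ∧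
      ∀ i ≤ n, QuasiOptimal (x i) (x (i + 1)) k U (πu i) ∧
        QuasiOptimal (x i) (x (i + 1)) k P (πp i) ∧
        QuasiOptimal (x i) (x (i + 1)) k Q (πq i) := by
  -- The condition i ≤ n stands inside the existential statement, so that `choose` yields sequences
  -- with the degree bound at every index.
  have hu : ∀ i, ∃ π : ℝ[X], π.degree < ((k + 1 : ℕ) : WithBot ℕ) ∧ (i ≤ n →
      π.eval (x (i + 1)) = U (x (i + 1)) ∧ (∀ s : ℝ[X], s.degree < k →
        ∫ t in x i..x (i + 1), π.eval t * s.eval t = ∫ t in x i..x (i + 1), U t * s.eval t) ∧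
      QuasiOptimal (x i) (x (i + 1)) k U π) := fun i => by
    by_cases hi : i ≤ n
    · obtain ⟨π, h1, h2⟩ := exists_right_radau k (hx.lt i hi) hU
      exact ⟨π, h1, fun _ => h2⟩
    · exact ⟨0, by simp, fun h => absurd h hi⟩
  have hp : ∀ i, ∃ π : ℝ[X], π.degree < ((k + 1 : ℕ) : WithBot ℕ) ∧ (i ≤ n →
      (∀ s : ℝ[X], s.degree < ((k + 1 : ℕ) : WithBot ℕ) →
        ∫ t in x i..x (i + 1), π.eval t * s.eval t = ∫ t in x i..x (i + 1), P t * s.eval t) ∧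
      QuasiOptimal (x i) (x (i + 1)) k P π) := fun i => by
    by_cases hi : i ≤ n
    · obtain ⟨π, h1, h2⟩ := exists_l2_projection' k (hx.lt i hi) hP
      exact ⟨π, h1, fun _ => h2⟩
    · exact ⟨0, by simp, fun h => absurd h hi⟩
  have hq : ∀ i, ∃ π : ℝ[X], π.degree < ((k + 1 : ℕ) : WithBot ℕ) ∧ (i ≤ n →
      π.eval (x i) = Q (x i) ∧ (∀ s : ℝ[X], s.degree < k →
        ∫ t in x i..x (i + 1), π.eval t * s.eval t = ∫ t in x i..x (i + 1), Q t * s.eval t) ∧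
      QuasiOptimal (x i) (x (i + 1)) k Q π) := fun i => by
    by_cases hi : i ≤ n
    · obtain ⟨π, h1, h2⟩ := exists_left_radau k (hx.lt i hi) hQ
      exact ⟨π, h1, fun _ => h2⟩
    · exact ⟨0, by simp, fun h => absurd h hi⟩
  choose πu du eu using hu
  choose πp dp ep using hp
  choose πq dq eq using hq
  exact ⟨πu, πp, πq, ⟨du, dp, dq, fun i hi => (eu i hi).1, fun i hi => (eq i hi).1,
    fun i hi => (eu i hi).2.1, fun i hi => (ep i hi).1, fun i hi => (eq i hi).2.1⟩,
    fun i hi => ⟨(eu i hi).2.2, (ep i hi).2, (eq i hi).2.2⟩⟩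

/-- `g` is the sum of a smooth function and of a layer function. -/
def Layered (l r ε : ℝ) (m : ℕ) (K₀ K₁ : ℝ) (g : ℝ → ℝ) : Prop :=
  ∃ g0 g1 : ℝ → ℝ, DerivBound l r 1 m K₀ g0 ∧ DerivBound l r ε⁻¹ m K₁ g1 ∧
    ∀ t ∈ Icc l r, g t = g0 t + g1 t

lemma DerivBound.const_mul {l r ρ : ℝ} {g : ℝ → ℝ} (hg : DerivBound l r ρ n K g) {s : ℝ}
    (hs : 0 ≤ s) : DerivBound l r ρ n (s * K) (fun t => s * g t) := by
  have hb : ∀ {K : ℝ} {g : ℝ → ℝ}, (∀ t ∈ Icc l r, |g t| ≤ K) →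
      ∀ t ∈ Icc l r, |s * g t| ≤ s * K := fun h t ht => by
    rw [abs_mul, abs_of_nonneg hs]; exact mul_le_mul_of_nonneg_left (h t ht) hs
  induction n generalizing K g with
  | zero => exact ⟨continuous_const.mul hg.1, hb hg.2⟩
  | succ n ih =>
    obtain ⟨h1, h2, g1, h3, h4⟩ := hg
    refine ⟨continuous_const.mul h1, hb h2, fun t => s * g1 t, fun t ht => (h3 t ht).const_mul s, ?_⟩
    rw [mul_assoc]
    exact ih h4

/-- For ε ≤ 1 a smooth function is in particular one that varies on the scale ε. -/
lemma Layered.derivBound {l r : ℝ} {m : ℕ} {K₀ K₁ : ℝ} {g : ℝ → ℝ} (h : Layered l r ε m K₀ K₁ g)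
    (hg : Continuous g) (hε : 1 ≤ ε⁻¹) (hK₀ : 0 ≤ K₀) :
    DerivBound l r ε⁻¹ m (K₀ + K₁) g := by
  obtain ⟨g0, g1, h0, h1, h2⟩ := h
  exact ((h0.mono zero_le_one hε hK₀ le_rfl).add h1).congr hg fun t ht => (h2 t ht).symm

lemma QuasiOptimal.abs_le {l r : ℝ} {K₀ K₁ : ℝ} {g : ℝ → ℝ} {π : ℝ[X]} (hlr : l ≤ r)
    (hπ : QuasiOptimal l r k g π) (hε : 0 < ε) (hK₀ : 0 ≤ K₀) (hK₁ : 0 ≤ K₁)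
    (h : Layered l r ε (k + 1) K₀ K₁ g) : ∀ t ∈ Icc l r, |g t - π.eval t| ≤
      projConst k * (K₀ * (r - l) ^ (k + 1) + K₁ * min 1 ((r - l) / ε) ^ (k + 1)) := by
  obtain ⟨g0, g1, h0, h1, h2⟩ := h
  obtain ⟨χ, h3, h4⟩ := exists_approx_of_layer hlr h0 h1 h2
  have h5 : 0 ≤ r - l := by linarith
  have h6 : 0 ≤ min 1 ((r - l) / ε) := le_min zero_le_one (by positivity)
  exact hπ χ _ h3 (by positivity) h4

/-- Approximation in a layer that is resolved up to the factor `min 1 (h / ε)`. -/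
lemma DerivBound.exists_approx_min {l r : ℝ} (hlr : l ≤ r) {m : ℕ} {g : ℝ → ℝ}
    (h : DerivBound l r ε⁻¹ m K g) : ∃ χ : ℝ[X], χ.degree < m ∧
      ∀ t ∈ Icc l r, |g t - χ.eval t| ≤ K * min 1 ((r - l) / ε) ^ m := by
  rcases le_total 1 ((r - l) / ε) with h1 | h1
  · refine ⟨0, by simp, fun t ht => ?_⟩
    rw [min_eq_left h1]; simpa using h.bound t ht
  · rw [min_eq_right h1, div_eq_inv_mul]
    exact h.exists_approx hlr

/-- The properties of a layer-adapted mesh that are used in the analysis; the layer has the size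
`e i` on the element `i`. -/
structure IsLayerMesh (x : ℕ → ℝ) (n k : ℕ) (ε ρ R : ℝ) (e : ℕ → ℝ) : Prop where
  mesh : IsMesh x n
  pos_ε : 0 < ε
  ε_le : ε * (n + 1) ≤ 1
  inv_le : ((n : ℝ) + 1)⁻¹ ≤ 2 * ρ
  ρ_le : ρ ≤ 1
  one_le_R : 1 ≤ R
  width : ∀ i ≤ n, x (i + 1) - x i ≤ R * ((n : ℝ) + 1)⁻¹
  e_nonneg : ∀ i, 0 ≤ e i
  e_last : e n ≤ 1
  layer : ∀ i ≤ n, min 1 ((x (i + 1) - x i) / ε) ^ (k + 1) * e i ≤ (R * ρ) ^ (k + 1)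
  last : min 1 ((x (n + 1) - x n) / ε) ≤ R * ρ

/-- The bounds of the exact solution on the elements of the mesh. -/
structure IsLayeredSolution (x : ℕ → ℝ) (n k : ℕ) (ε M : ℝ) (e : ℕ → ℝ) (U P P1 : ℝ → ℝ) :
    Prop where
  nonneg : 0 ≤ M
  u : ∀ i ≤ n, Layered (x i) (x (i + 1)) ε (k + 1) M (M * ε * e i) U
  p : ∀ i ≤ n, Layered (x i) (x (i + 1)) ε (k + 1) M (M * e i) P
  q : ∀ i ≤ n, Layered (x i) (x (i + 1)) ε (k + 1) M (M * e i) (fun t => ε * P1 t)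

section
variable {ρ R M : ℝ} {e : ℕ → ℝ} {πu πp πq : ℕ → ℝ[X]}

/-- The bound of the errors of the projections of `P` and `Q`. -/
def projBound (k : ℕ) (R M ρ : ℝ) : ℝ := projConst k * (M * (3 ^ (k + 1) * (R * ρ) ^ (k + 1)))

/-- The bound of the errors of the projection of `U`. -/
def projBoundU (k n : ℕ) (R M ε ρ : ℝ) : ℝ :=
  projConst k * (M * ((R * ((n : ℝ) + 1)⁻¹) ^ (k + 1) + ε * (R * ρ) ^ (k + 1)))

namespace IsLayerMesh

lemma ρ_pos (h : IsLayerMesh x n k ε ρ R e) : 0 < ρ := by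
  have : 0 < ((n : ℝ) + 1)⁻¹ := by positivity
  linarith [h.inv_le]

lemma ε_le_one (h : IsLayerMesh x n k ε ρ R e) : ε ≤ 1 := by
  have hn : (0 : ℝ) ≤ n := Nat.cast_nonneg n
  linarith [mul_nonneg h.pos_ε.le hn, h.ε_le]

lemma width_pow_le (h : IsLayerMesh x n k ε ρ R e) {i : ℕ} (hi : i ≤ n) :
    (x (i + 1) - x i) ^ (k + 1) ≤ (R * ((n : ℝ) + 1)⁻¹) ^ (k + 1) :=
  pow_le_pow_left₀ (by linarith [h.mesh.lt i hi]) (h.width i hi) _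

lemma inv_pow_le (h : IsLayerMesh x n k ε ρ R e) :
    (R * ((n : ℝ) + 1)⁻¹) ^ (k + 1) ≤ 2 ^ (k + 1) * (R * ρ) ^ (k + 1) := by
  rw [← mul_pow]
  have hR := h.one_le_R
  refine pow_le_pow_left₀ (by positivity) ?_ _
  have := mul_le_mul_of_nonneg_left h.inv_le (show 0 ≤ R by linarith)
  linarith

lemma min_nonneg (h : IsLayerMesh x n k ε ρ R e) {i : ℕ} (hi : i ≤ n) :
    0 ≤ min 1 ((x (i + 1) - x i) / ε) := by
  have := h.mesh.lt i hi
  have := h.pos_ε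
  exact le_min zero_le_one (div_nonneg (by linarith) (by linarith))

/-- The smooth part contributes a power of N⁻¹ ≤ 2 ρ and the layer part a power of R ρ; the two are
collected by 2^(k+1) + 1 ≤ 3^(k+1). For U they are kept apart, since its layer part has an
additional factor ε. -/
lemma proj_bounds (h : IsLayerMesh x n k ε ρ R e) (hl : IsLayeredSolution x n k ε M e U P P1)
    {i : ℕ} (hi : i ≤ n) (hu : QuasiOptimal (x i) (x (i + 1)) k U (πu i))
    (hp : QuasiOptimal (x i) (x (i + 1)) k P (πp i))
    (hq : QuasiOptimal (x i) (x (i + 1)) k (fun t => ε * P1 t) (πq i)) :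
    (∀ t ∈ Icc (x i) (x (i + 1)), |U t - (πu i).eval t| ≤ projBoundU k n R M ε ρ) ∧
    (∀ t ∈ Icc (x i) (x (i + 1)), |P t - (πp i).eval t| ≤ projBound k R M ρ) ∧
    (∀ t ∈ Icc (x i) (x (i + 1)), |ε * P1 t - (πq i).eval t| ≤ projBound k R M ρ) := by
  have hε := h.pos_ε
  have hM := hl.nonneg
  have he := h.e_nonneg i
  have hlt := h.mesh.lt i hi
  have hC : 0 ≤ projConst k := zero_le_one.trans (one_le_projConst k)
  have h1 := mul_le_mul_of_nonneg_left (h.width_pow_le hi) hM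
  have h2 := mul_le_mul_of_nonneg_left (h.layer i hi) hM
  have h3 := mul_le_mul_of_nonneg_left h.inv_pow_le hM
  have hR := h.one_le_R
  have hρ := h.ρ_pos
  have h4 : M * (2 ^ (k + 1) * (R * ρ) ^ (k + 1)) + M * (R * ρ) ^ (k + 1) ≤
      M * (3 ^ (k + 1) * (R * ρ) ^ (k + 1)) := by
    have e1 : (2 : ℝ) ^ (k + 1) + 1 ≤ 3 ^ (k + 1) := by
      have := one_le_pow₀ (one_le_two (α := ℝ)) (n := k)
      have e2 : (2 : ℝ) ^ k ≤ 3 ^ k := pow_le_pow_left₀ (by norm_num) (by norm_num) k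
      rw [pow_succ, pow_succ]; linarith
    have e3 := mul_le_mul_of_nonneg_right e1 (show 0 ≤ M * (R * ρ) ^ (k + 1) by positivity)
    linarith
  refine ⟨fun t ht => (hu.abs_le hlt.le hε hM (by positivity) (hl.u i hi) t ht).trans ?_,
    fun t ht => (hp.abs_le hlt.le hε hM (by positivity) (hl.p i hi) t ht).trans ?_,
    fun t ht => (hq.abs_le hlt.le hε hM (by positivity) (hl.q i hi) t ht).trans ?_⟩
  · refine mul_le_mul_of_nonneg_left ?_ hC
    have h5 := mul_le_mul_of_nonneg_left h2 hε.le
    linarith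
  all_goals
    refine mul_le_mul_of_nonneg_left ?_ hC
    linarith

lemma isProjError (h : IsLayerMesh x n k ε ρ R e) (hl : IsLayeredSolution x n k ε M e U P P1)
    (hU : Continuous U) (hP : Continuous P) (hP1 : Continuous P1)
    (hπ : IsProj x n k U P (fun t => ε * P1 t) πu πp πq)
    (hopt : ∀ i ≤ n, QuasiOptimal (x i) (x (i + 1)) k U (πu i) ∧
        QuasiOptimal (x i) (x (i + 1)) k P (πp i) ∧
        QuasiOptimal (x i) (x (i + 1)) k (fun t => ε * P1 t) (πq i)) :
    IsProjError x n k (projBound k R M ρ) (projBoundU k n R M ε ρ) (fun i t => U t - (πu i).eval t)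
      (fun i t => P t - (πp i).eval t) (fun i t => ε * P1 t - (πq i).eval t) := by
  have hM := hl.nonneg
  have hε := h.pos_ε
  have hR := h.one_le_R
  have hρ := h.ρ_pos
  have hC : 0 ≤ projConst k := zero_le_one.trans (one_le_projConst k)
  refine hπ.isProjError hU hP (by fun_prop) ?_ ?_
    (fun i hi => (h.proj_bounds hl hi (hopt i hi).1 (hopt i hi).2.1 (hopt i hi).2.2).1)
    (fun i hi => (h.proj_bounds hl hi (hopt i hi).1 (hopt i hi).2.1 (hopt i hi).2.2).2.1)
    (fun i hi => (h.proj_bounds hl hi (hopt i hi).1 (hopt i hi).2.1 (hopt i hi).2.2).2.2)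
  · rw [projBoundU]; positivity
  · rw [projBound, projBoundU]
    refine mul_le_mul_of_nonneg_left (mul_le_mul_of_nonneg_left ?_ hM) hC
    have h1 := h.inv_pow_le
    have e1 : (2 : ℝ) ^ (k + 1) + 1 ≤ 3 ^ (k + 1) := by
      have := one_le_pow₀ (one_le_two (α := ℝ)) (n := k)
      have e2 : (2 : ℝ) ^ k ≤ 3 ^ k := pow_le_pow_left₀ (by norm_num) (by norm_num) k
      rw [pow_succ, pow_succ]; linarith
    have e3 := mul_le_mul_of_nonneg_right e1 (show 0 ≤ (R * ρ) ^ (k + 1) by positivity)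
    have e4 := mul_le_mul_of_nonneg_right h.ε_le_one (show 0 ≤ (R * ρ) ^ (k + 1) by positivity)
    linarith

end IsLayerMesh

end

end

/-! ### Bounding the residual for w by the rate. -/

section

variable {x : ℕ → ℝ} {n k : ℕ} {u p v w : ℕ → ℝ[X]} {a a1 b b1 c : ℝ → ℝ} {α γ K Kf D ε : ℝ}
  {f U P P1 Q1 : ℝ → ℝ} {ρ R M : ℝ} {e : ℕ → ℝ} {πu πp πq : ℕ → ℝ[X]}

/-- The rate of convergence in terms of the resolution `ρ` of the layer. -/
def layerSum (k n : ℕ) (ε ρ : ℝ) : ℝ :=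
  Real.sqrt ε * ρ ^ k + ρ ^ (k + 1) + ((n : ℝ) + 1)⁻¹ ^ k * Real.sqrt ((n : ℝ) + 1)⁻¹

namespace IsLayerMesh

lemma layerSum_terms (h : IsLayerMesh x n k ε ρ R e) :
    0 ≤ Real.sqrt ε * ρ ^ k ∧ 0 ≤ ρ ^ (k + 1) ∧
      0 ≤ ((n : ℝ) + 1)⁻¹ ^ k * Real.sqrt ((n : ℝ) + 1)⁻¹ := by
  have := h.ρ_pos
  refine ⟨?_, ?_, ?_⟩ <;> positivity

lemma last_width_le_one (h : IsLayerMesh x n k ε ρ R e) : x (n + 1) - x n ≤ 1 := by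
  linarith [(h.mesh.mem (i := n) (by omega)).1, (h.mesh.mem (i := n + 1) le_rfl).2]

lemma min_last_pow_le (h : IsLayerMesh x n k ε ρ R e) :
    min 1 ((x (n + 1) - x n) / ε) ^ k ≤ R ^ (k + 1) * ρ ^ k := by
  have hR := h.one_le_R
  have hρ := h.ρ_pos
  refine (pow_le_pow_left₀ (h.min_nonneg le_rfl) h.last k).trans ?_
  rw [mul_pow]
  exact mul_le_mul_of_nonneg_right (pow_le_pow_right₀ hR (Nat.le_succ k)) (by positivity)

/-- If the last element is at least as wide as ε, then 1 ≤ R ρ. In this case the rate is bounded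
below, and any bounded quantity is admissible. -/
lemma one_le_of_le (h : IsLayerMesh x n k ε ρ R e) (hle : ε ≤ x (n + 1) - x n) :
    1 ≤ R ^ (k + 1) * layerSum k n ε ρ := by
  have hR := h.one_le_R
  obtain ⟨h1, h2, h3⟩ := h.layerSum_terms
  have h4 := h.last
  rw [min_eq_left ((one_le_div h.pos_ε).2 hle)] at h4
  have h5 := one_le_pow₀ h4 (n := k + 1)
  rw [mul_pow] at h5
  refine h5.trans (mul_le_mul_of_nonneg_left ?_ (by positivity))
  rw [layerSum]; linarith

/-- For a width h ≤ ε the root of h is at most √ε and the power at most a multiple of ρ^k; otherwise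
`one_le_of_le` applies. This is the source of the term √ε ρ^k. -/
lemma sqrt_mul_min_pow_le (h : IsLayerMesh x n k ε ρ R e) :
    Real.sqrt (x (n + 1) - x n) * min 1 ((x (n + 1) - x n) / ε) ^ k ≤
      R ^ (k + 1) * layerSum k n ε ρ := by
  have hR := h.one_le_R
  obtain ⟨h1, h2, h3⟩ := h.layerSum_terms
  have hm := h.min_nonneg le_rfl
  rcases le_total ε (x (n + 1) - x n) with h4 | h4
  · refine le_trans ?_ (h.one_le_of_le h4)
    exact mul_le_one₀ (Real.sqrt_le_one.2 h.last_width_le_one) (by positivity)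
      (pow_le_one₀ hm (min_le_left _ _))
  · calc _ ≤ Real.sqrt ε * (R ^ (k + 1) * ρ ^ k) :=
          mul_le_mul (Real.sqrt_le_sqrt h4) h.min_last_pow_le (by positivity) (Real.sqrt_nonneg _)
      _ = R ^ (k + 1) * (Real.sqrt ε * ρ ^ k) := by ring
      _ ≤ _ := mul_le_mul_of_nonneg_left (by rw [layerSum]; linarith) (by positivity)

/-- The quotient is the width to the power k + 1/2, and the width is of order N⁻¹. -/
lemma width_pow_div_sqrt_le (h : IsLayerMesh x n k ε ρ R e) :
    (x (n + 1) - x n) ^ (k + 1) / Real.sqrt (x (n + 1) - x n) ≤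
      R ^ (k + 1) * layerSum k n ε ρ := by
  have hR := h.one_le_R
  obtain ⟨h1, h2, h3⟩ := h.layerSum_terms
  have hpos : 0 < x (n + 1) - x n := by linarith [h.mesh.lt n le_rfl]
  rw [pow_succ, mul_div_assoc, Real.div_sqrt]
  calc _ ≤ (R * ((n : ℝ) + 1)⁻¹) ^ k * Real.sqrt (R * ((n : ℝ) + 1)⁻¹) :=
        mul_le_mul (pow_le_pow_left₀ hpos.le (h.width n le_rfl) k)
          (Real.sqrt_le_sqrt (h.width n le_rfl)) (Real.sqrt_nonneg _) (by positivity)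
    _ = R ^ k * Real.sqrt R * (((n : ℝ) + 1)⁻¹ ^ k * Real.sqrt ((n : ℝ) + 1)⁻¹) := by
        rw [mul_pow, Real.sqrt_mul (by linarith)]; ring
    _ ≤ R ^ (k + 1) * (((n : ℝ) + 1)⁻¹ ^ k * Real.sqrt ((n : ℝ) + 1)⁻¹) := by
        refine mul_le_mul_of_nonneg_right ?_ h3
        rw [pow_succ]
        exact mul_le_mul_of_nonneg_left (Real.sqrt_le_left (by linarith) |>.2 (by nlinarith))
          (by positivity)
    _ ≤ _ := mul_le_mul_of_nonneg_left (by rw [layerSum]; linarith) (by positivity)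

/-- With m = min(1, h/ε) one has ε m² ≤ ε m ≤ h, so √ε m / √h ≤ 1, and √ε m^k is left. -/
lemma min_pow_div_sqrt_le (h : IsLayerMesh x n k ε ρ R e) :
    ε * min 1 ((x (n + 1) - x n) / ε) ^ (k + 1) / Real.sqrt (x (n + 1) - x n) ≤
      R ^ (k + 1) * layerSum k n ε ρ := by
  have hR := h.one_le_R
  have hε := h.pos_ε
  obtain ⟨h1, h2, h3⟩ := h.layerSum_terms
  have hpos : 0 < x (n + 1) - x n := by linarith [h.mesh.lt n le_rfl]
  have hm := h.min_nonneg le_rfl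
  have hs := Real.sqrt_pos.2 hpos
  have h4 := h.min_last_pow_le
  set m := min 1 ((x (n + 1) - x n) / ε) with hmd
  have h5 : Real.sqrt ε * m ≤ Real.sqrt (x (n + 1) - x n) := by
    refine Real.le_sqrt_of_sq_le ?_
    rw [mul_pow, Real.sq_sqrt hε.le]
    have e1 : m ≤ 1 := min_le_left _ _
    have e2 : ε * m ≤ x (n + 1) - x n := by
      rw [mul_comm, ← le_div_iff₀ hε]; exact min_le_right _ _
    calc ε * m ^ 2 = ε * m * m := by ring
      _ ≤ ε * m * 1 := mul_le_mul_of_nonneg_left e1 (by positivity)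
      _ ≤ _ := by linarith
  calc ε * m ^ (k + 1) / Real.sqrt (x (n + 1) - x n)
      = Real.sqrt ε * m ^ k * (Real.sqrt ε * m) / Real.sqrt (x (n + 1) - x n) := by
        nth_rewrite 1 [← Real.mul_self_sqrt hε.le]; ring
    _ ≤ Real.sqrt ε * m ^ k := by
        rw [div_le_iff₀ hs]
        exact mul_le_mul_of_nonneg_left h5 (by positivity)
    _ ≤ Real.sqrt ε * (R ^ (k + 1) * ρ ^ k) := mul_le_mul_of_nonneg_left h4 (Real.sqrt_nonneg _)
    _ = R ^ (k + 1) * (Real.sqrt ε * ρ ^ k) := by ring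
    _ ≤ _ := mul_le_mul_of_nonneg_left (by rw [layerSum]; linarith) (by positivity)

lemma projBound_le (h : IsLayerMesh x n k ε ρ R e) (hM : 0 ≤ M) :
    projBound k R M ρ ≤ projBound k R M 1 * layerSum k n ε ρ := by
  have hR := h.one_le_R
  obtain ⟨h1, h2, h3⟩ := h.layerSum_terms
  have hC : 0 ≤ projConst k := zero_le_one.trans (one_le_projConst k)
  have : projBound k R M ρ = projBound k R M 1 * ρ ^ (k + 1) := by
    rw [projBound, projBound, mul_pow, mul_one]; ring
  rw [this]
  exact mul_le_mul_of_nonneg_left (by rw [layerSum]; linarith) (by rw [projBound]; positivity)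

lemma projBound_le_const (h : IsLayerMesh x n k ε ρ R e) (hM : 0 ≤ M) :
    projBound k R M ρ ≤ projBound k R M 1 := by
  have hR := h.one_le_R
  have hρ := h.ρ_pos
  have hC : 0 ≤ projConst k := zero_le_one.trans (one_le_projConst k)
  rw [projBound, projBound]
  gcongr
  exact h.ρ_le

/-- The loss √N turns N^(-(k+1)) into N^(-(k+1/2)); in the layer part it is absorbed by ε ≤ N⁻¹. -/
lemma sqrt_mul_projBoundU_le (h : IsLayerMesh x n k ε ρ R e) (hM : 0 ≤ M) :
    Real.sqrt (n + 1) * projBoundU k n R M ε ρ ≤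
      projConst k * (M * R ^ (k + 1)) * layerSum k n ε ρ := by
  have hR := h.one_le_R
  have hε := h.pos_ε
  obtain ⟨h1, h2, h3⟩ := h.layerSum_terms
  have hC : 0 ≤ projConst k := zero_le_one.trans (one_le_projConst k)
  have hn : (0 : ℝ) ≤ n := Nat.cast_nonneg n
  have hn1 : (1 : ℝ) ≤ n + 1 := by linarith
  have e1 : Real.sqrt (n + 1) * ((n : ℝ) + 1)⁻¹ = Real.sqrt ((n : ℝ) + 1)⁻¹ := by
    rw [Real.sqrt_inv, ← div_eq_mul_inv, Real.sqrt_div_self']; simp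
  have e2 : Real.sqrt (n + 1) * ε ≤ 1 := by
    have : Real.sqrt (n + 1 : ℝ) ≤ n + 1 := (Real.sqrt_le_left (by linarith)).2 (by nlinarith)
    calc Real.sqrt (n + 1 : ℝ) * ε ≤ (n + 1) * ε := mul_le_mul_of_nonneg_right this hε.le
      _ ≤ 1 := by linarith [h.ε_le]
  calc Real.sqrt (n + 1) * projBoundU k n R M ε ρ
      = projConst k * (M * R ^ (k + 1)) * (((n : ℝ) + 1)⁻¹ ^ k *
          (Real.sqrt (n + 1) * ((n : ℝ) + 1)⁻¹) + Real.sqrt (n + 1) * ε * ρ ^ (k + 1)) := by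
        rw [projBoundU, mul_pow, mul_pow]; ring
    _ ≤ _ := by
        refine mul_le_mul_of_nonneg_left ?_ (by positivity)
        rw [e1, layerSum]
        have := mul_le_mul_of_nonneg_right e2 h2
        linarith

end IsLayerMesh

/-- The smoothness of the data on the last element. -/
structure IsSmoothData (x : ℕ → ℝ) (n k : ℕ) (K Kf : ℝ) (a1 b c f : ℝ → ℝ) : Prop where
  nonneg : 0 ≤ Kf
  a1 : DerivBound (x n) (x (n + 1)) 1 k K a1
  b : DerivBound (x n) (x (n + 1)) 1 k K b
  c : DerivBound (x n) (x (n + 1)) 1 k K c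
  f : DerivBound (x n) (x (n + 1)) 1 k Kf f

/-- On an element of width at most ε the function a - a(x_n) is of order ε, and with respect to the
scale ε so are its rescaled derivatives. This factor ε compensates the size ε⁻¹ of u''. -/
lemma derivBound_sub_const (hx : IsMesh x n) (hc : IsCoeff a a1 b b1 c α γ K)
    (ha : DerivBound (x n) (x (n + 1)) 1 k K a1) (hε : 0 < ε) (hε1 : ε ≤ 1)
    (hle : x (n + 1) - x n ≤ ε) :
    DerivBound (x n) (x (n + 1)) ε⁻¹ k (K * ε) (fun t => a t - a (x n)) := by
  have hca := hc.ca
  have hK := hc.one_le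
  have hb : ∀ t ∈ Icc (x n) (x (n + 1)), |a t - a (x n)| ≤ K * ε := fun t ht =>
    (abs_sub_left_le hx hca hc.ca1 hc.ba1 hc.da le_rfl ht).trans
      (mul_le_mul_of_nonneg_left hle (by linarith))
  cases k with
  | zero => exact ⟨by fun_prop, hb⟩
  | succ k =>
    refine ⟨by fun_prop, hb, a1, fun t ht =>
      (hc.da t (Ioo_subset_of_mesh hx le_rfl ht)).sub_const _, ?_⟩
    refine ha.pred.mono zero_le_one ((one_le_inv₀ hε).2 hε1) (by linarith) ?_
    rw [mul_assoc, mul_inv_cancel₀ hε.ne', mul_one]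

/-- The constant in the bound of the residual for the component `w`. -/
def lastConst (k : ℕ) (K Kf M R : ℝ) : ℝ :=
  (Kf + 2 ^ k * (K * (2 * M)) + 2 ^ k * (K * (2 * M))) * R ^ (k + 1) +
  ((2 ^ k * (K * (2 * M)) + 2 ^ k * (K * (2 * M))) * R ^ (k + 1) +
    2 * K * invK (k + 1) * projBound k R M 1 +
    2 * K * invK (k + 1) * (2 * M + projBound k R M 1) * R ^ (k + 1)) +
  4 * K * invK (k + 1) * (projConst k * (M * (2 * R ^ (k + 1))))

/-- The three terms of `IsSplit.third_w_eq` are estimated separately. The function f - b u' - c u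
varies on the scale ε, and its distance from polynomials of degree less than k gives √h min(1,
h/ε)^k. The diffusion term is treated according to whether h ≤ ε. In the convection term the
projection error of u is divided by √h, which the preceding lemmas allow. -/
lemma IsLayerMesh.abs_third_w_le (h : IsLayerMesh x n k ε ρ R e)
    (hl : IsLayeredSolution x n k ε M e U P P1) (hc : IsCoeff a a1 b b1 c α γ K)
    (hd : IsSmoothData x n k K Kf a1 b c f)
    (he : IsExact ε a a1 b c f U P P1 Q1) (hs : IsSplit x n k D u p v w)
    (hπ : IsProj x n k U P (fun t => ε * P1 t) πu πp πq)
    (hopt : ∀ i ≤ n, QuasiOptimal (x i) (x (i + 1)) k U (πu i) ∧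
        QuasiOptimal (x i) (x (i + 1)) k P (πp i) ∧
        QuasiOptimal (x i) (x (i + 1)) k (fun t => ε * P1 t) (πq i)) :
    |-aform x n (fun _ => 1) (fun i t => ε * P1 t - (πq i).eval t) w +
      aform x n a (fun i t => P t - (πp i).eval t) w +
      bform x n b b1 c (fun i t => U t - (πu i).eval t) w| ≤
      lastConst k K Kf M R * layerSum k n ε ρ * l2 (x n) (x (n + 1)) (ev w n) := by
  have hx := h.mesh
  have hε := h.pos_ε
  have hε1 := h.ε_le_one
  have hεi : 1 ≤ ε⁻¹ := (one_le_inv₀ hε).2 hε1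
  have hM := hl.nonneg
  have hK := hc.one_le
  have hR := h.one_le_R
  have hI := invK_pos (k + 1)
  have hKf := hd.nonneg
  have hlt := hx.lt n le_rfl
  have hcU := he.cu
  have hcP := he.cp
  have hcP1 := he.cp1
  have hcf := he.cf
  have hca := hc.ca
  have hca1 := hc.ca1
  have hcb := hc.cb
  have hcc := hc.cc
  have hC : 0 ≤ projConst k := zero_le_one.trans (one_le_projConst k)
  have herr := h.isProjError hl hcU hcP hcP1 hπ hopt
  have he0 := h.e_nonneg n
  have he1 := h.e_last
  have hMe : M + M * e n ≤ 2 * M := by linarith [mul_le_mul_of_nonneg_left he1 hM]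
  have hMe0 : 0 ≤ M + M * e n := by positivity
  have dP : DerivBound (x n) (x (n + 1)) ε⁻¹ k (2 * M) P :=
    ((hl.p n le_rfl).derivBound hcP hεi hM).pred.mono (by positivity) le_rfl hMe0 hMe
  have dQ : DerivBound (x n) (x (n + 1)) ε⁻¹ k (2 * M) (fun t => ε * P1 t) :=
    ((hl.q n le_rfl).derivBound (by fun_prop) hεi hM).pred.mono (by positivity) le_rfl hMe0 hMe
  have dU : DerivBound (x n) (x (n + 1)) ε⁻¹ k (2 * M) U := by
    refine ((hl.u n le_rfl).derivBound hcU hεi hM).pred.mono (by positivity) le_rfl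
      (by positivity) ?_
    have : M * ε * e n ≤ M * e n := mul_le_mul_of_nonneg_right (mul_le_of_le_one_right hM hε1) he0
    linarith
  have dP1 : DerivBound (x n) (x (n + 1)) ε⁻¹ k (ε⁻¹ * (2 * M)) P1 :=
    (dQ.const_mul (inv_nonneg.2 hε.le)).congr hcP1 fun t _ => inv_mul_cancel_left₀ hε.ne' _
  have da1 := hd.a1.mono zero_le_one hεi (by linarith) le_rfl
  have db := hd.b.mono zero_le_one hεi (by linarith) le_rfl
  have dc := hd.c.mono zero_le_one hεi (by linarith) le_rfl
  have df := hd.f.mono zero_le_one hεi hKf le_rfl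
  have hK0 : 0 ≤ K := by linarith
  have h2M : 0 ≤ 2 * M := by linarith
  have hρ0 : 0 ≤ ε⁻¹ := by positivity
  have dG : DerivBound (x n) (x (n + 1)) ε⁻¹ k
      (Kf + (2 ^ k * (K * (2 * M)) + 2 ^ k * (K * (2 * M))))
      (fun t => f t - (b t * P t + c t * U t)) :=
    (df.add ((db.mul dP hK0 h2M hρ0).add (dc.mul dU hK0 h2M hρ0)).neg).congr (by fun_prop)
      fun t _ => by ring
  set W := l2 (x n) (x (n + 1)) (ev w n) with hW
  have hW0 : 0 ≤ W := l2_nonneg _ _ _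
  have hs1 : Real.sqrt (x (n + 1) - x n) ≤ 1 := Real.sqrt_le_one.2 h.last_width_le_one
  have hs0 := Real.sqrt_nonneg (x (n + 1) - x n)
  have hmk := h.sqrt_mul_min_pow_le
  have hm0 := h.min_nonneg le_rfl
  obtain ⟨l1, l2', l3⟩ := h.layerSum_terms
  have hpb := h.projBound_le hM
  have hpb0 : 0 ≤ projBound k R M ρ := herr.nonneg.trans herr.le
  have hpb1 := h.projBound_le_const hM
  have hone := h.one_le_of_le
  have hT0 : 0 ≤ layerSum k n ε ρ := by rw [layerSum]; linarith
  rw [hs.third_w_eq hx hc he (hπ.deg_q n)]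
  have t1 : |∫ t in x n..x (n + 1), (f t - (b t * P t + c t * U t)) * (w n).eval t| ≤
      (Kf + 2 ^ k * (K * (2 * M)) + 2 ^ k * (K * (2 * M))) * R ^ (k + 1) * layerSum k n ε ρ * W := by
    obtain ⟨χ, hχ, hb⟩ := dG.exists_approx_min hlt.le
    refine (hs.abs_integral_mul_w_le hx (by fun_prop) hχ (by positivity) hb).trans ?_
    refine mul_le_mul_of_nonneg_right ?_ hW0
    have := mul_le_mul_of_nonneg_left hmk
      (show 0 ≤ Kf + 2 ^ k * (K * (2 * M)) + 2 ^ k * (K * (2 * M)) by positivity)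
    linarith
  have t2 : |∫ t in x n..x (n + 1), (a1 t * (πp n).eval t + a t * (derivative (πp n)).eval t) *
      (w n).eval t| ≤
      ((2 ^ k * (K * (2 * M)) + 2 ^ k * (K * (2 * M))) * R ^ (k + 1) +
    2 * K * invK (k + 1) * projBound k R M 1 +
    2 * K * invK (k + 1) * (2 * M + projBound k R M 1) * R ^ (k + 1)) * layerSum k n ε ρ * W := by
    have q0 : 0 ≤ projBound k R M 1 := hpb0.trans hpb1
    have z1 : 0 ≤ 2 * K * invK (k + 1) * (2 * M + projBound k R M 1) * R ^ (k + 1) *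
      layerSum k n ε ρ * W := by positivity
    have z2 : 0 ≤ ((2 ^ k * (K * (2 * M)) + 2 ^ k * (K * (2 * M))) * R ^ (k + 1) +
      2 * K * invK (k + 1) * projBound k R M 1) * layerSum k n ε ρ * W := by positivity
    -- For h ≤ ε the refined estimate applies, in which a - a(x_n) makes up for the size of u''. For
    -- h ≥ ε the rate is bounded below, and the crude estimate with a bound of the projection is
    -- enough.
    rcases le_total (x (n + 1) - x n) ε with hle | hle
    · have dA : DerivBound (x n) (x (n + 1)) ε⁻¹ k
          (2 ^ k * (K * (2 * M)) + 2 ^ k * (K * ε * (ε⁻¹ * (2 * M))))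
          (fun t => a1 t * P t + (a t - a (x n)) * P1 t) :=
        (da1.mul dP hK0 h2M hρ0).add ((derivBound_sub_const hx hc hd.a1 hε hε1 hle).mul dP1
          (by positivity) (by positivity) hρ0)
      rw [show K * ε * (ε⁻¹ * (2 * M)) = K * (2 * M) by field_simp] at dA
      obtain ⟨χ, hχ, hb⟩ := dA.exists_approx_min hlt.le
      refine (hs.abs_diffusion_w_le hx hc he (hπ.deg_p n) hχ (by positivity) hpb0 hb
        (herr.bz n le_rfl)).trans ?_
      have g1 := mul_le_mul_of_nonneg_left hmk
        (show 0 ≤ 2 ^ k * (K * (2 * M)) + 2 ^ k * (K * (2 * M)) by positivity)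
      have g2 : projBound k R M ρ * Real.sqrt (x (n + 1) - x n) ≤
          projBound k R M 1 * layerSum k n ε ρ :=
        (mul_le_of_le_one_right hpb0 hs1).trans hpb
      have g3 := mul_le_mul_of_nonneg_left g2 (show 0 ≤ 2 * K * invK (k + 1) by positivity)
      have g4 := mul_le_mul_of_nonneg_right (add_le_add g1 g3) hW0
      linarith
    · have hS : ∀ t ∈ Icc (x n) (x (n + 1)), |(πp n).eval t| ≤ 2 * M + projBound k R M 1 := by
        intro t ht
        have g1 := dP.bound t ht
        have g2 := herr.bz n le_rfl t ht
        have g3 := abs_sub (P t) (P t - (πp n).eval t)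
        rw [sub_sub_cancel] at g3
        linarith
      refine (hs.abs_diffusion_w_le' hx hc (hπ.deg_p n) (by positivity) hS).trans ?_
      have g1 : Real.sqrt (x (n + 1) - x n) ≤ R ^ (k + 1) * layerSum k n ε ρ := hs1.trans (hone hle)
      have g2 := mul_le_mul_of_nonneg_left g1
        (show 0 ≤ 2 * K * invK (k + 1) * (2 * M + projBound k R M 1) by positivity)
      have g3 := mul_le_mul_of_nonneg_right g2 hW0
      linarith
  have t3 : |bform x n b b1 c (fun i t => U t - (πu i).eval t) w| ≤
      4 * K * invK (k + 1) * (projConst k * (M * (2 * R ^ (k + 1)))) * layerSum k n ε ρ * W := by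
    have hpos : 0 < x (n + 1) - x n := by linarith
    have g0 := (hopt n le_rfl).1.abs_le hlt.le hε hM (by positivity) (hl.u n le_rfl)
    -- On the last element the size of the layer is simply estimated by 1; the factor ε of the layer
    -- part of u has to be kept for `min_pow_div_sqrt_le`.
    set m := min 1 ((x (n + 1) - x n) / ε)
    have g1 : ∀ t ∈ Icc (x n) (x (n + 1)), |U t - (πu n).eval t| ≤
        projConst k * (M * ((x (n + 1) - x n) ^ (k + 1) + ε * m ^ (k + 1))) := by
      refine fun t ht => (g0 t ht).trans (mul_le_mul_of_nonneg_left ?_ hC)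
      have : M * ε * e n * m ^ (k + 1) ≤ M * ε * 1 * m ^ (k + 1) := by gcongr
      linarith
    refine (hs.abs_bform_w_le hx hc (y := fun i t => U t - (πu i).eval t) (by fun_prop)
      (herr.prev_y le_rfl) (herr.y_right n le_rfl) (by positivity) g1).trans ?_
    refine mul_le_mul_of_nonneg_right ?_ hW0
    rw [mul_assoc (4 * K * invK (k + 1))]
    refine mul_le_mul_of_nonneg_left ?_ (by positivity)
    rw [mul_div_assoc, mul_assoc]
    refine mul_le_mul_of_nonneg_left ?_ hC
    rw [mul_div_assoc, mul_assoc]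
    refine mul_le_mul_of_nonneg_left ?_ hM
    rw [add_div]
    have := h.width_pow_div_sqrt_le
    have := h.min_pow_div_sqrt_le
    linarith
  refine (abs_add_le _ _).trans ((add_le_add ((abs_add_le _ _).trans (add_le_add t1 t2)) t3).trans ?_)
  rw [lastConst]
  linarith

end

/-! ### The data and the exact solution in extended form. -/

section

variable {x : ℕ → ℝ} {n k : ℕ} {a b c f u : ℝ → ℝ} {α γ K ε M σ : ℝ}

lemma uniqueDiffOn_unitI : UniqueDiffOn ℝ (Icc (0 : ℝ) 1) := uniqueDiffOn_Icc zero_lt_one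

lemma D_eq (g : ℝ → ℝ) : D g = iteratedDerivWithin 1 g (Icc 0 1) := by
  funext t
  rw [iteratedDerivWithin_succ, iteratedDerivWithin_zero]
  rfl

lemma D_iteratedDerivWithin (m : ℕ) (g : ℝ → ℝ) :
    D (iteratedDerivWithin m g (Icc 0 1)) = iteratedDerivWithin (m + 1) g (Icc 0 1) := by
  funext t
  rw [iteratedDerivWithin_succ]
  rfl

lemma D_D_eq (g : ℝ → ℝ) : D (D g) = iteratedDerivWithin 2 g (Icc 0 1) := by
  rw [D_eq g, D_iteratedDerivWithin]

lemma D_D_D_eq (g : ℝ → ℝ) : D (D (D g)) = iteratedDerivWithin 3 g (Icc 0 1) := by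
  rw [D_eq g, D_iteratedDerivWithin, D_iteratedDerivWithin]

lemma hasDerivWithinAt_D {g : ℝ → ℝ} (hg : DifferentiableOn ℝ g (Icc 0 1)) {t : ℝ}
    (ht : t ∈ Icc (0 : ℝ) 1) : HasDerivWithinAt g (D g t) (Icc 0 1) t :=
  (hg t ht).hasDerivWithinAt

lemma hasDerivAt_ext_D {g : ℝ → ℝ} (hg : DifferentiableOn ℝ g (Icc 0 1)) {t : ℝ}
    (ht : t ∈ Ioo (0 : ℝ) 1) : HasDerivAt (ext g) (ext (D g) t) t :=
  hasDerivAt_ext ht (hasDerivWithinAt_D hg (Ioo_subset_Icc_self ht))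

lemma differentiableOn_iteratedDerivWithin_unitI {g : ℝ → ℝ} {N m : ℕ}
    (hg : ContDiffOn ℝ (N : WithTop ℕ∞) g (Icc 0 1)) (hm : m < N) :
    DifferentiableOn ℝ (iteratedDerivWithin m g (Icc 0 1)) (Icc 0 1) :=
  hg.differentiableOn_iteratedDerivWithin (by exact_mod_cast hm) uniqueDiffOn_unitI

lemma continuous_ext_iteratedDerivWithin {g : ℝ → ℝ} {N m : ℕ}
    (hg : ContDiffOn ℝ (N : WithTop ℕ∞) g (Icc 0 1)) (hm : m ≤ N) :
    Continuous (ext (iteratedDerivWithin m g (Icc 0 1))) :=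
  continuous_ext (hg.continuousOn_iteratedDerivWithin (by exact_mod_cast hm) uniqueDiffOn_unitI)

lemma contDiffOn_nat {g : ℝ → ℝ} (hg : ContDiffOn ℝ ∞ g (Icc 0 1)) (N : ℕ) :
    ContDiffOn ℝ (N : WithTop ℕ∞) g (Icc 0 1) :=
  hg.of_le (by exact_mod_cast le_top)

/-- The bounds on the coefficients are assumed in the open interval only; continuity carries them to
the end points, which are the values of the extension outside. -/
lemma le_ext_of_Ioo {g : ℝ → ℝ} (hg : ContinuousOn g (Icc 0 1)) {s : ℝ}
    (h : ∀ t ∈ Ioo (0 : ℝ) 1, s ≤ g t) (t : ℝ) : s ≤ ext g t := by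
  have hcl : closure (Ioo (0 : ℝ) 1) = Icc 0 1 := closure_Ioo zero_ne_one
  refine le_on_closure (f := fun _ => s) (g := g) h continuousOn_const (hcl ▸ hg) ?_
  rw [hcl]
  exact clamp_mem t

lemma isCoeff_ext (ha : ContDiffOn ℝ ∞ a (Icc 0 1)) (hb : ContDiffOn ℝ ∞ b (Icc 0 1))
    (hc : ContDiffOn ℝ ∞ c (Icc 0 1)) (hα : 0 < α) (hγ : 0 < γ)
    (haα : ∀ t ∈ Ioo (0 : ℝ) 1, α ≤ a t) (hcb : ∀ t ∈ Ioo (0 : ℝ) 1, γ ≤ c t - 1 / 2 * D b t)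
    (hK : 1 ≤ K)
    (hKa : ∀ j ≤ 1, ∀ t ∈ Icc (0 : ℝ) 1, |iteratedDerivWithin j a (Icc 0 1) t| ≤ K)
    (hKb : ∀ j ≤ 1, ∀ t ∈ Icc (0 : ℝ) 1, |iteratedDerivWithin j b (Icc 0 1) t| ≤ K)
    (hKc : ∀ j ≤ 1, ∀ t ∈ Icc (0 : ℝ) 1, |iteratedDerivWithin j c (Icc 0 1) t| ≤ K) :
    IsCoeff (ext a) (ext (D a)) (ext b) (ext (D b)) (ext c) α γ K where
  ca := continuous_ext ha.continuousOn
  ca1 := by rw [D_eq]; exact continuous_ext_iteratedDerivWithin (contDiffOn_nat ha 1) le_rfl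
  cb := continuous_ext hb.continuousOn
  cb1 := by rw [D_eq]; exact continuous_ext_iteratedDerivWithin (contDiffOn_nat hb 1) le_rfl
  cc := continuous_ext hc.continuousOn
  one_le := hK
  ba t := by simpa [ext] using hKa 0 zero_le_one _ (clamp_mem t)
  ba1 t := by rw [D_eq]; exact hKa 1 le_rfl _ (clamp_mem t)
  bb t := by simpa [ext] using hKb 0 zero_le_one _ (clamp_mem t)
  bb1 t := by rw [D_eq]; exact hKb 1 le_rfl _ (clamp_mem t)
  bc t := by simpa [ext] using hKc 0 zero_le_one _ (clamp_mem t)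
  da t ht := hasDerivAt_ext_D (ha.differentiableOn (by simp)) ht
  db t ht := hasDerivAt_ext_D (hb.differentiableOn (by simp)) ht
  pos_α := hα
  pos_γ := hγ
  le_a := le_ext_of_Ioo ha.continuousOn haα
  le_c t := le_ext_of_Ioo (g := fun t => c t - 1 / 2 * D b t) (by
    have h1 := (contDiffOn_nat hb 1).continuousOn_iteratedDerivWithin (m := 1) (by simp)
      uniqueDiffOn_unitI
    rw [← D_eq] at h1
    exact hc.continuousOn.sub (continuousOn_const.mul h1)) hcb t

lemma IsExactSolution.isExact (hu : IsExactSolution ε a b c f u)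
    (ha : ContDiffOn ℝ ∞ a (Icc 0 1)) (hf : ContDiffOn ℝ ∞ f (Icc 0 1)) :
    IsExact ε (ext a) (ext (D a)) (ext b) (ext c) (ext f) (ext u) (ext (D u)) (ext (D (D u)))
      (ext fun t => ε * D (D (D u)) t) := by
  have h3 : ContDiffOn ℝ ((3 : ℕ) : WithTop ℕ∞) u (Icc 0 1) := by exact_mod_cast hu.smooth
  have d1 : DifferentiableOn ℝ (D u) (Icc 0 1) := by
    rw [D_eq]; exact differentiableOn_iteratedDerivWithin_unitI h3 (by norm_num)
  have d2 : DifferentiableOn ℝ (D (D u)) (Icc 0 1) := by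
    rw [D_D_eq]; exact differentiableOn_iteratedDerivWithin_unitI h3 (by norm_num)
  have c3 : ContinuousOn (D (D (D u))) (Icc 0 1) := by
    rw [D_D_D_eq]; exact h3.continuousOn_iteratedDerivWithin (by simp) uniqueDiffOn_unitI
  refine ⟨continuous_ext hf.continuousOn, continuous_ext h3.continuousOn,
    continuous_ext d1.continuousOn, continuous_ext d2.continuousOn,
    continuous_ext (continuousOn_const.mul c3),
    fun t ht => hasDerivAt_ext_D (h3.differentiableOn (by norm_num)) ht,
    fun t ht => hasDerivAt_ext_D d1 ht, fun t ht => ?_, fun t ht => ?_, ?_, ?_, ?_⟩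
  · have ht' := Ioo_subset_Icc_self ht
    have := (hasDerivAt_ext_D d2 ht).const_mul ε
    rw [ext_of_mem _ ht'] at this
    rwa [ext_of_mem _ ht']
  · have ht' := Ioo_subset_Icc_self ht
    have h1 := hu.equation t ht
    have h2 : D (fun y => a y * D u y) t = D a t * D u t + a t * D (D u) t :=
      ((hasDerivWithinAt_D (ha.differentiableOn (by simp)) ht').mul
        (hasDerivWithinAt_D d1 ht')).derivWithin (uniqueDiffOn_unitI t ht')
    rw [h2] at h1
    simp only [ext_of_mem _ ht']
    exact h1
  · rw [ext_of_mem _ (by simp)]; exact hu.left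
  · rw [ext_of_mem _ (by simp)]; exact hu.right
  · rw [ext_of_mem _ (by simp)]; exact hu.right_deriv

/-- Relative to the derivative of order m, each further derivative of the layer part costs ε⁻¹,
since ε^(1-(m+j)) = ε^(1-m) ε^(-j). The exponential is replaced by its bound e on the element. -/
lemma Layered.of_decomposition {ubar ulay : ℝ → ℝ} {l r e : ℝ} {m N : ℕ} (hl : 0 ≤ l) (hr : r ≤ 1)
    (hbar : ContDiffOn ℝ (N : WithTop ℕ∞) ubar (Icc 0 1))
    (hlay : ContDiffOn ℝ (N : WithTop ℕ∞) ulay (Icc 0 1)) (hmn : m + n ≤ N) (hε : 0 < ε)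
    (hM : 0 ≤ M) (hadd : ∀ t ∈ Icc (0 : ℝ) 1, u t = ubar t + ulay t)
    (hbb : ∀ j ≤ N, ∀ t ∈ Icc (0 : ℝ) 1, |iteratedDerivWithin j ubar (Icc 0 1) t| ≤ M)
    (hbl : ∀ j ≤ N, ∀ t ∈ Icc (0 : ℝ) 1, |iteratedDerivWithin j ulay (Icc 0 1) t| ≤
        M * ε ^ (1 - (j : ℤ)) * Real.exp (-(α * (1 - t)) / ε))
    (he : ∀ t ≤ r, Real.exp (-(α * (1 - t)) / ε) ≤ e) :
    Layered l r ε n M (M * ε ^ (1 - (m : ℤ)) * e) (ext (iteratedDerivWithin m u (Icc 0 1))) := by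
  have hsub : ∀ t ∈ Icc l r, t ∈ Icc (0 : ℝ) 1 := fun t ht => ⟨hl.trans ht.1, ht.2.trans hr⟩
  refine ⟨ext (iteratedDerivWithin m ubar (Icc 0 1)), ext (iteratedDerivWithin m ulay (Icc 0 1)),
    DerivBound.of_iteratedDerivWithin hl hr hbar hmn fun j hj t ht => ?_,
    DerivBound.of_iteratedDerivWithin hl hr hlay hmn fun j hj t ht => ?_, fun t ht => ?_⟩
  · rw [one_pow, mul_one]
    exact hbb _ (by omega) t (hsub t ht)
  · refine (hbl _ (by omega) t (hsub t ht)).trans ?_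
    have h1 : ε ^ (1 - ((m + j : ℕ) : ℤ)) = ε ^ (1 - (m : ℤ)) * ε⁻¹ ^ j := by
      rw [show (1 : ℤ) - ((m + j : ℕ) : ℤ) = (1 - (m : ℤ)) - (j : ℤ) by push_cast; ring,
        zpow_sub₀ hε.ne', zpow_natCast, inv_pow, div_eq_mul_inv]
    rw [h1]
    have h2 := he t ht.2
    have h3 : 0 ≤ M * (ε ^ (1 - (m : ℤ)) * ε⁻¹ ^ j) := by positivity
    calc _ ≤ M * (ε ^ (1 - (m : ℤ)) * ε⁻¹ ^ j) * e := mul_le_mul_of_nonneg_left h2 h3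
      _ = _ := by ring
  · have ht' := hsub t ht
    rw [ext_of_mem _ ht', ext_of_mem _ ht', ext_of_mem _ ht',
      iteratedDerivWithin_congr hadd ht']
    have hm : ((m : ℕ) : WithTop ℕ∞) ≤ (N : WithTop ℕ∞) := by exact_mod_cast (by omega : m ≤ N)
    exact iteratedDerivWithin_fun_add ht' uniqueDiffOn_unitI ((hbar t ht').of_le hm)
      ((hlay t ht').of_le hm)

/-- The orders m = 0, 1, 2 give layer parts of size ε, 1 and ε⁻¹, and the last one is compensated by
the factor ε in q = ε u''. With k + 1 further derivatives for the approximation this uses the orders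
up to k + 3. The exponential increases with t, so it is evaluated at the right end of the element.
-/
lemma HasLayerDecomposition.isLayeredSolution (hx : IsMesh x n) (hα : 0 < α) (hε : 0 < ε)
    (hε1 : ε ≤ 1) (hu : HasLayerDecomposition (k + 3) M ε α u) :
    IsLayeredSolution x n k ε M (fun i => Real.exp (-(α * (1 - x (i + 1))) / ε)) (ext u)
      (ext (D u)) (ext (D (D u))) := by
  obtain ⟨ubar, ulay, h1, h2, h3, h4⟩ := hu
  have hM : 0 ≤ M := (abs_nonneg _).trans (h4 0 (by omega) 0 (by simp)).1
  have he : ∀ i, ∀ t ≤ x (i + 1), Real.exp (-(α * (1 - t)) / ε) ≤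
      Real.exp (-(α * (1 - x (i + 1))) / ε) := by
    intro i t ht
    rw [Real.exp_le_exp, div_le_div_iff_of_pos_right hε, neg_le_neg_iff]
    exact mul_le_mul_of_nonneg_left (by linarith) hα.le
  have hL : ∀ m : ℕ, m ≤ 2 → ∀ i ≤ n, Layered (x i) (x (i + 1)) ε (k + 1) M
      (M * ε ^ (1 - (m : ℤ)) * Real.exp (-(α * (1 - x (i + 1))) / ε))
      (ext (iteratedDerivWithin m u (Icc 0 1))) := fun m hm i hi =>
    Layered.of_decomposition (N := k + 3) (hx.mem (by omega)).1 (hx.mem (by omega)).2 h1 h2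
      (by omega) hε hM h3 (fun j hj t ht => (h4 j hj t ht).1) (fun j hj t ht => (h4 j hj t ht).2)
      (he i)
  refine ⟨hM, fun i hi => ?_, fun i hi => ?_, fun i hi => ?_⟩
  · simpa using hL 0 (by omega) i hi
  · rw [D_eq]
    simpa using hL 1 (by omega) i hi
  · rw [D_D_eq]
    obtain ⟨g0, g1, e0, e1, e2⟩ := hL 2 le_rfl i hi
    refine ⟨fun t => ε * g0 t, fun t => ε * g1 t, (e0.const_mul hε.le).mono zero_le_one le_rfl
      (by positivity) (mul_le_of_le_one_left hM hε1), ?_, fun t ht => by simp only [e2 t ht, mul_add]⟩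
    have := e1.const_mul hε.le
    rwa [show ε * (M * ε ^ (1 - ((2 : ℕ) : ℤ)) * Real.exp (-(α * (1 - x (i + 1))) / ε)) =
      M * Real.exp (-(α * (1 - x (i + 1))) / ε) by norm_num; field_simp] at this

lemma isSmoothData_ext {Kf : ℝ} (hx : IsMesh x n) (ha : ContDiffOn ℝ ∞ a (Icc 0 1))
    (hb : ContDiffOn ℝ ∞ b (Icc 0 1)) (hc : ContDiffOn ℝ ∞ c (Icc 0 1))
    (hf : ContDiffOn ℝ ∞ f (Icc 0 1))
    (hKa : ∀ j ≤ k + 1, ∀ t ∈ Icc (0 : ℝ) 1, |iteratedDerivWithin j a (Icc 0 1) t| ≤ K)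
    (hKb : ∀ j ≤ k + 1, ∀ t ∈ Icc (0 : ℝ) 1, |iteratedDerivWithin j b (Icc 0 1) t| ≤ K)
    (hKc : ∀ j ≤ k + 1, ∀ t ∈ Icc (0 : ℝ) 1, |iteratedDerivWithin j c (Icc 0 1) t| ≤ K)
    (hKf : ∀ j ≤ k + 1, ∀ t ∈ Icc (0 : ℝ) 1, |iteratedDerivWithin j f (Icc 0 1) t| ≤ Kf) :
    IsSmoothData x n k K Kf (ext (D a)) (ext b) (ext c) (ext f) := by
  have hs := hx.subset (le_refl n)
  have h : ∀ {g : ℝ → ℝ} {K : ℝ} {m : ℕ}, ContDiffOn ℝ ∞ g (Icc 0 1) →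
      (∀ j ≤ k + 1, ∀ t ∈ Icc (0 : ℝ) 1, |iteratedDerivWithin j g (Icc 0 1) t| ≤ K) → m ≤ 1 →
      DerivBound (x n) (x (n + 1)) 1 k K (ext (iteratedDerivWithin m g (Icc 0 1))) := by
    intro g K m hg hK hm
    refine DerivBound.of_iteratedDerivWithin (hx.mem (by omega)).1 (hx.mem le_rfl).2
      (contDiffOn_nat hg (m + k)) le_rfl fun j hj t ht => ?_
    rw [one_pow, mul_one]
    exact hK _ (by omega) t (hs ht)
  refine ⟨(abs_nonneg _).trans (hKf 0 (by omega) 0 (by simp)), ?_, ?_, ?_, ?_⟩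
  · rw [D_eq]; exact h ha hKa le_rfl
  · simpa using h hb hKb zero_le_one
  · simpa using h hc hKc zero_le_one
  · simpa using h hf hKf zero_le_one

lemma layerRate_le_one (kind : MeshKind) {N : ℕ} (hN : 2 ≤ N) : layerRate kind N ≤ 1 := by
  have hN0 : (0 : ℝ) < N := by exact_mod_cast (by omega : 0 < N)
  have h1 := inv_le_half hN
  cases kind <;> simp only [layerRate]
  · rw [inv_mul_le_iff₀ hN0, mul_one]
    exact Real.log_le_self hN0.le
  all_goals linarith

lemma IsMeshData.isLayerMesh {kind : MeshKind} (h : IsMeshData kind n σ α ε)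
    (hσ : (k : ℝ) + 1 ≤ σ) :
    IsLayerMesh (meshPoint kind (n + 1) σ α ε) n k ε (layerRate kind (n + 1)) (4 * (σ / α) + 4)
      (fun i => Real.exp (-(α * (1 - meshPoint kind (n + 1) σ α ε (i + 1))) / ε)) where
  mesh := h.isMesh
  pos_ε := h.pos_ε
  ε_le := by
    have h1 := h.le_ε
    have h2 : (0 : ℝ) < n + 1 := by positivity
    push_cast at h1
    rwa [le_inv_comm₀ h.pos_ε h2, ← one_div, le_div_iff₀ h.pos_ε, mul_comm] at h1
  inv_le := by simpa using inv_le_layerRate kind h.two_le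
  ρ_le := layerRate_le_one kind h.two_le
  one_le_R := by
    have := div_pos h.pos_σ h.pos_α
    linarith
  width i hi := by
    refine (h.width_le hi).trans ?_
    have := div_pos h.pos_σ h.pos_α
    push_cast
    exact mul_le_mul_of_nonneg_right (by linarith) (by positivity)
  e_nonneg i := (Real.exp_pos _).le
  e_last := by rw [h.isMesh.one]; simp
  layer i hi := h.layer_le hσ hi
  last := h.last_le (by linarith [Nat.cast_nonneg (α := ℝ) k])

end

/-! ### From the elementwise scheme to its summed form. -/

section

variable {x : ℕ → ℝ} {n k : ℕ} {a b c f : ℝ → ℝ} {ε : ℝ}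

/-- The polynomials of an element of the finite element space, extended by `0`. -/
def toPoly (U : DGSpace (n + 1) k) (i : ℕ) : ℝ[X] :=
  if h : i < n + 1 then (U ⟨i, h⟩ : ℝ[X]) else 0

lemma toPoly_of_le (U : DGSpace (n + 1) k) {i : ℕ} (hi : i ≤ n) :
    toPoly U i = (U ⟨i, Nat.lt_succ_of_le hi⟩ : ℝ[X]) := dif_pos _

lemma degree_lt_iff_le (q : ℝ[X]) :
    q.degree < ((k + 1 : ℕ) : WithBot ℕ) ↔ q.degree ≤ (k : WithBot ℕ) := by
  rw [degree_lt_iff_coeff_zero, degree_le_iff_coeff_zero]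
  refine forall_congr' fun m => ?_
  rw [Nat.cast_lt]
  rfl

lemma degree_toPoly (U : DGSpace (n + 1) k) (i : ℕ) :
    (toPoly U i).degree < ((k + 1 : ℕ) : WithBot ℕ) := by
  rw [toPoly]
  split_ifs with h
  · rw [degree_lt_iff_le]
    exact mem_degreeLE.1 (U ⟨i, h⟩).2
  · simp

/-- The element of the finite element space with given polynomials. -/
def ofPoly (n : ℕ) (v : ℕ → ℝ[X]) (hv : ∀ i, (v i).degree < ((k + 1 : ℕ) : WithBot ℕ)) :
    DGSpace (n + 1) k :=
  fun i => ⟨v i, mem_degreeLE.2 ((degree_lt_iff_le _).1 (hv i))⟩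

/-- `y` represents the piecewise function `w` on the elements. -/
def Represents (x : ℕ → ℝ) (w : Broken (n + 1)) (y : ℕ → ℝ → ℝ) : Prop :=
  ∀ i (h : i < n + 1), ∀ t ∈ Icc (x i) (x (i + 1)), w ⟨i, h⟩ t = y i t

lemma represents_toBroken (U : DGSpace (n + 1) k) : Represents x U.toBroken (ev (toPoly U)) := by
  intro i h t _
  simp [DGSpace.toBroken, ev, toPoly, h]

section traces
variable {w : Broken (n + 1)} {y : ℕ → ℝ → ℝ} {i : ℕ}

lemma Represents.traceR (hx : IsMesh x n) (h : Represents x w y) (hi : i ≤ n) :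
    traceR x w i = y i (x i) := by
  rw [LDG.traceR, dif_pos (Nat.lt_succ_of_le hi)]
  exact h i _ _ (left_mem_Icc.2 (hx.lt i hi).le)

lemma Represents.traceL (hx : IsMesh x n) (h : Represents x w y) (hi : i ≤ n) :
    traceL x w (i + 1) = y i (x (i + 1)) := by
  rw [LDG.traceL, dif_pos ⟨Nat.succ_pos i, Nat.succ_le_succ hi⟩]
  exact h i _ _ (right_mem_Icc.2 (hx.lt i hi).le)

lemma Represents.traceL_eq_prev (hx : IsMesh x n) (h : Represents x w y) (hi : i ≤ n + 1) :
    LDG.traceL x w i = prev x y i := by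
  cases i with
  | zero => simp [LDG.traceL, prev]
  | succ j => exact h.traceL hx (by omega)

lemma Represents.jump (hx : IsMesh x n) (h : Represents x w y) (hi : i ≤ n) :
    jump x w i = jmp x y i := by
  rw [LDG.jump, h.traceR hx hi, h.traceL_eq_prev hx (by omega), jmp]

lemma Represents.jump_last (hx : IsMesh x n) (h : Represents x w y) :
    LDG.jump x w (n + 1) = -y n (x (n + 1)) := by
  rw [LDG.jump, h.traceL hx le_rfl, LDG.traceR, dif_neg (lt_irrefl _), zero_sub]

lemma Represents.integral_eq (hx : IsMesh x n) (h : Represents x w y) (g : ℝ → ℝ) (hi : i < n + 1) :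
    ∫ t in x i..x (i + 1), g t * w ⟨i, hi⟩ t ^ 2 = ∫ t in x i..x (i + 1), g t * y i t ^ 2 := by
  refine intervalIntegral.integral_congr fun t ht => ?_
  rw [uIcc_of_le (hx.lt i (by omega)).le] at ht
  simp only [h i hi t ht]

end traces

lemma integral_ext_congr (hx : IsMesh x n) {i : ℕ} (hi : i ≤ n) {F G : ℝ → ℝ}
    (h : ∀ t ∈ Icc (0 : ℝ) 1, F t = G t) :
    ∫ t in x i..x (i + 1), F t = ∫ t in x i..x (i + 1), G t := by
  refine intervalIntegral.integral_congr fun t ht => ?_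
  rw [uIcc_of_le (hx.lt i hi).le] at ht
  exact h t (hx.subset hi ht)

/-- The energy norm in terms of functions that represent the first two components. -/
lemma energyNorm_eq (hx : IsMesh x n) {w1 w2 w3 : Broken (n + 1)} {y z : ℕ → ℝ → ℝ}
    (hy : Represents x w1 y) (hz : Represents x w2 z) :
    energyNorm x ε a b c (w1, w2, w3) =
      Real.sqrt (pquad x n ε (ext a) z + uquad x n (ext b) (ext (D b)) (ext c) y) := by
  rw [energyNorm]
  congr 1
  have hm : ∀ i ≤ n + 1, |b (x i)| = |ext b (x i)| := fun i hi => by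
    rw [ext_of_mem _ (hx.mem hi)]
  have e1 : ∑ j ∈ Finset.range (n + 1 + 1), jump x w2 j ^ 2 =
      (∑ i ∈ Finset.range (n + 1), jmp x z i ^ 2) + z n (x (n + 1)) ^ 2 := by
    rw [Finset.sum_range_succ, hz.jump_last hx, neg_sq]
    congr 1
    exact Finset.sum_congr rfl fun i hi => by
      rw [hz.jump hx (Nat.lt_succ_iff.1 (Finset.mem_range.1 hi))]
  have e2 : ∑ j ∈ Finset.range (n + 1 + 1), |b (x j)| * jump x w1 j ^ 2 =
      (∑ i ∈ Finset.range (n + 1), |ext b (x i)| * jmp x y i ^ 2) +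
        |ext b (x (n + 1))| * y n (x (n + 1)) ^ 2 := by
    rw [Finset.sum_range_succ, hy.jump_last hx, neg_sq, hm _ le_rfl]
    congr 1
    refine Finset.sum_congr rfl fun i hi => ?_
    have hi' := Nat.lt_succ_iff.1 (Finset.mem_range.1 hi)
    rw [hy.jump hx hi', hm i (by omega)]
  have e3 : ∑ i : Fin (n + 1), (∫ t in x i..x (i + 1), a t * w2 i t ^ 2) =
      ∑ i ∈ Finset.range (n + 1), ∫ t in x i..x (i + 1), ext a t * z i t ^ 2 := by
    rw [Finset.sum_range]
    refine Finset.sum_congr rfl fun i _ => ?_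
    rw [hz.integral_eq hx _ i.2]
    exact integral_ext_congr hx (by omega) fun t ht => by rw [ext_of_mem _ ht]
  have e4 : ∑ i : Fin (n + 1), (∫ t in x i..x (i + 1), (c t - 1 / 2 * D b t) * w1 i t ^ 2) =
      ∑ i ∈ Finset.range (n + 1), ∫ t in x i..x (i + 1),
        (ext c t - 1 / 2 * ext (D b) t) * y i t ^ 2 := by
    rw [Finset.sum_range]
    refine Finset.sum_congr rfl fun i _ => ?_
    rw [hy.integral_eq hx (fun t => c t - 1 / 2 * D b t) i.2]
    exact integral_ext_congr hx (by omega) fun t ht => by rw [ext_of_mem _ ht, ext_of_mem _ ht]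
  simp only
  rw [e1, e2, e3, e4, pquad, uquad, Finset.sum_add_distrib, Finset.sum_add_distrib,
    ← Finset.mul_sum, ← Finset.mul_sum]
  ring

/-- Summation of fluxes over the elements. -/
lemma sum_flux (F : ℕ → ℝ) (v : ℕ → ℝ[X]) (n : ℕ) :
    ∑ i ∈ Finset.range (n + 1), (F (i + 1) * (v i).eval (x (i + 1)) - F i * (v i).eval (x i)) =
      -(∑ i ∈ Finset.range (n + 1), F i * jmp x (ev v) i) +
        F (n + 1) * (v n).eval (x (n + 1)) := by
  induction n with
  | zero => simp [jmp, prev]; ring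
  | succ n ih =>
    rw [Finset.sum_range_succ, ih, Finset.sum_range_succ _ (n + 1)]
    simp only [jmp, prev, ev]
    ring

section scheme
variable {U P Q : DGSpace (n + 1) k}

lemma IsLDGSolution.local_first (h : IsLDGSolution x ε a b c f U P Q) {i : ℕ} (hi : i ≤ n) {r : ℝ[X]}
    (hr : r.degree < ((k + 1 : ℕ) : WithBot ℕ)) :
    (∫ t in x i..x (i + 1), (toPoly P i).eval t * r.eval t) +
      (∫ t in x i..x (i + 1), (toPoly U i).eval t * (derivative r).eval t) -
      fluxU x U.toBroken (i + 1) * r.eval (x (i + 1)) + fluxU x U.toBroken i * r.eval (x i) = 0 := by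
  have := (h (ofPoly n (fun _ => r) fun _ => hr) (ofPoly n (fun _ => r) fun _ => hr)
    (ofPoly n (fun _ => r) fun _ => hr) ⟨i, Nat.lt_succ_of_le hi⟩).1
  rw [toPoly_of_le U hi, toPoly_of_le P hi]
  exact this

lemma IsLDGSolution.local_second (h : IsLDGSolution x ε a b c f U P Q) {i : ℕ} (hi : i ≤ n)
    {s : ℝ[X]} (hs : s.degree < ((k + 1 : ℕ) : WithBot ℕ)) :
    (∫ t in x i..x (i + 1), (toPoly Q i).eval t * s.eval t) +
      ε * ((∫ t in x i..x (i + 1), (toPoly P i).eval t * (derivative s).eval t) -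
      fluxP x P.toBroken (i + 1) * s.eval (x (i + 1)) + fluxP x P.toBroken i * s.eval (x i)) = 0 := by
  have := (h (ofPoly n (fun _ => s) fun _ => hs) (ofPoly n (fun _ => s) fun _ => hs)
    (ofPoly n (fun _ => s) fun _ => hs) ⟨i, Nat.lt_succ_of_le hi⟩).2.1
  rw [toPoly_of_le P hi, toPoly_of_le Q hi]
  exact this

lemma IsLDGSolution.local_third (hx : IsMesh x n) (h : IsLDGSolution x ε a b c f U P Q) {i : ℕ}
    (hi : i ≤ n) {v : ℝ[X]} (hv : v.degree < ((k + 1 : ℕ) : WithBot ℕ)) :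
    -(∫ t in x i..x (i + 1), (toPoly Q i).eval t * (derivative v).eval t)
      + fluxQ x Q.toBroken (i + 1) * v.eval (x (i + 1)) - fluxQ x Q.toBroken i * v.eval (x i)
      + (∫ t in x i..x (i + 1), ext a t * (toPoly P i).eval t * (derivative v).eval t)
      - ext a (x (i + 1)) * fluxPtilde x P.toBroken (i + 1) * v.eval (x (i + 1))
      + ext a (x i) * fluxPtilde x P.toBroken i * v.eval (x i)
      - (∫ t in x i..x (i + 1), ext b t * (toPoly U i).eval t * (derivative v).eval t)
      + fluxBU x b U.toBroken (i + 1) * v.eval (x (i + 1)) - fluxBU x b U.toBroken i * v.eval (x i)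
      + (∫ t in x i..x (i + 1), (ext c t - ext (D b) t) * (toPoly U i).eval t * v.eval t)
      = ∫ t in x i..x (i + 1), ext f t * v.eval t := by
  have := (h (ofPoly n (fun _ => v) fun _ => hv) (ofPoly n (fun _ => v) fun _ => hv)
    (ofPoly n (fun _ => v) fun _ => hv) ⟨i, Nat.lt_succ_of_le hi⟩).2.2
  rw [toPoly_of_le U hi, toPoly_of_le P hi, toPoly_of_le Q hi, ext_of_mem a (hx.mem (by omega)),
    ext_of_mem a (hx.mem (by omega)),
    integral_ext_congr hx hi (F := fun t => ext a t * _ * _) (G := fun t => a t * _ * _)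
      (fun t ht => by rw [ext_of_mem _ ht]),
    integral_ext_congr hx hi (F := fun t => ext b t * _ * _) (G := fun t => b t * _ * _)
      (fun t ht => by rw [ext_of_mem _ ht]),
    integral_ext_congr hx hi (F := fun t => (ext c t - ext (D b) t) * _ * _)
      (G := fun t => (c t - D b t) * _ * _)
      (fun t ht => by rw [ext_of_mem _ ht, ext_of_mem _ ht]),
    integral_ext_congr hx hi (F := fun t => ext f t * _) (G := fun t => f t * _)
      (fun t ht => by rw [ext_of_mem _ ht])]
  exact this

/-- Summation over the elements turns the single-valued fluxes into products with jumps of the test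
function, which are the terms in `aform` and `bform`. The first equation stays local, since the
discrete derivative is analysed element by element. -/
lemma IsLDGSolution.isDiscSolution (hx : IsMesh x n) (h : IsLDGSolution x ε a b c f U P Q) :
    IsDiscSolution x n k ε (ext a) (ext b) (ext (D b)) (ext c) (ext f) (toPoly U) (toPoly P)
      (toPoly Q) := by
  have hU : Represents x U.toBroken (ev (toPoly U)) := represents_toBroken U
  have hP : Represents x P.toBroken (ev (toPoly P)) := represents_toBroken P
  have hQ : Represents x Q.toBroken (ev (toPoly Q)) := represents_toBroken Q
  have fU : ∀ i ≤ n, fluxU x U.toBroken i = prev x (ev (toPoly U)) i := by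
    intro i hi
    rw [fluxU]
    split_ifs with h1
    · obtain rfl : i = 0 := by omega
      rfl
    · exact hU.traceL_eq_prev hx (by omega)
  refine ⟨degree_toPoly U, degree_toPoly P, degree_toPoly Q, fun i hi r hr => ?_, fun r hr => ?_,
    fun s hs => ?_, fun v hv => ?_⟩
  · have := h.local_first hi.le hr
    rwa [fU i hi.le, fU (i + 1) hi] at this
  · have := h.local_first le_rfl hr
    rw [fU n le_rfl, fluxU, if_pos (Or.inr rfl)] at this
    linarith
  · have h1 := Finset.sum_congr rfl fun i (hi : i ∈ Finset.range (n + 1)) =>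
      h.local_second (Nat.lt_succ_iff.1 (Finset.mem_range.1 hi)) (hs i)
    rw [Finset.sum_const_zero, Finset.sum_add_distrib, ← Finset.mul_sum] at h1
    simp only [sub_add] at h1
    -- Here the flux at x = 1 is zero, whereas `aform` contains the trace from inside; the extra
    -- product in `IsDiscSolution.second` makes up for the difference.
    rw [Finset.sum_sub_distrib, sum_flux (fluxP x P.toBroken) s n, fluxP, if_pos rfl] at h1
    have h2 : ∑ i ∈ Finset.range (n + 1), fluxP x P.toBroken i * jmp x (ev s) i =
        ∑ i ∈ Finset.range (n + 1), (toPoly P i).eval (x i) * jmp x (ev s) i := by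
      refine Finset.sum_congr rfl fun i hi => ?_
      have hi' : i < n + 1 := Finset.mem_range.1 hi
      rw [fluxP, if_neg hi'.ne, hP.traceR hx (by omega)]
    rw [h2] at h1
    rw [aform, Finset.sum_add_distrib]
    simp only [one_mul, ev] at *
    linarith
  · have h1 := Finset.sum_congr rfl fun i (hi : i ∈ Finset.range (n + 1)) =>
      h.local_third hx (Nat.lt_succ_iff.1 (Finset.mem_range.1 hi)) (hv i)
    have e1 := sum_flux (x := x) (fluxQ x Q.toBroken) v n
    have e2 := sum_flux (x := x) (fun i => ext a (x i) * fluxPtilde x P.toBroken i) v n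
    have e3 := sum_flux (x := x) (fluxBU x b U.toBroken) v n
    have g1 : ∑ i ∈ Finset.range (n + 1), fluxQ x Q.toBroken i * jmp x (ev v) i =
        ∑ i ∈ Finset.range (n + 1), (toPoly Q i).eval (x i) * jmp x (ev v) i := by
      refine Finset.sum_congr rfl fun i hi => ?_
      have hi' : i < n + 1 := Finset.mem_range.1 hi
      rw [fluxQ, if_neg hi'.ne, hQ.traceR hx (by omega)]
    have g2 : ∑ i ∈ Finset.range (n + 1), ext a (x i) * fluxPtilde x P.toBroken i *
          jmp x (ev v) i =
        ∑ i ∈ Finset.range (n + 1), ext a (x i) * (toPoly P i).eval (x i) * jmp x (ev v) i := by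
      refine Finset.sum_congr rfl fun i hi => ?_
      have hi' : i < n + 1 := Finset.mem_range.1 hi
      rw [fluxPtilde, if_neg hi'.ne, hP.traceR hx (by omega)]
    -- At i = 0 the flux has no left part, in agreement with the convention that `prev` is 0 there.
    have g3 : ∑ i ∈ Finset.range (n + 1), fluxBU x b U.toBroken i * jmp x (ev v) i =
        ∑ i ∈ Finset.range (n + 1), ((ext b (x i) + |ext b (x i)|) / 2 *
          prev x (ev (toPoly U)) i + (ext b (x i) - |ext b (x i)|) / 2 * (toPoly U i).eval (x i)) *
            jmp x (ev v) i := by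
      refine Finset.sum_congr rfl fun i hi => ?_
      have hi' : i < n + 1 := Finset.mem_range.1 hi
      rw [fluxBU, ext_of_mem b (hx.mem (by omega))]
      split_ifs with h2 h3
      · subst h2
        rw [hU.traceR hx (by omega), prev]
        simp only [ev]
        ring
      · exact absurd h3 hi'.ne
      · rw [hU.traceR hx (by omega), hU.traceL_eq_prev hx (by omega)]
    have k1 : fluxQ x Q.toBroken (n + 1) = (toPoly Q n).eval (x (n + 1)) := by
      rw [fluxQ, if_pos rfl, hQ.traceL hx le_rfl]
    have k2 : fluxPtilde x P.toBroken (n + 1) = (toPoly P n).eval (x (n + 1)) := by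
      rw [fluxPtilde, if_pos rfl, hP.traceL hx le_rfl]
    have k3 : fluxBU x b U.toBroken (n + 1) =
        (ext b (x (n + 1)) + |ext b (x (n + 1))|) / 2 * (toPoly U n).eval (x (n + 1)) := by
      rw [fluxBU, if_neg (Nat.succ_ne_zero n), if_pos rfl, hU.traceL hx le_rfl,
        ext_of_mem b (hx.mem le_rfl)]
    rw [g1, k1] at e1
    rw [g2, k2] at e2
    rw [g3, k3] at e3
    simp only [aform, bform, one_mul, ev] at *
    simp only [Finset.sum_add_distrib, Finset.sum_sub_distrib, Finset.sum_neg_distrib] at *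
    linarith

end scheme

end

/-! ### Assembly of the error estimate. -/

section

lemma layerSum_le_rate (kind : MeshKind) (k : ℕ) {n : ℕ} (hn : 2 ≤ n + 1) (ε : ℝ) :
    layerSum k n ε (layerRate kind (n + 1)) ≤ 2 * rate kind k (n + 1) ε := by
  have h0 : (0 : ℝ) < (n : ℝ) + 1 := by positivity
  have h1 : ((n + 1 : ℕ) : ℝ) ^ (-((k : ℝ) + 1 / 2)) =
      ((n : ℝ) + 1)⁻¹ ^ k * Real.sqrt ((n : ℝ) + 1)⁻¹ := by
    push_cast
    rw [neg_add, Real.rpow_add h0, Real.rpow_neg h0.le, Real.rpow_natCast, Real.rpow_neg h0.le,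
      ← Real.sqrt_eq_rpow, inv_pow, Real.sqrt_inv]
  have h2 := layerRate_sum_le_rate kind k hn (ε := ε)
  rwa [h1] at h2

/-- Coercivity on layer-adapted meshes with sufficiently many elements; if the diffusion
coefficient is constant then there is no restriction. -/
lemma exists_coercive_of_layerMesh {a a1 b b1 c : ℝ → ℝ} {α γ K : ℝ}
    (hc : IsCoeff a a1 b b1 c α γ K) (k : ℕ) (R : ℝ) :
    ∃ (N₀ : ℕ) (κ C : ℝ), ((∀ t ∈ Icc (0 : ℝ) 1, a t = a 0) → N₀ = 2) ∧ 0 ≤ κ ∧ κ ≤ 1 ∧ 0 ≤ C ∧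
      ∀ (x : ℕ → ℝ) (n : ℕ) (ε ρ : ℝ) (e : ℕ → ℝ) (u p v w : ℕ → ℝ[X]),
        IsLayerMesh x n k ε ρ R e → N₀ ≤ n + 1 → IsDiscDeriv x n k u p →
        IsSplit x n k (4 * invK (k + 1)) u p v w →
        pquad x n ε a (ev p) + uquad x n b b1 c (ev u) ≤
          C * testValue x n ε a b b1 c u p v w κ := by
  by_cases hconst : ∀ t ∈ Icc (0 : ℝ) 1, a t = a 0
  · refine ⟨2, 1, 1, fun _ => rfl, zero_le_one, le_rfl, zero_le_one,
      fun x n ε ρ e u p v w hx _ hd hs => ?_⟩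
    rw [one_mul, coercive_of_const hx.mesh hc hconst hd hs]
  · have hD : 1 ≤ 4 * invK (k + 1) := by linarith [one_le_invK (k + 1)]
    obtain ⟨κ, H₀, C, h1, h2, h3, h4, h5⟩ := exists_coercive hc hD k
    -- With at least R / H₀ elements the width bound R N⁻¹ does not exceed H₀.
    refine ⟨⌈R / H₀⌉₊, κ, C, fun h => absurd h hconst, h1.le, h2, h4.le,
      fun x n ε ρ e u p v w hx hn hd hs =>
        h5 x n ε u p v w hx.pos_ε.le hx.mesh hd hs fun i hi => (hx.width i hi).trans ?_⟩
    have h6 : R / H₀ ≤ n + 1 := (Nat.ceil_le.1 hn).trans_eq (by push_cast; rfl)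
    rw [← div_eq_mul_inv, div_le_iff₀ (by positivity), mul_comm]
    rwa [div_le_iff₀ h3] at h6

/-- The constant of the error estimate. -/
def errorConst (k : ℕ) (α γ K Kf M R C : ℝ) : ℝ :=
  2 * ((K + 3) * projBound k R M 1 + 3 * K * (projConst k * (M * R ^ (k + 1))) +
    energyConst α γ K (4 * invK (k + 1)) C * (projBound k R M 1 + lastConst k K Kf M R))

/-- The error estimate on a layer-adapted mesh. -/
lemma IsDiscSolution.sqrt_error_le_layerSum {x : ℕ → ℝ} {n k : ℕ} {a a1 b b1 c f U P P1 Q1 : ℝ → ℝ}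
    {α γ K Kf ε ρ R M C κ : ℝ} {e : ℕ → ℝ} {Uh Ph Qh : ℕ → ℝ[X]}
    (hx : IsLayerMesh x n k ε ρ R e) (hc : IsCoeff a a1 b b1 c α γ K)
    (he : IsExact ε a a1 b c f U P P1 Q1) (hl : IsLayeredSolution x n k ε M e U P P1)
    (hs : IsSmoothData x n k K Kf a1 b c f)
    (hd : IsDiscSolution x n k ε a b b1 c f Uh Ph Qh) (hκ : 0 ≤ κ) (hκ1 : κ ≤ 1) (hC : 0 ≤ C)
    (hcoer : ∀ u p v w : ℕ → ℝ[X], IsDiscDeriv x n k u p →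
      IsSplit x n k (4 * invK (k + 1)) u p v w →
      pquad x n ε a (ev p) + uquad x n b b1 c (ev u) ≤ C * testValue x n ε a b b1 c u p v w κ) :
    Real.sqrt (pquad x n ε a (fun i t => P t - (Ph i).eval t) +
      uquad x n b b1 c (fun i t => U t - (Uh i).eval t)) ≤
    errorConst k α γ K Kf M R C * layerSum k n ε ρ := by
  have hcP1 := he.cp1
  have hM := hl.nonneg
  have hK := hc.one_le
  have hR := hx.one_le_R
  have hKf := hs.nonneg
  have hI := one_le_invK (k + 1)
  obtain ⟨πu, πp, πq, hπ, hopt⟩ := exists_isProj hx.mesh k he.cu he.cp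
    (show Continuous fun t => ε * P1 t by fun_prop)
  have hdd := hd.isDiscDeriv hx.mesh he hπ
  obtain ⟨v, w, hsp⟩ := hdd.exists_split hx.mesh
  have herr := hx.isProjError hl he.cu he.cp hcP1 hπ hopt
  have hw := hx.abs_third_w_le hl hc hs he hsp hπ hopt
  obtain ⟨l1, l2, l3⟩ := hx.layerSum_terms
  have hT : 0 ≤ layerSum k n ε ρ := by rw [layerSum]; linarith
  have hpc : 0 ≤ projConst k := zero_le_one.trans (one_le_projConst k)
  have hpb : 0 ≤ projBound k R M 1 := by rw [projBound]; positivity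
  have hlc : 0 ≤ lastConst k K Kf M R := by rw [lastConst]; positivity
  have hec : 0 ≤ energyConst α γ K (4 * invK (k + 1)) C := by rw [energyConst]; positivity
  have h1 := hd.sqrt_energy_le hx.mesh hc hx.pos_ε hx.ε_le he hπ hsp (by linarith) herr hκ hκ1 hC
    (by positivity) (hcoer _ _ _ _ hdd hsp) hw
  refine (he.sqrt_error_le hx.mesh hc hx.pos_ε hx.ε_le herr h1).trans ?_
  have e1 := hx.projBound_le hM
  have e2 := hx.sqrt_mul_projBoundU_le hM
  have e3 := mul_le_mul_of_nonneg_left e1 (show 0 ≤ K + 3 by linarith)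
  have e4 := mul_le_mul_of_nonneg_left e2 (show 0 ≤ 3 * K by linarith)
  have e5 := mul_le_mul_of_nonneg_left e1 hec
  rw [errorConst]
  linarith

end

end LDG

end

theorem theorem1
    (a b c : ℝ → ℝ)
    (ha : ContDiffOn ℝ ∞ a (Set.Icc 0 1)) (hb : ContDiffOn ℝ ∞ b (Set.Icc 0 1))
    (hc : ContDiffOn ℝ ∞ c (Set.Icc 0 1))
    (α γ : ℝ) (hα : 0 < α) (hγ : 0 < γ)
    (haα : ∀ t ∈ Set.Ioo (0 : ℝ) 1, α ≤ a t)
    (hcb : ∀ t ∈ Set.Ioo (0 : ℝ) 1, γ ≤ c t - 1 / 2 * LDG.D b t)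
    (k : ℕ) (σ : ℝ) (hσ : (k : ℝ) + 3 / 2 ≤ σ) :
    ∃ N₀ : ℕ, ((∀ t ∈ Set.Icc (0 : ℝ) 1, a t = a 0) → N₀ = 2) ∧
      ∀ f : ℝ → ℝ, ContDiffOn ℝ ∞ f (Set.Icc 0 1) → ∀ M : ℝ,
      ∃ C : ℝ, 0 < C ∧
        ∀ (kind : LDG.MeshKind) (N : ℕ), Even N → 2 ≤ N → N₀ ≤ N →
        ∀ ε : ℝ, 0 < ε → ε ≤ (N : ℝ)⁻¹ →
        LDG.tau kind N σ α ε = σ * ε / α * LDG.meshGen kind N ε (1 / 2) →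
        ∀ u : ℝ → ℝ, LDG.IsExactSolution ε a b c f u →
        LDG.HasLayerDecomposition (k + 3) M ε α u →
        ∀ U P Q : LDG.DGSpace N k,
        LDG.IsLDGSolution (LDG.meshPoint kind N σ α ε) ε a b c f U P Q →
        LDG.energyNorm (LDG.meshPoint kind N σ α ε) ε a b c (LDG.errorTriple ε u U P Q)
          ≤ C * LDG.rate kind k N ε := by
  obtain ⟨Ka, hKa1, hKa⟩ := LDG.exists_iteratedDerivWithin_bound ha (k + 1)
  obtain ⟨Kb, hKb1, hKb⟩ := LDG.exists_iteratedDerivWithin_bound hb (k + 1)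
  obtain ⟨Kc, hKc1, hKc⟩ := LDG.exists_iteratedDerivWithin_bound hc (k + 1)
  -- This constant depends on the coefficients only and is fixed before f and M, and hence so is N₀.
  -- The bound `Kf` of f enters the final constant alone.
  set K := max Ka (max Kb Kc) with hK
  have hKa' : ∀ j ≤ k + 1, ∀ t ∈ Icc (0 : ℝ) 1, |iteratedDerivWithin j a (Icc 0 1) t| ≤ K :=
    fun j hj t ht => (hKa j hj t ht).trans (le_max_left _ _)
  have hKb' : ∀ j ≤ k + 1, ∀ t ∈ Icc (0 : ℝ) 1, |iteratedDerivWithin j b (Icc 0 1) t| ≤ K :=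
    fun j hj t ht => (hKb j hj t ht).trans ((le_max_left _ _).trans (le_max_right _ _))
  have hKc' : ∀ j ≤ k + 1, ∀ t ∈ Icc (0 : ℝ) 1, |iteratedDerivWithin j c (Icc 0 1) t| ≤ K :=
    fun j hj t ht => (hKc j hj t ht).trans ((le_max_right _ _).trans (le_max_right _ _))
  have hcoeff := LDG.isCoeff_ext ha hb hc hα hγ haα hcb (hKa1.trans (le_max_left _ _))
    (fun j hj => hKa' j (by omega)) (fun j hj => hKb' j (by omega)) (fun j hj => hKc' j (by omega))
  obtain ⟨N₀, κ, C, hconst, hκ, hκ1, hC, hcoer⟩ :=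
    LDG.exists_coercive_of_layerMesh hcoeff k (4 * (σ / α) + 4)
  refine ⟨N₀, fun h => hconst fun t ht => ?_, fun f hf M => ?_⟩
  · rw [LDG.ext_of_mem _ ht, LDG.ext_of_mem _ (by simp)]
    exact h t ht
  obtain ⟨Kf, hKf1, hKf⟩ := LDG.exists_iteratedDerivWithin_bound hf (k + 1)
  -- The factor 2 comes from `layerSum_le_rate`. The maximum with 1 keeps the constant positive, as
  -- M is an arbitrary real number here.
  refine ⟨2 * max 1 (LDG.errorConst k α γ K Kf M (4 * (σ / α) + 4) C), by positivity, ?_⟩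
  intro kind N hNe hN2 hN0 ε hε hεN hτ u hu hdec U P Q hLDG
  obtain ⟨n, rfl⟩ : ∃ n, N = n + 1 := ⟨N - 1, by omega⟩
  have hσ0 : 0 < σ := by linarith [Nat.cast_nonneg (α := ℝ) k]
  have hdata : LDG.IsMeshData kind n σ α ε := ⟨hNe, hε, hεN, hα, hσ0, hτ⟩
  have hx := hdata.isLayerMesh (k := k) (by linarith)
  have hm := hx.mesh
  have hsol := hdec.isLayeredSolution hm hα hε hx.ε_le_one
  have hmain := (hLDG.isDiscSolution hm).sqrt_error_le_layerSum hx hcoeff (hu.isExact ha hf) hsol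
    (LDG.isSmoothData_ext hm ha hb hc hf hKa' hKb' hKc' hKf) hκ hκ1 hC
    (fun u p v w => hcoer _ n ε _ _ u p v w hx hN0)
  have hrep : ∀ (g : ℝ → ℝ) (V : LDG.DGSpace (n + 1) k),
      LDG.Represents (LDG.meshPoint kind (n + 1) σ α ε) (fun i t => g t - V.toBroken i t)
        fun i t => LDG.ext g t - (LDG.toPoly V i).eval t := by
    intro g V i hi t ht
    have h1 := LDG.represents_toBroken V i hi t ht
    simp only [h1, LDG.ev]
    rw [LDG.ext_of_mem _ (hm.subset (Nat.lt_succ_iff.1 hi) ht)]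
  rw [LDG.errorTriple, LDG.energyNorm_eq hm (hrep u U) (hrep (LDG.D u) P)]
  obtain ⟨l1, l2, l3⟩ := hx.layerSum_terms
  have hT : 0 ≤ LDG.layerSum k n ε (LDG.layerRate kind (n + 1)) := by
    rw [LDG.layerSum]; linarith
  have hr := LDG.layerSum_le_rate kind k hN2 ε
  calc _ ≤ _ := hmain
    _ ≤ max 1 (LDG.errorConst k α γ K Kf M (4 * (σ / α) + 4) C) *
        LDG.layerSum k n ε (LDG.layerRate kind (n + 1)) :=
      mul_le_mul_of_nonneg_right (le_max_right _ _) hT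
    _ ≤ max 1 (LDG.errorConst k α γ K Kf M (4 * (σ / α) + 4) C) *
        (2 * LDG.rate kind k (n + 1) ε) := mul_le_mul_of_nonneg_left hr (by positivity)
    _ = _ := by ring
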